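/- Let $M$ be a smooth surface (boundary and corners allowed) that is homeomorphic to a closed disc, with a smooth Riemannian metric $g$. Let $\hat T=\{x\in\mathbb R^2: x^1,x^2\ge 0,\ x^1+x^2\le 1\}$ with Euclidean metric $\delta$, let $\hat V\subset C^2(\hat T)$ be a fixed finite-dimensional subspace and $r\ge 0$ an integer. For $h$ in a set $S\subset(0,\infty)$ let $\mathcal T_h$ be a finite smooth triangulation of $M$ with diffeomorphisms $f_{h,T}:\hat T\to T$ onto its triangles, $g_h$ a Regge metric on $\mathcal T_h$ (a smooth metric on each closed triangle, with continuous tangential-tangential components across edges), and $V_h$ a space of continuous functions $v$ on $M$ with $v\circ f_{h,T}\in\hat V$ for all $T$, normed by $\|v\|_{V_h}=\|v\|_{L^2(M,g_h)}+\|dv\|_{L^2(M,g_h)}$. On $T$ write $\hat\delta=(f_{h,T}^{-1})^*\delta$, $\hat\nabla$ for its Levi-Civita connection, $\nabla$ for that of $g$, and $C_{g_1,g_2}(T)=\sup_{x\in T,\,0\neq w\in T_xM}\|w\|_{g_1}/\|w\|_{g_2}$. "$O(h^s)$" means: at most a constant times $h^s$ for all $h\in S$. Suppose that the family is shape-regular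 and quasi-uniform, i.e. $C_{g_h,\hat\delta}(T)\,C_{\hat\delta,g_h}(T)\le K$ and $C_{\hat\delta,g_h}(T)\le K'h^{-1}$ for all $h\in S$ and all triangles $T$, and that 1. $\|g_h-g\|_{L^2(M,g)}\in O(h^{r+1})$; 2. $\big(\sum_T\|\nabla g_h\|_{L^2(T,g)}^2\big)^{1/2}\in O(h^r)$; 3. $\|g_h-g\|_{L^\infty(M,g)}\le C'<1$ for all $h\in S$, where $\|\sigma\|_{L^\infty(M,g)}=\operatorname{ess\,sup}_x\sup_{v,w\ne0}|\sigma(v,w)|/(\|v\|_g\|w\|_g)$; 4. $\max_T\big(\|\hat\nabla g_h\|_{L^\infty(T,\hat\delta)}+\|\hat\nabla g\|_{L^\infty(T,\hat\delta)}\big)\in O(1)$. For a Regge metric $G$ on $\mathcal T_h$, a piecewise smooth symmetric $2$-tensor $\sigma$ and $v\in V_h$ put $$b_h(G;\sigma,v)=\sum_T\langle\mathbb S\sigma,\nabla_G\nabla_G v\rangle_{L^2(T,G)}-\sum_e\langle(\mathbb S\sigma)(n,n),dv([[n]])\rangle_{L^2(e,G)},\qquad \mathbb S\sigma=\sigma-\operatorname{tr}_G(\sigma)\,G,$$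 where $n$ is the $G$-unit normal of the edge $e$ and $dv([[n]])$ is the sum of the derivatives of $v$ in the direction of the outward unit normals of the (one or two) triangles containing $e$. Let $(e_1,e_2)$ be a smooth $g$-orthonormal frame on $M$, orient $M$ by it, let $\mu$ be the oriented angle from $e_1$ to the outward $g$-unit normal along $\partial M$ (with jump $[[\mu]]\in(-\pi,\pi]$ at boundary vertices), and let the $f_{h,T}$ preserve orientation. Put $$F_h(G)(v)=\sum_{e\subset\partial M}\int_e v\,(d\mu-k\,ds)-\sum_{p\in\partial M}v(p)\Big(\pi-[[\mu]]_p-\sum_{T\ni p}\theta_T(p)\Big)-\sum_T\int_T vK\,dA-\sum_{e\not\subset\partial M}\int_e v\,[[k\,ds]]-\sum_{p\notin\partial M}v(p)\Big(2\pi-\sum_{T\ni p}\theta_T(p)\Big),$$ where $p$ runs over the vertices, and the Gauss curvature $K$, the geodesic curvature $k$ (with respect to the inward normal of the triangle), the interior angles $\theta_T(p)$, $dA$ and $ds$ are those of $G$, and $[[k\,ds]]$ is the sum of the contributions of the two adjacent triangles. Then: (a) uniformly in $t\in[0,1]$, with $g(t)=t\,g_h+(1-t)\,g$, one has $\|b_h(g(t);g-g_h,\cdot)\|_{V_h^*}\in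 O(h^r)$; (b) $\|F_h(g)-F_h(g_h)\|_{V_h^*}\in O(h^r)$, uniformly in the frame. The constants in (a), (b) depend only on $(M,g)$, $\hat V$, $r$, $K$, $K'$, $C'$ and the constants in 1, 2, 4. (c) Suppose in addition that the connection form $\alpha=\langle\nabla e_2,e_1\rangle$ of the frame is $\alpha=\star du$ for a smooth function $u$ on $M$, that $V_h$ contains the constants, that $\inf_{v\in V_h}\big(\|u-v\|_{L^2(M,g)}+\|du-dv\|_{L^2(M,g)}\big)\in O(h^r)$ and that $\|g-g_h\|_{L^\infty(M,g)}\in O(h^r)$. If $u_h\in V_h$ solves the discrete problem $\langle du_h,dv\rangle_{L^2(M,g_h)}=F_h(g_h)(v)$ for all $v\in V_h$, and $\langle u_h,c\rangle_{L^2(M,g_h)}=0$ for all $c\in V_h$ with $dc=0$, then $\|du_h-du\|_{L^2(M,g)}\in O(h^r)$ and $\|\star_h du_h-\star du\|_{L^2(M,g)}\in O(h^r)$, $\star_h$ being the Hodge star of $g_h$; the constants depend in addition only on the frame, $u$ and the constants in the two added assumptions. -/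

import Mathlib

open scoped Manifold ContDiff ENNReal
open MeasureTheory

noncomputable section

namespace Regge

/-! ### The reference triangle -/

/-- The Euclidean plane. -/
abbrev E2 : Type := EuclideanSpace ℝ (Fin 2)

/-- `2 × 2` matrices: bilinear forms in the coordinates of the reference triangle. -/
abbrev Mat : Type := Matrix (Fin 2) (Fin 2) ℝ

/-- Model for compact surfaces with (possibly empty) boundary and corners. -/
abbrev IQ : ModelWithCorners ℝ E2 (EuclideanQuadrant 2) := modelWithCornersEuclideanQuadrant 2

/-- The standard (closed) simplex of the plane. -/
def refTri : Set E2 := {x | 0 ≤ x 0 ∧ 0 ≤ x 1 ∧ x 0 + x 1 ≤ 1}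

/-- Its vertices `(0,0)`, `(1,0)`, `(0,1)`, in counterclockwise order. -/
def vtx : Fin 3 → E2 := ![!₂[0, 0], !₂[1, 0], !₂[0, 1]]

/-- Direction of the `i`-th side, which runs from vertex `i` to vertex `i + 1`. -/
def sideDir (i : Fin 3) : E2 := vtx (i + 1) - vtx i

/-- Parametrization of the `i`-th side by `[0,1]`. -/
def sidePt (i : Fin 3) (s : ℝ) : E2 := vtx i + s • sideDir i

/-- The `i`-th side as a set. -/
def side (i : Fin 3) : Set E2 := sidePt i '' Set.Icc 0 1

/-- The face of the reference triangle spanned by a set of vertices. -/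
def face (s : Finset (Fin 3)) : Set E2 := convexHull ℝ (vtx '' (s : Set (Fin 3)))

/-- Partial derivative in direction `k` on the closed reference triangle. -/
def pd (k : Fin 2) (φ : E2 → ℝ) (x : E2) : ℝ :=
  fderivWithin ℝ φ refTri x (EuclideanSpace.single k 1)

/-- Supremum of a nonnegative function over the reference triangle. -/
def supTri (φ : E2 → ℝ) : ℝ≥0∞ := ⨆ x ∈ refTri, ENNReal.ofReal (φ x)

/-! ### Riemannian geometry of a metric `G` (a field of matrices) on the reference triangle -/

/-- Value of the bilinear form `A` on two vectors. -/
def pair (A : Mat) (v w : E2) : ℝ := ∑ i, ∑ j, A i j * v i * w j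

/-- Length of a vector. -/
def len (A : Mat) (v : E2) : ℝ := √(pair A v v)

/-- Density of the Riemannian area with respect to Lebesgue measure. -/
def dvol (G : E2 → Mat) (x : E2) : ℝ := √((G x).det)

/-- Inner product of covectors. -/
def inner1 (A : Mat) (a b : Fin 2 → ℝ) : ℝ := ∑ i, ∑ j, A⁻¹ i j * a i * b j

/-- Inner product of `(0,2)`-tensors. -/
def inner2 (A : Mat) (S T : Mat) : ℝ :=
  ∑ i, ∑ j, ∑ k, ∑ l, A⁻¹ i k * A⁻¹ j l * S i j * T k l

/-- Squared norm of a `(0,3)`-tensor. -/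
def normSq3 (A : Mat) (S : Fin 2 → Fin 2 → Fin 2 → ℝ) : ℝ :=
  ∑ i, ∑ j, ∑ k, ∑ i', ∑ j', ∑ k', A⁻¹ i i' * A⁻¹ j j' * A⁻¹ k k' * S i j k * S i' j' k'

/-- Christoffel symbols `Γ^k_{ij}` of the Levi-Civita connection. -/
def chris (G : E2 → Mat) (k i j : Fin 2) (x : E2) : ℝ :=
  (1 / 2) * ∑ l, (G x)⁻¹ k l *
    (pd i (fun y => G y l j) x + pd j (fun y => G y l i) x - pd l (fun y => G y i j) x)

/-- The differential of a function. -/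
def dfn (φ : E2 → ℝ) (x : E2) : Fin 2 → ℝ := fun k => pd k φ x

/-- The Hessian `∇∇φ`. -/
def hess (G : E2 → Mat) (φ : E2 → ℝ) (x : E2) : Mat :=
  Matrix.of fun i j => pd i (fun y => pd j φ y) x - ∑ k, chris G k i j x * pd k φ x

/-- The covariant derivative `∇σ` of a `(0,2)`-tensor field, `∇` being the connection of `G`;
the first index is the direction of differentiation. -/
def cov2 (G : E2 → Mat) (σ : E2 → Mat) (x : E2) (k i j : Fin 2) : ℝ :=
  pd k (fun y => σ y i j) x - (∑ l, chris G l k i x * σ x l j) - ∑ l, chris G l k j x * σ x i l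

/-- The covariant derivative with respect to the flat metric of the reference triangle. -/
def hatCov2 (σ : E2 → Mat) (x : E2) (k i j : Fin 2) : ℝ := pd k (fun y => σ y i j) x

/-- `𝕊σ = σ - tr(σ) G`. -/
def SS (G σ : E2 → Mat) (x : E2) : Mat :=
  σ x - (∑ i, ∑ j, (G x)⁻¹ i j * σ x i j) • G x

/-- The outward Euclidean conormal of the `i`-th side. -/
def conormal (i : Fin 3) : E2 := !₂[sideDir i 1, - sideDir i 0]

/-- The vector `G`-dual to the outward conormal. -/
def sharpNormal (G : E2 → Mat) (i : Fin 3) (x : E2) : E2 :=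
  WithLp.toLp 2 fun k => ∑ l, (G x)⁻¹ k l * conormal i l

/-- The outward `G`-unit normal of the `i`-th side. -/
def nrm (G : E2 → Mat) (i : Fin 3) (x : E2) : E2 :=
  (len (G x) (sharpNormal G i x))⁻¹ • sharpNormal G i x

/-- The differential of `φ` applied to a vector. -/
def dapp (φ : E2 → ℝ) (x : E2) (w : E2) : ℝ := ∑ k, pd k φ x * w k

/-- `∫ f ds_G` over the `i`-th side, `ds_G` being the `G`-arc length. -/
def sideInt (G : E2 → Mat) (i : Fin 3) (f : E2 → ℝ) : ℝ :=
  ∫ s in (0 : ℝ)..1, f (sidePt i s) * len (G (sidePt i s)) (sideDir i)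

/-- `∫ f dA_G` over the reference triangle. -/
def triInt (G : E2 → Mat) (f : E2 → ℝ) : ℝ := ∫ x in refTri, f x * dvol G x

/-- Component `l` of `R(∂₀,∂₁)∂₁`. -/
def riem (G : E2 → Mat) (l : Fin 2) (x : E2) : ℝ :=
  pd 0 (chris G l 1 1) x - pd 1 (chris G l 0 1) x
    + ∑ m, (chris G m 1 1 x * chris G l 0 m x - chris G m 0 1 x * chris G l 1 m x)

/-- The Gauss curvature. -/
def gaussK (G : E2 → Mat) (x : E2) : ℝ := (∑ l, riem G l x * G x l 0) / (G x).det

/-- The acceleration `∇_γ' γ'` of the (affinely parametrized) `i`-th side. -/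
def accel (G : E2 → Mat) (i : Fin 3) (x : E2) : E2 :=
  WithLp.toLp 2 fun l => ∑ p, ∑ q, chris G l p q x * sideDir i p * sideDir i q

/-- The geodesic curvature of the `i`-th side, with respect to the inward normal (so that it is
positive for the boundary of a round disc in the plane). -/
def geoK (G : E2 → Mat) (i : Fin 3) (x : E2) : ℝ :=
  - pair (G x) (accel G i x) (nrm G i x) / pair (G x) (sideDir i) (sideDir i)

/-- The interior angle at the vertex `i`. -/
def angle (G : E2 → Mat) (i : Fin 3) : ℝ :=
  Real.arccos (pair (G (vtx i)) (vtx (i + 1) - vtx i) (vtx (i + 2) - vtx i) /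
    (len (G (vtx i)) (vtx (i + 1) - vtx i) * len (G (vtx i)) (vtx (i + 2) - vtx i)))

/-- The Hodge star on covectors, for the standard orientation of the reference triangle:
`⋆a = √(det G) (a^♯⁰ dx¹ - a^♯¹ dx⁰)`. -/
def star1 (A : Mat) (a : Fin 2 → ℝ) : Fin 2 → ℝ :=
  ![- √A.det * ∑ j, A⁻¹ 1 j * a j, √A.det * ∑ j, A⁻¹ 0 j * a j]

/-- The connection form `⟨∇ e₂, e₁⟩` of a frame. -/
def connForm (G : E2 → Mat) (e₁ e₂ : E2 → E2) (x : E2) : Fin 2 → ℝ := fun k =>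
  ∑ l, ∑ m, G x l m * (pd k (fun y => e₂ y l) x + ∑ p, chris G l k p x * e₂ x p) * e₁ x m

/-- `C_{G₁,G₂}`: the supremum of `‖v‖_{G₁} / ‖v‖_{G₂}` over the triangle. -/
def CC (G₁ G₂ : E2 → Mat) : ℝ≥0∞ :=
  ⨆ x ∈ refTri, ⨆ v : E2, ⨆ _ : v ≠ 0, ENNReal.ofReal (len (G₁ x) v / len (G₂ x) v)

/-- The `L^∞` norm, measured in `G`, of a `(0,2)`-tensor field. -/
def linf2 (G σ : E2 → Mat) : ℝ≥0∞ :=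
  ⨆ x ∈ refTri, ⨆ v : E2, ⨆ _ : v ≠ 0, ⨆ w : E2, ⨆ _ : w ≠ 0,
    ENNReal.ofReal (|pair (σ x) v w| / (len (G x) v * len (G x) w))

/-- The flat metric of the reference triangle. -/
def flat : E2 → Mat := fun _ => 1

/-! ### Surfaces, meshes and Regge metrics -/

variable {M : Type*} [TopologicalSpace M] [ChartedSpace (EuclideanQuadrant 2) M]

/-- `M` is a closed topological disc. -/
def IsDisc (M : Type*) [TopologicalSpace M] : Prop :=
  Nonempty (M ≃ₜ Metric.closedBall (0 : E2) 1)

/-- The differential of a map from the reference triangle to `M`. -/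
def dpar (f : E2 → M) (x : E2) : E2 →L[ℝ] TangentSpace IQ (f x) :=
  mfderivWithin 𝓘(ℝ, E2) IQ f refTri x

/-- `f` restricts to a smooth immersion of the closed reference triangle in `M`. -/
structure IsSmoothTriangle (f : E2 → M) : Prop where
  smooth : ContMDiffOn 𝓘(ℝ, E2) IQ ∞ f refTri
  immersion : ∀ x ∈ refTri, Function.Injective (dpar f x)

/-- A finite smooth triangulation of `M`, given by diffeomorphisms from the reference triangle
onto its triangles. Two distinct triangles are disjoint or meet in a common proper face. -/
structure Mesh (M : Type*) [TopologicalSpace M] [ChartedSpace (EuclideanQuadrant 2) M] where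
  /-- number of triangles -/
  n : ℕ
  /-- the map `f_T` from the reference triangle onto the triangle `T` -/
  par : Fin n → E2 → M
  smooth : ∀ T, IsSmoothTriangle (par T)
  inj : ∀ T, Set.InjOn (par T) refTri
  cover : ⋃ T, par T '' refTri = Set.univ
  inter : ∀ T T', T ≠ T' → (par T '' refTri ∩ par T' '' refTri = ∅ ∨
    ∃ s s' : Finset (Fin 3), s ≠ Finset.univ ∧ s' ≠ Finset.univ ∧
      par T '' refTri ∩ par T' '' refTri = par T '' face s ∧
      par T '' face s = par T' '' face s')

/-- A Regge metric on a mesh: a smooth Riemannian metric on each closed triangle (given through its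
pullback to the reference triangle) such that the lengths of vectors tangent to a common
edge, measured from the two triangles, agree. -/
structure ReggeMetric (𝒯 : Mesh M) where
  /-- the metric on the triangle `T`, pulled back along `f_T` -/
  G : Fin 𝒯.n → E2 → Mat
  smooth : ∀ T i j, ContDiffOn ℝ ∞ (fun x => G T x i j) refTri
  posDef : ∀ T, ∀ x ∈ refTri, (G T x).PosDef
  compat : ∀ T T' i i', 𝒯.par T '' side i = 𝒯.par T' '' side i' →
    ∀ x ∈ side i, ∀ x' ∈ side i', ∀ heq : 𝒯.par T x = 𝒯.par T' x',
    ∀ c c' : ℝ, heq ▸ dpar (𝒯.par T) x (c • sideDir i) = dpar (𝒯.par T') x' (c' • sideDir i') →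
      pair (G T x) (c • sideDir i) (c • sideDir i) =
        pair (G T' x') (c' • sideDir i') (c' • sideDir i')

/-- Smooth Riemannian metrics on `M`. -/
abbrev Metric2 (M : Type*) [TopologicalSpace M] [ChartedSpace (EuclideanQuadrant 2) M]
    [IsManifold IQ ∞ M] : Type _ :=
  Bundle.ContMDiffRiemannianMetric IQ ∞ E2 (fun x : M => TangentSpace IQ x)

/-- Pullback of a metric on `M` along a map from the reference triangle. -/
def pull [IsManifold IQ ∞ M] (g : Metric2 M) (f : E2 → M) (x : E2) : Mat :=
  Matrix.of fun i j => g.inner (f x) (dpar f x (EuclideanSpace.single i 1))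
    (dpar f x (EuclideanSpace.single j 1))

/-- Pullback of a vector field. -/
def pullVec (f : E2 → M) (e : ∀ x : M, TangentSpace IQ x) (x : E2) : E2 :=
  (dpar f x).inverse (e (f x))

/-- A smooth metric on `M`, seen on the triangles of a mesh. -/
def onMesh [IsManifold IQ ∞ M] (g : Metric2 M) (𝒯 : Mesh M) (T : Fin 𝒯.n) : E2 → Mat :=
  pull g (𝒯.par T)

/-- The pullback of a function on `M` to the reference triangle along `f_T`. -/
def res (𝒯 : Mesh M) (T : Fin 𝒯.n) (v : M → ℝ) : E2 → ℝ := fun x => v (𝒯.par T x)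

/-! ### Norms on a mesh -/

/-- `⟨u,v⟩_{L²(M,G)}` for functions. -/
def innerL2 (𝒯 : Mesh M) (G : Fin 𝒯.n → E2 → Mat) (u v : M → ℝ) : ℝ :=
  ∑ T, triInt (G T) fun x => res 𝒯 T u x * res 𝒯 T v x

/-- `⟨a,b⟩_{L²(M,G)}` for (piecewise defined) `1`-forms. -/
def innerL2Form (𝒯 : Mesh M) (G : Fin 𝒯.n → E2 → Mat) (a b : Fin 𝒯.n → E2 → Fin 2 → ℝ) : ℝ :=
  ∑ T, triInt (G T) fun x => inner1 (G T x) (a T x) (b T x)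

/-- The differential of a function, triangle by triangle. -/
def dM (𝒯 : Mesh M) (v : M → ℝ) (T : Fin 𝒯.n) (x : E2) : Fin 2 → ℝ := dfn (res 𝒯 T v) x

/-- The `L²(M,G)` norm of a `1`-form. -/
def normL2Form (𝒯 : Mesh M) (G : Fin 𝒯.n → E2 → Mat) (a : Fin 𝒯.n → E2 → Fin 2 → ℝ) : ℝ :=
  √(innerL2Form 𝒯 G a a)

/-- The `H(d)(M,G)` norm of a function. -/
def normHd (𝒯 : Mesh M) (G : Fin 𝒯.n → E2 → Mat) (v : M → ℝ) : ℝ :=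
  √(innerL2 𝒯 G v v) + normL2Form 𝒯 G (dM 𝒯 v)

/-- The `L²(M,G)` norm of a `(0,2)`-tensor field. -/
def normL2Tensor (𝒯 : Mesh M) (G σ : Fin 𝒯.n → E2 → Mat) : ℝ :=
  √(∑ T, triInt (G T) fun x => inner2 (G T x) (σ T x) (σ T x))

/-- The broken norm `(∑_T ‖∇σ‖²_{L²(T,G)})^{1/2}`, with the connection of `G` on each triangle. -/
def brokenNorm (𝒯 : Mesh M) (G σ : Fin 𝒯.n → E2 → Mat) : ℝ :=
  √(∑ T, triInt (G T) fun x => normSq3 (G T x) (cov2 (G T) (σ T) x))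

/-- The `L^∞(M,G)` norm of a `(0,2)`-tensor field. -/
def normLinf (𝒯 : Mesh M) (G σ : Fin 𝒯.n → E2 → Mat) : ℝ≥0∞ := ⨆ T, linf2 (G T) (σ T)

/-- `‖∇̂σ‖_{L^∞(T,δ̂)}`. -/
def hatNorm (σ : E2 → Mat) : ℝ≥0∞ :=
  supTri fun x => √(∑ k, ∑ i, ∑ j, hatCov2 σ x k i j ^ 2)

/-- The norm of a functional in the dual of the space `V` with norm `N`. -/
def dualNorm (N : (M → ℝ) → ℝ) (V : Submodule ℝ (M → ℝ)) (ℓ : (M → ℝ) → ℝ) : ℝ≥0∞ :=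
  ⨆ v ∈ V, ⨆ _ : v ≠ 0, ENNReal.ofReal |ℓ v| / ENNReal.ofReal (N v)

/-! ### The functionals -/

/-- `b_h(G; σ, v)`. In the sum over edges, the pairing with the jump `dv([[n]])` is distributed over
the triangles that contain the edge, each contributing with its own outward unit normal. -/
def bh (𝒯 : Mesh M) (G σ : Fin 𝒯.n → E2 → Mat) (v : M → ℝ) : ℝ :=
  (∑ T, triInt (G T) fun x => inner2 (G T x) (SS (G T) (σ T) x) (hess (G T) (res 𝒯 T v) x)) -
    ∑ T, ∑ i, sideInt (G T) i fun x =>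
      pair (SS (G T) (σ T) x) (nrm (G T) i x) (nrm (G T) i x) *
        dapp (res 𝒯 T v) x (nrm (G T) i x)

/-- The `i`-th side of `T` lies on `∂M`. -/
def IsBdrySide (𝒯 : Mesh M) (T : Fin 𝒯.n) (i : Fin 3) : Prop :=
  𝒯.par T '' side i ⊆ ModelWithCorners.boundary (I := IQ) M

open Classical in
/-- The vertices of a mesh. -/
def verts (𝒯 : Mesh M) : Finset M :=
  Finset.univ.image fun q : Fin 𝒯.n × Fin 3 => 𝒯.par q.1 (vtx q.2)

open Classical in
/-- The sum of the interior angles at a vertex `p`. -/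
def angleSum (𝒯 : Mesh M) (G : Fin 𝒯.n → E2 → Mat) (p : M) : ℝ :=
  ∑ T, ∑ i, if 𝒯.par T (vtx i) = p then angle (G T) i else 0

open Classical in
/-- The distributional Gauss curvature `⟨⟨K dA_dist(G), v⟩⟩`. The jump of the geodesic curvature
across an interior edge is distributed over the two triangles that contain it. -/
def KdAdist (𝒯 : Mesh M) (G : Fin 𝒯.n → E2 → Mat) (v : M → ℝ) : ℝ :=
  (∑ T, triInt (G T) fun x => res 𝒯 T v x * gaussK (G T) x) +
  (∑ T, ∑ i, if IsBdrySide 𝒯 T i then 0 else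
    sideInt (G T) i fun x => res 𝒯 T v x * geoK (G T) i x) +
  ∑ p ∈ verts 𝒯, if ModelWithCorners.IsBoundaryPoint (I := IQ) p then 0 else
    v p * (2 * Real.pi - angleSum 𝒯 G p)

section Frame

variable [IsManifold IQ ∞ M]

/-- A smooth `g`-orthonormal frame; it also orients `M`. -/
structure IsFrame (g : Metric2 M) (e₁ e₂ : ∀ x : M, TangentSpace IQ x) : Prop where
  smooth₁ : ContMDiff IQ IQ.tangent ∞ fun x => (⟨x, e₁ x⟩ : TangentBundle IQ M)
  smooth₂ : ContMDiff IQ IQ.tangent ∞ fun x => (⟨x, e₂ x⟩ : TangentBundle IQ M)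
  unit₁ : ∀ x, g.inner x (e₁ x) (e₁ x) = 1
  unit₂ : ∀ x, g.inner x (e₂ x) (e₂ x) = 1
  orth : ∀ x, g.inner x (e₁ x) (e₂ x) = 0

/-- `f` preserves orientation, `M` being oriented by the frame. -/
def PreservesOrientation (e₁ e₂ : ∀ x : M, TangentSpace IQ x) (f : E2 → M) : Prop :=
  ∀ x ∈ refTri,
    0 < pullVec f e₁ x 0 * pullVec f e₂ x 1 - pullVec f e₁ x 1 * pullVec f e₂ x 0

/-- `exp(iμ)` along the `i`-th side of the triangle parametrized by `f`, where `μ` is the oriented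
angle between `e₁` and the outward `g`-unit normal `n`, that is `n = cos μ e₁ + sin μ e₂`. -/
def expMu (g : Metric2 M) (e₁ e₂ : ∀ x : M, TangentSpace IQ x) (f : E2 → M) (i : Fin 3)
    (s : ℝ) : ℂ :=
  ⟨pair (pull g f (sidePt i s)) (pullVec f e₁ (sidePt i s)) (nrm (pull g f) i (sidePt i s)),
    pair (pull g f (sidePt i s)) (pullVec f e₂ (sidePt i s)) (nrm (pull g f) i (sidePt i s))⟩

/-- The derivative of `μ` along the parametrized side. -/
def dMu (g : Metric2 M) (e₁ e₂ : ∀ x : M, TangentSpace IQ x) (f : E2 → M) (i : Fin 3)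
    (s : ℝ) : ℝ :=
  (starRingEnd ℂ (expMu g e₁ e₂ f i s) *
    derivWithin (expMu g e₁ e₂ f i) (Set.Icc 0 1) s).im

open Classical in
/-- The jump `[[μ]]` at a boundary vertex `p`, in `(-π, π]`: the value of `μ` on the boundary edge
that starts at `p` minus its value on the boundary edge that ends at `p` (each product has
one factor different from `1`). -/
def jumpMu (g : Metric2 M) (e₁ e₂ : ∀ x : M, TangentSpace IQ x) (𝒯 : Mesh M) (p : M) : ℝ :=
  Complex.arg
    ((∏ T, ∏ i, if IsBdrySide 𝒯 T i ∧ 𝒯.par T (sidePt i 0) = p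
        then expMu g e₁ e₂ (𝒯.par T) i 0 else 1) *
      ∏ T, ∏ i, if IsBdrySide 𝒯 T i ∧ 𝒯.par T (sidePt i 1) = p
        then starRingEnd ℂ (expMu g e₁ e₂ (𝒯.par T) i 1) else 1)

open Classical in
/-- `⟨⟨α_dist(G), v⟩⟩`; the angle `μ` is measured by the smooth metric `g`. -/
def alphaDist (g : Metric2 M) (e₁ e₂ : ∀ x : M, TangentSpace IQ x) (𝒯 : Mesh M)
    (G : Fin 𝒯.n → E2 → Mat) (v : M → ℝ) : ℝ :=
  (∑ T, ∑ i, if IsBdrySide 𝒯 T i then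
      (∫ s in (0 : ℝ)..1, res 𝒯 T v (sidePt i s) * dMu g e₁ e₂ (𝒯.par T) i s) -
        sideInt (G T) i (fun x => res 𝒯 T v x * geoK (G T) i x)
    else 0) -
  ∑ p ∈ verts 𝒯, if ModelWithCorners.IsBoundaryPoint (I := IQ) p then
    v p * (Real.pi - jumpMu g e₁ e₂ 𝒯 p - angleSum 𝒯 G p) else 0

/-- The functional `F_h(G)`. -/
def Fh (g : Metric2 M) (e₁ e₂ : ∀ x : M, TangentSpace IQ x) (𝒯 : Mesh M)
    (G : Fin 𝒯.n → E2 → Mat) (v : M → ℝ) : ℝ :=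
  alphaDist g e₁ e₂ 𝒯 G v - KdAdist 𝒯 G v

/-- `α = ⋆du`, where `α = ⟨∇e₂,e₁⟩` is the connection form of the frame; the equation of `1`-forms
on `M` is expressed in all positively oriented smooth triangles of `M`. -/
def IsPotential (g : Metric2 M) (e₁ e₂ : ∀ x : M, TangentSpace IQ x) (u : M → ℝ) : Prop :=
  ContMDiff IQ 𝓘(ℝ, ℝ) ∞ u ∧
  ∀ f : E2 → M, IsSmoothTriangle f → PreservesOrientation e₁ e₂ f → ∀ x ∈ refTri,
    connForm (pull g f) (pullVec f e₁) (pullVec f e₂) x =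
      star1 (pull g f x) (dfn (fun y => u (f y)) x)

/-- `u_h ∈ V` solves the discrete problem for the Regge metric `G`. -/
structure IsDiscreteSolution (g : Metric2 M) (e₁ e₂ : ∀ x : M, TangentSpace IQ x) (𝒯 : Mesh M)
    (G : Fin 𝒯.n → E2 → Mat) (V : Submodule ℝ (M → ℝ)) (uh : M → ℝ) : Prop where
  mem : uh ∈ V
  eqn : ∀ v ∈ V, innerL2Form 𝒯 G (dM 𝒯 uh) (dM 𝒯 v) = Fh g e₁ e₂ 𝒯 G v
  orth : ∀ c ∈ V, (∀ T, ∀ x ∈ refTri, dM 𝒯 c T x = 0) → innerL2 𝒯 G uh c = 0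

/-! ### Hypotheses on meshes, finite element spaces and metrics -/

/-- A reference element space: a finite-dimensional space of functions that are `C²` on the closed
reference triangle. -/
structure IsRefSpace (Vhat : Submodule ℝ (E2 → ℝ)) : Prop where
  finite : FiniteDimensional ℝ Vhat
  c2 : ∀ φ ∈ Vhat, ContDiffOn ℝ 2 φ refTri

/-- Riemannian shape-regularity with constant `K`. -/
def ShapeRegular {𝒯 : Mesh M} (γ : ReggeMetric 𝒯) (K : ℝ) : Prop :=
  ∀ T, CC (γ.G T) flat * CC flat (γ.G T) ≤ ENNReal.ofReal K

/-- Riemannian quasi-uniformity with constant `K'`. -/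
def QuasiUniform {𝒯 : Mesh M} (γ : ReggeMetric 𝒯) (K' h : ℝ) : Prop :=
  ∀ T, CC flat (γ.G T) ≤ ENNReal.ofReal (K' * h⁻¹)

/-- `V` consists of functions in `H(d)Ω⁰(M)` which on each triangle are the pushforward of an
element of `Vhat`. A function that is `C²` on each triangle is in `H(d)Ω⁰(M)` if and only if
it is continuous. -/
structure IsElementSpace (Vhat : Submodule ℝ (E2 → ℝ)) (𝒯 : Mesh M)
    (V : Submodule ℝ (M → ℝ)) : Prop where
  cont : ∀ v ∈ V, Continuous v
  local_mem : ∀ v ∈ V, ∀ T, ∃ φ ∈ Vhat, Set.EqOn (res 𝒯 T v) φ refTri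

/-- The hypotheses at mesh parameter `h`, with explicit constants `A₁`, `A₂`, `A₄` for the three
bounds `O(h^(r+1))`, `O(h^r)`, `O(1)`. -/
structure IsAdmissible (g : Metric2 M) (Vhat : Submodule ℝ (E2 → ℝ)) (r : ℕ)
    (K K' C' A₁ A₂ A₄ h : ℝ) (𝒯 : Mesh M) (γ : ReggeMetric 𝒯)
    (V : Submodule ℝ (M → ℝ)) : Prop where
  shape : ShapeRegular γ K
  quasi : QuasiUniform γ K' h
  space : IsElementSpace Vhat 𝒯 V
  l2 : normL2Tensor 𝒯 (onMesh g 𝒯) (γ.G - onMesh g 𝒯) ≤ A₁ * h ^ (r + 1)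
  broken : brokenNorm 𝒯 (onMesh g 𝒯) γ.G ≤ A₂ * h ^ r
  linf : normLinf 𝒯 (onMesh g 𝒯) (γ.G - onMesh g 𝒯) ≤ ENNReal.ofReal C'
  hat : ∀ T, hatNorm (γ.G T) + hatNorm (onMesh g 𝒯 T) ≤ ENNReal.ofReal A₄

end Frame

end Regge

end

open scoped Manifold ContDiff ENNReal
open MeasureTheory

noncomputable section

namespace Regge

section

/-! ### Calculus on the reference triangle -/

theorem continuous_coord (i : Fin 2) : Continuous fun x : E2 => x i := by fun_prop

theorem isClosed_refTri : IsClosed refTri :=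
  (isClosed_le continuous_const (continuous_coord 0)).inter
    ((isClosed_le continuous_const (continuous_coord 1)).inter
      (isClosed_le ((continuous_coord 0).add (continuous_coord 1)) continuous_const))

theorem convex_refTri : Convex ℝ refTri := by
  intro x hx y hy a b ha hb hab
  obtain ⟨h1, h2, h3⟩ := hx
  obtain ⟨k1, k2, k3⟩ := hy
  refine ⟨?_, ?_, ?_⟩ <;> simp only [PiLp.add_apply, PiLp.smul_apply, smul_eq_mul]
  · positivity
  · positivity
  · nlinarith

theorem isCompact_refTri : IsCompact refTri := by
  refine Metric.isCompact_of_isClosed_isBounded isClosed_refTri ?_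
  refine (Metric.isBounded_closedBall (x := (0 : E2)) (r := 2)).subset fun x hx => ?_
  obtain ⟨h1, h2, h3⟩ := hx
  rw [mem_closedBall_zero_iff, EuclideanSpace.norm_eq, Real.sqrt_le_left (by norm_num)]
  simp only [Fin.sum_univ_two, Real.norm_eq_abs, sq_abs]
  nlinarith

/-- The open reference triangle. -/
def openTri : Set E2 := {x | 0 < x 0 ∧ 0 < x 1 ∧ x 0 + x 1 < 1}

theorem isOpen_openTri : IsOpen openTri :=
  (isOpen_lt continuous_const (continuous_coord 0)).inter
    ((isOpen_lt continuous_const (continuous_coord 1)).inter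
      (isOpen_lt ((continuous_coord 0).add (continuous_coord 1)) continuous_const))

theorem openTri_subset : openTri ⊆ refTri := fun _ h => ⟨h.1.le, h.2.1.le, h.2.2.le⟩

theorem openTri_subset_interior : openTri ⊆ interior refTri :=
  interior_maximal openTri_subset isOpen_openTri

theorem centroid_mem : (!₂[1/3, 1/3] : E2) ∈ openTri := by
  refine ⟨?_, ?_, ?_⟩ <;> norm_num

theorem uniqueDiffOn_refTri : UniqueDiffOn ℝ refTri :=
  uniqueDiffOn_convex convex_refTri ⟨_, openTri_subset_interior centroid_mem⟩

theorem vtx_mem (i : Fin 3) : vtx i ∈ refTri := by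
  fin_cases i <;> simp [vtx, refTri]

theorem sidePt_mem (i : Fin 3) {s : ℝ} (hs : s ∈ Set.Icc (0 : ℝ) 1) : sidePt i s ∈ refTri := by
  have : sidePt i s = (1 - s) • vtx i + s • vtx (i + 1) := by
    simp only [sidePt, sideDir]; module
  rw [this]
  exact convex_refTri (vtx_mem _) (vtx_mem _) (by linarith [hs.2]) hs.1 (by ring)

/-- The partial derivatives of `φ` on the closed reference triangle at `x` are `a`. -/
def HasPd (φ : E2 → ℝ) (a : Fin 2 → ℝ) (x : E2) : Prop :=
  ∃ φ' : E2 →L[ℝ] ℝ, HasFDerivWithinAt φ φ' refTri x ∧ ∀ k, φ' (EuclideanSpace.single k 1) = a k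

namespace HasPd

variable {φ ψ : E2 → ℝ} {a b : Fin 2 → ℝ} {x : E2}

theorem pd_eq (h : HasPd φ a x) (hx : x ∈ refTri) (k : Fin 2) : pd k φ x = a k := by
  obtain ⟨φ', h', ha⟩ := h
  rw [pd, h'.fderivWithin (uniqueDiffOn_refTri x hx), ha]

theorem of_differentiable (h : DifferentiableWithinAt ℝ φ refTri x) :
    HasPd φ (fun k => pd k φ x) x :=
  ⟨_, h.hasFDerivWithinAt, fun _ => rfl⟩

theorem of_contDiffOn {n : WithTop ℕ∞} (h : ContDiffOn ℝ n φ refTri) (hn : n ≠ 0)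
    (hx : x ∈ refTri) : HasPd φ (fun k => pd k φ x) x :=
  of_differentiable (h.differentiableOn hn x hx)

theorem congr (h : HasPd φ a x) (hab : ∀ k, a k = b k) : HasPd φ b x := by
  rwa [← funext hab]

theorem const (c : ℝ) : HasPd (fun _ => c) (fun _ => 0) x :=
  ⟨0, hasFDerivWithinAt_const _ _ _, fun _ => rfl⟩

theorem add (h : HasPd φ a x) (k : HasPd ψ b x) :
    HasPd (fun y => φ y + ψ y) (fun j => a j + b j) x := by
  obtain ⟨φ', h', ha⟩ := h
  obtain ⟨ψ', k', hb⟩ := k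
  exact ⟨_, h'.add k', fun j => by simp [ha, hb]⟩

theorem neg (h : HasPd φ a x) : HasPd (fun y => - φ y) (fun j => - a j) x := by
  obtain ⟨φ', h', ha⟩ := h
  exact ⟨_, h'.neg, fun j => by simp [ha]⟩

theorem sub (h : HasPd φ a x) (k : HasPd ψ b x) :
    HasPd (fun y => φ y - ψ y) (fun j => a j - b j) x := by
  obtain ⟨φ', h', ha⟩ := h
  obtain ⟨ψ', k', hb⟩ := k
  exact ⟨_, h'.sub k', fun j => by simp [ha, hb]⟩

theorem mul (h : HasPd φ a x) (k : HasPd ψ b x) :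
    HasPd (fun y => φ y * ψ y) (fun j => a j * ψ x + φ x * b j) x := by
  obtain ⟨φ', h', ha⟩ := h
  obtain ⟨ψ', k', hb⟩ := k
  exact ⟨_, h'.mul k', fun j => by simp [ha, hb]; ring⟩

theorem comp_deriv {f : ℝ → ℝ} {f' : ℝ} (hf : HasDerivAt f f' (φ x)) (h : HasPd φ a x) :
    HasPd (fun y => f (φ y)) (fun j => f' * a j) x := by
  obtain ⟨φ', h', ha⟩ := h
  exact ⟨_, hf.comp_hasFDerivWithinAt x h', fun j => by simp [ha]⟩

theorem inv (h : HasPd φ a x) (h0 : φ x ≠ 0) :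
    HasPd (fun y => (φ y)⁻¹) (fun j => - (a j / φ x ^ 2)) x :=
  (h.comp_deriv (hasDerivAt_inv h0)).congr fun j => by ring

theorem div (h : HasPd φ a x) (k : HasPd ψ b x) (h0 : ψ x ≠ 0) :
    HasPd (fun y => φ y / ψ y) (fun j => (a j * ψ x - φ x * b j) / ψ x ^ 2) x :=
  (h.mul (k.inv h0)).congr fun j => by field_simp; ring

theorem sqrt (h : HasPd φ a x) (h0 : φ x ≠ 0) :
    HasPd (fun y => √(φ y)) (fun j => a j / (2 * √(φ x))) x :=
  (h.comp_deriv (Real.hasDerivAt_sqrt h0)).congr fun j => by ring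

theorem arctan (h : HasPd φ a x) :
    HasPd (fun y => Real.arctan (φ y)) (fun j => a j / (1 + φ x ^ 2)) x :=
  (h.comp_deriv (Real.hasDerivAt_arctan (φ x))).congr fun j => by ring

theorem coord (i : Fin 2) : HasPd (fun y => y i) (fun j => if i = j then 1 else 0) x :=
  ⟨EuclideanSpace.proj i,
    (EuclideanSpace.proj i : E2 →L[ℝ] ℝ).hasFDerivWithinAt, fun j => by simp⟩

theorem congr_fun (h : HasPd φ a x) (hφ : Set.EqOn ψ φ refTri) (hx : x ∈ refTri) :
    HasPd ψ a x := by
  obtain ⟨φ', h', ha⟩ := h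
  exact ⟨φ', h'.congr hφ (hφ hx), ha⟩

end HasPd

theorem pd_congr {φ ψ : E2 → ℝ} (h : Set.EqOn φ ψ refTri) {x : E2} (hx : x ∈ refTri) (k : Fin 2) :
    pd k φ x = pd k ψ x := by
  rw [pd, pd, fderivWithin_congr h (h hx)]

theorem contDiffOn_pd {m n : WithTop ℕ∞} {φ : E2 → ℝ} (h : ContDiffOn ℝ n φ refTri)
    (hm : m + 1 ≤ n) (k : Fin 2) : ContDiffOn ℝ m (pd k φ) refTri :=
  (h.fderivWithin uniqueDiffOn_refTri hm).clm_apply contDiffOn_const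

theorem continuousOn_pd {n : WithTop ℕ∞} {φ : E2 → ℝ} (h : ContDiffOn ℝ n φ refTri)
    (hn : 1 ≤ n) (k : Fin 2) : ContinuousOn (pd k φ) refTri :=
  (contDiffOn_pd (m := 0) h (by simpa using hn) k).continuousOn

theorem vec_eq_sum (w : E2) : w = w 0 • EuclideanSpace.single 0 1 + w 1 • EuclideanSpace.single 1 1 := by
  ext i; fin_cases i <;> simp

theorem fderivWithin_apply_eq (φ : E2 → ℝ) (x w : E2) :
    fderivWithin ℝ φ refTri x w = w 0 * pd 0 φ x + w 1 * pd 1 φ x := by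
  conv_lhs => rw [vec_eq_sum w]
  simp [pd]

theorem hasDerivWithinAt_comp_sidePt {φ : E2 → ℝ} (i : Fin 3) {s : ℝ}
    (h : DifferentiableWithinAt ℝ φ refTri (sidePt i s)) :
    HasDerivWithinAt (fun t => φ (sidePt i t)) (dapp φ (sidePt i s) (sideDir i)) (Set.Icc 0 1) s := by
  have h1 : HasDerivWithinAt (sidePt i) (sideDir i) (Set.Icc 0 1) s := by
    have := (((hasDerivAt_id s).smul_const (sideDir i)).const_add (vtx i)).hasDerivWithinAt
      (s := Set.Icc (0:ℝ) 1)
    rw [one_smul] at this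
    exact this
  have h2 := h.hasFDerivWithinAt.comp_hasDerivWithinAt s h1 (fun t ht => sidePt_mem i ht)
  have e : fderivWithin ℝ φ refTri (sidePt i s) (sideDir i) = dapp φ (sidePt i s) (sideDir i) := by
    rw [fderivWithin_apply_eq, dapp, Fin.sum_univ_two]; ring
  rw [e] at h2
  exact h2

theorem continuous_sidePt (i : Fin 3) : Continuous (sidePt i) := by
  unfold sidePt; fun_prop

theorem continuousOn_comp_sidePt {X : Type*} [TopologicalSpace X] {φ : E2 → X}
    (h : ContinuousOn φ refTri) (i : Fin 3) :
    ContinuousOn (fun s => φ (sidePt i s)) (Set.Icc 0 1) :=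
  h.comp (continuous_sidePt i).continuousOn fun _ hs => sidePt_mem i hs

theorem intervalIntegrable_sidePt {φ : E2 → ℝ} (h : ContinuousOn φ refTri) (i : Fin 3) :
    IntervalIntegrable (fun s => φ (sidePt i s)) volume 0 1 :=
  ((continuousOn_comp_sidePt h i).mono (by rw [Set.uIcc_of_le zero_le_one])).intervalIntegrable

theorem integrableOn_refTri {φ : E2 → ℝ} (h : ContinuousOn φ refTri) : IntegrableOn φ refTri :=
  h.integrableOn_compact isCompact_refTri

theorem integral_dapp_sidePt {φ : E2 → ℝ} (h : ContDiffOn ℝ 1 φ refTri) (i : Fin 3) :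
    ∫ s in (0:ℝ)..1, dapp φ (sidePt i s) (sideDir i) = φ (vtx (i + 1)) - φ (vtx i) := by
  have hc : ContinuousOn (fun x => dapp φ x (sideDir i)) refTri := by
    unfold dapp
    exact continuousOn_finsetSum _ fun k _ => (continuousOn_pd h le_rfl k).mul continuousOn_const
  have := intervalIntegral.integral_eq_sub_of_hasDerivAt_of_le zero_le_one
    (f := fun s => φ (sidePt i s)) (continuousOn_comp_sidePt h.continuousOn i)
    (fun s hs => (hasDerivWithinAt_comp_sidePt i
      (h.differentiableOn one_ne_zero _ (sidePt_mem i (Set.Ioo_subset_Icc_self hs)))).hasDerivAt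
        (Icc_mem_nhds hs.1 hs.2)) (intervalIntegrable_sidePt hc i)
  rw [this]
  simp [sidePt, sideDir]

/-! ### The divergence theorem on the reference triangle -/

/-- The point with coordinates `a`, `b`. -/
def pt (a b : ℝ) : E2 := !₂[a, b]

theorem integral_refTri_eq_prod (f : E2 → ℝ) :
    ∫ x in refTri, f x =
      ∫ z in {z : ℝ × ℝ | 0 ≤ z.1 ∧ 0 ≤ z.2 ∧ z.1 + z.2 ≤ 1}, f (pt z.1 z.2) := by
  have h1 := (volume_preserving_finTwoArrow ℝ).symm
  have h2 := (EuclideanSpace.volume_preserving_symm_measurableEquiv_toLp (Fin 2)).symm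
  have h3 := h2.comp h1
  have e := h3.setIntegral_preimage_emb
    (((MeasurableEquiv.toLp 2 (Fin 2 → ℝ)).symm.symm.measurableEmbedding).comp
      (MeasurableEquiv.finTwoArrow (α := ℝ)).symm.measurableEmbedding) f refTri
  rw [← e]
  rfl

theorem integral_refTri_iterated {f : E2 → ℝ} (hf : ContinuousOn f refTri) :
    (∫ x in refTri, f x = ∫ a in (0:ℝ)..1, ∫ b in (0:ℝ)..(1 - a), f (pt a b)) ∧
    ∫ x in refTri, f x = ∫ b in (0:ℝ)..1, ∫ a in (0:ℝ)..(1 - b), f (pt a b) := by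
  set S : Set (ℝ × ℝ) := {z : ℝ × ℝ | 0 ≤ z.1 ∧ 0 ≤ z.2 ∧ z.1 + z.2 ≤ 1} with hS
  have hSc : IsClosed S :=
    (isClosed_le continuous_const continuous_fst).inter
      ((isClosed_le continuous_const continuous_snd).inter
        (isClosed_le (continuous_fst.add continuous_snd) continuous_const))
  have hSm : MeasurableSet S := hSc.measurableSet
  have hScomp : IsCompact S := by
    refine Metric.isCompact_of_isClosed_isBounded hSc ?_
    refine ((Metric.isBounded_Icc (0:ℝ) 1).prod (Metric.isBounded_Icc (0:ℝ) 1)).subset ?_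
    rintro ⟨a, b⟩ ⟨h1, h2, h3⟩
    simp only at h1 h2 h3
    exact ⟨⟨h1, by linarith⟩, ⟨h2, by linarith⟩⟩
  have hpt : Continuous fun z : ℝ × ℝ => pt z.1 z.2 := by
    unfold pt
    refine (PiLp.continuous_toLp 2 _).comp (continuous_pi fun i => ?_)
    fin_cases i
    · exact continuous_fst
    · exact continuous_snd
  have hc : ContinuousOn (fun z : ℝ × ℝ => f (pt z.1 z.2)) S :=
    hf.comp hpt.continuousOn fun z hz => by simpa [pt, refTri, hS] using hz
  have hint : Integrable (S.indicator fun z : ℝ × ℝ => f (pt z.1 z.2)) :=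
    (integrable_indicator_iff hSm).2 (hc.integrableOn_compact hScomp)
  rw [integral_refTri_eq_prod, ← hS, ← integral_indicator hSm]
  constructor
  · rw [Measure.volume_eq_prod, integral_prod _ (by rwa [← Measure.volume_eq_prod]),
      intervalIntegral.integral_of_le zero_le_one, ← integral_Icc_eq_integral_Ioc,
      ← integral_indicator measurableSet_Icc]
    congr 1; ext a
    by_cases ha : a ∈ Set.Icc (0:ℝ) 1
    · rw [Set.indicator_of_mem ha, intervalIntegral.integral_of_le (by linarith [ha.2]),
        ← integral_Icc_eq_integral_Ioc, ← integral_indicator measurableSet_Icc]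
      congr 1; ext b
      by_cases hb : b ∈ Set.Icc 0 (1 - a)
      · rw [Set.indicator_of_mem hb, Set.indicator_of_mem]
        exact ⟨ha.1, hb.1, by linarith [hb.2]⟩
      · rw [Set.indicator_of_notMem hb, Set.indicator_of_notMem]
        rintro ⟨h1, h2, h3⟩
        exact hb ⟨h2, by simp only at h3; linarith⟩
    · rw [Set.indicator_of_notMem ha]
      refine integral_eq_zero_of_ae (Filter.Eventually.of_forall fun b => ?_)
      refine Set.indicator_of_notMem ?_ _
      rintro ⟨h1, h2, h3⟩
      simp only at h1 h2 h3
      exact ha ⟨h1, by linarith⟩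
  · rw [Measure.volume_eq_prod, integral_prod_symm _ (by rwa [← Measure.volume_eq_prod]),
      intervalIntegral.integral_of_le zero_le_one, ← integral_Icc_eq_integral_Ioc,
      ← integral_indicator measurableSet_Icc]
    congr 1; ext a
    by_cases ha : a ∈ Set.Icc (0:ℝ) 1
    · rw [Set.indicator_of_mem ha, intervalIntegral.integral_of_le (by linarith [ha.2]),
        ← integral_Icc_eq_integral_Ioc, ← integral_indicator measurableSet_Icc]
      congr 1; ext b
      by_cases hb : b ∈ Set.Icc 0 (1 - a)
      · rw [Set.indicator_of_mem hb, Set.indicator_of_mem]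
        exact ⟨hb.1, ha.1, by simp only; linarith [hb.2]⟩
      · rw [Set.indicator_of_notMem hb, Set.indicator_of_notMem]
        rintro ⟨h1, h2, h3⟩
        exact hb ⟨h1, by simp only at h3; linarith⟩
    · rw [Set.indicator_of_notMem ha]
      refine integral_eq_zero_of_ae (Filter.Eventually.of_forall fun b => ?_)
      refine Set.indicator_of_notMem ?_ _
      rintro ⟨h1, h2, h3⟩
      simp only at h1 h2 h3
      exact ha ⟨h2, by linarith⟩

theorem integral_pd_line {φ : E2 → ℝ} (h : ContDiffOn ℝ 1 φ refTri) (k : Fin 2) {p : E2} {l : ℝ}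
    (hl : 0 ≤ l) (hp : ∀ t ∈ Set.Icc 0 l, p + t • EuclideanSpace.single k 1 ∈ refTri) :
    ∫ t in (0:ℝ)..l, pd k φ (p + t • EuclideanSpace.single k 1) =
      φ (p + l • EuclideanSpace.single k 1) - φ p := by
  have hline : Continuous fun t : ℝ => p + t • (EuclideanSpace.single k 1 : E2) := by fun_prop
  have := intervalIntegral.integral_eq_sub_of_hasDerivAt_of_le hl
    (f := fun t : ℝ => φ (p + t • (EuclideanSpace.single k 1 : E2)))
    (f' := fun t => pd k φ (p + t • EuclideanSpace.single k 1))
    (h.continuousOn.comp hline.continuousOn fun t ht => hp t ht)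
    (fun t ht => ?_) ?_
  · simpa using this
  · have h1 : HasDerivWithinAt (fun t : ℝ => p + t • (EuclideanSpace.single k 1 : E2))
        (EuclideanSpace.single k 1) (Set.Icc 0 l) t := by
      simpa using (((hasDerivAt_id t).smul_const (EuclideanSpace.single k 1 : E2)).const_add
        p).hasDerivWithinAt (s := Set.Icc (0:ℝ) l)
    have h2 := (h.differentiableOn one_ne_zero _
      (hp t (Set.Ioo_subset_Icc_self ht))).hasFDerivWithinAt.comp_hasDerivWithinAt t h1 hp
    exact h2.hasDerivAt (Icc_mem_nhds ht.1 ht.2)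
  · refine ContinuousOn.intervalIntegrable ?_
    rw [Set.uIcc_of_le hl]
    exact (continuousOn_pd h le_rfl k).comp hline.continuousOn fun t ht => hp t ht

theorem integral_pd_one {φ : E2 → ℝ} (h : ContDiffOn ℝ 1 φ refTri) :
    ∫ x in refTri, pd 1 φ x = ∫ a in (0:ℝ)..1, (φ (pt a (1 - a)) - φ (pt a 0)) := by
  rw [(integral_refTri_iterated (continuousOn_pd h le_rfl 1)).1]
  refine intervalIntegral.integral_congr fun a ha => ?_
  rw [Set.uIcc_of_le zero_le_one] at ha
  have e : ∀ b, pt a b = pt a 0 + b • EuclideanSpace.single 1 1 := fun b => by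
    ext i; fin_cases i <;> simp [pt]
  rw [e (1 - a), ← integral_pd_line h 1 (by linarith [ha.2])]
  · refine intervalIntegral.integral_congr fun b _ => ?_
    simp only [← e]
  · intro t ht
    rw [← e]
    exact ⟨ha.1, ht.1, by simp only [pt]; simp; linarith [ht.2]⟩

theorem integral_pd_zero {φ : E2 → ℝ} (h : ContDiffOn ℝ 1 φ refTri) :
    ∫ x in refTri, pd 0 φ x = ∫ b in (0:ℝ)..1, (φ (pt (1 - b) b) - φ (pt 0 b)) := by
  rw [(integral_refTri_iterated (continuousOn_pd h le_rfl 0)).2]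
  refine intervalIntegral.integral_congr fun b hb => ?_
  rw [Set.uIcc_of_le zero_le_one] at hb
  have e : ∀ a, pt a b = pt 0 b + a • EuclideanSpace.single 0 1 := fun a => by
    ext i; fin_cases i <;> simp [pt]
  rw [e (1 - b), ← integral_pd_line h 0 (by linarith [hb.2])]
  · refine intervalIntegral.integral_congr fun a _ => ?_
    simp only [← e]
  · intro t ht
    rw [← e]
    exact ⟨ht.1, hb.1, by simp only [pt]; simp; linarith [ht.2]⟩

theorem sidePt_zero (s : ℝ) : sidePt 0 s = pt s 0 := by
  ext j; fin_cases j <;> simp [sidePt, sideDir, vtx, pt]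

theorem sidePt_one (s : ℝ) : sidePt 1 s = pt (1 - s) s := by
  ext j; fin_cases j <;> simp [sidePt, sideDir, vtx, pt]; ring

theorem sidePt_two (s : ℝ) : sidePt 2 s = pt 0 (1 - s) := by
  ext j; fin_cases j <;> simp [sidePt, sideDir, vtx, pt]; ring

theorem sideDir_zero : sideDir 0 = pt 1 0 := by
  ext j; fin_cases j <;> simp [sideDir, vtx, pt]

theorem sideDir_one : sideDir 1 = pt (-1) 1 := by
  ext j; fin_cases j <;> simp [sideDir, vtx, pt]

theorem sideDir_two : sideDir 2 = pt 0 (-1) := by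
  ext j; fin_cases j <;> simp [sideDir, vtx, pt]

@[simp] theorem pt_zero (a b : ℝ) : pt a b 0 = a := rfl
@[simp] theorem pt_one (a b : ℝ) : pt a b 1 = b := rfl

theorem integral_div_refTri {X₀ X₁ : E2 → ℝ} (h₀ : ContDiffOn ℝ 1 X₀ refTri)
    (h₁ : ContDiffOn ℝ 1 X₁ refTri) :
    ∫ x in refTri, (pd 0 X₀ x + pd 1 X₁ x) = ∑ i, ∫ s in (0:ℝ)..1,
      (X₀ (sidePt i s) * sideDir i 1 - X₁ (sidePt i s) * sideDir i 0) := by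
  rw [integral_add (integrableOn_refTri (continuousOn_pd h₀ le_rfl 0))
    (integrableOn_refTri (continuousOn_pd h₁ le_rfl 1)), integral_pd_zero h₀, integral_pd_one h₁,
    Fin.sum_univ_three]
  have c0 := fun i => intervalIntegrable_sidePt h₀.continuousOn i
  have c1 := fun i => intervalIntegrable_sidePt h₁.continuousOn i
  have d0 := c0 1
  have d2 := c0 2
  have d1 := c1 1
  have d3 := c1 0
  simp only [sidePt_zero, sidePt_one, sidePt_two] at d0 d1 d2 d3
  simp only [sidePt_zero, sidePt_one, sidePt_two, sideDir_zero, sideDir_one, sideDir_two,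
    pt_zero, pt_one, mul_zero, mul_one, zero_sub, mul_neg, sub_neg_eq_add, sub_zero]
  have r : ∫ a in (0:ℝ)..1, (X₁ (pt a (1 - a)) - X₁ (pt a 0)) =
      ∫ a in (0:ℝ)..1, (X₁ (pt (1 - a) a) - X₁ (pt (1 - a) 0)) := by
    have := intervalIntegral.integral_comp_sub_left (a := 0) (b := 1)
      (fun a => X₁ (pt (1 - a) a) - X₁ (pt (1 - a) 0)) 1
    simpa using this
  have r2 : ∫ a in (0:ℝ)..1, X₁ (pt (1 - a) 0) = ∫ a in (0:ℝ)..1, X₁ (pt a 0) := by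
    have := intervalIntegral.integral_comp_sub_left (a := 0) (b := 1)
      (fun a => X₁ (pt a 0)) 1
    simpa using this
  have r3 : ∫ a in (0:ℝ)..1, X₀ (pt 0 (1 - a)) = ∫ a in (0:ℝ)..1, X₀ (pt 0 a) := by
    have := intervalIntegral.integral_comp_sub_left (a := 0) (b := 1)
      (fun a => X₀ (pt 0 a)) 1
    simpa using this
  have i1 : IntervalIntegrable (fun a => X₁ (pt (1 - a) 0)) volume 0 1 := by
    simpa using (d3.comp_sub_left 1).symm
  have i2 : IntervalIntegrable (fun a => X₀ (pt 0 a)) volume 0 1 := by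
    simpa using (d2.comp_sub_left 1).symm
  rw [r, intervalIntegral.integral_sub d0 i2, intervalIntegral.integral_sub d1 i1,
    intervalIntegral.integral_add d0 d1, r2, intervalIntegral.integral_neg,
    intervalIntegral.integral_neg, r3]
  ring

end

section

/-! ### Symmetric `2 × 2` matrices -/

theorem inv_entries {A : Mat} (hs : A 1 0 = A 0 1) :
    A⁻¹ 0 0 = A 1 1 / (A 0 0 * A 1 1 - A 0 1 ^ 2) ∧ A⁻¹ 0 1 = - A 0 1 / (A 0 0 * A 1 1 - A 0 1 ^ 2) ∧
    A⁻¹ 1 0 = - A 0 1 / (A 0 0 * A 1 1 - A 0 1 ^ 2) ∧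
    A⁻¹ 1 1 = A 0 0 / (A 0 0 * A 1 1 - A 0 1 ^ 2) := by
  have hd : A.det = A 0 0 * A 1 1 - A 0 1 ^ 2 := by rw [Matrix.det_fin_two, hs]; ring
  rw [Matrix.inv_def, Matrix.adjugate_fin_two, hd, Ring.inverse_eq_inv', hs]
  simp [div_eq_inv_mul]

theorem inner2_SS {A S T : Mat} (hA : A 1 0 = A 0 1) (hS : S 1 0 = S 0 1)
    (hd : A 0 0 * A 1 1 - A 0 1 ^ 2 ≠ 0) :
    inner2 A (S - (∑ i, ∑ j, A⁻¹ i j * S i j) • A) T =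
      - (S 1 1 * T 0 0 - S 0 1 * T 0 1 - S 0 1 * T 1 0 + S 0 0 * T 1 1) /
        (A 0 0 * A 1 1 - A 0 1 ^ 2) := by
  obtain ⟨h00, h01, h10, h11⟩ := inv_entries hA
  simp only [inner2, Fin.sum_univ_two, h00, h01, h10, h11, Matrix.sub_apply, Matrix.smul_apply,
    smul_eq_mul, hA, hS]
  generalize hD : A 0 0 * A 1 1 - A 0 1 ^ 2 = D at *
  field_simp
  rw [← hD]
  ring

/-- Pointwise algebra of the normal component: the part of the boundary flux that is not
accounted for by the normal-normal component of `𝕊σ` pairs with the tangential derivative. -/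
theorem pair_SS_normal {A S : Mat} (hA : A 1 0 = A 0 1) (hS : S 1 0 = S 0 1)
    (hd : A 0 0 * A 1 1 - A 0 1 ^ 2 ≠ 0) {t n : Fin 2 → ℝ} {P l : ℝ}
    (hP : P ^ 2 = A 0 0 * A 1 1 - A 0 1 ^ 2)
    (hl0 : l ≠ 0)
    {q : ℝ} (hq : q ^ 2 = l)
    (hn0 : n 0 = (A 0 1 * t 0 + A 1 1 * t 1) / (P * q))
    (hn1 : n 1 = - (A 0 0 * t 0 + A 0 1 * t 1) / (P * q)) (d : Fin 2 → ℝ) :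
    (∑ i, ∑ j, (S - (∑ i, ∑ j, A⁻¹ i j * S i j) • A) i j * n i * n j) *
        (∑ k, d k * n k) * q =
      - (S 0 0 * t 0 ^ 2 + 2 * S 0 1 * t 0 * t 1 + S 1 1 * t 1 ^ 2) / l *
        ((A 0 1 * t 0 + A 1 1 * t 1) * d 0 - (A 0 0 * t 0 + A 0 1 * t 1) * d 1) / P := by
  obtain ⟨h00, h01, h10, h11⟩ := inv_entries hA
  have hP0 : P ≠ 0 := by rintro rfl; exact hd (by rw [← hP]; ring)
  have hq0 : q ≠ 0 := by rintro rfl; exact hl0 (by rw [← hq]; ring)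
  have key : (∑ i, ∑ j, (S - (∑ i, ∑ j, A⁻¹ i j * S i j) • A) i j * n i * n j) =
      - (S 0 0 * t 0 ^ 2 + 2 * S 0 1 * t 0 * t 1 + S 1 1 * t 1 ^ 2) / l := by
    simp only [Fin.sum_univ_two, h00, h01, h10, h11, Matrix.sub_apply, Matrix.smul_apply,
      smul_eq_mul, hA, hS, hn0, hn1]
    rw [← hP]
    field_simp
    rw [hq, hP]
    field_simp
    have hP4 : P ^ 4 = (A 0 0 * A 1 1 - A 0 1 ^ 2) ^ 2 := by rw [← hP]; ring
    rw [hP4]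
    ring
  rw [key]
  simp only [Fin.sum_univ_two, hn0, hn1]
  field_simp
  ring

/-! ### Metrics on the reference triangle -/

/-- A smooth Riemannian metric on the closed reference triangle. -/
structure IsMetric (G : E2 → Mat) : Prop where
  smooth : ∀ i j, ContDiffOn ℝ ∞ (fun x => G x i j) refTri
  posDef : ∀ x ∈ refTri, (G x).PosDef

namespace IsMetric

variable {G : E2 → Mat} (hG : IsMetric G) {x : E2} (hx : x ∈ refTri)
include hG

theorem symm (hx : x ∈ refTri) : G x 1 0 = G x 0 1 := by
  have := (hG.posDef x hx).isHermitian.apply 0 1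
  simpa using this

theorem det_eq (hx : x ∈ refTri) : (G x).det = G x 0 0 * G x 1 1 - G x 0 1 ^ 2 := by
  rw [Matrix.det_fin_two, hG.symm hx]; ring

theorem det_pos (hx : x ∈ refTri) : 0 < G x 0 0 * G x 1 1 - G x 0 1 ^ 2 := by
  rw [← hG.det_eq hx]; exact (hG.posDef x hx).det_pos

theorem diag_pos (hx : x ∈ refTri) (i : Fin 2) : 0 < G x i i := (hG.posDef x hx).diag_pos

theorem dvol_pos (hx : x ∈ refTri) : 0 < dvol G x :=
  Real.sqrt_pos.2 (hG.posDef x hx).det_pos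

theorem dvol_sq (hx : x ∈ refTri) : dvol G x ^ 2 = G x 0 0 * G x 1 1 - G x 0 1 ^ 2 := by
  rw [dvol, Real.sq_sqrt (hG.posDef x hx).det_pos.le, hG.det_eq hx]

theorem pd_symm (hx : x ∈ refTri) (k : Fin 2) :
    pd k (fun y => G y 1 0) x = pd k (fun y => G y 0 1) x :=
  pd_congr (fun _ hy => hG.symm hy) hx k

theorem chris_symm (hx : x ∈ refTri) (k i j : Fin 2) : chris G k i j x = chris G k j i x := by
  fin_cases i <;> fin_cases j <;> simp only [chris, Fin.sum_univ_two, Fin.zero_eta, Fin.mk_one,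
    Fin.isValue, hG.pd_symm hx] <;> ring

theorem pd_entry (hx : x ∈ refTri) (k i j : Fin 2) :
    pd k (fun y => G y i j) x =
      (chris G 0 k i x * G x 0 j + chris G 1 k i x * G x 1 j) +
        (chris G 0 k j x * G x i 0 + chris G 1 k j x * G x i 1) := by
  obtain ⟨h00, h01, h10, h11⟩ := inv_entries (hG.symm hx)
  have hd := (hG.det_pos hx).ne'
  fin_cases k <;> fin_cases i <;> fin_cases j <;> simp only [chris, Fin.sum_univ_two,
    Fin.zero_eta, Fin.mk_one, Fin.isValue, hG.pd_symm hx, h00, h01, h10, h11, hG.symm hx] <;>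
    generalize hD : G x 0 0 * G x 1 1 - G x 0 1 ^ 2 = D at * <;> field_simp <;> rw [← hD] <;> ring

theorem hasPd_entry (hx : x ∈ refTri) (i j : Fin 2) :
    HasPd (fun y => G y i j) (fun k => (chris G 0 k i x * G x 0 j + chris G 1 k i x * G x 1 j) +
        (chris G 0 k j x * G x i 0 + chris G 1 k j x * G x i 1)) x :=
  (HasPd.of_contDiffOn (hG.smooth i j) (by simp) hx).congr fun k => hG.pd_entry hx k i j

theorem hasPd_dvol (hx : x ∈ refTri) :
    HasPd (dvol G) (fun k => (chris G 0 k 0 x + chris G 1 k 1 x) * dvol G x) x := by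
  have h1 : HasPd (fun y => G y 0 0 * G y 1 1 - G y 0 1 * G y 0 1) _ x :=
    ((hG.hasPd_entry hx 0 0).mul (hG.hasPd_entry hx 1 1)).sub
      ((hG.hasPd_entry hx 0 1).mul (hG.hasPd_entry hx 0 1))
  have hd : G x 0 0 * G x 1 1 - G x 0 1 * G x 0 1 = dvol G x ^ 2 := by
    rw [hG.dvol_sq hx]; ring
  have hP := hG.dvol_pos hx
  have h2 := h1.sqrt (by rw [hd]; positivity)
  refine (h2.congr_fun (ψ := dvol G) (fun y hy => ?_) hx).congr fun k => ?_
  · rw [dvol, hG.det_eq hy, sq]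
  · rw [hd, Real.sqrt_sq hP.le, hG.symm hx]
    rw [div_eq_iff (by positivity)]
    have : (chris G 0 k 0 x + chris G 1 k 1 x) * dvol G x * (2 * dvol G x) =
      (chris G 0 k 0 x + chris G 1 k 1 x) * 2 * dvol G x ^ 2 := by ring
    rw [this, ← hd]
    ring

theorem contDiffOn_dvol : ContDiffOn ℝ ∞ (dvol G) refTri := by
  have : ContDiffOn ℝ ∞ (fun x => (G x).det) refTri := by
    simp only [Matrix.det_fin_two]
    exact ((hG.smooth 0 0).mul (hG.smooth 1 1)).sub ((hG.smooth 0 1).mul (hG.smooth 1 0))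
  exact this.sqrt fun x hx => (hG.posDef x hx).det_pos.ne'

theorem contDiffOn_inv (i j : Fin 2) : ContDiffOn ℝ ∞ (fun x => (G x)⁻¹ i j) refTri := by
  have hd : ContDiffOn ℝ ∞ (fun x => G x 0 0 * G x 1 1 - G x 0 1 ^ 2) refTri :=
    ((hG.smooth 0 0).mul (hG.smooth 1 1)).sub ((hG.smooth 0 1).pow 2)
  have hd0 : ∀ x ∈ refTri, G x 0 0 * G x 1 1 - G x 0 1 ^ 2 ≠ 0 := fun x hx => (hG.det_pos hx).ne'
  have e := fun x (hx : x ∈ refTri) => inv_entries (hG.symm hx)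
  fin_cases i <;> fin_cases j
  · exact ((hG.smooth 1 1).div hd hd0).congr fun x hx => (e x hx).1
  · exact ((hG.smooth 0 1).neg.div hd hd0).congr fun x hx => (e x hx).2.1
  · exact ((hG.smooth 0 1).neg.div hd hd0).congr fun x hx => (e x hx).2.2.1
  · exact ((hG.smooth 0 0).div hd hd0).congr fun x hx => (e x hx).2.2.2

theorem contDiffOn_chris (k i j : Fin 2) : ContDiffOn ℝ ∞ (chris G k i j) refTri := by
  unfold chris
  have h := fun a b c => contDiffOn_pd (m := ∞) (hG.smooth a b) (by simp) c
  refine contDiffOn_const.mul (ContDiffOn.sum fun l _ => ?_)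
  exact (hG.contDiffOn_inv k l).mul (((h l j i).add (h l i j)).sub (h i j l))

/-- Squared length of the constant vector `t`. -/
theorem pair_pos (hx : x ∈ refTri) {t : E2} (ht : t ≠ 0) : 0 < pair (G x) t t := by
  have := (hG.posDef x hx).dotProduct_mulVec_pos (x := fun i => t i)
    (fun h => ht (by ext i; exact congrFun h i))
  have e : pair (G x) t t = star (fun i => t i) ⬝ᵥ (G x).mulVec fun i => t i := by
    simp only [pair, Matrix.mulVec, dotProduct, Fin.sum_univ_two, Pi.star_apply, star_trivial]
    ring
  rwa [e]

theorem pair_self_eq (hx : x ∈ refTri) (t : E2) :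
    pair (G x) t t = G x 0 0 * t 0 ^ 2 + 2 * G x 0 1 * t 0 * t 1 + G x 1 1 * t 1 ^ 2 := by
  simp only [pair, Fin.sum_univ_two, hG.symm hx]; ring

theorem len_sq (hx : x ∈ refTri) {t : E2} (ht : t ≠ 0) : len (G x) t ^ 2 = pair (G x) t t := by
  rw [len, Real.sq_sqrt (hG.pair_pos hx ht).le]

theorem len_pos (hx : x ∈ refTri) {t : E2} (ht : t ≠ 0) : 0 < len (G x) t :=
  Real.sqrt_pos.2 (hG.pair_pos hx ht)

end IsMetric

theorem sideDir_ne_zero (i : Fin 3) : sideDir i ≠ 0 := by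
  intro h
  have h0 := congrArg (fun w : E2 => w 0) h
  have h1 := congrArg (fun w : E2 => w 1) h
  fin_cases i <;> simp [sideDir_zero, sideDir_one, sideDir_two] at h0 h1

theorem IsMetric.nrm_eq {G : E2 → Mat} (hG : IsMetric G) {x : E2} (hx : x ∈ refTri) (i : Fin 3) :
    nrm G i x 0 = (G x 0 1 * sideDir i 0 + G x 1 1 * sideDir i 1) /
        (dvol G x * len (G x) (sideDir i)) ∧
    nrm G i x 1 = - (G x 0 0 * sideDir i 0 + G x 0 1 * sideDir i 1) /
        (dvol G x * len (G x) (sideDir i)) := by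
  obtain ⟨h00, h01, h10, h11⟩ := inv_entries (hG.symm hx)
  have hP := hG.dvol_pos hx
  have hl := hG.len_pos hx (sideDir_ne_zero i)
  have hP2 := hG.dvol_sq hx
  have s0 : sharpNormal G i x 0 =
      (G x 0 1 * sideDir i 0 + G x 1 1 * sideDir i 1) / dvol G x ^ 2 := by
    simp only [sharpNormal, conormal, Fin.sum_univ_two, h00, h01, hP2]
    simp; ring
  have s1 : sharpNormal G i x 1 =
      - (G x 0 0 * sideDir i 0 + G x 0 1 * sideDir i 1) / dvol G x ^ 2 := by
    simp only [sharpNormal, conormal, Fin.sum_univ_two, h10, h11, hP2]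
    simp; ring
  have hlen : len (G x) (sharpNormal G i x) = len (G x) (sideDir i) / dvol G x := by
    have : pair (G x) (sharpNormal G i x) (sharpNormal G i x) =
        (len (G x) (sideDir i) / dvol G x) ^ 2 := by
      rw [hG.pair_self_eq hx, s0, s1, div_pow (len _ _), hG.len_sq hx (sideDir_ne_zero i),
        hG.pair_self_eq hx]
      have : dvol G x ≠ 0 := hP.ne'
      field_simp
      rw [hP2]; ring
    rw [len, this, Real.sqrt_sq (by positivity)]
  constructor
  · simp only [nrm, PiLp.smul_apply, smul_eq_mul, hlen, s0]; field_simp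
  · simp only [nrm, PiLp.smul_apply, smul_eq_mul, hlen, s1]; field_simp

/-! ### Integration by parts in `b_h` -/

section IntegrationByParts

variable {G σ : E2 → Mat} {v : E2 → ℝ}

theorem pd_eq_cov2 (G σ : E2 → Mat) (x : E2) (k i j : Fin 2) :
    pd k (fun y => σ y i j) x = cov2 G σ x k i j +
      (chris G 0 k i x * σ x 0 j + chris G 1 k i x * σ x 1 j) +
      (chris G 0 k j x * σ x i 0 + chris G 1 k j x * σ x i 1) := by
  simp only [cov2, Fin.sum_univ_two]; ring

/-- A symmetric smooth tensor field on the closed reference triangle. -/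
structure IsSymField (σ : E2 → Mat) : Prop where
  smooth : ∀ i j, ContDiffOn ℝ ∞ (fun x => σ x i j) refTri
  symm : ∀ x ∈ refTri, σ x 1 0 = σ x 0 1

theorem IsSymField.hasPd (hσ : IsSymField σ) (G : E2 → Mat) {x : E2} (hx : x ∈ refTri)
    (i j : Fin 2) : HasPd (fun y => σ y i j) (fun k => cov2 G σ x k i j +
      (chris G 0 k i x * σ x 0 j + chris G 1 k i x * σ x 1 j) +
      (chris G 0 k j x * σ x i 0 + chris G 1 k j x * σ x i 1)) x :=
  (HasPd.of_contDiffOn (hσ.smooth i j) (by simp) hx).congr fun k => pd_eq_cov2 G σ x k i j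

/-- The density of `⟨div 𝕊σ, dv⟩`. -/
def divDensity (G σ : E2 → Mat) (v : E2 → ℝ) (x : E2) : ℝ :=
  ((cov2 G σ x 0 1 1 - cov2 G σ x 1 0 1) * pd 0 v x +
    (cov2 G σ x 1 0 0 - cov2 G σ x 0 0 1) * pd 1 v x) / dvol G x

/-- The density of the normal-tangential component of `σ` on a side. -/
def tangDensity (G σ : E2 → Mat) (t : E2) (x : E2) : ℝ :=
  ((G x 0 0 * t 0 + G x 0 1 * t 1) * (σ x 0 1 * t 0 + σ x 1 1 * t 1) -
    (σ x 0 0 * t 0 + σ x 0 1 * t 1) * (G x 0 1 * t 0 + G x 1 1 * t 1)) /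
    (dvol G x * pair (G x) t t)

theorem local_bh_eq (hG : IsMetric G) (hσ : IsSymField σ) (hv : ContDiffOn ℝ 2 v refTri) :
    triInt G (fun x => inner2 (G x) (SS G σ x) (hess G v x)) -
      ∑ i, sideInt G i (fun x => pair (SS G σ x) (nrm G i x) (nrm G i x) *
        dapp v x (nrm G i x)) =
    (∫ x in refTri, divDensity G σ v x) -
      ∑ i, ∫ s in (0:ℝ)..1, tangDensity G σ (sideDir i) (sidePt i s) *
        dapp v (sidePt i s) (sideDir i) := by
  have hP : ContDiffOn ℝ 1 (dvol G) refTri := hG.contDiffOn_dvol.of_le (by simp)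
  have hP0 : ∀ x ∈ refTri, dvol G x ≠ 0 := fun x hx => (hG.dvol_pos hx).ne'
  have hs : ∀ i j, ContDiffOn ℝ 1 (fun x => σ x i j) refTri := fun i j =>
    (hσ.smooth i j).of_le (by simp)
  have hv1 : ∀ k, ContDiffOn ℝ 1 (pd k v) refTri := fun k =>
    contDiffOn_pd hv (by norm_num) k
  set X₀ : E2 → ℝ := fun x => - (σ x 1 1 * pd 0 v x - σ x 0 1 * pd 1 v x) / dvol G x with hX0
  set X₁ : E2 → ℝ := fun x => - (σ x 0 0 * pd 1 v x - σ x 0 1 * pd 0 v x) / dvol G x with hX1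
  have c0 : ContDiffOn ℝ 1 X₀ refTri :=
    ((((hs 1 1).mul (hv1 0)).sub ((hs 0 1).mul (hv1 1))).neg).div hP hP0
  have c1 : ContDiffOn ℝ 1 X₁ refTri :=
    ((((hs 0 0).mul (hv1 1)).sub ((hs 0 1).mul (hv1 0))).neg).div hP hP0
  have hdiv := integral_div_refTri c0 c1
  have e1 : ∀ x ∈ refTri, inner2 (G x) (SS G σ x) (hess G v x) * dvol G x =
      (pd 0 X₀ x + pd 1 X₁ x) + divDensity G σ v x := by
    intro x hx
    have hd := (hG.det_pos hx).ne'
    have hp := hP0 x hx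
    have dv : ∀ k, HasPd (pd k v) (fun j => pd j (pd k v) x) x := fun k =>
      HasPd.of_contDiffOn (hv1 k) one_ne_zero hx
    have hA := ((((hσ.hasPd G hx 1 1).mul (dv 0)).sub
      ((hσ.hasPd G hx 0 1).mul (dv 1))).neg.div (hG.hasPd_dvol hx) hp).pd_eq hx 0
    have hB := ((((hσ.hasPd G hx 0 0).mul (dv 1)).sub
      ((hσ.hasPd G hx 0 1).mul (dv 0))).neg.div (hG.hasPd_dvol hx) hp).pd_eq hx 1
    rw [hX0, hX1, hA, hB, SS, inner2_SS (hG.symm hx) (hσ.symm x hx) hd, ← hG.dvol_sq hx]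
    simp only [divDensity, hess, Matrix.of_apply, Fin.sum_univ_two, hσ.symm x hx,
      hG.chris_symm hx _ 1 0]
    field_simp
    ring
  have e2 : ∀ i, sideInt G i (fun x => pair (SS G σ x) (nrm G i x) (nrm G i x) *
        dapp v x (nrm G i x)) = (∫ s in (0:ℝ)..1,
          (X₀ (sidePt i s) * sideDir i 1 - X₁ (sidePt i s) * sideDir i 0)) +
      ∫ s in (0:ℝ)..1, tangDensity G σ (sideDir i) (sidePt i s) *
        dapp v (sidePt i s) (sideDir i) := by
    intro i
    have cG : ∀ a b, ContinuousOn (fun x => G x a b) refTri := fun a b => (hG.smooth a b).continuousOn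
    have cs : ∀ a b, ContinuousOn (fun x => σ x a b) refTri := fun a b => (hs a b).continuousOn
    have cpair : ContinuousOn (fun x => pair (G x) (sideDir i) (sideDir i)) refTri := by
      unfold pair
      exact continuousOn_finsetSum _ fun a _ => continuousOn_finsetSum _ fun b _ =>
        ((cG a b).mul continuousOn_const).mul continuousOn_const
    have ct : ContinuousOn (fun x => tangDensity G σ (sideDir i) x * dapp v x (sideDir i))
        refTri := by
      refine ContinuousOn.mul ?_ ?_
      · unfold tangDensity
        refine ContinuousOn.div ?_ (hP.continuousOn.mul cpair) fun x hx =>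
          mul_ne_zero (hP0 x hx) (hG.pair_pos hx (sideDir_ne_zero i)).ne'
        exact ((((cG 0 0).mul continuousOn_const).add ((cG 0 1).mul continuousOn_const)).mul
          (((cs 0 1).mul continuousOn_const).add ((cs 1 1).mul continuousOn_const))).sub
          ((((cs 0 0).mul continuousOn_const).add ((cs 0 1).mul continuousOn_const)).mul
          (((cG 0 1).mul continuousOn_const).add ((cG 1 1).mul continuousOn_const)))
      · unfold dapp
        exact continuousOn_finsetSum _ fun k _ => (hv1 k).continuousOn.mul continuousOn_const
    rw [sideInt, ← intervalIntegral.integral_add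
      (((intervalIntegrable_sidePt c0.continuousOn i).mul_const _).sub
        ((intervalIntegrable_sidePt c1.continuousOn i).mul_const _))
      (intervalIntegrable_sidePt ct i)]
    refine intervalIntegral.integral_congr fun s hs' => ?_
    rw [Set.uIcc_of_le zero_le_one] at hs'
    have hx := sidePt_mem i hs'
    set x := sidePt i s
    have hn := hG.nrm_eq hx i
    have hq := hG.len_sq hx (sideDir_ne_zero i)
    have hl0 := (hG.pair_pos hx (sideDir_ne_zero i)).ne'
    have hp := hP0 x hx
    have hps := hG.pair_self_eq hx (sideDir i)
    have := pair_SS_normal (hG.symm hx) (hσ.symm x hx) (hG.det_pos hx).ne' (hG.dvol_sq hx)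
      hl0 hq (n := fun k => nrm G i x k) hn.1 hn.2 (fun k => pd k v x)
    simp only [pair, dapp, SS] at this ⊢
    rw [this]
    simp only [hX0, hX1, tangDensity, pair, Fin.sum_univ_two]
    simp only [pair, Fin.sum_univ_two] at hps hl0
    rw [hG.symm hx] at hps hl0 ⊢
    generalize hL : (G x 0 0 * sideDir i 0 * sideDir i 0 + G x 0 1 * sideDir i 0 * sideDir i 1 +
      (G x 0 1 * sideDir i 1 * sideDir i 0 + G x 1 1 * sideDir i 1 * sideDir i 1)) = ℓ at *
    field_simp
    rw [hps]
    ring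
  have hsum : ∑ i, sideInt G i (fun x => pair (SS G σ x) (nrm G i x) (nrm G i x) *
        dapp v x (nrm G i x)) = (∫ x in refTri, (pd 0 X₀ x + pd 1 X₁ x)) +
      ∑ i, ∫ s in (0:ℝ)..1, tangDensity G σ (sideDir i) (sidePt i s) *
        dapp v (sidePt i s) (sideDir i) := by
    rw [hdiv, ← Finset.sum_add_distrib]
    exact Finset.sum_congr rfl fun i _ => e2 i
  rw [hsum, triInt, setIntegral_congr_fun isClosed_refTri.measurableSet e1, integral_add]
  · ring
  · exact integrableOn_refTri ((continuousOn_pd c0 le_rfl 0).add (continuousOn_pd c1 le_rfl 1))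
  · refine integrableOn_refTri ?_
    have cc : ∀ k i j, ContinuousOn (fun x => cov2 G σ x k i j) refTri := by
      intro k i j
      unfold cov2
      have ch := fun a b c => (hG.contDiffOn_chris a b c).continuousOn
      exact ((continuousOn_pd (hs i j) le_rfl k).sub (continuousOn_finsetSum _ fun l _ =>
        (ch l k i).mul (hs l j).continuousOn)).sub (continuousOn_finsetSum _ fun l _ =>
        (ch l k j).mul (hs i l).continuousOn)
    exact ((((cc 0 1 1).sub (cc 1 0 1)).mul (hv1 0).continuousOn).add
      (((cc 1 0 0).sub (cc 0 0 1)).mul (hv1 1).continuousOn)).div hP.continuousOn hP0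

end IntegrationByParts

end

section

/-! ### Metrics comparable to a multiple of the flat metric -/

/-- The bilinear form `A` is symmetric and between `L` and `κ L` times the Euclidean one. -/
structure Pinch (L κ : ℝ) (A : Mat) : Prop where
  symm : A 1 0 = A 0 1
  lower : ∀ a b : ℝ, L * (a ^ 2 + b ^ 2) ≤ A 0 0 * a ^ 2 + 2 * A 0 1 * a * b + A 1 1 * b ^ 2
  upper : ∀ a b : ℝ, A 0 0 * a ^ 2 + 2 * A 0 1 * a * b + A 1 1 * b ^ 2 ≤ κ * L * (a ^ 2 + b ^ 2)

theorem quad_nonneg {p q r x y z : ℝ} (hp : 0 ≤ p) (hr : 0 ≤ r) (hq : q ^ 2 ≤ p * r)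
    (hx : 0 ≤ x) (hz : 0 ≤ z) (hy : y ^ 2 ≤ x * z) : 0 ≤ p * x + 2 * (q * y) + r * z := by
  have h : (q * y) ^ 2 ≤ (p * x) * (r * z) := by
    calc (q * y) ^ 2 = q ^ 2 * y ^ 2 := by ring
      _ ≤ (p * r) * (x * z) := mul_le_mul hq hy (sq_nonneg _) (by positivity)
      _ = _ := by ring
  have h1 : 0 ≤ p * x := by positivity
  have h2 : 0 ≤ r * z := by positivity
  have h3 : |2 * (q * y)| ≤ p * x + r * z := by
    refine abs_le_of_sq_le_sq ?_ (by positivity)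
    nlinarith [sq_nonneg (p * x - r * z)]
  linarith [neg_abs_le (2 * (q * y))]

theorem sq_le_mul_of_quad_nonneg {p q r : ℝ} (h : ∀ a b : ℝ, 0 ≤ p * a ^ 2 + 2 * q * a * b + r * b ^ 2) :
    q ^ 2 ≤ p * r := by
  have := discrim_le_zero (a := p) (b := 2 * q) (c := r) fun x => by
    have := h x 1; nlinarith
  rw [discrim] at this
  nlinarith

namespace Pinch

variable {L κ : ℝ} {A : Mat} (h : Pinch L κ A)
include h

theorem lo0 : L ≤ A 0 0 := by have := h.lower 1 0; nlinarith
theorem lo1 : L ≤ A 1 1 := by have := h.lower 0 1; nlinarith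
theorem up0 : A 0 0 ≤ κ * L := by have := h.upper 1 0; nlinarith
theorem up1 : A 1 1 ≤ κ * L := by have := h.upper 0 1; nlinarith

theorem lo_sq : A 0 1 ^ 2 ≤ (A 0 0 - L) * (A 1 1 - L) :=
  sq_le_mul_of_quad_nonneg fun a b => by have := h.lower a b; nlinarith

theorem up_sq : A 0 1 ^ 2 ≤ (κ * L - A 0 0) * (κ * L - A 1 1) := by
  have := sq_le_mul_of_quad_nonneg (p := κ * L - A 0 0) (q := - A 0 1) (r := κ * L - A 1 1)
    fun a b => by have := h.upper a b; nlinarith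
  nlinarith

theorem det_lower (hL : 0 < L) : L ^ 2 ≤ A 0 0 * A 1 1 - A 0 1 ^ 2 := by
  have := h.lo_sq; nlinarith [h.lo0, h.lo1]

theorem det_upper (hL : 0 < L) : A 0 0 * A 1 1 - A 0 1 ^ 2 ≤ (κ * L) ^ 2 := by
  have h1 : A 0 0 * A 1 1 ≤ (κ * L) * (κ * L) :=
    mul_le_mul h.up0 h.up1 (hL.le.trans h.lo1) (hL.le.trans (h.lo0.trans h.up0))
  nlinarith [sq_nonneg (A 0 1)]

theorem one_le (hL : 0 < L) : 1 ≤ κ := by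
  have := h.lo0.trans h.up0
  by_contra hk; push Not at hk; nlinarith

theorem off (hL : 0 < L) : |A 0 1| ≤ κ * L := by
  refine abs_le_of_sq_le_sq ?_ (hL.le.trans (h.lo0.trans h.up0))
  have h0 := h.lo0; have h1 := h.lo1
  have := h.up_sq
  nlinarith [h.up0, h.up1]

theorem entry (hL : 0 < L) (i j : Fin 2) : |A i j| ≤ κ * L := by
  have h0 := h.lo0; have h1 := h.lo1
  fin_cases i <;> fin_cases j
  · exact abs_le.2 ⟨by have := h.up0; simp only [Fin.zero_eta]; linarith, h.up0⟩
  · exact h.off hL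
  · simpa [h.symm] using h.off hL
  · exact abs_le.2 ⟨by have := h.up1; simp only [Fin.mk_one]; linarith, h.up1⟩

theorem inv_entry (hL : 0 < L) (i j : Fin 2) : |A⁻¹ i j| ≤ κ / L := by
  have hd := h.det_lower hL
  have hdp : 0 < A 0 0 * A 1 1 - A 0 1 ^ 2 := lt_of_lt_of_le (by positivity) hd
  obtain ⟨h00, h01, h10, h11⟩ := inv_entries h.symm
  have key : ∀ a : ℝ, |a| ≤ κ * L → |a / (A 0 0 * A 1 1 - A 0 1 ^ 2)| ≤ κ / L := by
    intro a ha
    rw [abs_div, abs_of_pos hdp, div_le_div_iff₀ hdp hL]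
    have hκ : 0 ≤ κ := zero_le_one.trans (h.one_le hL)
    nlinarith [mul_le_mul_of_nonneg_left hd hκ]
  fin_cases i <;> fin_cases j
  · exact h00 ▸ key _ (h.entry hL 1 1)
  · exact h01 ▸ key _ (by rw [abs_neg]; exact h.entry hL 0 1)
  · exact h10 ▸ key _ (by rw [abs_neg]; exact h.entry hL 0 1)
  · exact h11 ▸ key _ (h.entry hL 0 0)

/-- The inverse is bounded below by `1 / (κ L)`. -/
theorem inv_lower (hL : 0 < L) :
    (κ * L)⁻¹ ≤ A⁻¹ 0 0 ∧ (κ * L)⁻¹ ≤ A⁻¹ 1 1 ∧ A⁻¹ 1 0 = A⁻¹ 0 1 ∧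
      A⁻¹ 0 1 ^ 2 ≤ (A⁻¹ 0 0 - (κ * L)⁻¹) * (A⁻¹ 1 1 - (κ * L)⁻¹) := by
  obtain ⟨h00, h01, h10, h11⟩ := inv_entries h.symm
  have hdp : 0 < A 0 0 * A 1 1 - A 0 1 ^ 2 := lt_of_lt_of_le (by positivity) (h.det_lower hL)
  have hu : 0 < κ * L := hL.trans_le (h.lo0.trans h.up0)
  have hus := h.up_sq
  have u0 := h.up0; have u1 := h.up1
  have l0 := h.lo0; have l1 := h.lo1
  generalize κ * L = u at *
  rw [h00, h01, h10, h11]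
  generalize hD : A 0 0 * A 1 1 - A 0 1 ^ 2 = D at *
  refine ⟨?_, ?_, rfl, ?_⟩
  · rw [inv_eq_one_div, div_le_div_iff₀ hu hdp, ← hD]
    nlinarith [sq_nonneg (A 0 1)]
  · rw [inv_eq_one_div, div_le_div_iff₀ hu hdp, ← hD]
    nlinarith [sq_nonneg (A 0 1)]
  · have e : (A 1 1 / D - u⁻¹) * (A 0 0 / D - u⁻¹) - (-A 0 1 / D) ^ 2 =
        ((u - A 0 0) * (u - A 1 1) - A 0 1 ^ 2) / (D * u ^ 2) := by
      field_simp
      rw [← hD]; ring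
    have : 0 ≤ ((u - A 0 0) * (u - A 1 1) - A 0 1 ^ 2) / (D * u ^ 2) :=
      div_nonneg (by linarith) (by positivity)
    linarith

theorem inner1_lower (hL : 0 < L) (a : Fin 2 → ℝ) :
    (κ * L)⁻¹ * (a 0 ^ 2 + a 1 ^ 2) ≤ inner1 A a a := by
  obtain ⟨h0, h1, hs, hq⟩ := h.inv_lower hL
  have := quad_nonneg (sub_nonneg.2 h0) (sub_nonneg.2 h1) hq (sq_nonneg (a 0)) (sq_nonneg (a 1))
    (y := a 0 * a 1) (by nlinarith)
  simp only [inner1, Fin.sum_univ_two, hs]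
  nlinarith

theorem inner1_nonneg (hL : 0 < L) (a : Fin 2 → ℝ) : 0 ≤ inner1 A a a :=
  (mul_nonneg (inv_nonneg.2 (hL.le.trans (h.lo0.trans h.up0))) (by positivity)).trans
    (h.inner1_lower hL a)

theorem inner1_cauchy (hL : 0 < L) (a b : Fin 2 → ℝ) :
    inner1 A a b ^ 2 ≤ inner1 A a a * inner1 A b b := by
  refine sq_le_mul_of_quad_nonneg fun s t => ?_
  have := h.inner1_nonneg hL (fun k => s * a k + t * b k)
  obtain ⟨h0, h1, hs, hq⟩ := h.inv_lower hL
  simp only [inner1, Fin.sum_univ_two, hs] at this ⊢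
  nlinarith

theorem inner2_lower (hL : 0 < L) (S : Mat) :
    (κ * L)⁻¹ ^ 2 * (S 0 0 ^ 2 + S 0 1 ^ 2 + S 1 0 ^ 2 + S 1 1 ^ 2) ≤ inner2 A S S := by
  obtain ⟨h0, h1, hs, hq⟩ := h.inv_lower hL
  have hu : 0 < (κ * L)⁻¹ := inv_pos.2 (hL.trans_le (h.lo0.trans h.up0))
  have key := quad_nonneg (sub_nonneg.2 h0) (sub_nonneg.2 h1) hq (h.inner1_nonneg hL (S 0))
    (h.inner1_nonneg hL (S 1)) (h.inner1_cauchy hL (S 0) (S 1))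
  have e : inner2 A S S = A⁻¹ 0 0 * inner1 A (S 0) (S 0) + 2 * (A⁻¹ 0 1 * inner1 A (S 0) (S 1)) +
      A⁻¹ 1 1 * inner1 A (S 1) (S 1) := by
    simp only [inner2, inner1, Fin.sum_univ_two, hs]; ring
  have k0 := mul_le_mul_of_nonneg_left (h.inner1_lower hL (S 0)) hu.le
  have k1 := mul_le_mul_of_nonneg_left (h.inner1_lower hL (S 1)) hu.le
  rw [e]
  nlinarith

theorem inner2_nonneg (hL : 0 < L) (S : Mat) : 0 ≤ inner2 A S S :=
  (mul_nonneg (sq_nonneg _) (by positivity)).trans (h.inner2_lower hL S)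

theorem inner2_cauchy (hL : 0 < L) (S T : Mat) :
    inner2 A S T ^ 2 ≤ inner2 A S S * inner2 A T T := by
  refine sq_le_mul_of_quad_nonneg fun s t => ?_
  have := h.inner2_nonneg hL (s • S + t • T)
  obtain ⟨h0, h1, hs, hq⟩ := h.inv_lower hL
  simp only [inner2, Fin.sum_univ_two, hs, Matrix.add_apply, Matrix.smul_apply, smul_eq_mul]
    at this ⊢
  refine this.trans_eq ?_
  ring

theorem normSq3_lower (hL : 0 < L) (N : Fin 2 → Fin 2 → Fin 2 → ℝ) :
    (κ * L)⁻¹ ^ 3 * ∑ k, ∑ i, ∑ j, N k i j ^ 2 ≤ normSq3 A N := by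
  obtain ⟨h0, h1, hs, hq⟩ := h.inv_lower hL
  have hu : 0 < (κ * L)⁻¹ := inv_pos.2 (hL.trans_le (h.lo0.trans h.up0))
  have key := quad_nonneg (sub_nonneg.2 h0) (sub_nonneg.2 h1) hq
    (h.inner2_nonneg hL (Matrix.of (N 0)))
    (h.inner2_nonneg hL (Matrix.of (N 1))) (h.inner2_cauchy hL (Matrix.of (N 0)) (Matrix.of (N 1)))
  have e : normSq3 A N = A⁻¹ 0 0 * inner2 A (Matrix.of (N 0)) (Matrix.of (N 0)) +
      2 * (A⁻¹ 0 1 * inner2 A (Matrix.of (N 0)) (Matrix.of (N 1))) +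
      A⁻¹ 1 1 * inner2 A (Matrix.of (N 1)) (Matrix.of (N 1)) := by
    simp only [normSq3, inner2, Fin.sum_univ_two, hs, Matrix.of_apply]; ring
  have k0 := mul_le_mul_of_nonneg_left (h.inner2_lower hL (Matrix.of (N 0))) hu.le
  have k1 := mul_le_mul_of_nonneg_left (h.inner2_lower hL (Matrix.of (N 1))) hu.le
  simp only [Matrix.of_apply] at k0 k1
  rw [e]
  simp only [Fin.sum_univ_two]
  nlinarith

end Pinch

theorem Pinch.dvol_bounds {L κ : ℝ} {G : E2 → Mat} {x : E2} (h : Pinch L κ (G x)) (hL : 0 < L) :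
    L ≤ dvol G x ∧ dvol G x ≤ κ * L := by
  have e : (G x).det = G x 0 0 * G x 1 1 - G x 0 1 ^ 2 := by
    rw [Matrix.det_fin_two, h.symm]; ring
  have hu : 0 < κ * L := hL.trans_le (h.lo0.trans h.up0)
  rw [dvol, e]
  exact ⟨Real.le_sqrt_of_sq_le (h.det_lower hL), (Real.sqrt_le_left hu.le).2 (h.det_upper hL)⟩

/-! ### Inverse estimate for the reference element space -/

theorem refTri_subset_closure_interior : refTri ⊆ closure (interior refTri) := by
  rw [convex_refTri.closure_interior_eq_closure_of_nonempty_interior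
    ⟨_, openTri_subset_interior centroid_mem⟩]
  exact subset_closure

theorem eqOn_zero_of_integral_eq_zero {f : E2 → ℝ} (hf : ContinuousOn f refTri)
    (h0 : ∀ x ∈ refTri, 0 ≤ f x) (hi : ∫ x in refTri, f x = 0) : Set.EqOn f 0 refTri := by
  have hae := (setIntegral_eq_zero_iff_of_nonneg_ae
    ((ae_restrict_iff' isClosed_refTri.measurableSet).2 (Filter.Eventually.of_forall h0))
    (integrableOn_refTri hf)).1 hi
  exact Measure.eqOn_of_ae_eq hae hf continuousOn_const refTri_subset_closure_interior

/-- Squared Euclidean length of the gradient. -/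
def gradSq (v : E2 → ℝ) (x : E2) : ℝ := pd 0 v x ^ 2 + pd 1 v x ^ 2

theorem gradSq_nonneg (v : E2 → ℝ) (x : E2) : 0 ≤ gradSq v x := by unfold gradSq; positivity

theorem continuousOn_gradSq {n : WithTop ℕ∞} {v : E2 → ℝ} (hv : ContDiffOn ℝ n v refTri)
    (hn : 1 ≤ n) : ContinuousOn (gradSq v) refTri :=
  ((continuousOn_pd hv hn 0).pow 2).add ((continuousOn_pd hv hn 1).pow 2)

theorem exists_pos_mul_norm_sq_le {W : Type*} [NormedAddCommGroup W] [NormedSpace ℝ W]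
    [FiniteDimensional ℝ W] {n : W → ℝ} (hcont : Continuous n) (hpos : ∀ w, 0 ≤ n w)
    (hsmul : ∀ (c : ℝ) w, n (c • w) = c ^ 2 * n w) (hzero : ∀ w, n w = 0 → w = 0) :
    ∃ c : ℝ, 0 < c ∧ ∀ w : W, c * ‖w‖ ^ 2 ≤ n w := by
  have := FiniteDimensional.proper_real W
  have hn : ∀ w : W, w ≠ 0 → ‖w‖⁻¹ • w ∈ Metric.sphere (0 : W) 1 := fun w hw => by
    rw [mem_sphere_zero_iff_norm, norm_smul, norm_inv, norm_norm,
      inv_mul_cancel₀ (norm_ne_zero_iff.2 hw)]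
  rcases (Metric.sphere (0 : W) 1).eq_empty_or_nonempty with he | hne
  · refine ⟨1, one_pos, fun w => ?_⟩
    have : w = 0 := by
      by_contra hw
      have := hn w hw
      rw [he] at this
      exact this
    rw [this]; simpa using hpos 0
  · obtain ⟨w₀, hw₀, hmin⟩ := (isCompact_sphere (0 : W) 1).exists_isMinOn hne hcont.continuousOn
    have h0 : 0 < n w₀ := by
      refine lt_of_le_of_ne (hpos _) fun h => ?_
      rw [hzero w₀ h.symm] at hw₀
      simp at hw₀
    refine ⟨n w₀, h0, fun w => ?_⟩
    by_cases hw : w = 0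
    · rw [hw]; simpa using hpos 0
    have hw' : ‖w‖ ≠ 0 := norm_ne_zero_iff.2 hw
    have := hmin (hn w hw)
    simp only [Set.mem_ofPred_eq, hsmul] at this
    calc n w₀ * ‖w‖ ^ 2 ≤ (‖w‖⁻¹ ^ 2 * n w) * ‖w‖ ^ 2 := by gcongr
      _ = n w := by field_simp

theorem exists_gradSq_le {Vhat : Submodule ℝ (E2 → ℝ)} (hV : IsRefSpace Vhat) :
    ∃ C : ℝ, 0 ≤ C ∧ ∀ φ ∈ Vhat, ∀ x ∈ refTri, gradSq φ x ≤ C * ∫ y in refTri, gradSq φ y := by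
  have := hV.finite
  have : CompactSpace refTri := isCompact_iff_compactSpace.1 isCompact_refTri
  have hd : ∀ φ : Vhat, ∀ k, ContinuousOn (pd k φ.1) refTri := fun φ k =>
    continuousOn_pd (hV.c2 φ φ.2) (by norm_num) k
  have hdiff : ∀ φ : Vhat, ∀ x ∈ refTri, DifferentiableWithinAt ℝ φ.1 refTri x := fun φ x hx =>
    (hV.c2 φ φ.2).differentiableOn (by norm_num) x hx
  let Λ : Vhat →ₗ[ℝ] C(refTri, ℝ) × C(refTri, ℝ) :=
    { toFun := fun φ => (⟨_, (hd φ 0).domRestrict⟩, ⟨_, (hd φ 1).domRestrict⟩)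
      map_add' := fun φ ψ => by
        ext x
        · exact ((HasPd.of_differentiable (hdiff φ x x.2)).add
            (HasPd.of_differentiable (hdiff ψ x x.2))).pd_eq x.2 0
        · exact ((HasPd.of_differentiable (hdiff φ x x.2)).add
            (HasPd.of_differentiable (hdiff ψ x x.2))).pd_eq x.2 1
      map_smul' := fun c φ => by
        have e : ∀ x : refTri, ∀ k, pd k (c • φ).1 x = c * pd k φ.1 x := fun x k => by
          have := ((HasPd.const c).mul (HasPd.of_differentiable (hdiff φ x x.2))).pd_eq x.2 k
          rw [zero_mul, zero_add] at this
          exact this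
        ext x
        · exact e x 0
        · exact e x 1 }
  let W := LinearMap.range Λ
  let μ : Measure refTri := Measure.comap Subtype.val volume
  have : IsFiniteMeasure μ := ⟨by
    rw [(MeasurableEmbedding.subtype_coe isClosed_refTri.measurableSet).comap_apply]
    simpa using isCompact_refTri.measure_lt_top⟩
  let n : W → ℝ := fun w => ∫ y : refTri, ((w.1.1 y) ^ 2 + (w.1.2 y) ^ 2) ∂μ
  have hn : ∀ φ : Vhat, n ⟨Λ φ, φ, rfl⟩ = ∫ y in refTri, gradSq φ.1 y := fun φ =>
    integral_subtype_comap isClosed_refTri.measurableSet (gradSq φ.1)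
  have hcont : Continuous n := by
    have := continuous_parametric_integral_of_continuous (μ := μ)
      (f := fun (w : W) (y : refTri) => (w.1.1 y) ^ 2 + (w.1.2 y) ^ 2) (s := Set.univ) (by
        unfold Function.uncurry
        fun_prop) isCompact_univ
    simpa [n] using this
  have hpos : ∀ w : W, 0 ≤ n w := fun w => integral_nonneg fun y => by positivity
  have hsmul : ∀ (c : ℝ) (w : W), n (c • w) = c ^ 2 * n w := by
    intro c w
    simp only [n, ← integral_const_mul]
    congr 1; ext y
    simp; ring
  have hzero : ∀ w : W, n w = 0 → w = 0 := by
    rintro ⟨_, φ, rfl⟩ hw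
    rw [hn] at hw
    have := eqOn_zero_of_integral_eq_zero (continuousOn_gradSq (hV.c2 φ φ.2) (by norm_num))
      (fun x _ => gradSq_nonneg _ x) hw
    have e : ∀ x : refTri, pd 0 φ.1 x = 0 ∧ pd 1 φ.1 x = 0 := fun x => by
      have h := this x.2
      simp only [gradSq, Pi.zero_apply] at h
      constructor <;> nlinarith [sq_nonneg (pd 0 φ.1 x), sq_nonneg (pd 1 φ.1 x)]
    ext x
    · exact (e x).1
    · exact (e x).2
  obtain ⟨c, hc, hcW⟩ := exists_pos_mul_norm_sq_le hcont hpos hsmul hzero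
  refine ⟨2 * c⁻¹, by positivity, fun φ hφ x hx => ?_⟩
  have h1 := hcW ⟨Λ ⟨φ, hφ⟩, ⟨φ, hφ⟩, rfl⟩
  rw [hn] at h1
  have h2 : |pd 0 φ x| ≤ ‖Λ ⟨φ, hφ⟩‖ :=
    ((Λ ⟨φ, hφ⟩).1.norm_coe_le_norm ⟨x, hx⟩).trans (norm_fst_le _)
  have h3 : |pd 1 φ x| ≤ ‖Λ ⟨φ, hφ⟩‖ :=
    ((Λ ⟨φ, hφ⟩).2.norm_coe_le_norm ⟨x, hx⟩).trans (norm_snd_le _)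
  have h4 : gradSq φ x ≤ 2 * ‖Λ ⟨φ, hφ⟩‖ ^ 2 := by
    have := pow_le_pow_left₀ (abs_nonneg _) h2 2
    have := pow_le_pow_left₀ (abs_nonneg _) h3 2
    rw [sq_abs] at *
    unfold gradSq; linarith
  refine h4.trans ?_
  have : ‖Λ ⟨φ, hφ⟩‖ ^ 2 ≤ c⁻¹ * ∫ y in refTri, gradSq φ y := by
    rw [inv_mul_eq_div, le_div_iff₀ hc, mul_comm]; exact h1
  linarith

end

section

/-! ### Integral inequalities -/

theorem abs_integral_le_sqrt_mul_sqrt {α : Type*} [MeasurableSpace α] {μ : Measure α}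
    {F p q : α → ℝ} (hp : Integrable p μ) (hq : Integrable q μ) (p0 : ∀ᵐ x ∂μ, 0 ≤ p x)
    (q0 : ∀ᵐ x ∂μ, 0 ≤ q x) (h : ∀ᵐ x ∂μ, |F x| ≤ √(p x) * √(q x)) :
    |∫ x, F x ∂μ| ≤ √(∫ x, p x ∂μ) * √(∫ x, q x ∂μ) := by
  have hm : AEStronglyMeasurable (fun x => √(p x) * √(q x)) μ :=
    (hp.aemeasurable.sqrt.mul hq.aemeasurable.sqrt).aestronglyMeasurable
  have hpq : Integrable (fun x => √(p x) * √(q x)) μ := by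
    refine (hp.add hq).mono' hm ?_
    filter_upwards [p0, q0] with x hx hy
    rw [Real.norm_eq_abs, abs_of_nonneg (by positivity), Pi.add_apply]
    nlinarith [Real.sq_sqrt hx, Real.sq_sqrt hy, sq_nonneg (√(p x) - √(q x)), Real.sqrt_nonneg (p x),
      Real.sqrt_nonneg (q x)]
  have h1 : |∫ x, F x ∂μ| ≤ ∫ x, √(p x) * √(q x) ∂μ :=
    (Real.norm_eq_abs _).symm.trans_le (norm_integral_le_of_norm_le hpq h)
  have h2 : (∫ x, √(p x) * √(q x) ∂μ) ^ 2 ≤ (∫ x, p x ∂μ) * ∫ x, q x ∂μ := by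
    refine sq_le_mul_of_quad_nonneg fun a b => ?_
    have e : ∫ x, (p x * a ^ 2 + (√(p x) * √(q x)) * (2 * a * b) + q x * b ^ 2) ∂μ =
        (∫ x, p x ∂μ) * a ^ 2 + 2 * (∫ x, √(p x) * √(q x) ∂μ) * a * b +
          (∫ x, q x ∂μ) * b ^ 2 := by
      have hi : Integrable (fun x => p x * a ^ 2 + (√(p x) * √(q x)) * (2 * a * b)) μ :=
        (hp.mul_const _).add (hpq.mul_const _)
      rw [integral_add hi (hq.mul_const _),
        integral_add (hp.mul_const _) (hpq.mul_const _), integral_mul_const, integral_mul_const,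
        integral_mul_const]
      ring
    rw [← e]
    refine integral_nonneg_of_ae ?_
    filter_upwards [p0, q0] with x hx hy
    have : p x * a ^ 2 + (√(p x) * √(q x)) * (2 * a * b) + q x * b ^ 2 =
        (√(p x) * a + √(q x) * b) ^ 2 := by
      rw [add_sq, mul_pow, mul_pow, Real.sq_sqrt hx, Real.sq_sqrt hy]; ring
    rw [this]; exact sq_nonneg _
  rw [← Real.sqrt_mul (integral_nonneg_of_ae p0)]
  exact h1.trans (Real.le_sqrt_of_sq_le h2)

theorem abs_integral_refTri_le {F p q : E2 → ℝ} (hp : ContinuousOn p refTri)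
    (hq : ContinuousOn q refTri) (p0 : ∀ x ∈ refTri, 0 ≤ p x) (q0 : ∀ x ∈ refTri, 0 ≤ q x)
    (h : ∀ x ∈ refTri, |F x| ≤ √(p x) * √(q x)) :
    |∫ x in refTri, F x| ≤ √(∫ x in refTri, p x) * √(∫ x in refTri, q x) := by
  have hm := isClosed_refTri.measurableSet
  refine abs_integral_le_sqrt_mul_sqrt (integrableOn_refTri hp) (integrableOn_refTri hq) ?_ ?_ ?_
  · exact (ae_restrict_iff' hm).2 (Filter.Eventually.of_forall p0)
  · exact (ae_restrict_iff' hm).2 (Filter.Eventually.of_forall q0)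
  · exact (ae_restrict_iff' hm).2 (Filter.Eventually.of_forall h)

theorem abs_integral_side_le {F : ℝ → ℝ} {p q : E2 → ℝ} (i : Fin 3) (hp : ContinuousOn p refTri)
    (hq : ContinuousOn q refTri) (p0 : ∀ x ∈ refTri, 0 ≤ p x) (q0 : ∀ x ∈ refTri, 0 ≤ q x)
    (h : ∀ s ∈ Set.Icc (0:ℝ) 1, |F s| ≤ √(p (sidePt i s)) * √(q (sidePt i s))) :
    |∫ s in (0:ℝ)..1, F s| ≤
      √(∫ s in (0:ℝ)..1, p (sidePt i s)) * √(∫ s in (0:ℝ)..1, q (sidePt i s)) := by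
  have hm : MeasurableSet (Set.Ioc (0:ℝ) 1) := measurableSet_Ioc
  simp only [intervalIntegral.integral_of_le zero_le_one]
  refine abs_integral_le_sqrt_mul_sqrt (intervalIntegrable_sidePt hp i).1
    (intervalIntegrable_sidePt hq i).1 ?_ ?_ ?_
  · exact (ae_restrict_iff' hm).2 (Filter.Eventually.of_forall fun s hs =>
      p0 _ (sidePt_mem i (Set.Ioc_subset_Icc_self hs)))
  · exact (ae_restrict_iff' hm).2 (Filter.Eventually.of_forall fun s hs =>
      q0 _ (sidePt_mem i (Set.Ioc_subset_Icc_self hs)))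
  · exact (ae_restrict_iff' hm).2 (Filter.Eventually.of_forall fun s hs =>
      h _ (Set.Ioc_subset_Icc_self hs))

theorem sum_sideIntegral_eq {q : E2 → ℝ} (hq : ContDiffOn ℝ 1 q refTri) :
    ∑ i, ∫ s in (0:ℝ)..1, q (sidePt i s) =
      3 * ∫ x in refTri, (2 * q x + (x 0 - 1 / 3) * pd 0 q x + (x 1 - 1 / 3) * pd 1 q x) := by
  have hc : ∀ k : Fin 2, ContDiffOn ℝ 1 (fun x : E2 => x k - 1 / 3) refTri := fun k => by fun_prop
  have h := integral_div_refTri (hq.mul (hc 0)) (hq.mul (hc 1))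
  have e : ∀ x ∈ refTri, pd 0 (fun x => q x * (x 0 - 1 / 3)) x +
      pd 1 (fun x => q x * (x 1 - 1 / 3)) x =
      2 * q x + (x 0 - 1 / 3) * pd 0 q x + (x 1 - 1 / 3) * pd 1 q x := by
    intro x hx
    have hq' := HasPd.of_contDiffOn hq one_ne_zero hx
    have h0 := (hq'.mul ((HasPd.coord 0).sub (HasPd.const (1 / 3)))).pd_eq hx 0
    have h1 := (hq'.mul ((HasPd.coord 1).sub (HasPd.const (1 / 3)))).pd_eq hx 1
    rw [h0, h1]
    simp; ring
  rw [← setIntegral_congr_fun isClosed_refTri.measurableSet e]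
  rw [h, Finset.mul_sum]
  refine Finset.sum_congr rfl fun i _ => ?_
  rw [← intervalIntegral.integral_const_mul]
  congr 1; ext s
  fin_cases i
  · simp [sidePt_zero, sideDir_zero]; ring
  · simp [sidePt_one, sideDir_one]; ring
  · simp [sidePt_two, sideDir_two]; ring

/-! ### Comparison of two metrics -/

theorem inner2_self_eq {A S : Mat} (hA : A 1 0 = A 0 1) (hS : S 1 0 = S 0 1)
    (hd : A 0 0 * A 1 1 - A 0 1 ^ 2 ≠ 0) :
    inner2 A S S = ((A 1 1 * S 0 0 - 2 * A 0 1 * S 0 1 + A 0 0 * S 1 1) /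
        (A 0 0 * A 1 1 - A 0 1 ^ 2)) ^ 2 -
      2 * (S 0 0 * S 1 1 - S 0 1 ^ 2) / (A 0 0 * A 1 1 - A 0 1 ^ 2) := by
  obtain ⟨h00, h01, h10, h11⟩ := inv_entries hA
  simp only [inner2, Fin.sum_univ_two, h00, h01, h10, h11, hS]
  generalize hD : A 0 0 * A 1 1 - A 0 1 ^ 2 = D at *
  field_simp
  rw [← hD]
  ring

theorem IsMetric.of_pinch {L κ : ℝ} {G : E2 → Mat} (hL : 0 < L)
    (hs : ∀ i j, ContDiffOn ℝ ∞ (fun x => G x i j) refTri)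
    (hp : ∀ x ∈ refTri, Pinch L κ (G x)) : IsMetric G := by
  refine ⟨hs, fun x hx => ?_⟩
  have h := hp x hx
  refine Matrix.PosDef.of_dotProduct_mulVec_pos ?_ fun v hv => ?_
  · ext i j; fin_cases i <;> fin_cases j <;> simp [h.symm]
  · have h1 := h.lower (v 0) (v 1)
    have h2 : 0 < v 0 ^ 2 + v 1 ^ 2 := by
      by_contra hc
      refine hv (funext fun i => ?_)
      fin_cases i <;> simp <;> nlinarith [sq_nonneg (v 0), sq_nonneg (v 1)]
    simp only [Matrix.mulVec, dotProduct, Fin.sum_univ_two, Pi.star_apply, star_trivial, h.symm]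
    nlinarith [mul_pos hL h2]

theorem Pinch.lincomb {L κ : ℝ} {A B : Mat} (hA : Pinch L κ A) (hB : Pinch L κ B) {t : ℝ}
    (ht : t ∈ Set.Icc (0:ℝ) 1) : Pinch L κ (t • A + (1 - t) • B) := by
  have h0 := ht.1
  have h1 : 0 ≤ 1 - t := by linarith [ht.2]
  refine ⟨by simp [hA.symm, hB.symm], fun a b => ?_, fun a b => ?_⟩
  · have k1 := mul_le_mul_of_nonneg_left (hA.lower a b) h0
    have k2 := mul_le_mul_of_nonneg_left (hB.lower a b) h1
    simp only [Matrix.add_apply, Matrix.smul_apply, smul_eq_mul]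
    linarith
  · have k1 := mul_le_mul_of_nonneg_left (hA.upper a b) h0
    have k2 := mul_le_mul_of_nonneg_left (hB.upper a b) h1
    simp only [Matrix.add_apply, Matrix.smul_apply, smul_eq_mul]
    linarith

theorem cov2_lincomb (G : E2 → Mat) {σ τ : E2 → Mat}
    (hσ : ∀ i j, ContDiffOn ℝ ∞ (fun x => σ x i j) refTri)
    (hτ : ∀ i j, ContDiffOn ℝ ∞ (fun x => τ x i j) refTri) (a b : ℝ) {x : E2} (hx : x ∈ refTri)
    (k i j : Fin 2) :
    cov2 G (a • σ + b • τ) x k i j = a * cov2 G σ x k i j + b * cov2 G τ x k i j := by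
  have e := (((HasPd.const a).mul (HasPd.of_contDiffOn (hσ i j) (by simp) hx)).add
    ((HasPd.const b).mul (HasPd.of_contDiffOn (hτ i j) (by simp) hx))).pd_eq hx k
  simp only [cov2, Fin.sum_univ_two, Pi.add_apply, Pi.smul_apply, Matrix.add_apply,
    Matrix.smul_apply, smul_eq_mul]
  rw [e]
  ring

theorem IsMetric.cov2_self {G : E2 → Mat} (hG : IsMetric G) {x : E2} (hx : x ∈ refTri)
    (k i j : Fin 2) : cov2 G G x k i j = 0 := by
  simp only [cov2, Fin.sum_univ_two, hG.pd_entry hx]; ring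

/-- The difference of two Levi-Civita connections. -/
theorem chris_sub {G g : E2 → Mat} (hG : IsMetric G) (hg : IsMetric g) {x : E2} (hx : x ∈ refTri)
    (l k i : Fin 2) : chris G l k i x = chris g l k i x +
      (1 / 2) * ∑ m, (G x)⁻¹ l m * (cov2 g G x k m i + cov2 g G x i m k - cov2 g G x m k i) := by
  obtain ⟨h00, h01, h10, h11⟩ := inv_entries (hG.symm hx)
  have hd := (hG.det_pos hx).ne'
  rw [show chris G l k i x = (1 / 2) * ∑ m, (G x)⁻¹ l m * (pd k (fun y => G y m i) x +
    pd i (fun y => G y m k) x - pd m (fun y => G y k i) x) from rfl]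
  simp only [cov2]
  fin_cases l <;> fin_cases k <;> fin_cases i <;> simp only [Fin.sum_univ_two,
    Fin.zero_eta, Fin.mk_one, Fin.isValue, hG.pd_symm hx, h00, h01, h10, h11, hG.symm hx,
    hg.chris_symm hx _ 1 0] <;>
    generalize hD : G x 0 0 * G x 1 1 - G x 0 1 ^ 2 = D at * <;> field_simp <;> rw [← hD] <;> ring

end

section

/-! ### The basic estimate for functionals of the gradient -/

/-- A pair of metrics on the reference triangle which are both comparable to `L` times the flat
metric. -/
structure MetricPair (L κ : ℝ) (g γ : E2 → Mat) : Prop where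
  pos : 0 < L
  metric₁ : IsMetric g
  metric₂ : IsMetric γ
  pinch₁ : ∀ x ∈ refTri, Pinch L κ (g x)
  pinch₂ : ∀ x ∈ refTri, Pinch L κ (γ x)

/-- Squared Euclidean norm of the difference of two metrics. -/
def diffSq (g γ : E2 → Mat) (x : E2) : ℝ := ∑ i, ∑ j, (γ x i j - g x i j) ^ 2

/-- Squared Euclidean norm of the covariant derivative. -/
def covSq (g γ : E2 → Mat) (x : E2) : ℝ := ∑ k, ∑ i, ∑ j, cov2 g γ x k i j ^ 2

theorem diffSq_nonneg (g γ : E2 → Mat) (x : E2) : 0 ≤ diffSq g γ x := by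
  unfold diffSq; positivity

theorem covSq_nonneg (g γ : E2 → Mat) (x : E2) : 0 ≤ covSq g γ x := by
  unfold covSq; positivity

theorem abs_diff_le (g γ : E2 → Mat) (x : E2) (i j : Fin 2) :
    |γ x i j - g x i j| ≤ √(diffSq g γ x) := by
  refine Real.abs_le_sqrt ?_
  unfold diffSq
  calc (γ x i j - g x i j) ^ 2 ≤ ∑ j, (γ x i j - g x i j) ^ 2 :=
        Finset.single_le_sum (f := fun j => (γ x i j - g x i j) ^ 2)
          (fun _ _ => sq_nonneg _) (Finset.mem_univ j)
    _ ≤ _ := Finset.single_le_sum (f := fun i => ∑ j, (γ x i j - g x i j) ^ 2)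
          (fun _ _ => Finset.sum_nonneg fun _ _ => sq_nonneg _) (Finset.mem_univ i)

theorem abs_cov_le (g γ : E2 → Mat) (x : E2) (k i j : Fin 2) :
    |cov2 g γ x k i j| ≤ √(covSq g γ x) := by
  refine Real.abs_le_sqrt ?_
  unfold covSq
  calc cov2 g γ x k i j ^ 2 ≤ ∑ j, cov2 g γ x k i j ^ 2 :=
        Finset.single_le_sum (f := fun j => cov2 g γ x k i j ^ 2)
          (fun _ _ => sq_nonneg _) (Finset.mem_univ j)
    _ ≤ ∑ i, ∑ j, cov2 g γ x k i j ^ 2 :=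
        Finset.single_le_sum (f := fun i => ∑ j, cov2 g γ x k i j ^ 2)
          (fun _ _ => Finset.sum_nonneg fun _ _ => sq_nonneg _) (Finset.mem_univ i)
    _ ≤ _ := Finset.single_le_sum (f := fun k => ∑ i, ∑ j, cov2 g γ x k i j ^ 2)
          (fun _ _ => Finset.sum_nonneg fun _ _ => Finset.sum_nonneg fun _ _ => sq_nonneg _)
          (Finset.mem_univ k)

theorem continuousOn_cov2 {G σ : E2 → Mat} (hG : IsMetric G)
    (hs : ∀ i j, ContDiffOn ℝ ∞ (fun x => σ x i j) refTri) (k i j : Fin 2) :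
    ContinuousOn (fun x => cov2 G σ x k i j) refTri := by
  unfold cov2
  have ch := fun a b c => (hG.contDiffOn_chris a b c).continuousOn
  exact ((continuousOn_pd (hs i j) (by simp) k).sub (continuousOn_finsetSum _ fun l _ =>
    (ch l k i).mul (hs l j).continuousOn)).sub (continuousOn_finsetSum _ fun l _ =>
    (ch l k j).mul (hs i l).continuousOn)

/-- The energy density that controls the difference of two metrics. -/
def energy (L : ℝ) (g γ : E2 → Mat) (x : E2) : ℝ := (diffSq g γ x + covSq g γ x) / L ^ 2

theorem energy_nonneg (L : ℝ) (g γ : E2 → Mat) (x : E2) : 0 ≤ energy L g γ x :=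
  div_nonneg (add_nonneg (diffSq_nonneg _ _ _) (covSq_nonneg _ _ _)) (sq_nonneg _)

theorem IsMetric.isSymField {G : E2 → Mat} (hG : IsMetric G) : IsSymField G :=
  ⟨hG.smooth, fun _ hx => hG.symm hx⟩

theorem IsSymField.sub {σ τ : E2 → Mat} (hσ : IsSymField σ) (hτ : IsSymField τ) :
    IsSymField (σ - τ) :=
  ⟨fun i j => (hσ.smooth i j).sub (hτ.smooth i j), fun x hx => by
    simp [hσ.symm x hx, hτ.symm x hx]⟩

theorem abs_mul_le_mul {a b m n : ℝ} (ha : |a| ≤ m) (hb : |b| ≤ n) : |a * b| ≤ m * n := by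
  rw [abs_mul]; exact mul_le_mul ha hb (abs_nonneg _) ((abs_nonneg _).trans ha)

theorem abs_sub_two_mul_add_le {p q r m : ℝ} (hp : |p| ≤ m) (hq : |q| ≤ m) (hr : |r| ≤ m) :
    |p - 2 * q + r| ≤ 4 * m := by
  have h1 := abs_le.1 hp; have h2 := abs_le.1 hq; have h3 := abs_le.1 hr
  exact abs_le.2 ⟨by linarith, by linarith⟩

namespace MetricPair

variable {L κ : ℝ} {g γ : E2 → Mat} (h : MetricPair L κ g γ)
include h

theorem one_le_kappa : 1 ≤ κ :=
  (h.pinch₁ _ (vtx_mem 0)).one_le h.pos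

theorem continuousOn_diffSq : ContinuousOn (diffSq g γ) refTri :=
  continuousOn_finsetSum _ fun i _ => continuousOn_finsetSum _ fun j _ =>
    ((h.metric₂.smooth i j).continuousOn.sub (h.metric₁.smooth i j).continuousOn).pow 2

theorem continuousOn_covSq : ContinuousOn (covSq g γ) refTri :=
  continuousOn_finsetSum _ fun k _ => continuousOn_finsetSum _ fun i _ =>
    continuousOn_finsetSum _ fun j _ => (continuousOn_cov2 h.metric₁ h.metric₂.smooth k i j).pow 2

theorem continuousOn_energy : ContinuousOn (energy L g γ) refTri :=
  (h.continuousOn_diffSq.add h.continuousOn_covSq).div_const _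

theorem cov2_sub {x : E2} (hx : x ∈ refTri) (k i j : Fin 2) :
    cov2 g (γ - g) x k i j = cov2 g γ x k i j := by
  have := cov2_lincomb g h.metric₂.smooth h.metric₁.smooth 1 (-1) hx k i j
  rw [h.metric₁.cov2_self hx] at this
  simpa [sub_eq_add_neg] using this

set_option maxHeartbeats 1000000 in
/-- Trace inequality for the difference of the metrics. -/
theorem sum_side_diffSq_le :
    ∑ i, ∫ s in (0:ℝ)..1, diffSq g γ (sidePt i s) / L ^ 2 ≤
      48 * κ ^ 2 * (4 * κ ^ 2 + 1) * ∫ x in refTri, energy L g γ x := by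
  have hL := h.pos
  have hκ := h.one_le_kappa
  have hsym : IsSymField (γ - g) := h.metric₂.isSymField.sub h.metric₁.isSymField
  set σ := γ - g with hσ
  set q : E2 → ℝ := fun x => ((g x 1 1 * σ x 0 0 - 2 * g x 0 1 * σ x 0 1 + g x 0 0 * σ x 1 1) /
        dvol g x ^ 2) ^ 2 -
      2 * (σ x 0 0 * σ x 1 1 - σ x 0 1 ^ 2) / dvol g x ^ 2 with hq
  have hq2 : ∀ x ∈ refTri, q x = inner2 (g x) (σ x) (σ x) := by
    intro x hx
    rw [inner2_self_eq (h.metric₁.symm hx) (hsym.symm x hx) (h.metric₁.det_pos hx).ne',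
      ← h.metric₁.dvol_sq hx]
  have hP : ContDiffOn ℝ ∞ (fun x => dvol g x ^ 2) refTri := h.metric₁.contDiffOn_dvol.pow 2
  have hP0 : ∀ x ∈ refTri, dvol g x ^ 2 ≠ 0 := fun x hx => (pow_pos (h.metric₁.dvol_pos hx) 2).ne'
  have cg := h.metric₁.smooth
  have cs := hsym.smooth
  have hqc : ContDiffOn ℝ 1 q refTri := by
    refine ContDiffOn.of_le (n := ∞) ?_ (by simp)
    exact (((((cg 1 1).mul (cs 0 0)).sub ((contDiffOn_const.mul (cg 0 1)).mul (cs 0 1))).add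
      ((cg 0 0).mul (cs 1 1))).div hP hP0 |>.pow 2).sub
      ((contDiffOn_const.mul (((cs 0 0).mul (cs 1 1)).sub ((cs 0 1).pow 2))).div hP hP0)
  have hpd : ∀ x ∈ refTri, ∀ k, pd k q x =
      2 * ((g x 1 1 * σ x 0 0 - 2 * g x 0 1 * σ x 0 1 + g x 0 0 * σ x 1 1) / dvol g x ^ 2) *
        ((g x 1 1 * cov2 g γ x k 0 0 - 2 * g x 0 1 * cov2 g γ x k 0 1 +
          g x 0 0 * cov2 g γ x k 1 1) / dvol g x ^ 2) -
      2 * (cov2 g γ x k 0 0 * σ x 1 1 + σ x 0 0 * cov2 g γ x k 1 1 -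
        2 * σ x 0 1 * cov2 g γ x k 0 1) / dvol g x ^ 2 := by
    intro x hx k
    have hp := (h.metric₁.dvol_pos hx).ne'
    have hs := fun i j => (hsym.hasPd g hx i j)
    have hg' := fun i j => (h.metric₁.hasPd_entry hx i j)
    have hP' := (h.metric₁.hasPd_dvol hx).mul (h.metric₁.hasPd_dvol hx)
    have hp2 : dvol g x * dvol g x ≠ 0 := mul_ne_zero hp hp
    have h1 := ((((hg' 1 1).mul (hs 0 0)).sub (((HasPd.const 2).mul (hg' 0 1)).mul (hs 0 1))).add
      ((hg' 0 0).mul (hs 1 1))).div hP' hp2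
    have h2 := ((HasPd.const 2).mul (((hs 0 0).mul (hs 1 1)).sub
      ((hs 0 1).mul (hs 0 1)))).div hP' hp2
    have h3 := ((h1.mul h1).sub h2).pd_eq hx k
    have e : q = fun x => ((g x 1 1 * σ x 0 0 - 2 * g x 0 1 * σ x 0 1 + g x 0 0 * σ x 1 1) /
        (dvol g x * dvol g x)) * ((g x 1 1 * σ x 0 0 - 2 * g x 0 1 * σ x 0 1 + g x 0 0 * σ x 1 1) /
        (dvol g x * dvol g x)) -
      2 * (σ x 0 0 * σ x 1 1 - σ x 0 1 * σ x 0 1) / (dvol g x * dvol g x) := by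
      funext y; simp only [hq, sq]
    rw [e, h3]
    have hcov : ∀ i j, cov2 g σ x k i j = cov2 g γ x k i j := fun i j => h.cov2_sub hx k i j
    simp only [hsym.symm x hx, h.metric₁.symm hx, hcov]
    field_simp
    ring
  have key : ∀ x ∈ refTri, diffSq g γ x / L ^ 2 ≤ κ ^ 2 * q x ∧
      2 * q x + (x 0 - 1 / 3) * pd 0 q x + (x 1 - 1 / 3) * pd 1 q x ≤
        4 * (4 * (4 * κ ^ 2 + 1)) * energy L g γ x := by
    intro x hx
    have hpin := h.pinch₁ x hx
    have hpp := h.metric₁.dvol_pos hx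
    have hlow := hpin.inner2_lower hL (σ x)
    have hdb := (hpin.dvol_bounds hL).1
    have hd2 : L ^ 2 ≤ dvol g x ^ 2 := pow_le_pow_left₀ hL.le hdb 2
    have hqe := hq2 x hx
    set s := √(diffSq g γ x) with hs
    set n := √(covSq g γ x) with hn
    have hs2 : s ^ 2 = diffSq g γ x := Real.sq_sqrt (diffSq_nonneg _ _ _)
    have hn2 : n ^ 2 = covSq g γ x := Real.sq_sqrt (covSq_nonneg _ _ _)
    have s0 : 0 ≤ s := Real.sqrt_nonneg _
    have n0 : 0 ≤ n := Real.sqrt_nonneg _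
    have bs : ∀ i j, |σ x i j| ≤ s := fun i j => abs_diff_le g γ x i j
    have bn : ∀ k i j, |cov2 g γ x k i j| ≤ n := fun k i j => abs_cov_le g γ x k i j
    have bg := fun i j => hpin.entry hL i j
    have hκL : 0 ≤ κ * L := by positivity
    have b1 : ∀ a b c m : ℝ, |a| ≤ m → |b| ≤ m → |c| ≤ m →
        |(g x 1 1 * a - 2 * g x 0 1 * b + g x 0 0 * c) / dvol g x ^ 2| ≤ 4 * κ * m / L := by
      intro a b c m ha hb hc
      have hm : 0 ≤ m := (abs_nonneg _).trans ha
      have : |g x 1 1 * a - 2 * g x 0 1 * b + g x 0 0 * c| ≤ 4 * κ * L * m := by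
        have := abs_sub_two_mul_add_le (abs_mul_le_mul (bg 1 1) ha)
          (abs_mul_le_mul (bg 0 1) hb) (abs_mul_le_mul (bg 0 0) hc)
        rw [← mul_assoc] at this
        exact this.trans_eq (by ring)
      rw [abs_div, abs_of_pos (pow_pos hpp 2), div_le_div_iff₀ (pow_pos hpp 2) hL]
      calc |g x 1 1 * a - 2 * g x 0 1 * b + g x 0 0 * c| * L ≤ 4 * κ * L * m * L := by gcongr
        _ = 4 * κ * m * L ^ 2 := by ring
        _ ≤ _ := by gcongr
    have bq : q x ≤ 4 * (4 * κ ^ 2 + 1) * s ^ 2 / L ^ 2 := by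
      have t1 := b1 _ _ _ s (bs 0 0) (bs 0 1) (bs 1 1)
      have t2 := pow_le_pow_left₀ (abs_nonneg _) t1 2
      rw [sq_abs] at t2
      have t3 : |2 * (σ x 0 0 * σ x 1 1 - σ x 0 1 ^ 2) / dvol g x ^ 2| ≤ 4 * s ^ 2 / L ^ 2 := by
        rw [abs_div, abs_of_pos (pow_pos hpp 2)]
        have : |2 * (σ x 0 0 * σ x 1 1 - σ x 0 1 ^ 2)| ≤ 4 * s ^ 2 := by
          have u1 := abs_mul_le_mul (bs 0 0) (bs 1 1)
          have u2 := abs_mul_le_mul (bs 0 1) (bs 0 1)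
          rw [abs_mul, abs_two, sq, sq]
          linarith [abs_sub (σ x 0 0 * σ x 1 1) (σ x 0 1 * σ x 0 1)]
        gcongr
      have t4 := (abs_le.1 t3).1
      have : q x ≤ (4 * κ * s / L) ^ 2 + 4 * s ^ 2 / L ^ 2 := by
        simp only [hq]; linarith
      refine this.trans_eq ?_
      ring
    have bd : ∀ k, |pd k q x| ≤ 8 * (4 * κ ^ 2 + 1) * (n * s) / L ^ 2 := by
      intro k
      have t1 := b1 _ _ _ s (bs 0 0) (bs 0 1) (bs 1 1)
      have t2 := b1 _ _ _ n (bn k 0 0) (bn k 0 1) (bn k 1 1)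
      have t3 : |2 * (cov2 g γ x k 0 0 * σ x 1 1 + σ x 0 0 * cov2 g γ x k 1 1 -
        2 * σ x 0 1 * cov2 g γ x k 0 1) / dvol g x ^ 2| ≤ 8 * (n * s) / L ^ 2 := by
        rw [abs_div, abs_of_pos (pow_pos hpp 2)]
        have : |2 * (cov2 g γ x k 0 0 * σ x 1 1 + σ x 0 0 * cov2 g γ x k 1 1 -
            2 * σ x 0 1 * cov2 g γ x k 0 1)| ≤ 8 * (n * s) := by
          have := abs_sub_two_mul_add_le (abs_mul_le_mul (bn k 0 0) (bs 1 1))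
            (abs_mul_le_mul (bn k 0 1) (bs 0 1)) (abs_mul_le_mul (bn k 1 1) (bs 0 0))
          have e : 2 * (cov2 g γ x k 0 0 * σ x 1 1 + σ x 0 0 * cov2 g γ x k 1 1 -
            2 * σ x 0 1 * cov2 g γ x k 0 1) = 2 * (cov2 g γ x k 0 0 * σ x 1 1 -
              2 * (cov2 g γ x k 0 1 * σ x 0 1) + cov2 g γ x k 1 1 * σ x 0 0) := by ring
          rw [e, abs_mul, abs_two]
          linarith
        gcongr
      rw [hpd x hx k]
      refine (abs_sub _ _).trans ?_
      rw [abs_mul, abs_mul, abs_two]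
      have t4 : 2 * |(g x 1 1 * σ x 0 0 - 2 * g x 0 1 * σ x 0 1 + g x 0 0 * σ x 1 1) /
          dvol g x ^ 2| * |(g x 1 1 * cov2 g γ x k 0 0 - 2 * g x 0 1 * cov2 g γ x k 0 1 +
          g x 0 0 * cov2 g γ x k 1 1) / dvol g x ^ 2| ≤ 2 * (4 * κ * s / L) * (4 * κ * n / L) := by
        gcongr
      refine (add_le_add t4 t3).trans_eq ?_
      ring
    constructor
    · have e : diffSq g γ x = σ x 0 0 ^ 2 + σ x 0 1 ^ 2 + σ x 1 0 ^ 2 + σ x 1 1 ^ 2 := by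
        simp only [diffSq, Fin.sum_univ_two, hσ, Pi.sub_apply, Matrix.sub_apply]; ring
      rw [← e, ← hqe] at hlow
      have := mul_le_mul_of_nonneg_left hlow (sq_nonneg κ)
      refine le_trans (le_of_eq ?_) this
      field_simp
    · have hx0 : |x 0 - 1 / 3| ≤ 1 := abs_le.2 ⟨by linarith [hx.1], by linarith [hx.2.1, hx.2.2]⟩
      have hx1 : |x 1 - 1 / 3| ≤ 1 := abs_le.2 ⟨by linarith [hx.2.1], by linarith [hx.1, hx.2.2]⟩
      have w : ∀ a b m : ℝ, |a| ≤ 1 → |b| ≤ m → a * b ≤ m := fun a b m ha hb => by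
        refine (le_abs_self _).trans ?_
        rw [abs_mul]
        nlinarith [abs_nonneg a, abs_nonneg b]
      have w0 := w _ _ _ hx0 (bd 0)
      have w1 := w _ _ _ hx1 (bd 1)
      have hen : energy L g γ x = (s ^ 2 + n ^ 2) / L ^ 2 := by rw [energy, hs2, hn2]
      have : 2 * q x + (x 0 - 1 / 3) * pd 0 q x + (x 1 - 1 / 3) * pd 1 q x ≤
          8 * (4 * κ ^ 2 + 1) * (s ^ 2 + 2 * (n * s)) / L ^ 2 := by
        have : 8 * (4 * κ ^ 2 + 1) * (s ^ 2 + 2 * (n * s)) / L ^ 2 =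
          2 * (4 * (4 * κ ^ 2 + 1) * s ^ 2 / L ^ 2) + 8 * (4 * κ ^ 2 + 1) * (n * s) / L ^ 2 +
            8 * (4 * κ ^ 2 + 1) * (n * s) / L ^ 2 := by ring
        rw [this]
        linarith
      refine this.trans ?_
      rw [hen, ← mul_div_assoc]
      refine div_le_div_of_nonneg_right ?_ (by positivity)
      have h1 : s ^ 2 + 2 * (n * s) ≤ 2 * (s ^ 2 + n ^ 2) := by nlinarith [sq_nonneg (s - n)]
      have h2 := mul_le_mul_of_nonneg_left h1 (by positivity : 0 ≤ 8 * (4 * κ ^ 2 + 1))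
      linarith
  have hqcont := hqc.continuousOn
  calc ∑ i, ∫ s in (0:ℝ)..1, diffSq g γ (sidePt i s) / L ^ 2
      ≤ ∑ i, ∫ s in (0:ℝ)..1, κ ^ 2 * q (sidePt i s) := by
        refine Finset.sum_le_sum fun i _ => intervalIntegral.integral_mono_on zero_le_one
          (intervalIntegrable_sidePt (h.continuousOn_diffSq.div_const _) i)
          ((intervalIntegrable_sidePt hqcont i).const_mul _) fun s hs =>
            (key _ (sidePt_mem i hs)).1
    _ = κ ^ 2 * ∑ i, ∫ s in (0:ℝ)..1, q (sidePt i s) := by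
        rw [Finset.mul_sum]
        simp only [intervalIntegral.integral_const_mul]
    _ = κ ^ 2 * (3 * ∫ x in refTri,
          (2 * q x + (x 0 - 1 / 3) * pd 0 q x + (x 1 - 1 / 3) * pd 1 q x)) := by
        rw [sum_sideIntegral_eq hqc]
    _ ≤ κ ^ 2 * (3 * ∫ x in refTri, 4 * (4 * (4 * κ ^ 2 + 1)) * energy L g γ x) := by
        refine mul_le_mul_of_nonneg_left (mul_le_mul_of_nonneg_left ?_ (by norm_num)) (sq_nonneg κ)
        refine setIntegral_mono_on ?_ ?_ isClosed_refTri.measurableSet fun x hx => (key x hx).2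
        · refine integrableOn_refTri ?_
          have hc : ∀ k : Fin 2, ContinuousOn (fun x : E2 => x k - 1 / 3) refTri := fun k => by
            fun_prop
          exact ((continuousOn_const.mul hqcont).add ((hc 0).mul (continuousOn_pd hqc le_rfl 0))).add
            ((hc 1).mul (continuousOn_pd hqc le_rfl 1))
        · exact integrableOn_refTri (continuousOn_const.mul h.continuousOn_energy)
    _ = _ := by rw [integral_const_mul]; ring

end MetricPair

end

section

/-- The constant in `MetricPair.functional_bound`. -/
def functionalConst (κ c CV : ℝ) : ℝ :=
  2 * c + 3 * (c * √(48 * κ ^ 2 * (4 * κ ^ 2 + 1)) * (2 * √CV))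

theorem abs_dapp_le (v : E2 → ℝ) (x : E2) (i : Fin 3) :
    |dapp v x (sideDir i)| ≤ 2 * √(gradSq v x) := by
  have h0 : |pd 0 v x| ≤ √(gradSq v x) := Real.abs_le_sqrt (by
    unfold gradSq; nlinarith [sq_nonneg (pd 1 v x)])
  have h1 : |pd 1 v x| ≤ √(gradSq v x) := Real.abs_le_sqrt (by
    unfold gradSq; nlinarith [sq_nonneg (pd 0 v x)])
  have h2 := abs_le.1 h0
  have h3 := abs_le.1 h1
  have h4 := Real.sqrt_nonneg (gradSq v x)
  rw [dapp, Fin.sum_univ_two, abs_le]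
  fin_cases i <;> simp [sideDir_zero, sideDir_one, sideDir_two] <;> constructor <;> linarith

theorem continuousOn_dapp {n : WithTop ℕ∞} {v : E2 → ℝ} (hv : ContDiffOn ℝ n v refTri)
    (hn : 1 ≤ n) (w : E2) : ContinuousOn (fun x => dapp v x w) refTri := by
  unfold dapp
  exact continuousOn_finsetSum _ fun k _ => (continuousOn_pd hv hn k).mul continuousOn_const

theorem MetricPair.functional_bound {L κ : ℝ} {g γ : E2 → Mat} (h : MetricPair L κ g γ)
    {c CV : ℝ} (hc : 0 ≤ c) (hCV : 0 ≤ CV) {v : E2 → ℝ} (hv : ContDiffOn ℝ 2 v refTri)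
    (hinv : ∀ x ∈ refTri, gradSq v x ≤ CV * ∫ y in refTri, gradSq v y)
    {a : Fin 2 → E2 → ℝ} {b : Fin 3 → E2 → ℝ}
    (ha : ∀ x ∈ refTri, ∀ k, |a k x| ≤ c * (√(covSq g γ x) / L))
    (hb : ∀ x ∈ refTri, ∀ i, |b i x| ≤ c * (√(diffSq g γ x) / L)) :
    |∫ x in refTri, (a 0 x * pd 0 v x + a 1 x * pd 1 v x)| +
      ∑ i, |∫ s in (0:ℝ)..1, b i (sidePt i s) * dapp v (sidePt i s) (sideDir i)| ≤
    functionalConst κ c CV * (√(∫ x in refTri, energy L g γ x) * √(∫ x in refTri, gradSq v x)) := by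
  have hL := h.pos
  set En := ∫ x in refTri, energy L g γ x with hEn
  set Gr := ∫ x in refTri, gradSq v x with hGr
  have cE := h.continuousOn_energy
  have cG : ContinuousOn (gradSq v) refTri := continuousOn_gradSq hv (by norm_num)
  have hpde : ∀ x, ∀ k, |pd k v x| ≤ √(gradSq v x) := fun x k => by
    refine Real.abs_le_sqrt ?_
    unfold gradSq
    fin_cases k
    · simp only [Fin.zero_eta]; nlinarith [sq_nonneg (pd 1 v x)]
    · simp only [Fin.mk_one]; nlinarith [sq_nonneg (pd 0 v x)]
  have e1 : ∀ x, √(covSq g γ x) / L ≤ √(energy L g γ x) := fun x => by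
    refine Real.le_sqrt_of_sq_le ?_
    rw [div_pow, Real.sq_sqrt (covSq_nonneg _ _ _), energy]
    gcongr
    linarith [diffSq_nonneg g γ x]
  have hA : |∫ x in refTri, (a 0 x * pd 0 v x + a 1 x * pd 1 v x)| ≤ 2 * c * (√En * √Gr) := by
    have hp := abs_integral_refTri_le (F := fun x => a 0 x * pd 0 v x + a 1 x * pd 1 v x)
      (p := fun x => (2 * c) ^ 2 * energy L g γ x) (q := gradSq v)
      (continuousOn_const.mul cE) cG (fun x _ => mul_nonneg (sq_nonneg _) (energy_nonneg _ _ _ _))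
      (fun x _ => gradSq_nonneg _ _) fun x hx => ?_
    · rw [integral_const_mul, Real.sqrt_mul (sq_nonneg _), Real.sqrt_sq (by positivity)] at hp
      linarith
    · rw [Real.sqrt_mul (sq_nonneg _), Real.sqrt_sq (by positivity)]
      have t : ∀ k, |a k x * pd k v x| ≤ c * √(energy L g γ x) * √(gradSq v x) := fun k =>
        abs_mul_le_mul ((ha x hx k).trans (mul_le_mul_of_nonneg_left (e1 x) hc)) (hpde x k)
      linarith [abs_add_le (a 0 x * pd 0 v x) (a 1 x * pd 1 v x), t 0, t 1]
  have hB : ∀ i, |∫ s in (0:ℝ)..1, b i (sidePt i s) * dapp v (sidePt i s) (sideDir i)| ≤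
      c * √(48 * κ ^ 2 * (4 * κ ^ 2 + 1)) * (2 * √CV) * (√En * √Gr) := by
    intro i
    have cD : ContinuousOn (fun x => c ^ 2 * (diffSq g γ x / L ^ 2)) refTri :=
      continuousOn_const.mul (h.continuousOn_diffSq.div_const _)
    have hp := abs_integral_side_le
      (F := fun s => b i (sidePt i s) * dapp v (sidePt i s) (sideDir i))
      (p := fun x => c ^ 2 * (diffSq g γ x / L ^ 2)) (q := fun x => 2 ^ 2 * gradSq v x) i
      cD (continuousOn_const.mul cG)
      (fun x _ => mul_nonneg (sq_nonneg _) (div_nonneg (diffSq_nonneg _ _ _) (sq_nonneg _)))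
      (fun x _ => mul_nonneg (sq_nonneg _) (gradSq_nonneg _ _)) fun s hs => ?_
    · refine hp.trans ?_
      have t1 : ∫ s in (0:ℝ)..1, c ^ 2 * (diffSq g γ (sidePt i s) / L ^ 2) ≤
          c ^ 2 * (48 * κ ^ 2 * (4 * κ ^ 2 + 1) * En) := by
        rw [intervalIntegral.integral_const_mul]
        refine mul_le_mul_of_nonneg_left (le_trans ?_ h.sum_side_diffSq_le) (sq_nonneg _)
        exact Finset.single_le_sum
          (f := fun i => ∫ s in (0:ℝ)..1, diffSq g γ (sidePt i s) / L ^ 2)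
          (fun j _ => intervalIntegral.integral_nonneg zero_le_one fun s _ =>
            div_nonneg (diffSq_nonneg _ _ _) (sq_nonneg _)) (Finset.mem_univ i)
      have t2 : ∫ s in (0:ℝ)..1, 2 ^ 2 * gradSq v (sidePt i s) ≤ 2 ^ 2 * (CV * Gr) := by
        rw [intervalIntegral.integral_const_mul]
        refine mul_le_mul_of_nonneg_left ?_ (sq_nonneg _)
        calc ∫ s in (0:ℝ)..1, gradSq v (sidePt i s) ≤ ∫ s in (0:ℝ)..1, CV * Gr :=
              intervalIntegral.integral_mono_on zero_le_one (intervalIntegrable_sidePt cG i)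
                intervalIntegrable_const fun s hs => hinv _ (sidePt_mem i hs)
          _ = CV * Gr := by simp
      have u1 := Real.sqrt_le_sqrt t1
      have u2 := Real.sqrt_le_sqrt t2
      rw [Real.sqrt_mul (sq_nonneg _), Real.sqrt_sq hc, Real.sqrt_mul (by positivity)] at u1
      rw [Real.sqrt_mul (sq_nonneg _), Real.sqrt_sq (by norm_num), Real.sqrt_mul hCV] at u2
      refine (mul_le_mul u1 u2 (Real.sqrt_nonneg _) (by positivity)).trans_eq (by ring)
    · have hx := sidePt_mem i hs
      rw [Real.sqrt_mul (sq_nonneg _), Real.sqrt_sq hc, Real.sqrt_div (diffSq_nonneg _ _ _),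
        Real.sqrt_sq hL.le, Real.sqrt_mul (sq_nonneg _), Real.sqrt_sq (by norm_num)]
      exact abs_mul_le_mul (hb _ hx i) (abs_dapp_le v _ i)
  have hsum := Finset.sum_le_sum fun i (_ : i ∈ Finset.univ) => hB i
  rw [Fin.sum_const] at hsum
  rw [functionalConst]
  simp only [nsmul_eq_mul] at hsum
  push_cast at hsum
  linarith

/-! ### The local bound for `b_h` -/

theorem abs_sum_two_le {f : Fin 2 → ℝ} {m : ℝ} (h : ∀ k, |f k| ≤ m) : |∑ k, f k| ≤ 2 * m := by
  rw [Fin.sum_univ_two]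
  linarith [abs_add_le (f 0) (f 1), h 0, h 1]

namespace MetricPair

variable {L κ : ℝ} {g γ : E2 → Mat} (h : MetricPair L κ g γ)
include h

theorem lincomb {t : ℝ} (ht : t ∈ Set.Icc (0:ℝ) 1) :
    MetricPair L κ g (t • γ + (1 - t) • g) := by
  have hp : ∀ x ∈ refTri, Pinch L κ ((t • γ + (1 - t) • g) x) := fun x hx =>
    (h.pinch₂ x hx).lincomb (h.pinch₁ x hx) ht
  refine ⟨h.pos, h.metric₁, IsMetric.of_pinch h.pos (fun i j => ?_) hp, h.pinch₁, hp⟩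
  exact (contDiffOn_const.mul (h.metric₂.smooth i j)).add
    (contDiffOn_const.mul (h.metric₁.smooth i j))

/-- The difference of the Christoffel symbols is bounded by the covariant derivative. -/
theorem chris_sub_le {x : E2} (hx : x ∈ refTri) {n : ℝ}
    (hn : ∀ k i j, |cov2 g γ x k i j| ≤ n) (l k i : Fin 2) :
    |chris γ l k i x - chris g l k i x| ≤ 3 * (κ / L) * n := by
  rw [chris_sub h.metric₂ h.metric₁ hx l k i, add_sub_cancel_left, abs_mul]
  have t : ∀ m, |(γ x)⁻¹ l m * (cov2 g γ x k m i + cov2 g γ x i m k - cov2 g γ x m k i)| ≤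
      (κ / L) * (3 * n) := fun m => by
    refine abs_mul_le_mul ((h.pinch₂ x hx).inv_entry h.pos l m) ?_
    have h1 := abs_le.1 (hn k m i)
    have h2 := abs_le.1 (hn i m k)
    have h3 := abs_le.1 (hn m k i)
    exact abs_le.2 ⟨by linarith, by linarith⟩
  have := abs_sum_two_le t
  rw [abs_of_pos (by norm_num : (0:ℝ) < 1 / 2)]
  linarith

theorem abs_sub_entry_le {x : E2} (hx : x ∈ refTri) (i j : Fin 2) :
    |γ x i j - g x i j| ≤ 2 * (κ * L) := by
  linarith [abs_sub (γ x i j) (g x i j), (h.pinch₁ x hx).entry h.pos i j,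
    (h.pinch₂ x hx).entry h.pos i j]

theorem cov2_lincomb_sub_le {t : ℝ} (ht : t ∈ Set.Icc (0:ℝ) 1) {x : E2} (hx : x ∈ refTri)
    (k i j : Fin 2) :
    |cov2 (t • γ + (1 - t) • g) (g - γ) x k i j| ≤ (1 + 24 * κ ^ 2) * √(covSq g γ x) := by
  have hL := h.pos
  have hκ := h.one_le_kappa
  set n := √(covSq g γ x)
  have hn0 : 0 ≤ n := Real.sqrt_nonneg _
  have hn : ∀ k i j, |cov2 g γ x k i j| ≤ n := abs_cov_le g γ x
  have hn' : ∀ k i j, |cov2 g (t • γ + (1 - t) • g) x k i j| ≤ n := fun k i j => by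
    rw [cov2_lincomb g h.metric₂.smooth h.metric₁.smooth t (1 - t) hx, h.metric₁.cov2_self hx,
      mul_zero, add_zero, abs_mul, abs_of_nonneg ht.1]
    exact (mul_le_of_le_one_left (abs_nonneg _) ht.2).trans (hn k i j)
  set G := t • γ + (1 - t) • g with hG
  have hD := (h.lincomb ht).chris_sub_le hx hn'
  have hs := fun i j => h.abs_sub_entry_le hx i j
  have e : cov2 G (g - γ) x k i j = - cov2 g γ x k i j +
      ((∑ l, (chris G l k i x - chris g l k i x) * (γ x l j - g x l j)) +
        ∑ l, (chris G l k j x - chris g l k j x) * (γ x i l - g x i l)) := by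
    have e1 : cov2 g (g - γ) x k i j = - cov2 g γ x k i j := by
      have := cov2_lincomb g h.metric₁.smooth h.metric₂.smooth 1 (-1) hx k i j
      rw [h.metric₁.cov2_self hx] at this
      simpa [sub_eq_add_neg] using this
    rw [← e1]
    simp only [cov2, Fin.sum_univ_two, Pi.sub_apply, Matrix.sub_apply]
    ring
  have b1 := abs_sum_two_le fun l => abs_mul_le_mul (hD l k i) (hs l j)
  have b2 := abs_sum_two_le fun l => abs_mul_le_mul (hD l k j) (hs i l)
  have e2 : 3 * (κ / L) * n * (2 * (κ * L)) = 6 * κ ^ 2 * n := by field_simp; ring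
  rw [e2] at b1 b2
  rw [e]
  have b3 := abs_add_le (- cov2 g γ x k i j)
    ((∑ l, (chris G l k i x - chris g l k i x) * (γ x l j - g x l j)) +
        ∑ l, (chris G l k j x - chris g l k j x) * (γ x i l - g x i l))
  have b4 := abs_add_le (∑ l, (chris G l k i x - chris g l k i x) * (γ x l j - g x l j))
    (∑ l, (chris G l k j x - chris g l k j x) * (γ x i l - g x i l))
  rw [abs_neg] at b3
  linarith [hn k i j]

theorem tangDensity_le {t : ℝ} (ht : t ∈ Set.Icc (0:ℝ) 1) {x : E2} (hx : x ∈ refTri) (i : Fin 3) :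
    |tangDensity (t • γ + (1 - t) • g) (g - γ) (sideDir i) x| ≤
      8 * κ * (√(diffSq g γ x) / L) := by
  have hL := h.pos
  have hκ := h.one_le_kappa
  have hp := (h.lincomb ht).pinch₂ x hx
  have hm := (h.lincomb ht).metric₂
  set G := t • γ + (1 - t) • g
  set s := √(diffSq g γ x)
  have hs : ∀ a b, |(g - γ) x a b| ≤ s := fun a b => by
    rw [Pi.sub_apply, Matrix.sub_apply, abs_sub_comm]; exact abs_diff_le g γ x a b
  have hd : ∀ k : Fin 2, |sideDir i k| ≤ 1 := fun k => by
    fin_cases i <;> fin_cases k <;> simp [sideDir_zero, sideDir_one, sideDir_two]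
  have hnn : (1:ℝ) ≤ sideDir i 0 ^ 2 + sideDir i 1 ^ 2 := by
    fin_cases i <;> simp [sideDir_zero, sideDir_one, sideDir_two]
  have s0 : 0 ≤ s := Real.sqrt_nonneg _
  have two : ∀ (A B m : ℝ), |A| ≤ m → |B| ≤ m →
      |A * sideDir i 0 + B * sideDir i 1| ≤ 2 * m := fun A B m hA hB => by
    have := abs_mul_le_mul hA (hd 0)
    have := abs_mul_le_mul hB (hd 1)
    linarith [abs_add_le (A * sideDir i 0) (B * sideDir i 1)]
  have hden : L * L ≤ dvol G x * pair (G x) (sideDir i) (sideDir i) := by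
    refine mul_le_mul (hp.dvol_bounds hL).1 ?_ hL.le (hm.dvol_pos hx).le
    rw [hm.pair_self_eq hx]
    exact le_trans (by nlinarith) (hp.lower _ _)
  have hLL : 0 < L * L := by positivity
  rw [tangDensity, abs_div, abs_of_pos (hLL.trans_le hden), div_le_iff₀ (hLL.trans_le hden)]
  have n1 := abs_mul_le_mul (two _ _ _ (hp.entry hL 0 0) (hp.entry hL 0 1))
    (two _ _ _ (hs 0 1) (hs 1 1))
  have n2 := abs_mul_le_mul (two _ _ _ (hs 0 0) (hs 0 1))
    (two _ _ _ (hp.entry hL 0 1) (hp.entry hL 1 1))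
  refine (abs_sub _ _).trans ((add_le_add n1 n2).trans ?_)
  calc 2 * (κ * L) * (2 * s) + 2 * s * (2 * (κ * L)) = 8 * κ * (s / L) * (L * L) := by
        field_simp; ring
    _ ≤ _ := by gcongr

theorem local_bh_le {CV : ℝ} (hCV : 0 ≤ CV) {v : E2 → ℝ} (hv : ContDiffOn ℝ 2 v refTri)
    (hinv : ∀ x ∈ refTri, gradSq v x ≤ CV * ∫ y in refTri, gradSq v y)
    {t : ℝ} (ht : t ∈ Set.Icc (0:ℝ) 1) :
    |triInt (t • γ + (1 - t) • g) (fun x => inner2 ((t • γ + (1 - t) • g) x)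
        (SS (t • γ + (1 - t) • g) (g - γ) x) (hess (t • γ + (1 - t) • g) v x)) -
      ∑ i, sideInt (t • γ + (1 - t) • g) i (fun x =>
        pair (SS (t • γ + (1 - t) • g) (g - γ) x) (nrm (t • γ + (1 - t) • g) i x)
          (nrm (t • γ + (1 - t) • g) i x) * dapp v x (nrm (t • γ + (1 - t) • g) i x))| ≤
    functionalConst κ (2 + 48 * κ ^ 2 + 8 * κ) CV *
      (√(∫ x in refTri, energy L g γ x) * √(∫ x in refTri, gradSq v x)) := by
  have hL := h.pos
  have hκ := h.one_le_kappa
  have hm := (h.lincomb ht).metric₂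
  rw [local_bh_eq hm (h.metric₁.isSymField.sub h.metric₂.isSymField) hv]
  have hcov := fun x (hx : x ∈ refTri) => h.cov2_lincomb_sub_le ht hx
  have htan := fun x (hx : x ∈ refTri) => h.tangDensity_le ht hx
  have hpin := fun x (hx : x ∈ refTri) => ((h.lincomb ht).pinch₂ x hx).dvol_bounds hL
  set G := t • γ + (1 - t) • g
  have hdiv : ∀ x ∈ refTri, ∀ A B : ℝ, |A| ≤ (1 + 24 * κ ^ 2) * √(covSq g γ x) →
      |B| ≤ (1 + 24 * κ ^ 2) * √(covSq g γ x) →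
      |(A - B) / dvol G x| ≤ (2 + 48 * κ ^ 2 + 8 * κ) * (√(covSq g γ x) / L) := by
    intro x hx A B hA hB
    have hP := hm.dvol_pos hx
    rw [abs_div, abs_of_pos hP, div_le_iff₀ hP]
    have s0 := Real.sqrt_nonneg (covSq g γ x)
    calc |A - B| ≤ (2 + 48 * κ ^ 2) * √(covSq g γ x) := by linarith [abs_sub A B]
      _ ≤ (2 + 48 * κ ^ 2 + 8 * κ) * √(covSq g γ x) :=
          mul_le_mul_of_nonneg_right (by linarith) s0
      _ = (2 + 48 * κ ^ 2 + 8 * κ) * (√(covSq g γ x) / L) * L := by field_simp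
      _ ≤ _ := by gcongr; exact (hpin x hx).1
  have key := h.functional_bound (c := 2 + 48 * κ ^ 2 + 8 * κ) (by positivity) hCV hv hinv
    (a := ![fun x => (cov2 G (g - γ) x 0 1 1 - cov2 G (g - γ) x 1 0 1) / dvol G x,
      fun x => (cov2 G (g - γ) x 1 0 0 - cov2 G (g - γ) x 0 0 1) / dvol G x])
    (b := fun i => tangDensity G (g - γ) (sideDir i)) (fun x hx k => by
      fin_cases k
      · exact hdiv x hx _ _ (hcov x hx _ _ _) (hcov x hx _ _ _)
      · exact hdiv x hx _ _ (hcov x hx _ _ _) (hcov x hx _ _ _))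
    (fun x hx i => (htan x hx i).trans (by gcongr; nlinarith [sq_nonneg κ]))
  refine le_trans ((abs_sub _ _).trans ?_) key
  refine add_le_add (le_of_eq ?_) (Finset.abs_sum_le_sum_abs _ _)
  congr 2
  ext x
  simp only [divDensity, Matrix.cons_val_zero, Matrix.cons_val_one]
  ring

end MetricPair

end

section

/-! ### The connection form of the Gram-Schmidt frame -/

theorem pd_comm {φ : E2 → ℝ} (h : ContDiffOn ℝ 2 φ refTri) {x : E2} (hx : x ∈ refTri) :
    pd 0 (pd 1 φ) x = pd 1 (pd 0 φ) x := by
  have hs := (h x hx).isSymmSndFDerivWithinAt (by simp) uniqueDiffOn_refTri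
    (refTri_subset_closure_interior hx) hx
  have hd : DifferentiableWithinAt ℝ (fderivWithin ℝ φ refTri) refTri x :=
    (h.fderivWithin uniqueDiffOn_refTri (m := 1) (by norm_num)).differentiableOn one_ne_zero x hx
  have e : ∀ j k, pd j (pd k φ) x = fderivWithin ℝ (fderivWithin ℝ φ refTri) refTri x
      (EuclideanSpace.single j 1) (EuclideanSpace.single k 1) := by
    intro j k
    have := (hd.hasFDerivWithinAt.clm_apply (hasFDerivWithinAt_const
      (EuclideanSpace.single k (1:ℝ) : E2) x refTri)).fderivWithin (uniqueDiffOn_refTri x hx)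
    have h2 : pd j (pd k φ) x = fderivWithin ℝ (fun y => fderivWithin ℝ φ refTri y
      (EuclideanSpace.single k 1)) refTri x (EuclideanSpace.single j 1) := rfl
    rw [h2, this]
    simp
  rw [e, e]
  exact hs _ _

/-- The connection form `⟨∇E₁,E₂⟩` of the frame obtained from the coordinate frame by the
Gram-Schmidt procedure. -/
def omega (G : E2 → Mat) (k : Fin 2) (x : E2) : ℝ := dvol G x / G x 0 0 * chris G 1 k 0 x

theorem contDiffOn_omega {G : E2 → Mat} (hG : IsMetric G) (k : Fin 2) :
    ContDiffOn ℝ ∞ (omega G k) refTri :=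
  (hG.contDiffOn_dvol.div (hG.smooth 0 0) fun _ hx => (hG.diag_pos hx 0).ne').mul
    (hG.contDiffOn_chris 1 k 0)

theorem pd_omega {G : E2 → Mat} (hG : IsMetric G) {x : E2} (hx : x ∈ refTri) :
    pd 0 (omega G 1) x - pd 1 (omega G 0) x = - (gaussK G x * dvol G x) := by
  have hE := (hG.diag_pos hx 0).ne'
  have hP := (hG.dvol_pos hx).ne'
  have hc : ∀ l i j, HasPd (chris G l i j) (fun k => pd k (chris G l i j) x) x := fun l i j =>
    HasPd.of_contDiffOn (hG.contDiffOn_chris l i j) (by simp) hx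
  have hen := fun i j => hG.hasPd_entry hx i j
  have o := fun k j => ((((hG.hasPd_dvol hx).div (hen 0 0) hE).mul (hc 1 k 0))).pd_eq hx j
  have o1 := o 1 0
  have o0 := o 0 1
  have sym : ∀ l k, pd k (chris G l 1 0) x = pd k (chris G l 0 1) x := fun l k =>
    pd_congr (fun y hy => hG.chris_symm hy l 1 0) hx k
  have form : ∀ a i j b, pd b (pd a (fun y => G y i j)) x =
      pd b (fun y => (chris G 0 a i y * G y 0 j + chris G 1 a i y * G y 1 j) +
        (chris G 0 a j y * G y i 0 + chris G 1 a j y * G y i 1)) x := fun a i j b =>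
    pd_congr (fun y hy => hG.pd_entry hy a i j) hx b
  have form2 : ∀ a i j b, pd b (pd a (fun y => G y i j)) x = _ := fun a i j b =>
    (form a i j b).trans (((((hc 0 a i).mul (hen 0 j)).add ((hc 1 a i).mul (hen 1 j))).add
      (((hc 0 a j).mul (hen i 0)).add ((hc 1 a j).mul (hen i 1)))).pd_eq hx b)
  have comm : ∀ i j, pd 0 (pd 1 (fun y => G y i j)) x = pd 1 (pd 0 (fun y => G y i j)) x :=
    fun i j => pd_comm ((hG.smooth i j).of_le (by norm_cast)) hx
  have r1 := comm 0 0
  have r2 := comm 0 1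
  rw [form2, form2] at r1 r2
  have e0 : pd 0 (omega G 1) x = _ := o1
  have e1 : pd 1 (omega G 0) x = _ := o0
  rw [e0, e1, gaussK, hG.det_eq hx, ← hG.dvol_sq hx]
  simp only [riem, Fin.sum_univ_two, sym, hG.chris_symm hx _ 1 0, hG.symm hx] at r1 r2 ⊢
  have hP2 := hG.dvol_sq hx
  generalize dvol G x = P at *
  generalize G x 0 0 = E at *
  generalize G x 0 1 = F at *
  generalize G x 1 1 = H at *
  field_simp
  rw [hP2]
  linear_combination E ^ 2 * r2 - E * F / 2 * r1

/-! ### The angles -/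

/-- The angle from the first coordinate direction to the direction `(-c, 1)`. -/
def beta (c : ℝ) (G : E2 → Mat) (x : E2) : ℝ :=
  Real.pi / 2 - Real.arctan ((G x 0 1 - c * G x 0 0) / dvol G x)

theorem contDiffOn_beta {G : E2 → Mat} (hG : IsMetric G) (c : ℝ) :
    ContDiffOn ℝ ∞ (beta c G) refTri :=
  contDiffOn_const.sub (((((hG.smooth 0 1).sub (contDiffOn_const.mul (hG.smooth 0 0))).div
    hG.contDiffOn_dvol fun _ hx => (hG.dvol_pos hx).ne')).arctan)

theorem pd_beta {G : E2 → Mat} (hG : IsMetric G) (c : ℝ) {x : E2} (hx : x ∈ refTri) (k : Fin 2) :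
    pd k (beta c G) x = dvol G x * (- c * (chris G 1 k 1 x - c * chris G 1 k 0 x) -
        (chris G 0 k 1 x - c * chris G 0 k 0 x)) /
          (G x 1 1 - 2 * c * G x 0 1 + c ^ 2 * G x 0 0) - omega G k x := by
  have hE := (hG.diag_pos hx 0).ne'
  have hP := (hG.dvol_pos hx).ne'
  have hP2 := hG.dvol_sq hx
  have hen := fun i j => hG.hasPd_entry hx i j
  have h1 : pd k (beta c G) x = _ := ((HasPd.const (Real.pi / 2)).sub
    (((hen 0 1).sub ((HasPd.const c).mul (hen 0 0))).div (hG.hasPd_dvol hx) hP).arctan).pd_eq hx k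
  rw [h1]
  simp only [hG.symm hx, omega]
  generalize dvol G x = P at *
  generalize G x 0 0 = E at *
  generalize G x 0 1 = F at *
  generalize G x 1 1 = H at *
  obtain rfl : H = (P ^ 2 + F ^ 2) / E := by field_simp; linarith
  have e1 : (P ^ 2 + F ^ 2) / E - 2 * c * F + c ^ 2 * E = (P ^ 2 + (F - c * E) ^ 2) / E := by
    field_simp; ring
  have e2 : 1 + ((F - c * E) / P) ^ 2 = (P ^ 2 + (F - c * E) ^ 2) / P ^ 2 := by field_simp
  rw [e1, e2]
  have hQ : P ^ 2 + (F - c * E) ^ 2 ≠ 0 := by positivity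
  generalize hQe : P ^ 2 + (F - c * E) ^ 2 = Q at *
  field_simp
  rw [← hQe]
  ring

theorem geoK_mul_len {G : E2 → Mat} (hG : IsMetric G) {x : E2} (hx : x ∈ refTri) (i : Fin 3) :
    geoK G i x * len (G x) (sideDir i) = dvol G x *
      (sideDir i 0 * accel G i x 1 - sideDir i 1 * accel G i x 0) /
        pair (G x) (sideDir i) (sideDir i) := by
  obtain ⟨n0, n1⟩ := hG.nrm_eq hx i
  have hP := (hG.dvol_pos hx).ne'
  have hl := (hG.len_pos hx (sideDir_ne_zero i)).ne'
  have hl2 := hG.len_sq hx (sideDir_ne_zero i)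
  have hl0 := (hG.pair_pos hx (sideDir_ne_zero i)).ne'
  rw [geoK, pair]
  simp only [Fin.sum_univ_two, n0, n1, hG.symm hx]
  have hP2 := hG.dvol_sq hx
  field_simp
  rw [hP2]
  ring

theorem geoK_eq {G : E2 → Mat} (hG : IsMetric G) {x : E2} (hx : x ∈ refTri) :
    geoK G 0 x * len (G x) (sideDir 0) =
        omega G 0 x * sideDir 0 0 + omega G 1 x * sideDir 0 1 ∧
    geoK G 1 x * len (G x) (sideDir 1) =
        omega G 0 x * sideDir 1 0 + omega G 1 x * sideDir 1 1 + dapp (beta 1 G) x (sideDir 1) ∧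
    geoK G 2 x * len (G x) (sideDir 2) =
        omega G 0 x * sideDir 2 0 + omega G 1 x * sideDir 2 1 + dapp (beta 0 G) x (sideDir 2) := by
  have hE := (hG.diag_pos hx 0).ne'
  refine ⟨?_, ?_, ?_⟩
  · rw [geoK_mul_len hG hx, hG.pair_self_eq hx]
    simp [accel, sideDir_zero, omega]
    ring
  · rw [geoK_mul_len hG hx, hG.pair_self_eq hx, dapp, Fin.sum_univ_two, pd_beta hG 1 hx,
      pd_beta hG 1 hx]
    simp only [accel, sideDir_one, Fin.sum_univ_two, pt_zero, pt_one, hG.chris_symm hx _ 1 0]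
    ring_nf
  · rw [geoK_mul_len hG hx, hG.pair_self_eq hx, dapp, Fin.sum_univ_two, pd_beta hG 0 hx,
      pd_beta hG 0 hx]
    simp only [accel, sideDir_two, Fin.sum_univ_two, pt_zero, pt_one, hG.chris_symm hx _ 1 0]
    ring_nf

theorem arccos_eq_sub_arctan {u p a b : ℝ} (hp : 0 < p) (ha : 0 < a) (h : a * b = u ^ 2 + p ^ 2) :
    Real.arccos (u / (√a * √b)) = Real.pi / 2 - Real.arctan (u / p) := by
  have e : u / (√a * √b) = u / p / √(1 + (u / p) ^ 2) := by
    have h1 : 1 + (u / p) ^ 2 = (u ^ 2 + p ^ 2) / p ^ 2 := by field_simp; ring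
    rw [← Real.sqrt_mul ha.le, h, h1, Real.sqrt_div (by positivity), Real.sqrt_sq hp.le]
    have : √(u ^ 2 + p ^ 2) ≠ 0 := (Real.sqrt_pos.2 (by positivity)).ne'
    field_simp
  rw [Real.arccos, Real.arctan_eq_arcsin, e]

theorem arctan_add_add_eq {x y z : ℝ} (hxy : 0 < x + y) (h : x * y + y * z + z * x = 1) :
    Real.arctan x + Real.arctan y + Real.arctan z = Real.pi / 2 := by
  have hz : 1 - x * y = z * (x + y) := by linarith
  rcases lt_trichotomy z 0 with h0 | h0 | h0
  · have h1 : 1 < x * y := by nlinarith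
    have hx : 0 < x := by
      by_contra hx
      push Not at hx
      nlinarith
    have e := Real.arctan_add_eq_add_pi h1 hx
    have e2 : (x + y) / (1 - x * y) = z⁻¹ := by
      rw [hz]; field_simp
    rw [e, e2, Real.arctan_inv_of_neg h0]; ring
  · subst h0
    have hx : 0 < x := by
      by_contra hx
      push Not at hx
      nlinarith
    have : y = x⁻¹ := by field_simp; linarith
    rw [this, Real.arctan_inv_of_pos hx]; simp
  · have h1 : x * y < 1 := by nlinarith
    have e2 : (x + y) / (1 - x * y) = z⁻¹ := by
      rw [hz]; field_simp
    rw [Real.arctan_add h1, e2, Real.arctan_inv_of_pos h0]; ring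

theorem angle_eq {G : E2 → Mat} (hG : IsMetric G) :
    angle G 0 = beta 0 G (vtx 0) ∧ angle G 1 = Real.pi - beta 1 G (vtx 1) ∧
      angle G 2 = beta 1 G (vtx 2) - beta 0 G (vtx 2) := by
  have v0 : vtx (0 + 1) - vtx 0 = pt 1 0 := by ext j; fin_cases j <;> simp [vtx, pt]
  have v1 : vtx (0 + 2) - vtx 0 = pt 0 1 := by ext j; fin_cases j <;> simp [vtx, pt]
  have v2 : vtx (1 + 1) - vtx 1 = pt (-1) 1 := by ext j; fin_cases j <;> simp [vtx, pt]
  have v3 : vtx (1 + 2) - vtx 1 = pt (-1) 0 := by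
    rw [show (1 + 2 : Fin 3) = 0 from rfl]; ext j; fin_cases j <;> simp [vtx, pt]
  have v4 : vtx (2 + 1) - vtx 2 = pt 0 (-1) := by
    rw [show (2 + 1 : Fin 3) = 0 from rfl]; ext j; fin_cases j <;> simp [vtx, pt]
  have v5 : vtx (2 + 2) - vtx 2 = pt 1 (-1) := by
    rw [show (2 + 2 : Fin 3) = 1 from rfl]; ext j; fin_cases j <;> simp [vtx, pt]
  have ne : ∀ a b : ℝ, (a ≠ 0 ∨ b ≠ 0) → pt a b ≠ 0 := by
    rintro a b h h0
    have h1 := congrArg (fun w : E2 => w 0) h0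
    have h2 := congrArg (fun w : E2 => w 1) h0
    simp at h1 h2
    rcases h with h | h
    · exact h h1
    · exact h h2
  refine ⟨?_, ?_, ?_⟩
  · have hx := vtx_mem 0
    rw [angle, v0, v1, beta, len, len, arccos_eq_sub_arctan (hG.dvol_pos hx)
      (hG.pair_pos hx (ne 1 0 (by simp)))]
    · simp [pair]
    · rw [hG.dvol_sq hx]
      simp [pair, hG.symm hx]
  · have hx := vtx_mem 1
    rw [angle, v2, v3, beta, len, len, arccos_eq_sub_arctan (hG.dvol_pos hx)
      (hG.pair_pos hx (ne (-1) 1 (by simp)))]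
    · have : pair (G (vtx 1)) (pt (-1) 1) (pt (-1) 0) / dvol G (vtx 1) =
          - ((G (vtx 1) 0 1 - 1 * G (vtx 1) 0 0) / dvol G (vtx 1)) := by
        simp [pair, hG.symm hx]; ring
      rw [this, Real.arctan_neg]; ring
    · rw [hG.dvol_sq hx]
      simp [pair, hG.symm hx]; ring
  · have hx := vtx_mem 2
    have hP := hG.dvol_pos hx
    have hP2 := hG.dvol_sq hx
    have hE := hG.diag_pos hx 0
    rw [angle, v4, v5, beta, beta, len, len, arccos_eq_sub_arctan hP
      (hG.pair_pos hx (ne 0 (-1) (by simp)))]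
    · have := arctan_add_add_eq (x := (G (vtx 2) 0 1) / dvol G (vtx 2))
        (y := - ((G (vtx 2) 0 1 - 1 * G (vtx 2) 0 0) / dvol G (vtx 2)))
        (z := pair (G (vtx 2)) (pt 0 (-1)) (pt 1 (-1)) / dvol G (vtx 2)) (by
          have : G (vtx 2) 0 1 / dvol G (vtx 2) +
            - ((G (vtx 2) 0 1 - 1 * G (vtx 2) 0 0) / dvol G (vtx 2)) =
              G (vtx 2) 0 0 / dvol G (vtx 2) := by ring
          rw [this]; positivity) (by
          simp [pair, hG.symm hx]
          field_simp
          rw [hP2]; ring)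
      rw [Real.arctan_neg] at this
      simp only [zero_mul, sub_zero]
      linarith
    · rw [hG.dvol_sq hx]
      simp [pair, hG.symm hx]; ring

end

section

/-! ### The local curvature functional -/

/-- The contribution of a triangle to the distributional curvature, tested with `v`. -/
def curvFun (G : E2 → Mat) (v : E2 → ℝ) : ℝ :=
  triInt G (fun x => v x * gaussK G x) + ∑ i, sideInt G i (fun x => v x * geoK G i x) -
    ∑ i, v (vtx i) * angle G i

theorem pd_mul {φ ψ : E2 → ℝ} (hφ : ContDiffOn ℝ 1 φ refTri) (hψ : ContDiffOn ℝ 1 ψ refTri)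
    {x : E2} (hx : x ∈ refTri) (k : Fin 2) :
    pd k (fun y => φ y * ψ y) x = pd k φ x * ψ x + φ x * pd k ψ x :=
  ((HasPd.of_contDiffOn hφ one_ne_zero hx).mul (HasPd.of_contDiffOn hψ one_ne_zero hx)).pd_eq hx k

theorem integral_side_by_parts {φ ψ : E2 → ℝ} (hφ : ContDiffOn ℝ 1 φ refTri)
    (hψ : ContDiffOn ℝ 1 ψ refTri) (i : Fin 3) :
    ∫ s in (0:ℝ)..1, φ (sidePt i s) * dapp ψ (sidePt i s) (sideDir i) =
      φ (vtx (i + 1)) * ψ (vtx (i + 1)) - φ (vtx i) * ψ (vtx i) -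
        ∫ s in (0:ℝ)..1, ψ (sidePt i s) * dapp φ (sidePt i s) (sideDir i) := by
  have c : ∀ {φ ψ : E2 → ℝ}, ContDiffOn ℝ 1 φ refTri → ContDiffOn ℝ 1 ψ refTri →
      ContinuousOn (fun x => φ x * dapp ψ x (sideDir i)) refTri := fun h h' =>
    h.continuousOn.mul (continuousOn_dapp h' le_rfl _)
  rw [← integral_dapp_sidePt (hφ.mul hψ) i, eq_sub_iff_add_eq,
    ← intervalIntegral.integral_add (intervalIntegrable_sidePt (c hφ hψ) i)
      (intervalIntegrable_sidePt (c hψ hφ) i)]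
  refine intervalIntegral.integral_congr fun s hs => ?_
  rw [Set.uIcc_of_le zero_le_one] at hs
  have hx := sidePt_mem i hs
  simp only [dapp, Fin.sum_univ_two, pd_mul hφ hψ hx]
  ring

/-- Integration by parts of `v (∂₀ω₁ - ∂₁ω₀)`. -/
theorem integral_mul_curl {v ω₀ ω₁ : E2 → ℝ} (hv : ContDiffOn ℝ 1 v refTri)
    (h₀ : ContDiffOn ℝ 1 ω₀ refTri) (h₁ : ContDiffOn ℝ 1 ω₁ refTri) :
    ∫ x in refTri, v x * (pd 0 ω₁ x - pd 1 ω₀ x) =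
      (∑ i, ∫ s in (0:ℝ)..1, v (sidePt i s) *
        (ω₀ (sidePt i s) * sideDir i 0 + ω₁ (sidePt i s) * sideDir i 1)) -
      ∫ x in refTri, (pd 0 v x * ω₁ x - pd 1 v x * ω₀ x) := by
  have h := integral_div_refTri (hv.mul h₁) (hv.mul h₀).neg
  have e : (∑ i, ∫ s in (0:ℝ)..1, v (sidePt i s) *
        (ω₀ (sidePt i s) * sideDir i 0 + ω₁ (sidePt i s) * sideDir i 1)) =
      ∑ i, ∫ s in (0:ℝ)..1, ((fun x => v x * ω₁ x) (sidePt i s) * sideDir i 1 -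
        (fun x => - (v x * ω₀ x)) (sidePt i s) * sideDir i 0) := by
    refine Finset.sum_congr rfl fun i _ => intervalIntegral.integral_congr fun s _ => ?_
    simp only; ring
  rw [e, ← h, eq_sub_iff_add_eq, ← integral_add]
  · refine setIntegral_congr_fun isClosed_refTri.measurableSet fun x hx => ?_
    have : pd 1 (fun y => - (v y * ω₀ y)) x = - (pd 1 v x * ω₀ x + v x * pd 1 ω₀ x) := by
      rw [← pd_mul hv h₀ hx]
      exact (HasPd.of_contDiffOn (hv.mul h₀) one_ne_zero hx).neg.pd_eq hx 1
    simp only [pd_mul hv h₁ hx, this]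
    ring
  · exact integrableOn_refTri (hv.continuousOn.mul ((continuousOn_pd h₁ le_rfl 0).sub
      (continuousOn_pd h₀ le_rfl 1)))
  · exact integrableOn_refTri (((continuousOn_pd hv le_rfl 0).mul h₁.continuousOn).sub
      ((continuousOn_pd hv le_rfl 1).mul h₀.continuousOn))

theorem one_le_smooth : (1 : WithTop ℕ∞) ≤ (∞ : WithTop ℕ∞) := by norm_cast

theorem curvFun_eq {G : E2 → Mat} (hG : IsMetric G) {v : E2 → ℝ} (hv : ContDiffOn ℝ 1 v refTri) :
    curvFun G v = - (Real.pi * v (vtx 1)) +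
      (∫ x in refTri, (pd 0 v x * omega G 1 x - pd 1 v x * omega G 0 x)) -
      (∫ s in (0:ℝ)..1, beta 1 G (sidePt 1 s) * dapp v (sidePt 1 s) (sideDir 1)) -
      (∫ s in (0:ℝ)..1, beta 0 G (sidePt 2 s) * dapp v (sidePt 2 s) (sideDir 2)) := by
  have ho := fun k => (contDiffOn_omega hG k).of_le one_le_smooth
  have hb := fun c => (contDiffOn_beta hG c).of_le one_le_smooth
  have e1 : triInt G (fun x => v x * gaussK G x) =
      - ∫ x in refTri, v x * (pd 0 (omega G 1) x - pd 1 (omega G 0) x) := by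
    rw [← integral_neg, triInt]
    refine setIntegral_congr_fun isClosed_refTri.measurableSet fun x hx => ?_
    simp only [pd_omega hG hx]; ring
  have s : ∀ i, sideInt G i (fun x => v x * geoK G i x) =
      ∫ s in (0:ℝ)..1, v (sidePt i s) * (geoK G i (sidePt i s) * len (G (sidePt i s)) (sideDir i)) :=
    fun i => intervalIntegral.integral_congr fun s _ => by simp only; ring
  have cw : ∀ i : Fin 3, ContinuousOn (fun x => v x * (omega G 0 x * sideDir i 0 +
      omega G 1 x * sideDir i 1)) refTri := fun i => hv.continuousOn.mul
    (((ho 0).continuousOn.mul continuousOn_const).add ((ho 1).continuousOn.mul continuousOn_const))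
  have cb : ∀ (i : Fin 3) (c : ℝ), ContinuousOn (fun x => v x * dapp (beta c G) x (sideDir i))
      refTri := fun i c => hv.continuousOn.mul (continuousOn_dapp (hb c) le_rfl _)
  have aux : ∀ (i : Fin 3) (c : ℝ), (∀ x ∈ refTri, geoK G i x * len (G x) (sideDir i) =
      omega G 0 x * sideDir i 0 + omega G 1 x * sideDir i 1 + dapp (beta c G) x (sideDir i)) →
      sideInt G i (fun x => v x * geoK G i x) = (∫ s in (0:ℝ)..1, v (sidePt i s) *
        (omega G 0 (sidePt i s) * sideDir i 0 + omega G 1 (sidePt i s) * sideDir i 1)) +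
      ∫ s in (0:ℝ)..1, v (sidePt i s) * dapp (beta c G) (sidePt i s) (sideDir i) := by
    intro i c hi
    rw [s, ← intervalIntegral.integral_add (intervalIntegrable_sidePt (cw i) i)
      (intervalIntegrable_sidePt (cb i c) i)]
    refine intervalIntegral.integral_congr fun s hs => ?_
    rw [Set.uIcc_of_le zero_le_one] at hs
    simp only [hi _ (sidePt_mem i hs)]; ring
  have s0 : sideInt G 0 (fun x => v x * geoK G 0 x) = (∫ s in (0:ℝ)..1, v (sidePt 0 s) *
        (omega G 0 (sidePt 0 s) * sideDir 0 0 + omega G 1 (sidePt 0 s) * sideDir 0 1)) := by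
    rw [s]
    refine intervalIntegral.integral_congr fun s hs => ?_
    rw [Set.uIcc_of_le zero_le_one] at hs
    simp only [(geoK_eq hG (sidePt_mem 0 hs)).1]
  have s1 := aux 1 1 fun x hx => (geoK_eq hG hx).2.1
  have s2 := aux 2 0 fun x hx => (geoK_eq hG hx).2.2
  rw [integral_side_by_parts hv (hb _)] at s1 s2
  obtain ⟨a0, a1, a2⟩ := angle_eq hG
  rw [curvFun, e1, integral_mul_curl hv (ho 0) (ho 1)]
  simp only [Fin.sum_univ_three, s0, s1, s2, a0, a1, a2]
  rw [show (1 + 1 : Fin 3) = 2 from rfl, show (2 + 1 : Fin 3) = 0 from rfl]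
  ring

/-! ### Comparison of two metrics -/

/-- The angle between the Gram-Schmidt frames of two metrics. -/
def rho (g γ : E2 → Mat) (x : E2) : ℝ :=
  Real.arctan ((g x 0 0 * γ x 0 1 - g x 0 1 * γ x 0 0) /
    (dvol γ x * g x 0 0 + dvol g x * γ x 0 0))

theorem contDiffOn_rho {g γ : E2 → Mat} (hg : IsMetric g) (hγ : IsMetric γ) :
    ContDiffOn ℝ ∞ (rho g γ) refTri := by
  refine ContDiffOn.arctan (ContDiffOn.div (((hg.smooth 0 0).mul (hγ.smooth 0 1)).sub
    ((hg.smooth 0 1).mul (hγ.smooth 0 0))) ((hγ.contDiffOn_dvol.mul (hg.smooth 0 0)).add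
      (hg.contDiffOn_dvol.mul (hγ.smooth 0 0))) fun x hx => ?_)
  have h1 := hg.diag_pos hx 0
  have h2 := hγ.diag_pos hx 0
  have h3 := hg.dvol_pos hx
  have h4 := hγ.dvol_pos hx
  positivity

theorem rho_identity {E F H P E' F' H' P' a b c d N₀ N₁ S : ℝ} (hE : 0 < E) (hE' : 0 < E')
    (hP : 0 < P) (hP' : 0 < P') (h : P ^ 2 = E * H - F ^ 2) (h' : P' ^ 2 = E' * H' - F' ^ 2) :
    let u := E * F' - F * E'
    let w := P' * E + P * E'
    (w * (2 * (a * E + b * F) * F' + E * (N₁ + a * F' + b * H' + c * E' + d * F') -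
        (a * F + b * H + c * E + d * F) * E' - F * (N₀ + 2 * (a * E' + b * F'))) -
      u * ((S + (a + d) * P') * E + P' * (2 * (a * E + b * F)) + (a + d) * P * E' +
        P * (N₀ + 2 * (a * E' + b * F')))) / (u ^ 2 + w ^ 2) =
      P' / E' * b - P / E * b + (w * (E * N₁ - F * N₀) - u * (S * E + P * N₀)) / (u ^ 2 + w ^ 2) := by
  intro u w
  have hw : 0 < w := by positivity
  have hQ : u ^ 2 + w ^ 2 ≠ 0 := by positivity
  obtain rfl : H = (P ^ 2 + F ^ 2) / E := by field_simp; linarith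
  obtain rfl : H' = (P' ^ 2 + F' ^ 2) / E' := by field_simp; linarith
  have key : ∀ A B, A = (P' / E' * b - P / E * b) * (u ^ 2 + w ^ 2) + B →
      A / (u ^ 2 + w ^ 2) = P' / E' * b - P / E * b + B / (u ^ 2 + w ^ 2) := by
    intro A B hAB
    rw [hAB, add_div, mul_div_cancel_right₀ _ hQ]
  apply key
  simp only [u, w]
  field_simp
  ring

end

section

theorem abs_arctan_sub_le (a b : ℝ) : |Real.arctan a - Real.arctan b| ≤ |a - b| := by
  have h := Convex.norm_image_sub_le_of_norm_deriv_le (f := Real.arctan) (s := Set.univ) (C := 1)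
    (x := b) (y := a) (fun x _ => Real.differentiableAt_arctan x) (fun x _ => by
      rw [Real.deriv_arctan, Real.norm_of_nonneg (by positivity)]
      exact (div_le_one (by positivity)).2 (by nlinarith [sq_nonneg x])) convex_univ
      (Set.mem_univ _) (Set.mem_univ _)
  simpa using h

theorem abs_sub_div_le {u w p q Q : ℝ} (hw : 0 < w) (hQ : Q = u ^ 2 + w ^ 2) :
    |(w * p - u * q) / Q| ≤ (|p| + |q|) / w := by
  have hQ0 : 0 < Q := by rw [hQ]; positivity
  rw [abs_div, abs_of_pos hQ0, div_le_div_iff₀ hQ0 hw]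
  have h1 : |u| * w ≤ Q := by
    rw [hQ]; nlinarith [sq_nonneg (|u| - w), sq_abs u, abs_nonneg u]
  have h2 : w * w ≤ Q := by rw [hQ]; nlinarith [sq_nonneg u]
  calc |w * p - u * q| * w ≤ (w * |p| + |u| * |q|) * w := by
        gcongr
        refine (abs_sub _ _).trans ?_
        rw [abs_mul, abs_mul, abs_of_pos hw]
    _ = |p| * (w * w) + |q| * (|u| * w) := by ring
    _ ≤ |p| * Q + |q| * Q := by gcongr
    _ = _ := by ring

namespace MetricPair

variable {L κ : ℝ} {g γ : E2 → Mat} (h : MetricPair L κ g γ)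
include h

theorem abs_dvol_sub_le {x : E2} (hx : x ∈ refTri) :
    |dvol γ x - dvol g x| ≤ 2 * κ * √(diffSq g γ x) := by
  have hL := h.pos
  have hκ := h.one_le_kappa
  obtain ⟨l1, -⟩ := (h.pinch₁ x hx).dvol_bounds hL
  obtain ⟨l2, -⟩ := (h.pinch₂ x hx).dvol_bounds hL
  set s := √(diffSq g γ x)
  have s0 : 0 ≤ s := Real.sqrt_nonneg _
  have hs : ∀ i j, |γ x i j - g x i j| ≤ s := abs_diff_le g γ x
  have b1 := fun i j => (h.pinch₁ x hx).entry hL i j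
  have b2 := fun i j => (h.pinch₂ x hx).entry hL i j
  have e : (dvol γ x - dvol g x) * (dvol γ x + dvol g x) =
      γ x 0 0 * (γ x 1 1 - g x 1 1) + (g x 1 1 * (γ x 0 0 - g x 0 0)
        - (γ x 0 1 * (γ x 0 1 - g x 0 1) + g x 0 1 * (γ x 0 1 - g x 0 1))) := by
    have h1 := h.metric₁.dvol_sq hx
    have h2 := h.metric₂.dvol_sq hx
    linear_combination h2 - h1
  have t1 := abs_mul_le_mul (b2 0 0) (hs 1 1)
  have t2 := abs_mul_le_mul (b1 1 1) (hs 0 0)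
  have t3 := abs_mul_le_mul (b2 0 1) (hs 0 1)
  have t4 := abs_mul_le_mul (b1 0 1) (hs 0 1)
  have t : |(dvol γ x - dvol g x) * (dvol γ x + dvol g x)| ≤ 4 * (κ * L * s) := by
    rw [e]
    refine (abs_add_le _ _).trans ?_
    refine (add_le_add t1 ((abs_sub _ _).trans (add_le_add t2 ((abs_add_le _ _).trans
      (add_le_add t3 t4))))).trans (by linarith)
  rw [abs_mul, abs_of_pos (by linarith : 0 < dvol γ x + dvol g x)] at t
  have : |dvol γ x - dvol g x| * (2 * L) ≤ 2 * κ * s * (2 * L) := by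
    refine le_trans (mul_le_mul_of_nonneg_left (by linarith) (abs_nonneg _)) (t.trans_eq ?_)
    ring
  exact le_of_mul_le_mul_right this (by linarith)

theorem abs_beta_sub_le {x : E2} (hx : x ∈ refTri) {c : ℝ} (hc : |c| ≤ 1) :
    |beta c γ x - beta c g x| ≤ (2 + 4 * κ ^ 2) * (√(diffSq g γ x) / L) := by
  have hL := h.pos
  have hκ := h.one_le_kappa
  obtain ⟨l1, -⟩ := (h.pinch₁ x hx).dvol_bounds hL
  obtain ⟨l2, -⟩ := (h.pinch₂ x hx).dvol_bounds hL
  have hP := h.abs_dvol_sub_le hx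
  set s := √(diffSq g γ x)
  have s0 : 0 ≤ s := Real.sqrt_nonneg _
  have hs : ∀ i j, |γ x i j - g x i j| ≤ s := abs_diff_le g γ x
  have b1 := fun i j => (h.pinch₁ x hx).entry hL i j
  have p1 : 0 < dvol g x := hL.trans_le l1
  have p2 : 0 < dvol γ x := hL.trans_le l2
  have e : beta c γ x - beta c g x = Real.arctan ((g x 0 1 - c * g x 0 0) / dvol g x) -
      Real.arctan ((γ x 0 1 - c * γ x 0 0) / dvol γ x) := by
    rw [beta, beta]; ring
  rw [e, abs_sub_comm]
  refine (abs_arctan_sub_le _ _).trans ?_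
  have e2 : (γ x 0 1 - c * γ x 0 0) / dvol γ x - (g x 0 1 - c * g x 0 0) / dvol g x =
      ((γ x 0 1 - g x 0 1) - c * (γ x 0 0 - g x 0 0)) / dvol γ x -
        (g x 0 1 - c * g x 0 0) * (dvol γ x - dvol g x) / (dvol γ x * dvol g x) := by
    field_simp; ring
  rw [e2]
  have t1 : |((γ x 0 1 - g x 0 1) - c * (γ x 0 0 - g x 0 0)) / dvol γ x| ≤ 2 * s / L := by
    rw [abs_div, abs_of_pos p2]
    have := abs_mul_le_mul hc (hs 0 0)
    have : |(γ x 0 1 - g x 0 1) - c * (γ x 0 0 - g x 0 0)| ≤ 2 * s := by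
      linarith [abs_sub (γ x 0 1 - g x 0 1) (c * (γ x 0 0 - g x 0 0)), hs 0 1]
    gcongr
  have t2 : |(g x 0 1 - c * g x 0 0) * (dvol γ x - dvol g x) / (dvol γ x * dvol g x)| ≤
      2 * (κ * L) * (2 * κ * s) / (L * L) := by
    rw [abs_div, abs_of_pos (mul_pos p2 p1)]
    have h1 := abs_mul_le_mul hc (b1 0 0)
    have h2 : |g x 0 1 - c * g x 0 0| ≤ 2 * (κ * L) := by
      linarith [abs_sub (g x 0 1) (c * g x 0 0), b1 0 1]
    have := abs_mul_le_mul h2 hP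
    gcongr
  refine (abs_sub _ _).trans ((add_le_add t1 t2).trans_eq ?_)
  field_simp
  ring

theorem abs_rho_le {x : E2} (hx : x ∈ refTri) :
    |rho g γ x| ≤ κ * (√(diffSq g γ x) / L) := by
  have hL := h.pos
  have hκ := h.one_le_kappa
  obtain ⟨l1, -⟩ := (h.pinch₁ x hx).dvol_bounds hL
  obtain ⟨l2, -⟩ := (h.pinch₂ x hx).dvol_bounds hL
  set s := √(diffSq g γ x)
  have s0 : 0 ≤ s := Real.sqrt_nonneg _
  have hs : ∀ i j, |γ x i j - g x i j| ≤ s := abs_diff_le g γ x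
  have b1 := fun i j => (h.pinch₁ x hx).entry hL i j
  have hw : 2 * (L * L) ≤ dvol γ x * g x 0 0 + dvol g x * γ x 0 0 := by
    have := mul_le_mul l2 (h.pinch₁ x hx).lo0 hL.le (hL.le.trans l2)
    have := mul_le_mul l1 (h.pinch₂ x hx).lo0 hL.le (hL.le.trans l1)
    linarith
  have hLL : 0 < L * L := by positivity
  have a := abs_arctan_sub_le ((g x 0 0 * γ x 0 1 - g x 0 1 * γ x 0 0) /
    (dvol γ x * g x 0 0 + dvol g x * γ x 0 0)) 0
  rw [Real.arctan_zero, sub_zero, sub_zero] at a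
  refine a.trans ?_
  have e : g x 0 0 * γ x 0 1 - g x 0 1 * γ x 0 0 =
      g x 0 0 * (γ x 0 1 - g x 0 1) - g x 0 1 * (γ x 0 0 - g x 0 0) := by ring
  have t : |g x 0 0 * γ x 0 1 - g x 0 1 * γ x 0 0| ≤ 2 * (κ * L * s) := by
    rw [e]
    linarith [abs_sub (g x 0 0 * (γ x 0 1 - g x 0 1)) (g x 0 1 * (γ x 0 0 - g x 0 0)),
      abs_mul_le_mul (b1 0 0) (hs 0 1), abs_mul_le_mul (b1 0 1) (hs 0 0)]
  have hw0 : 0 < dvol γ x * g x 0 0 + dvol g x * γ x 0 0 := by linarith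
  rw [abs_div, abs_of_pos hw0, div_le_iff₀ hw0]
  refine t.trans ?_
  calc 2 * (κ * L * s) = κ * (s / L) * (2 * (L * L)) := by field_simp
    _ ≤ _ := by gcongr

/-- The difference of the connection forms is exact up to terms controlled by the covariant
derivative. -/
theorem abs_omega_sub_le {x : E2} (hx : x ∈ refTri) (k : Fin 2) :
    |omega γ k x - omega g k x - pd k (rho g γ) x| ≤
      (3 * κ ^ 2 + 3 * κ ^ 3 + 3 / 2 * κ) * (√(covSq g γ x) / L) := by
  have hL := h.pos
  have hκ := h.one_le_kappa
  have hE := h.metric₁.diag_pos hx 0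
  have hE' := h.metric₂.diag_pos hx 0
  have hP := h.metric₁.dvol_pos hx
  have hP' := h.metric₂.dvol_pos hx
  set n := √(covSq g γ x)
  have n0 : 0 ≤ n := Real.sqrt_nonneg _
  have hn : ∀ k i j, |cov2 g γ x k i j| ≤ n := abs_cov_le g γ x
  have hD := fun l i => h.chris_sub_le hx hn l k i
  have en := fun i j => h.metric₁.hasPd_entry hx i j
  have en' := fun i j => h.metric₂.isSymField.hasPd g hx i j
  have hw : 0 < dvol γ x * g x 0 0 + dvol g x * γ x 0 0 := by positivity
  have hpd : pd k (rho g γ) x = _ :=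
    (((((en 0 0).mul (en' 0 1)).sub ((en 0 1).mul (en' 0 0))).div
      (((h.metric₂.hasPd_dvol hx).mul (en 0 0)).add ((h.metric₁.hasPd_dvol hx).mul (en' 0 0)))
      hw.ne').arctan).pd_eq hx k
  have id := rho_identity (a := chris g 0 k 0 x) (b := chris g 1 k 0 x) (c := chris g 0 k 1 x)
    (d := chris g 1 k 1 x) (N₀ := cov2 g γ x k 0 0) (N₁ := cov2 g γ x k 0 1)
    (S := dvol γ x * ((chris γ 0 k 0 x - chris g 0 k 0 x) + (chris γ 1 k 1 x - chris g 1 k 1 x)))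
    hE hE' hP hP' (h.metric₁.dvol_sq hx) (h.metric₂.dvol_sq hx)
  have e : pd k (rho g γ) x = dvol γ x / γ x 0 0 * chris g 1 k 0 x -
      dvol g x / g x 0 0 * chris g 1 k 0 x + _ := Eq.trans ?_ id
  swap
  · rw [hpd]
    simp only [h.metric₁.symm hx, h.metric₂.symm hx]
    have : ∀ u w du dw : ℝ, w ≠ 0 → (du * w - u * dw) / w ^ 2 / (1 + (u / w) ^ 2) =
        (w * du - u * dw) / (u ^ 2 + w ^ 2) := by
      intro u w du dw hw
      have : u ^ 2 + w ^ 2 ≠ 0 := by positivity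
      field_simp
      ring
    rw [this _ _ _ _ hw.ne']
    congr 1
    ring
  have bP := ((h.pinch₁ x hx).dvol_bounds hL)
  have bP' := ((h.pinch₂ x hx).dvol_bounds hL)
  have b1 := fun i j => (h.pinch₁ x hx).entry hL i j
  have hw2 : 2 * (L * L) ≤ dvol γ x * g x 0 0 + dvol g x * γ x 0 0 := by
    have := mul_le_mul bP'.1 (h.pinch₁ x hx).lo0 hL.le hP'.le
    have := mul_le_mul bP.1 (h.pinch₂ x hx).lo0 hL.le hP.le
    linarith
  rw [e, omega, omega]
  have aux : ∀ a b c d f : ℝ, a * b - c * d - (a * d - c * d + f) = a * (b - d) - f := by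
    intros; ring
  rw [aux]
  refine (abs_sub _ _).trans (((add_le_add (abs_mul_le_mul (m := κ) ?_ (hD 1 0))
    (abs_sub_div_le hw rfl))).trans (le_trans (b := κ * (3 * (κ / L) * n) +
      (2 * (κ * L * n) + (κ * L * (6 * (κ / L) * n) * (κ * L) + κ * L * n)) / (2 * (L * L))) ?_ ?_))
  · rw [abs_div, abs_of_pos hP', abs_of_pos hE', div_le_iff₀ hE']
    exact bP'.2.trans (by gcongr; exact (h.pinch₂ x hx).lo0)
  · have t1 : |g x 0 0 * cov2 g γ x k 0 1 - g x 0 1 * cov2 g γ x k 0 0| ≤ 2 * (κ * L * n) := by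
      linarith [abs_sub (g x 0 0 * cov2 g γ x k 0 1) (g x 0 1 * cov2 g γ x k 0 0),
        abs_mul_le_mul (b1 0 0) (hn k 0 1), abs_mul_le_mul (b1 0 1) (hn k 0 0)]
    have aP : |dvol g x| ≤ κ * L := by rw [abs_of_pos hP]; exact bP.2
    have aP' : |dvol γ x| ≤ κ * L := by rw [abs_of_pos hP']; exact bP'.2
    have tr : |(chris γ 0 k 0 x - chris g 0 k 0 x) + (chris γ 1 k 1 x - chris g 1 k 1 x)| ≤
        6 * (κ / L) * n := by
      linarith [abs_add_le (chris γ 0 k 0 x - chris g 0 k 0 x) (chris γ 1 k 1 x - chris g 1 k 1 x),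
        hD 0 0, hD 1 1]
    have t2 := (abs_add_le _ _).trans (add_le_add (abs_mul_le_mul (abs_mul_le_mul aP' tr) (b1 0 0))
      (abs_mul_le_mul aP (hn k 0 0)))
    gcongr
  · apply le_of_eq
    field_simp
    ring

theorem curvFun_sub_le {CV : ℝ} (hCV : 0 ≤ CV) {v : E2 → ℝ} (hv : ContDiffOn ℝ 2 v refTri)
    (hinv : ∀ x ∈ refTri, gradSq v x ≤ CV * ∫ y in refTri, gradSq v y) :
    |curvFun γ v - curvFun g v| ≤ functionalConst κ (2 + 3 * κ + 7 * κ ^ 2 + 3 * κ ^ 3) CV *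
      (√(∫ x in refTri, energy L g γ x) * √(∫ x in refTri, gradSq v x)) := by
  have hL := h.pos
  have hκ := h.one_le_kappa
  have hv1 : ContDiffOn ℝ 1 v refTri := hv.of_le (by norm_num)
  have hr := contDiffOn_rho h.metric₁ h.metric₂
  have hr1 := hr.of_le one_le_smooth
  have dv := fun k => contDiffOn_pd (m := 1) hv (by norm_num) k
  have co := fun {G : E2 → Mat} (hG : IsMetric G) k => (contDiffOn_omega hG k).continuousOn
  have cb := fun {G : E2 → Mat} (hG : IsMetric G) c => (contDiffOn_beta hG c).continuousOn
  have cv := fun k => (dv k).continuousOn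
  have cr := fun k => continuousOn_pd hr one_le_smooth k
  have cd := fun i : Fin 3 => continuousOn_dapp hv1 le_rfl (sideDir i)
  have stokes : ∫ x in refTri, (pd 0 v x * pd 1 (rho g γ) x - pd 1 v x * pd 0 (rho g γ) x) =
      - ∑ i, ∫ s in (0:ℝ)..1, rho g γ (sidePt i s) * dapp v (sidePt i s) (sideDir i) := by
    have key := integral_mul_curl hr1 (dv 0) (dv 1)
    have z : ∫ x in refTri, rho g γ x * (pd 0 (pd 1 v) x - pd 1 (pd 0 v) x) = 0 := by
      rw [setIntegral_congr_fun (g := fun _ => (0:ℝ)) isClosed_refTri.measurableSet, integral_zero]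
      intro x hx
      simp only [pd_comm hv hx, sub_self, mul_zero]
    rw [z] at key
    have e : ∫ x in refTri, (pd 0 v x * pd 1 (rho g γ) x - pd 1 v x * pd 0 (rho g γ) x) =
        - ∫ x in refTri, (pd 0 (rho g γ) x * pd 1 v x - pd 1 (rho g γ) x * pd 0 v x) := by
      rw [← integral_neg]; congr 1; ext x; ring
    rw [e]
    simp only [dapp, Fin.sum_univ_two]
    linarith
  set a : Fin 2 → E2 → ℝ := ![fun x => omega γ 1 x - omega g 1 x - pd 1 (rho g γ) x,
    fun x => - (omega γ 0 x - omega g 0 x - pd 0 (rho g γ) x)] with ha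
  set b : Fin 3 → E2 → ℝ := ![rho g γ, fun x => rho g γ x + (beta 1 γ x - beta 1 g x),
    fun x => rho g γ x + (beta 0 γ x - beta 0 g x)] with hb
  have key := h.functional_bound (c := 2 + 3 * κ + 7 * κ ^ 2 + 3 * κ ^ 3) (by positivity) hCV hv hinv
    (a := a) (b := b) (fun x hx k => by
      have n0 : 0 ≤ √(covSq g γ x) / L := by positivity
      have hle : (3 * κ ^ 2 + 3 * κ ^ 3 + 3 / 2 * κ) * (√(covSq g γ x) / L) ≤
        (2 + 3 * κ + 7 * κ ^ 2 + 3 * κ ^ 3) * (√(covSq g γ x) / L) := by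
          refine mul_le_mul_of_nonneg_right ?_ n0; nlinarith [sq_nonneg κ]
      fin_cases k
      · exact (h.abs_omega_sub_le hx 1).trans hle
      · refine (le_of_eq ?_).trans ((h.abs_omega_sub_le hx 0).trans hle)
        exact abs_neg _)
    (fun x hx i => by
      have n0 : 0 ≤ √(diffSq g γ x) / L := by positivity
      have k3 : 0 ≤ κ ^ 3 := by positivity
      have h0 := h.abs_rho_le hx
      have h1 := h.abs_beta_sub_le hx (c := 1) (by simp)
      have h2 := h.abs_beta_sub_le hx (c := 0) (by simp)
      have t : κ * (√(diffSq g γ x) / L) + (2 + 4 * κ ^ 2) * (√(diffSq g γ x) / L) ≤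
          (2 + 3 * κ + 7 * κ ^ 2 + 3 * κ ^ 3) * (√(diffSq g γ x) / L) := by
        rw [← add_mul]; refine mul_le_mul_of_nonneg_right ?_ n0; nlinarith [sq_nonneg κ]
      fin_cases i
      · exact h0.trans (le_trans (by nlinarith [sq_nonneg κ]) t)
      · exact (abs_add_le _ _).trans ((add_le_add h0 h1).trans t)
      · exact (abs_add_le _ _).trans ((add_le_add h0 h2).trans t))
  refine le_trans ?_ key
  have cω : ContinuousOn (fun x => pd 0 v x * omega γ 1 x - pd 1 v x * omega γ 0 x) refTri :=
    ((cv 0).mul (co h.metric₂ 1)).sub ((cv 1).mul (co h.metric₂ 0))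
  have cω' : ContinuousOn (fun x => pd 0 v x * omega g 1 x - pd 1 v x * omega g 0 x) refTri :=
    ((cv 0).mul (co h.metric₁ 1)).sub ((cv 1).mul (co h.metric₁ 0))
  have cρ : ContinuousOn (fun x => pd 0 v x * pd 1 (rho g γ) x - pd 1 v x * pd 0 (rho g γ) x)
    refTri := ((cv 0).mul (cr 1)).sub ((cv 1).mul (cr 0))
  have e1 : ∫ x in refTri, (a 0 x * pd 0 v x + a 1 x * pd 1 v x) =
      (∫ x in refTri, (pd 0 v x * omega γ 1 x - pd 1 v x * omega γ 0 x)) -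
      (∫ x in refTri, (pd 0 v x * omega g 1 x - pd 1 v x * omega g 0 x)) -
      (∫ x in refTri, (pd 0 v x * pd 1 (rho g γ) x - pd 1 v x * pd 0 (rho g γ) x)) := by
    have cs : ContinuousOn (fun x => pd 0 v x * omega γ 1 x - pd 1 v x * omega γ 0 x -
        (pd 0 v x * omega g 1 x - pd 1 v x * omega g 0 x)) refTri := cω.sub cω'
    rw [← integral_sub (integrableOn_refTri cω) (integrableOn_refTri cω'),
      ← integral_sub (integrableOn_refTri cs) (integrableOn_refTri cρ)]
    congr 1; ext x
    simp only [ha, Matrix.cons_val_zero, Matrix.cons_val_one, Pi.sub_apply]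
    ring
  have eb : ∀ (i : Fin 3) (c : ℝ), ∫ s in (0:ℝ)..1, (rho g γ (sidePt i s) +
        (beta c γ (sidePt i s) - beta c g (sidePt i s))) * dapp v (sidePt i s) (sideDir i) =
      (∫ s in (0:ℝ)..1, rho g γ (sidePt i s) * dapp v (sidePt i s) (sideDir i)) +
      ((∫ s in (0:ℝ)..1, beta c γ (sidePt i s) * dapp v (sidePt i s) (sideDir i)) -
      (∫ s in (0:ℝ)..1, beta c g (sidePt i s) * dapp v (sidePt i s) (sideDir i))) := by
    intro i c
    have i1 := intervalIntegrable_sidePt (φ := fun x => rho g γ x * dapp v x (sideDir i))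
      (hr.continuousOn.mul (cd i)) i
    have i2 := intervalIntegrable_sidePt (φ := fun x => beta c γ x * dapp v x (sideDir i))
      ((cb h.metric₂ c).mul (cd i)) i
    have i3 := intervalIntegrable_sidePt (φ := fun x => beta c g x * dapp v x (sideDir i))
      ((cb h.metric₁ c).mul (cd i)) i
    rw [← intervalIntegral.integral_sub i2 i3, ← intervalIntegral.integral_add i1 (i2.sub i3)]
    congr 1; ext s; ring
  have e2 : curvFun γ v - curvFun g v = (∫ x in refTri, (a 0 x * pd 0 v x + a 1 x * pd 1 v x)) -
      ∑ i, ∫ s in (0:ℝ)..1, b i (sidePt i s) * dapp v (sidePt i s) (sideDir i) := by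
    rw [curvFun_eq h.metric₂ hv1, curvFun_eq h.metric₁ hv1, e1, stokes, Fin.sum_univ_three,
      Fin.sum_univ_three]
    simp only [hb, Matrix.cons_val_zero, Matrix.cons_val_one, Matrix.cons_val, eb]
    ring
  rw [e2]
  exact (abs_sub _ _).trans (add_le_add le_rfl (Finset.abs_sum_le_sum_abs _ _))

end MetricPair

end

section

variable {M : Type*} [TopologicalSpace M] [ChartedSpace (EuclideanQuadrant 2) M]

theorem dpar_apply_eq (f : E2 → M) (x w : E2) : dpar f x w =
    w 0 • dpar f x (EuclideanSpace.single 0 1) + w 1 • dpar f x (EuclideanSpace.single 1 1) := by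
  conv_lhs => rw [vec_eq_sum w]
  rw [map_add, map_smul, map_smul]

variable [IsManifold IQ ∞ M]

theorem pair_pull (g : Metric2 M) (f : E2 → M) (x v w : E2) :
    pair (pull g f x) v w = g.inner (f x) (dpar f x v) (dpar f x w) := by
  rw [dpar_apply_eq f x v, dpar_apply_eq f x w]
  simp only [pair, Fin.sum_univ_two, pull, Matrix.of_apply, map_add, map_smul,
    ContinuousLinearMap.add_apply, ContinuousLinearMap.smul_apply, smul_eq_mul]
  ring

theorem IsSmoothTriangle.contMDiffOn_dpar {f : E2 → M} (hf : IsSmoothTriangle f) (w : E2) :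
    ContMDiffOn 𝓘(ℝ, E2) IQ.tangent ∞
      (fun x => (⟨f x, dpar f x w⟩ : TangentBundle IQ M)) refTri := by
  have h1 := hf.smooth.contMDiffOn_tangentMapWithin (m := ∞) (by simp)
    uniqueDiffOn_refTri.uniqueMDiffOn
  have h2 : ContMDiffOn 𝓘(ℝ, E2) 𝓘(ℝ, E2).tangent ∞
      (fun x => (⟨x, w⟩ : TangentBundle 𝓘(ℝ, E2) E2)) refTri :=
    contMDiffOn_vectorSpace_iff_contDiffOn.2 contDiffOn_const
  exact h1.comp h2 fun x hx => hx

/-- The inner product of two smooth vector fields along a map is smooth. -/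
theorem contDiffOn_inner_along (g : Metric2 M) {f : E2 → M} {s : Set E2}
    {X Y : ∀ x, TangentSpace IQ (f x)}
    (hX : ContMDiffOn 𝓘(ℝ, E2) IQ.tangent ∞ (fun x => (⟨f x, X x⟩ : TangentBundle IQ M)) s)
    (hY : ContMDiffOn 𝓘(ℝ, E2) IQ.tangent ∞ (fun x => (⟨f x, Y x⟩ : TangentBundle IQ M)) s) :
    ContDiffOn ℝ ∞ (fun x => g.inner (f x) (X x) (Y x)) s := by
  rw [← contMDiffOn_iff_contDiffOn]
  intro x hx
  have hf : ContMDiffWithinAt 𝓘(ℝ, E2) IQ ∞ f s x := by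
    have := hX x hx
    simp only [Bundle.contMDiffWithinAt_totalSpace] at this
    exact this.1
  have : ContMDiffWithinAt 𝓘(ℝ, E2) (IQ.prod 𝓘(ℝ)) ∞
      (fun m => Bundle.TotalSpace.mk' ℝ (E := Bundle.Trivial M ℝ) (f m)
        (g.inner (f m) (X m) (Y m))) s x := by
    apply ContMDiffWithinAt.clm_bundle_apply₂ (F₁ := E2) (F₂ := E2)
    · exact ContMDiffAt.comp_contMDiffWithinAt x g.contMDiff.contMDiffAt hf
    · exact hX x hx
    · exact hY x hx
  simp only [Bundle.contMDiffWithinAt_totalSpace] at this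
  exact this.2

theorem IsSmoothTriangle.isMetric_pull {f : E2 → M} (hf : IsSmoothTriangle f) (g : Metric2 M) :
    IsMetric (pull g f) := by
  refine ⟨fun i j => contDiffOn_inner_along g (hf.contMDiffOn_dpar _) (hf.contMDiffOn_dpar _),
    fun x hx => Matrix.PosDef.of_dotProduct_mulVec_pos ?_ fun v hv => ?_⟩
  · ext i j
    simp [pull, g.symm]
  · have e : star v ⬝ᵥ (pull g f x).mulVec v =
        pair (pull g f x) (WithLp.toLp 2 v) (WithLp.toLp 2 v) := by
      simp only [Matrix.mulVec, dotProduct, pair, Fin.sum_univ_two, Pi.star_apply, star_trivial]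
      ring
    rw [e, pair_pull]
    refine g.pos _ _ fun h0 => hv ?_
    have := hf.immersion x hx (h0.trans (map_zero _).symm)
    exact (WithLp.toLp_eq_zero 2).1 this

theorem isMetric_onMesh (g : Metric2 M) (𝒯 : Mesh M) (T : Fin 𝒯.n) : IsMetric (onMesh g 𝒯 T) :=
  (𝒯.smooth T).isMetric_pull g

theorem ReggeMetric.isMetric {𝒯 : Mesh M} (γ : ReggeMetric 𝒯) (T : Fin 𝒯.n) : IsMetric (γ.G T) :=
  ⟨γ.smooth T, γ.posDef T⟩

end

section

/-! ### Consequences of shape-regularity -/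

theorem len_flat_sq (x v : E2) : len (flat x) v ^ 2 = v 0 ^ 2 + v 1 ^ 2 := by
  have : pair (flat x) v v = v 0 ^ 2 + v 1 ^ 2 := by simp [pair, flat]; ring
  rw [len, this, Real.sq_sqrt (by positivity)]

theorem len_flat_pos (x : E2) {v : E2} (hv : v ≠ 0) : 0 < len (flat x) v := by
  have h0 : 0 ≤ len (flat x) v := Real.sqrt_nonneg _
  refine h0.lt_of_ne' fun h => hv ?_
  have := len_flat_sq x v
  rw [h] at this
  ext i; fin_cases i <;> simp <;> nlinarith [sq_nonneg (v 0), sq_nonneg (v 1)]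

theorem le_CC (G₁ G₂ : E2 → Mat) {x : E2} (hx : x ∈ refTri) {v : E2} (hv : v ≠ 0) :
    ENNReal.ofReal (len (G₁ x) v / len (G₂ x) v) ≤ CC G₁ G₂ :=
  le_iSup₂_of_le x hx (le_iSup₂_of_le v hv le_rfl)

theorem abs_pair_le_of_linf2 {G σ : E2 → Mat} (hG : IsMetric G) {c : ℝ} (hc : 0 ≤ c)
    (h : linf2 G σ ≤ ENNReal.ofReal c) {x : E2} (hx : x ∈ refTri) {v w : E2} (hv : v ≠ 0)
    (hw : w ≠ 0) : |pair (σ x) v w| ≤ c * (len (G x) v * len (G x) w) := by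
  have h1 : ENNReal.ofReal (|pair (σ x) v w| / (len (G x) v * len (G x) w)) ≤
      ENNReal.ofReal c := by
    refine le_trans (le_iSup₂_of_le x hx (le_iSup₂_of_le v hv ?_)) h
    exact le_iSup₂_of_le (f := fun (w : E2) (_ : w ≠ 0) =>
      ENNReal.ofReal (|pair (σ x) v w| / (len (G x) v * len (G x) w))) w hw le_rfl
  rw [ENNReal.ofReal_le_ofReal_iff hc] at h1
  exact (div_le_iff₀ (mul_pos (hG.len_pos hx hv) (hG.len_pos hx hw))).1 h1

theorem pinch_of_pair {L κ : ℝ} {A : Mat} (hA : A 1 0 = A 0 1)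
    (hl : ∀ v : E2, v ≠ 0 → L * (v 0 ^ 2 + v 1 ^ 2) ≤ pair A v v)
    (hu : ∀ v : E2, v ≠ 0 → pair A v v ≤ κ * L * (v 0 ^ 2 + v 1 ^ 2)) : Pinch L κ A := by
  have e : ∀ a b : ℝ, pair A (pt a b) (pt a b) =
      A 0 0 * a ^ 2 + 2 * A 0 1 * a * b + A 1 1 * b ^ 2 := fun a b => by
    simp only [pair, Fin.sum_univ_two, pt_zero, pt_one, hA]; ring
  have z : ∀ a b : ℝ, pt a b = 0 → a = 0 ∧ b = 0 := fun a b h =>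
    ⟨congrArg (fun w : E2 => w 0) h, congrArg (fun w : E2 => w 1) h⟩
  refine ⟨hA, fun a b => ?_, fun a b => ?_⟩
  · by_cases h : pt a b = 0
    · obtain ⟨rfl, rfl⟩ := z a b h; simp
    · rw [← e]; exact hl _ h
  · by_cases h : pt a b = 0
    · obtain ⟨rfl, rfl⟩ := z a b h; simp
    · rw [← e]; exact hu _ h

/-- The ratio of the pinching constants. -/
def pinchConst (K C' : ℝ) : ℝ := 2 * K ^ 2 / (1 - max C' 0)

theorem exists_metricPair {g γ : E2 → Mat} (hg : IsMetric g) (hγ : IsMetric γ) {K K' C' h : ℝ}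
    (hC' : C' < 1) (hh : 0 < h) (hs : CC γ flat * CC flat γ ≤ ENNReal.ofReal K)
    (hq : CC flat γ ≤ ENNReal.ofReal (K' * h⁻¹)) (hl : linf2 g (γ - g) ≤ ENNReal.ofReal C') :
    ∃ L, MetricPair L (pinchConst K C') g γ ∧ h ^ 2 ≤ 2 * K' ^ 2 * L := by
  have hx0 := vtx_mem 0
  have hv0 := sideDir_ne_zero 0
  have p1 : 0 < CC γ flat := lt_of_lt_of_le
    (ENNReal.ofReal_pos.2 (div_pos (hγ.len_pos hx0 hv0) (len_flat_pos _ hv0))) (le_CC γ flat hx0 hv0)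
  have p2 : 0 < CC flat γ := lt_of_lt_of_le
    (ENNReal.ofReal_pos.2 (div_pos (len_flat_pos _ hv0) (hγ.len_pos hx0 hv0))) (le_CC flat γ hx0 hv0)
  have f2 : CC flat γ ≠ ⊤ := ne_top_of_le_ne_top ENNReal.ofReal_ne_top hq
  have f1 : CC γ flat ≠ ⊤ := by
    intro ht
    rw [ht, ENNReal.top_mul p2.ne'] at hs
    exact ENNReal.ofReal_ne_top (top_le_iff.1 hs)
  have q2 := hq
  have s2 := hs
  obtain ⟨a, ha⟩ : ∃ a, a = (CC γ flat).toReal := ⟨_, rfl⟩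
  obtain ⟨b, hb⟩ : ∃ b, b = (CC flat γ).toReal := ⟨_, rfl⟩
  have ea : CC γ flat = ENNReal.ofReal a := by rw [ha, ENNReal.ofReal_toReal f1]
  have eb : CC flat γ = ENNReal.ofReal b := by rw [hb, ENNReal.ofReal_toReal f2]
  have a0 : 0 < a := ENNReal.ofReal_pos.1 (ea ▸ p1)
  have b0 : 0 < b := ENNReal.ofReal_pos.1 (eb ▸ p2)
  rw [ea, eb, ← ENNReal.ofReal_mul a0.le] at s2
  rw [eb] at q2
  have hab : a * b ≤ K := (ENNReal.ofReal_le_ofReal_iff' .. |>.1 s2).resolve_right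
    (not_le.2 (mul_pos a0 b0))
  have hbq : b ≤ K' * h⁻¹ := (ENNReal.ofReal_le_ofReal_iff' .. |>.1 q2).resolve_right (not_le.2 b0)
  set c := max C' 0 with hc
  have c0 : 0 ≤ c := le_max_right _ _
  have c1 : c < 1 := max_lt hC' one_pos
  have hl' : linf2 g (γ - g) ≤ ENNReal.ofReal c := hl.trans (ENNReal.ofReal_le_ofReal (le_max_left _ _))
  have up : ∀ x ∈ refTri, ∀ v : E2, v ≠ 0 → pair (γ x) v v ≤ a ^ 2 * (v 0 ^ 2 + v 1 ^ 2) := by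
    intro x hx v hv
    have := le_CC γ flat hx hv
    rw [ea, ENNReal.ofReal_le_ofReal_iff a0.le, div_le_iff₀ (len_flat_pos x hv)] at this
    rw [← len_flat_sq x, ← hγ.len_sq hx hv, ← mul_pow]
    exact pow_le_pow_left₀ (hγ.len_pos hx hv).le this 2
  have lo : ∀ x ∈ refTri, ∀ v : E2, v ≠ 0 → v 0 ^ 2 + v 1 ^ 2 ≤ b ^ 2 * pair (γ x) v v := by
    intro x hx v hv
    have := le_CC flat γ hx hv
    rw [eb, ENNReal.ofReal_le_ofReal_iff b0.le, div_le_iff₀ (hγ.len_pos hx hv)] at this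
    rw [← len_flat_sq x, ← hγ.len_sq hx hv, ← mul_pow]
    exact pow_le_pow_left₀ (len_flat_pos x hv).le this 2
  have cmp : ∀ x ∈ refTri, ∀ v : E2, v ≠ 0 →
      pair (γ x) v v ≤ 2 * pair (g x) v v ∧ (1 - c) * pair (g x) v v ≤ pair (γ x) v v := by
    intro x hx v hv
    have h1 := abs_pair_le_of_linf2 hg c0 hl' hx hv hv
    rw [← sq, hg.len_sq hx hv] at h1
    have e : pair ((γ - g) x) v v = pair (γ x) v v - pair (g x) v v := by
      simp only [pair, Fin.sum_univ_two, Pi.sub_apply, Matrix.sub_apply]; ring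
    rw [e] at h1
    have h2 := abs_le.1 h1
    have := hg.pair_pos hx hv
    constructor <;> nlinarith
  have hκ : pinchConst K C' = 2 * K ^ 2 / (1 - c) := rfl
  have hL : 0 < (2 * b ^ 2)⁻¹ := by positivity
  have hcc : 0 < 1 - c := by linarith
  have hK : a ^ 2 ≤ 2 * K ^ 2 * (2 * b ^ 2)⁻¹ := by
    have : (a * b) ^ 2 ≤ K ^ 2 := pow_le_pow_left₀ (by positivity) hab 2
    calc a ^ 2 = (a * b) ^ 2 / b ^ 2 := by field_simp
      _ ≤ K ^ 2 / b ^ 2 := by gcongr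
      _ = _ := by field_simp
  have hκ1 : 2 * K ^ 2 ≤ pinchConst K C' := by
    rw [hκ, le_div_iff₀ hcc]; nlinarith [sq_nonneg K]
  refine ⟨(2 * b ^ 2)⁻¹, ⟨hL, hg, hγ, fun x hx => pinch_of_pair (hg.symm hx) (fun v hv => ?_)
    fun v hv => ?_, fun x hx => pinch_of_pair (hγ.symm hx) (fun v hv => ?_) fun v hv => ?_⟩, ?_⟩
  · rw [inv_mul_le_iff₀ (by positivity)]
    nlinarith [lo x hx v hv, (cmp x hx v hv).1, sq_nonneg b]
  · have h1 := (cmp x hx v hv).2.trans (up x hx v hv)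
    have h2 : pair (g x) v v ≤ a ^ 2 * (v 0 ^ 2 + v 1 ^ 2) / (1 - c) := by
      rw [le_div_iff₀ hcc]; linarith
    refine h2.trans ?_
    calc a ^ 2 * (v 0 ^ 2 + v 1 ^ 2) / (1 - c) ≤
        2 * K ^ 2 * (2 * b ^ 2)⁻¹ * (v 0 ^ 2 + v 1 ^ 2) / (1 - c) := by gcongr
      _ = _ := by rw [hκ]; ring
  · rw [inv_mul_le_iff₀ (by positivity)]
    nlinarith [lo x hx v hv, hγ.pair_pos hx hv, sq_nonneg b]
  · refine (up x hx v hv).trans ?_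
    have : a ^ 2 ≤ pinchConst K C' * (2 * b ^ 2)⁻¹ := hK.trans (by gcongr)
    gcongr
  · have h1 : b * h ≤ K' := by
      rw [← div_eq_mul_inv, le_div_iff₀ hh] at hbq; exact hbq
    have h2 : (b * h) ^ 2 ≤ K' ^ 2 := pow_le_pow_left₀ (by positivity) h1 2
    calc h ^ 2 = (b * h) ^ 2 / b ^ 2 := by field_simp
      _ ≤ K' ^ 2 / b ^ 2 := by gcongr
      _ = _ := by field_simp

/-! ### Local quantities bounded by the norms on a triangle -/

theorem triInt_nonneg {G : E2 → Mat} {φ : E2 → ℝ} (h : ∀ x ∈ refTri, 0 ≤ φ x) : 0 ≤ triInt G φ :=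
  setIntegral_nonneg isClosed_refTri.measurableSet fun x hx =>
    mul_nonneg (h x hx) (Real.sqrt_nonneg _)

theorem mul_integral_le_triInt {L κ c : ℝ} {G : E2 → Mat} (hL : 0 < L)
    (hG : IsMetric G) (hp : ∀ x ∈ refTri, Pinch L κ (G x)) {φ ψ : E2 → ℝ}
    (hφ : ContinuousOn φ refTri) (hψ : ContinuousOn ψ refTri) (hc : 0 ≤ c)
    (hφ0 : ∀ x ∈ refTri, 0 ≤ φ x) (h : ∀ x ∈ refTri, c * φ x ≤ ψ x) :
    c * L * ∫ x in refTri, φ x ≤ triInt G ψ := by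
  rw [← integral_const_mul, triInt]
  refine setIntegral_mono_on (integrableOn_refTri (continuousOn_const.mul hφ))
    (integrableOn_refTri (hψ.mul hG.contDiffOn_dvol.continuousOn))
    isClosed_refTri.measurableSet fun x hx => ?_
  calc c * L * φ x = c * φ x * L := by ring
    _ ≤ ψ x * dvol G x := mul_le_mul (h x hx) ((hp x hx).dvol_bounds hL).1 hL.le
        ((mul_nonneg hc (hφ0 x hx)).trans (h x hx))

theorem continuousOn_inner1 {G : E2 → Mat} (hG : IsMetric G) {a b : E2 → Fin 2 → ℝ}
    (ha : ∀ k, ContinuousOn (fun x => a x k) refTri)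
    (hb : ∀ k, ContinuousOn (fun x => b x k) refTri) :
    ContinuousOn (fun x => inner1 (G x) (a x) (b x)) refTri := by
  unfold inner1
  exact continuousOn_finsetSum _ fun i _ => continuousOn_finsetSum _ fun j _ =>
    (((hG.contDiffOn_inv i j).continuousOn).mul (ha i)).mul (hb j)

theorem continuousOn_inner2 {G S T : E2 → Mat} (hG : IsMetric G)
    (hS : ∀ i j, ContinuousOn (fun x => S x i j) refTri)
    (hT : ∀ i j, ContinuousOn (fun x => T x i j) refTri) :
    ContinuousOn (fun x => inner2 (G x) (S x) (T x)) refTri := by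
  unfold inner2
  exact continuousOn_finsetSum _ fun i _ => continuousOn_finsetSum _ fun j _ =>
    continuousOn_finsetSum _ fun k _ => continuousOn_finsetSum _ fun l _ =>
    ((((hG.contDiffOn_inv i k).continuousOn).mul ((hG.contDiffOn_inv j l).continuousOn)).mul
      (hS i j)).mul (hT k l)

theorem continuousOn_normSq3 {G : E2 → Mat} (hG : IsMetric G)
    {N : E2 → Fin 2 → Fin 2 → Fin 2 → ℝ}
    (hN : ∀ k i j, ContinuousOn (fun x => N x k i j) refTri) :
    ContinuousOn (fun x => normSq3 (G x) (N x)) refTri := by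
  unfold normSq3
  have hi := fun a b => (hG.contDiffOn_inv a b).continuousOn
  exact continuousOn_finsetSum _ fun i _ => continuousOn_finsetSum _ fun j _ =>
    continuousOn_finsetSum _ fun k _ => continuousOn_finsetSum _ fun i' _ =>
    continuousOn_finsetSum _ fun j' _ => continuousOn_finsetSum _ fun k' _ =>
    ((((hi i i').mul (hi j j')).mul (hi k k')).mul (hN i j k)).mul (hN i' j' k')

namespace MetricPair

variable {L κ : ℝ} {g γ : E2 → Mat} (h : MetricPair L κ g γ)
include h

theorem integral_energy_le {b : ℝ} (hb : 1 ≤ b * L) :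
    ∫ x in refTri, energy L g γ x ≤
      κ ^ 2 * b * triInt g (fun x => inner2 (g x) ((γ - g) x) ((γ - g) x)) +
        κ ^ 3 * triInt g (fun x => normSq3 (g x) (cov2 g γ x)) := by
  have hL := h.pos
  have hκ := h.one_le_kappa
  have hs := h.metric₂.isSymField.sub h.metric₁.isSymField
  have c1 := continuousOn_inner2 h.metric₁ (fun i j => (hs.smooth i j).continuousOn)
    fun i j => (hs.smooth i j).continuousOn
  have c2 := continuousOn_normSq3 h.metric₁ fun k i j =>
    continuousOn_cov2 h.metric₁ h.metric₂.smooth k i j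
  have t1 := mul_integral_le_triInt hL h.metric₁ h.pinch₁ h.continuousOn_diffSq c1
    (c := (κ * L)⁻¹ ^ 2) (by positivity) (fun x _ => diffSq_nonneg _ _ _) (fun x hx => by
      have := (h.pinch₁ x hx).inner2_lower hL ((γ - g) x)
      refine le_trans (le_of_eq ?_) this
      simp only [diffSq, Fin.sum_univ_two, Pi.sub_apply, Matrix.sub_apply]; ring)
  have t2 := mul_integral_le_triInt hL h.metric₁ h.pinch₁ h.continuousOn_covSq c2
    (c := (κ * L)⁻¹ ^ 3) (by positivity) (fun x _ => covSq_nonneg _ _ _) (fun x hx =>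
      (h.pinch₁ x hx).normSq3_lower hL (cov2 g γ x))
  have e : ∫ x in refTri, energy L g γ x =
      (∫ x in refTri, diffSq g γ x) / L ^ 2 + (∫ x in refTri, covSq g γ x) / L ^ 2 := by
    rw [← add_div, ← integral_add (integrableOn_refTri h.continuousOn_diffSq)
      (integrableOn_refTri h.continuousOn_covSq), ← integral_div]
    rfl
  rw [e]
  have d0 : 0 ≤ ∫ x in refTri, diffSq g γ x := integral_nonneg fun x => diffSq_nonneg _ _ _
  have s0 : 0 ≤ triInt g (fun x => inner2 (g x) ((γ - g) x) ((γ - g) x)) :=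
    triInt_nonneg fun x hx => (h.pinch₁ x hx).inner2_nonneg hL _
  refine add_le_add ?_ ?_
  · calc (∫ x in refTri, diffSq g γ x) / L ^ 2 =
        κ ^ 2 * L⁻¹ * ((κ * L)⁻¹ ^ 2 * L * ∫ x in refTri, diffSq g γ x) := by field_simp
      _ ≤ κ ^ 2 * L⁻¹ * triInt g (fun x => inner2 (g x) ((γ - g) x) ((γ - g) x)) := by gcongr
      _ ≤ _ := by
        gcongr
        rw [inv_le_iff_one_le_mul₀ hL]; exact hb
  · calc (∫ x in refTri, covSq g γ x) / L ^ 2 =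
        κ ^ 3 * ((κ * L)⁻¹ ^ 3 * L * ∫ x in refTri, covSq g γ x) := by field_simp
      _ ≤ _ := by gcongr

theorem integral_gradSq_le {v : E2 → ℝ} (hv : ContDiffOn ℝ 1 v refTri) :
    ∫ x in refTri, gradSq v x ≤ κ * triInt γ (fun x => inner1 (γ x) (dfn v x) (dfn v x)) := by
  have hL := h.pos
  have hκ := h.one_le_kappa
  have c := continuousOn_inner1 h.metric₂ (a := dfn v) (b := dfn v)
    (fun k => continuousOn_pd hv le_rfl k) fun k => continuousOn_pd hv le_rfl k
  have t := mul_integral_le_triInt hL h.metric₂ h.pinch₂ (continuousOn_gradSq hv le_rfl) c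
    (c := (κ * L)⁻¹) (by positivity) (fun x _ => gradSq_nonneg _ _)
    (fun x hx => (h.pinch₂ x hx).inner1_lower hL (dfn v x))
  calc ∫ x in refTri, gradSq v x = κ * ((κ * L)⁻¹ * L * ∫ x in refTri, gradSq v x) := by field_simp
    _ ≤ _ := by gcongr

end MetricPair

end

section

variable {M : Type*} [TopologicalSpace M] [ChartedSpace (EuclideanQuadrant 2) M]

/-! ### Summation over the triangles of a mesh -/

theorem IsElementSpace.contDiffOn_res {Vhat : Submodule ℝ (E2 → ℝ)} (hV : IsRefSpace Vhat)
    {𝒯 : Mesh M} {V : Submodule ℝ (M → ℝ)} (h : IsElementSpace Vhat 𝒯 V) {v : M → ℝ} (hv : v ∈ V)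
    (T : Fin 𝒯.n) : ContDiffOn ℝ 2 (res 𝒯 T v) refTri := by
  obtain ⟨φ, hφ, he⟩ := h.local_mem v hv T
  exact (hV.c2 φ hφ).congr he

theorem IsElementSpace.gradSq_res_le {Vhat : Submodule ℝ (E2 → ℝ)} {𝒯 : Mesh M}
    {V : Submodule ℝ (M → ℝ)} (h : IsElementSpace Vhat 𝒯 V) {v : M → ℝ} (hv : v ∈ V)
    (T : Fin 𝒯.n) {CV : ℝ}
    (hCV : ∀ φ ∈ Vhat, ∀ x ∈ refTri, gradSq φ x ≤ CV * ∫ y in refTri, gradSq φ y) :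
    ∀ x ∈ refTri, gradSq (res 𝒯 T v) x ≤ CV * ∫ y in refTri, gradSq (res 𝒯 T v) y := by
  obtain ⟨φ, hφ, he⟩ := h.local_mem v hv T
  have e : Set.EqOn (gradSq (res 𝒯 T v)) (gradSq φ) refTri := fun x hx => by
    simp only [gradSq, pd_congr he hx]
  intro x hx
  rw [setIntegral_congr_fun isClosed_refTri.measurableSet e, e hx]
  exact hCV φ hφ x hx

variable [IsManifold IQ ∞ M]

/-- The constant in the bound of the energy. -/
def energyConst (κ K' A₁ A₂ : ℝ) : ℝ := √(2 * κ ^ 2 * K' ^ 2 * A₁ ^ 2 + κ ^ 3 * A₂ ^ 2)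

theorem innerL2Form_self_nonneg {𝒯 : Mesh M} {G : Fin 𝒯.n → E2 → Mat} (hG : ∀ T, IsMetric (G T))
    (a : Fin 𝒯.n → E2 → Fin 2 → ℝ) : 0 ≤ innerL2Form 𝒯 G a a :=
  Finset.sum_nonneg fun T _ => triInt_nonneg fun x hx => by
    have hi := ((hG T).posDef x hx).inv.posSemidef.dotProduct_mulVec_nonneg (a T x)
    refine hi.trans_eq ?_
    simp only [inner1, Matrix.mulVec, dotProduct, Fin.sum_univ_two, Pi.star_apply, star_trivial]
    ring

namespace IsAdmissible

variable {g : Metric2 M} {Vhat : Submodule ℝ (E2 → ℝ)} {r : ℕ} {K K' C' A₁ A₂ A₄ h : ℝ}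
  {𝒯 : Mesh M} {γ : ReggeMetric 𝒯} {V : Submodule ℝ (M → ℝ)}

theorem exists_metricPair (ad : IsAdmissible g Vhat r K K' C' A₁ A₂ A₄ h 𝒯 γ V) (hC' : C' < 1)
    (hh : 0 < h) (T : Fin 𝒯.n) :
    ∃ L, MetricPair L (pinchConst K C') (onMesh g 𝒯 T) (γ.G T) ∧ h ^ 2 ≤ 2 * K' ^ 2 * L :=
  Regge.exists_metricPair (isMetric_onMesh g 𝒯 T) (γ.isMetric T) hC' hh (ad.shape T) (ad.quasi T)
    ((le_iSup (fun T => linf2 (onMesh g 𝒯 T) ((γ.G - onMesh g 𝒯) T)) T).trans ad.linf)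

theorem sum_energy_le (ad : IsAdmissible g Vhat r K K' C' A₁ A₂ A₄ h 𝒯 γ V) (hh : 0 < h)
    {κ : ℝ} {L : Fin 𝒯.n → ℝ} (hκ : 0 ≤ κ)
    (hL : ∀ T, MetricPair (L T) κ (onMesh g 𝒯 T) (γ.G T) ∧ h ^ 2 ≤ 2 * K' ^ 2 * L T) :
    √(∑ T, ∫ x in refTri, energy (L T) (onMesh g 𝒯 T) (γ.G T) x) ≤
      energyConst κ K' A₁ A₂ * h ^ r := by
  have l2 := ad.l2
  have br := ad.broken
  rw [normL2Tensor, Real.sqrt_le_iff] at l2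
  rw [brokenNorm, Real.sqrt_le_iff] at br
  have hb : ∀ T, 1 ≤ 2 * K' ^ 2 / h ^ 2 * L T := fun T => by
    rw [div_mul_eq_mul_div, one_le_div (by positivity)]; exact (hL T).2
  rw [energyConst, ← Real.sqrt_sq (pow_nonneg hh.le r), ← Real.sqrt_mul (by positivity)]
  refine Real.sqrt_le_sqrt ((Finset.sum_le_sum fun T _ =>
    (hL T).1.integral_energy_le (hb T)).trans ?_)
  rw [Finset.sum_add_distrib, ← Finset.mul_sum, ← Finset.mul_sum]
  calc _ ≤ κ ^ 2 * (2 * K' ^ 2 / h ^ 2) * (A₁ * h ^ (r + 1)) ^ 2 + κ ^ 3 * (A₂ * h ^ r) ^ 2 :=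
        add_le_add (mul_le_mul_of_nonneg_left l2.2 (by positivity))
          (mul_le_mul_of_nonneg_left br.2 (by positivity))
    _ = _ := by field_simp; ring

/-- Summation of local bounds over the triangles. -/
theorem abs_sum_le (ad : IsAdmissible g Vhat r K K' C' A₁ A₂ A₄ h 𝒯 γ V)
    (hV : IsRefSpace Vhat) (hh : 0 < h) {κ : ℝ} {L : Fin 𝒯.n → ℝ} (hκ : 0 ≤ κ)
    (hL : ∀ T, MetricPair (L T) κ (onMesh g 𝒯 T) (γ.G T) ∧ h ^ 2 ≤ 2 * K' ^ 2 * L T)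
    {v : M → ℝ} (hv : v ∈ V) {c : ℝ} (hc : 0 ≤ c) {ℓ : Fin 𝒯.n → ℝ}
    (hℓ : ∀ T, |ℓ T| ≤ c * (√(∫ x in refTri, energy (L T) (onMesh g 𝒯 T) (γ.G T) x) *
      √(∫ x in refTri, gradSq (res 𝒯 T v) x))) :
    |∑ T, ℓ T| ≤ c * energyConst κ K' A₁ A₂ * √κ * h ^ r * normL2Form 𝒯 γ.G (dM 𝒯 v) := by
  have h1 : ∑ T, |ℓ T| ≤ c * ∑ T, (√(∫ x in refTri, energy (L T) (onMesh g 𝒯 T) (γ.G T) x) *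
      √(∫ x in refTri, gradSq (res 𝒯 T v) x)) := by
    rw [Finset.mul_sum]; exact Finset.sum_le_sum fun T _ => hℓ T
  have h2 := Real.sum_sqrt_mul_sqrt_le Finset.univ
    (f := fun T => ∫ x in refTri, energy (L T) (onMesh g 𝒯 T) (γ.G T) x)
    (g := fun T => ∫ x in refTri, gradSq (res 𝒯 T v) x)
    (fun T => integral_nonneg fun x => energy_nonneg _ _ _ _)
    (fun T => integral_nonneg fun x => gradSq_nonneg _ _)
  have h3 : √(∑ T, ∫ x in refTri, gradSq (res 𝒯 T v) x) ≤ √κ * normL2Form 𝒯 γ.G (dM 𝒯 v) := by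
    rw [normL2Form, ← Real.sqrt_mul hκ, innerL2Form, Finset.mul_sum]
    exact Real.sqrt_le_sqrt (Finset.sum_le_sum fun T _ => (hL T).1.integral_gradSq_le
      ((ad.space.contDiffOn_res hV hv T).of_le (by norm_num)))
  have h4 := ad.sum_energy_le hh hκ hL
  have e0 : 0 ≤ energyConst κ K' A₁ A₂ := Real.sqrt_nonneg _
  calc |∑ T, ℓ T| ≤ ∑ T, |ℓ T| := Finset.abs_sum_le_sum_abs _ _
    _ ≤ _ := h1
    _ ≤ c * (√(∑ T, ∫ x in refTri, energy (L T) (onMesh g 𝒯 T) (γ.G T) x) *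
        √(∑ T, ∫ x in refTri, gradSq (res 𝒯 T v) x)) := by gcongr
    _ ≤ c * (energyConst κ K' A₁ A₂ * h ^ r * (√κ * normL2Form 𝒯 γ.G (dM 𝒯 v))) := by gcongr
    _ = _ := by ring

end IsAdmissible

theorem normL2Form_nonneg {𝒯 : Mesh M} {G : Fin 𝒯.n → E2 → Mat}
    (a : Fin 𝒯.n → E2 → Fin 2 → ℝ) : 0 ≤ normL2Form 𝒯 G a := Real.sqrt_nonneg _

theorem dualNorm_le_of_le {𝒯 : Mesh M} {G : Fin 𝒯.n → E2 → Mat} {V : Submodule ℝ (M → ℝ)}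
    {ℓ : (M → ℝ) → ℝ} {c : ℝ} (hc : 0 ≤ c)
    (h : ∀ v ∈ V, |ℓ v| ≤ c * normL2Form 𝒯 G (dM 𝒯 v)) :
    dualNorm (normHd 𝒯 G) V ℓ ≤ ENNReal.ofReal c := by
  refine iSup₂_le fun v hv => iSup_le fun _ => ENNReal.div_le_of_le_mul ?_
  rw [← ENNReal.ofReal_mul hc]
  refine ENNReal.ofReal_le_ofReal ((h v hv).trans (mul_le_mul_of_nonneg_left ?_ hc))
  exact le_add_of_nonneg_left (Real.sqrt_nonneg _)

theorem bh_eq_sum (𝒯 : Mesh M) (G σ : Fin 𝒯.n → E2 → Mat) (v : M → ℝ) :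
    bh 𝒯 G σ v = ∑ T, ((triInt (G T) fun x => inner2 (G T x) (SS (G T) (σ T) x)
      (hess (G T) (res 𝒯 T v) x)) - ∑ i, sideInt (G T) i fun x =>
        pair (SS (G T) (σ T) x) (nrm (G T) i x) (nrm (G T) i x) *
        dapp (res 𝒯 T v) x (nrm (G T) i x)) := by
  rw [Finset.sum_sub_distrib]; rfl

open Classical in
/-- The part of `Fh` that does not depend on the Regge metric. -/
def frameFun (g : Metric2 M) (e₁ e₂ : ∀ x : M, TangentSpace IQ x) (𝒯 : Mesh M) (v : M → ℝ) : ℝ :=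
  (∑ T, ∑ i, if IsBdrySide 𝒯 T i then
      ∫ s in (0 : ℝ)..1, res 𝒯 T v (sidePt i s) * dMu g e₁ e₂ (𝒯.par T) i s else 0) -
  ∑ p ∈ verts 𝒯, v p * (if ModelWithCorners.IsBoundaryPoint (I := IQ) p then
    Real.pi - jumpMu g e₁ e₂ 𝒯 p else 2 * Real.pi)

omit [IsManifold IQ ∞ M] in
theorem sum_verts_angleSum (𝒯 : Mesh M) (G : Fin 𝒯.n → E2 → Mat) (v : M → ℝ) :
    ∑ p ∈ verts 𝒯, v p * angleSum 𝒯 G p = ∑ T, ∑ i, res 𝒯 T v (vtx i) * angle (G T) i := by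
  classical
  simp only [angleSum, Finset.mul_sum, mul_ite, mul_zero]
  rw [Finset.sum_comm]
  refine Finset.sum_congr rfl fun T _ => ?_
  rw [Finset.sum_comm]
  refine Finset.sum_congr rfl fun i _ => ?_
  rw [Finset.sum_ite_eq]
  rw [if_pos]
  · rfl
  · exact Finset.mem_image.2 ⟨(T, i), Finset.mem_univ _, rfl⟩

theorem Fh_eq (g : Metric2 M) (e₁ e₂ : ∀ x : M, TangentSpace IQ x) (𝒯 : Mesh M)
    (G : Fin 𝒯.n → E2 → Mat) (v : M → ℝ) :
    Fh g e₁ e₂ 𝒯 G v = frameFun g e₁ e₂ 𝒯 v - ∑ T, curvFun (G T) (res 𝒯 T v) := by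
  classical
  have h1 : ∑ T, curvFun (G T) (res 𝒯 T v) =
      (∑ T, triInt (G T) fun x => res 𝒯 T v x * gaussK (G T) x) +
      (∑ T, ∑ i, sideInt (G T) i fun x => res 𝒯 T v x * geoK (G T) i x) -
      ∑ p ∈ verts 𝒯, v p * angleSum 𝒯 G p := by
    rw [sum_verts_angleSum, ← Finset.sum_add_distrib, ← Finset.sum_sub_distrib]; rfl
  have h2 : ∀ T (i : Fin 3), (if IsBdrySide 𝒯 T i then
      (∫ s in (0 : ℝ)..1, res 𝒯 T v (sidePt i s) * dMu g e₁ e₂ (𝒯.par T) i s) -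
        sideInt (G T) i (fun x => res 𝒯 T v x * geoK (G T) i x) else 0) =
      (if IsBdrySide 𝒯 T i then
        ∫ s in (0 : ℝ)..1, res 𝒯 T v (sidePt i s) * dMu g e₁ e₂ (𝒯.par T) i s else 0) -
      (sideInt (G T) i (fun x => res 𝒯 T v x * geoK (G T) i x) -
        if IsBdrySide 𝒯 T i then 0 else
          sideInt (G T) i fun x => res 𝒯 T v x * geoK (G T) i x) := by
    intro T i; split_ifs <;> ring
  have h3 : ∀ p, (v p * (if ModelWithCorners.IsBoundaryPoint (I := IQ) p then
      Real.pi - jumpMu g e₁ e₂ 𝒯 p else 2 * Real.pi)) =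
      (if ModelWithCorners.IsBoundaryPoint (I := IQ) p then
        v p * (Real.pi - jumpMu g e₁ e₂ 𝒯 p - angleSum 𝒯 G p) else 0) +
      (if ModelWithCorners.IsBoundaryPoint (I := IQ) p then 0 else
        v p * (2 * Real.pi - angleSum 𝒯 G p)) + v p * angleSum 𝒯 G p := by
    intro p; split_ifs <;> ring
  rw [h1, Fh, alphaDist, KdAdist, frameFun]
  simp only [h2, h3, Finset.sum_add_distrib, Finset.sum_sub_distrib]
  ring

/-! ### The two estimates -/

section Estimates

variable {g : Metric2 M} {Vhat : Submodule ℝ (E2 → ℝ)} {r : ℕ} {K K' C' A₁ A₂ A₄ h : ℝ}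
  {𝒯 : Mesh M} {γ : ReggeMetric 𝒯} {V : Submodule ℝ (M → ℝ)}

theorem pinchConst_nonneg (hC' : C' < 1) : 0 ≤ pinchConst K C' :=
  div_nonneg (by positivity) (sub_nonneg.2 (max_lt hC' one_pos).le)

theorem functionalConst_nonneg {κ c CV : ℝ} (hc : 0 ≤ c) : 0 ≤ functionalConst κ c CV := by
  unfold functionalConst; positivity

/-- The constant in the estimate of `bh`. -/
def bhConst (K K' C' A₁ A₂ CV : ℝ) : ℝ :=
  functionalConst (pinchConst K C')
    (2 + 48 * pinchConst K C' ^ 2 + 8 * pinchConst K C') CV *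
      energyConst (pinchConst K C') K' A₁ A₂ * √(pinchConst K C')

/-- The constant in the estimate of the difference of the functionals `Fh`. -/
def FhConst (K K' C' A₁ A₂ CV : ℝ) : ℝ :=
  functionalConst (pinchConst K C')
    (2 + 3 * pinchConst K C' + 7 * pinchConst K C' ^ 2 + 3 * pinchConst K C' ^ 3) CV *
      energyConst (pinchConst K C') K' A₁ A₂ * √(pinchConst K C')

theorem abs_bh_le (ad : IsAdmissible g Vhat r K K' C' A₁ A₂ A₄ h 𝒯 γ V) (hV : IsRefSpace Vhat)
    (hC' : C' < 1) (hh : 0 < h) {CV : ℝ} (hCV : 0 ≤ CV)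
    (hinv : ∀ φ ∈ Vhat, ∀ x ∈ refTri, gradSq φ x ≤ CV * ∫ y in refTri, gradSq φ y)
    {t : ℝ} (ht : t ∈ Set.Icc (0:ℝ) 1) {v : M → ℝ} (hv : v ∈ V) :
    |bh 𝒯 (t • γ.G + (1 - t) • onMesh g 𝒯) (onMesh g 𝒯 - γ.G) v| ≤
      bhConst K K' C' A₁ A₂ CV * h ^ r * normL2Form 𝒯 γ.G (dM 𝒯 v) := by
  choose L hL using fun T => ad.exists_metricPair hC' hh T
  have hκ := pinchConst_nonneg (K := K) hC'
  rw [bh_eq_sum]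
  exact ad.abs_sum_le hV hh hκ hL hv (functionalConst_nonneg (by positivity)) fun T =>
    (hL T).1.local_bh_le hCV (ad.space.contDiffOn_res hV hv T)
      (ad.space.gradSq_res_le hv T hinv) ht

theorem abs_Fh_sub_le (ad : IsAdmissible g Vhat r K K' C' A₁ A₂ A₄ h 𝒯 γ V)
    (hV : IsRefSpace Vhat) (hC' : C' < 1) (hh : 0 < h) {CV : ℝ} (hCV : 0 ≤ CV)
    (hinv : ∀ φ ∈ Vhat, ∀ x ∈ refTri, gradSq φ x ≤ CV * ∫ y in refTri, gradSq φ y)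
    (e₁ e₂ : ∀ x : M, TangentSpace IQ x) {v : M → ℝ} (hv : v ∈ V) :
    |Fh g e₁ e₂ 𝒯 (onMesh g 𝒯) v - Fh g e₁ e₂ 𝒯 γ.G v| ≤
      FhConst K K' C' A₁ A₂ CV * h ^ r * normL2Form 𝒯 γ.G (dM 𝒯 v) := by
  choose L hL using fun T => ad.exists_metricPair hC' hh T
  have hκ := pinchConst_nonneg (K := K) hC'
  rw [Fh_eq, Fh_eq, sub_sub_sub_cancel_left, ← Finset.sum_sub_distrib]
  exact ad.abs_sum_le hV hh hκ hL hv (functionalConst_nonneg (by positivity)) fun T =>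
    (hL T).1.curvFun_sub_le hCV (ad.space.contDiffOn_res hV hv T)
      (ad.space.gradSq_res_le hv T hinv)

theorem bhConst_nonneg (hC' : C' < 1) {CV : ℝ} : 0 ≤ bhConst K K' C' A₁ A₂ CV := by
  have hκ := pinchConst_nonneg (K := K) hC'
  have := functionalConst_nonneg (κ := pinchConst K C') (CV := CV)
    (c := 2 + 48 * pinchConst K C' ^ 2 + 8 * pinchConst K C') (by positivity)
  unfold bhConst energyConst; positivity

theorem FhConst_nonneg (hC' : C' < 1) {CV : ℝ} : 0 ≤ FhConst K K' C' A₁ A₂ CV := by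
  have hκ := pinchConst_nonneg (K := K) hC'
  have := functionalConst_nonneg (κ := pinchConst K C') (CV := CV)
    (c := 2 + 3 * pinchConst K C' + 7 * pinchConst K C' ^ 2 + 3 * pinchConst K C' ^ 3)
    (by positivity)
  unfold FhConst energyConst; positivity

end Estimates

/-- The bounds of `bh` and of the difference of the functionals `Fh` in the dual norm. -/
theorem exists_dualNorm_le (g : Metric2 M) {Vhat : Submodule ℝ (E2 → ℝ)} (hVhat : IsRefSpace Vhat)
    (r : ℕ) (K K' : ℝ) {C' : ℝ} (A₁ A₂ A₄ : ℝ) (hC' : C' < 1) :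
    ∃ C : ℝ, ∀ (S : Set ℝ) (_ : ∀ h ∈ S, 0 < h) (𝒯 : S → Mesh M)
      (γ : ∀ h : S, ReggeMetric (𝒯 h)) (V : S → Submodule ℝ (M → ℝ)),
      (∀ h : S, IsAdmissible g Vhat r K K' C' A₁ A₂ A₄ h (𝒯 h) (γ h) (V h)) →
      ∀ h : S,
        (∀ t ∈ Set.Icc (0 : ℝ) 1,
          dualNorm (normHd (𝒯 h) (γ h).G) (V h)
            (bh (𝒯 h) (t • (γ h).G + (1 - t) • onMesh g (𝒯 h)) (onMesh g (𝒯 h) - (γ h).G))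
            ≤ ENNReal.ofReal (C * (h : ℝ) ^ r)) ∧
        (∀ e₁ e₂ : ∀ x : M, TangentSpace IQ x, IsFrame g e₁ e₂ →
          (∀ T, PreservesOrientation e₁ e₂ ((𝒯 h).par T)) →
          dualNorm (normHd (𝒯 h) (γ h).G) (V h)
            (Fh g e₁ e₂ (𝒯 h) (onMesh g (𝒯 h)) - Fh g e₁ e₂ (𝒯 h) (γ h).G)
            ≤ ENNReal.ofReal (C * (h : ℝ) ^ r)) := by
  obtain ⟨CV, hCV, hinv⟩ := exists_gradSq_le hVhat
  refine ⟨bhConst K K' C' A₁ A₂ CV + FhConst K K' C' A₁ A₂ CV, fun S hS 𝒯 γ V ad h => ?_⟩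
  have hh : 0 < (h : ℝ) := hS h h.2
  have hb := bhConst_nonneg (K := K) (K' := K') (A₁ := A₁) (A₂ := A₂) (CV := CV) hC'
  have hF := FhConst_nonneg (K := K) (K' := K') (A₁ := A₁) (A₂ := A₂) (CV := CV) hC'
  refine ⟨fun t ht => dualNorm_le_of_le (by positivity) fun v hv =>
    (abs_bh_le (ad h) hVhat hC' hh hCV hinv ht hv).trans ?_,
    fun e₁ e₂ _ _ => dualNorm_le_of_le (by positivity) fun v hv =>
    (abs_Fh_sub_le (ad h) hVhat hC' hh hCV hinv e₁ e₂ hv).trans ?_⟩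
  · have := normL2Form_nonneg (G := (γ h).G) (dM (𝒯 h) v)
    gcongr; linarith
  · have := normL2Form_nonneg (G := (γ h).G) (dM (𝒯 h) v)
    gcongr; linarith

end

section

/-! ### Coframes and the connection form -/

/-- A smooth positively oriented orthonormal coframe `(a, b)` of the metric `G`. -/
structure Coframe (G : E2 → Mat) (a b : Fin 2 → E2 → ℝ) : Prop where
  smooth₁ : ∀ k, ContDiffOn ℝ ∞ (a k) refTri
  smooth₂ : ∀ k, ContDiffOn ℝ ∞ (b k) refTri
  eq : ∀ x ∈ refTri, ∀ i j, G x i j = a i x * a j x + b i x * b j x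
  pos : ∀ x ∈ refTri, 0 < a 0 x * b 1 x - a 1 x * b 0 x

/-- `(p, q)` is the frame dual to the coframe `(a, b)`. -/
structure DualFrame (a b : Fin 2 → E2 → ℝ) (p q : E2 → E2) : Prop where
  p0 : ∀ x ∈ refTri, p x 0 = b 1 x / (a 0 x * b 1 x - a 1 x * b 0 x)
  p1 : ∀ x ∈ refTri, p x 1 = - b 0 x / (a 0 x * b 1 x - a 1 x * b 0 x)
  q0 : ∀ x ∈ refTri, q x 0 = - a 1 x / (a 0 x * b 1 x - a 1 x * b 0 x)
  q1 : ∀ x ∈ refTri, q x 1 = a 0 x / (a 0 x * b 1 x - a 1 x * b 0 x)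

theorem cartan_algebra {a₀ a₁ b₀ b₁ r₀ r₁ s₀ s₁ P : ℝ} (hP : P = a₀ * b₁ - a₁ * b₀) (hP0 : P ≠ 0)
    (h00 : a₀ * r₀ + b₀ * s₀ = 0) (h01 : a₀ * r₁ + a₁ * r₀ + b₀ * s₁ + b₁ * s₀ = 0)
    (h11 : a₁ * r₁ + b₁ * s₁ = 0) :
    r₀ = - ((a₁ * r₀ - a₀ * r₁) / P) * b₀ ∧ r₁ = - ((a₁ * r₀ - a₀ * r₁) / P) * b₁ ∧
    s₀ = (a₁ * r₀ - a₀ * r₁) / P * a₀ ∧ s₁ = (a₁ * r₀ - a₀ * r₁) / P * a₁ := by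
  have hr : b₁ * r₀ - b₀ * r₁ = 0 := by
    have : P * (b₁ * r₀ - b₀ * r₁) = 0 := by
      rw [hP]; linear_combination b₁ ^ 2 * h00 - b₀ * b₁ * h01 + b₀ ^ 2 * h11
    exact (mul_eq_zero.1 this).resolve_left hP0
  have hs : a₁ * s₀ - a₀ * s₁ = 0 := by
    have : P * (a₁ * s₀ - a₀ * s₁) = 0 := by
      rw [hP]; linear_combination - a₁ ^ 2 * h00 + a₀ * a₁ * h01 - a₀ ^ 2 * h11
    exact (mul_eq_zero.1 this).resolve_left hP0
  refine ⟨?_, ?_, ?_, ?_⟩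
  · field_simp; rw [hP]; linear_combination a₀ * hr
  · field_simp; rw [hP]; linear_combination a₁ * hr
  · field_simp; rw [hP]; linear_combination a₀ * h01 - 2 * a₁ * h00 + b₀ * hs
  · field_simp; rw [hP]; linear_combination - a₁ * h01 + 2 * a₀ * h11 + b₁ * hs

namespace Coframe

variable {G : E2 → Mat} {a b : Fin 2 → E2 → ℝ} (c : Coframe G a b) (hG : IsMetric G)
include c hG

theorem dvol_eq {x : E2} (hx : x ∈ refTri) : dvol G x = a 0 x * b 1 x - a 1 x * b 0 x := by
  have : dvol G x ^ 2 = (a 0 x * b 1 x - a 1 x * b 0 x) ^ 2 := by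
    rw [hG.dvol_sq hx]; simp only [c.eq x hx]; ring
  exact (pow_left_inj₀ (hG.dvol_pos hx).le (c.pos x hx).le two_ne_zero).1 this

/-- The structure equations of the Levi-Civita connection. -/
theorem pd_eq {p q : E2 → E2} (d : DualFrame a b p q) {x : E2} (hx : x ∈ refTri) (k i : Fin 2) :
    pd k (a i) x = chris G 0 k i x * a 0 x + chris G 1 k i x * a 1 x - connForm G p q x k * b i x ∧
    pd k (b i) x = chris G 0 k i x * b 0 x + chris G 1 k i x * b 1 x +
      connForm G p q x k * a i x := by
  have ha := fun j => HasPd.of_contDiffOn (c.smooth₁ j) (by simp) hx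
  have hb := fun j => HasPd.of_contDiffOn (c.smooth₂ j) (by simp) hx
  have hP := c.pos x hx
  have hP0 := hP.ne'
  have hq0 : pd k (fun y => q y 0) x = _ := (pd_congr d.q0 hx k).trans
    (((ha 1).neg.div (((ha 0).mul (hb 1)).sub ((ha 1).mul (hb 0))) hP0).pd_eq hx k)
  have hq1 : pd k (fun y => q y 1) x = _ := (pd_congr d.q1 hx k).trans
    (((ha 0).div (((ha 0).mul (hb 1)).sub ((ha 1).mul (hb 0))) hP0).pd_eq hx k)
  have hen : ∀ i j, pd k (fun y => G y i j) x = _ := fun i j =>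
    (pd_congr (fun y hy => c.eq y hy i j) hx k).trans
      ((((ha i).mul (ha j)).add ((hb i).mul (hb j))).pd_eq hx k)
  have e := fun i j => (hen i j).symm.trans (hG.pd_entry hx k i j)
  have e00 := e 0 0
  have e01 := e 0 1
  have e11 := e 1 1
  have al : connForm G p q x k =
      (a 1 x * (pd k (a 0) x - (chris G 0 k 0 x * a 0 x + chris G 1 k 0 x * a 1 x)) -
      a 0 x * (pd k (a 1) x - (chris G 0 k 1 x * a 0 x + chris G 1 k 1 x * a 1 x))) /
        (a 0 x * b 1 x - a 1 x * b 0 x) := by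
    simp only [connForm, Fin.sum_univ_two, hq0, hq1, d.p0 x hx, d.p1 x hx, d.q0 x hx, d.q1 x hx,
      c.eq x hx]
    generalize hPe : a 0 x * b 1 x - a 1 x * b 0 x = P at *
    field_simp
    rw [← hPe]
    ring
  simp only [c.eq x hx] at e00 e01 e11
  have key := cartan_algebra
    (r₀ := pd k (a 0) x - (chris G 0 k 0 x * a 0 x + chris G 1 k 0 x * a 1 x))
    (r₁ := pd k (a 1) x - (chris G 0 k 1 x * a 0 x + chris G 1 k 1 x * a 1 x))
    (s₀ := pd k (b 0) x - (chris G 0 k 0 x * b 0 x + chris G 1 k 0 x * b 1 x))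
    (s₁ := pd k (b 1) x - (chris G 0 k 1 x * b 0 x + chris G 1 k 1 x * b 1 x)) rfl hP0
    (by linear_combination e00 / 2) (by linear_combination e01) (by linear_combination e11 / 2)
  rw [← al] at key
  obtain ⟨k0, k1, k2, k3⟩ := key
  fin_cases i
  · exact ⟨by simp only [Fin.zero_eta]; linarith, by simp only [Fin.zero_eta]; linarith⟩
  · exact ⟨by simp only [Fin.mk_one]; linarith, by simp only [Fin.mk_one]; linarith⟩

theorem connForm_eq {p q : E2 → E2} (d : DualFrame a b p q) {x : E2} (hx : x ∈ refTri)
    (k : Fin 2) : connForm G p q x k =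
      (a 0 x * (pd k (b 0) x - (chris G 0 k 0 x * b 0 x + chris G 1 k 0 x * b 1 x)) -
        b 0 x * (pd k (a 0) x - (chris G 0 k 0 x * a 0 x + chris G 1 k 0 x * a 1 x))) /
        G x 0 0 := by
  obtain ⟨h1, h2⟩ := c.pd_eq hG d hx k 0
  have hE := (hG.diag_pos hx 0).ne'
  rw [h1, h2, eq_div_iff hE, c.eq x hx]
  ring

theorem contDiffOn_connForm {p q : E2 → E2} (d : DualFrame a b p q) (k : Fin 2) :
    ContDiffOn ℝ ∞ (fun x => connForm G p q x k) refTri := by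
  have ca := fun i => contDiffOn_pd (m := ∞) (c.smooth₁ i) (by simp) k
  have cb := fun i => contDiffOn_pd (m := ∞) (c.smooth₂ i) (by simp) k
  have cc := fun l => hG.contDiffOn_chris l k 0
  refine ContDiffOn.congr ?_ fun x hx => c.connForm_eq hG d hx k
  exact (((c.smooth₁ 0).mul ((cb 0).sub (((cc 0).mul (c.smooth₂ 0)).add
    ((cc 1).mul (c.smooth₂ 1))))).sub ((c.smooth₂ 0).mul ((ca 0).sub (((cc 0).mul (c.smooth₁ 0)).add
    ((cc 1).mul (c.smooth₁ 1)))))).div (hG.smooth 0 0) fun x hx => (hG.diag_pos hx 0).ne'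

/-- The exterior derivative of the connection form is the curvature form. -/
theorem curl_connForm {p q : E2 → E2} (d : DualFrame a b p q) {x : E2} (hx : x ∈ refTri) :
    pd 0 (fun y => connForm G p q y 1) x - pd 1 (fun y => connForm G p q y 0) x =
      gaussK G x * dvol G x := by
  have ha := fun j => HasPd.of_contDiffOn (c.smooth₁ j) (by simp) hx
  have hb := fun j => HasPd.of_contDiffOn (c.smooth₂ j) (by simp) hx
  have hc : ∀ l i j, HasPd (chris G l i j) (fun k => pd k (chris G l i j) x) x := fun l i j =>
    HasPd.of_contDiffOn (hG.contDiffOn_chris l i j) (by simp) hx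
  have hα := fun k => HasPd.of_contDiffOn (c.contDiffOn_connForm hG d k) (by simp) hx
  have sym : ∀ l k, pd k (chris G l 1 0) x = pd k (chris G l 0 1) x := fun l k =>
    pd_congr (fun y hy => hG.chris_symm hy l 1 0) hx k
  have fa : ∀ k j, pd j (pd k (a 1)) x = _ := fun k j =>
    (pd_congr (fun y hy => (c.pd_eq hG d hy k 1).1) hx j).trans
      (((((hc 0 k 1).mul (ha 0)).add ((hc 1 k 1).mul (ha 1))).sub ((hα k).mul (hb 1))).pd_eq hx j)
  have fb : ∀ k j, pd j (pd k (b 1)) x = _ := fun k j =>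
    (pd_congr (fun y hy => (c.pd_eq hG d hy k 1).2) hx j).trans
      (((((hc 0 k 1).mul (hb 0)).add ((hc 1 k 1).mul (hb 1))).add ((hα k).mul (ha 1))).pd_eq hx j)
  have c1 := pd_comm ((c.smooth₁ 1).of_le (by norm_cast)) hx
  have c2 := pd_comm ((c.smooth₂ 1).of_le (by norm_cast)) hx
  rw [fa, fa] at c1
  rw [fb, fb] at c2
  simp only [c.pd_eq hG d hx, hG.chris_symm hx _ 1 0] at c1 c2
  have hP := c.pos x hx
  have hdv := c.dvol_eq hG hx
  have hdet : (G x).det = (a 0 x * b 1 x - a 1 x * b 0 x) ^ 2 := by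
    rw [hG.det_eq hx]; simp only [c.eq x hx]; ring
  rw [gaussK, hdv, hdet]
  simp only [riem, Fin.sum_univ_two, c.eq x hx, hG.chris_symm hx _ 1 0]
  have hP0 := hP.ne'
  rw [div_mul_eq_mul_div, eq_div_iff (pow_ne_zero 2 hP0)]
  generalize pd 0 (fun y => connForm G p q y 1) x = A at *
  generalize pd 1 (fun y => connForm G p q y 0) x = B at *
  linear_combination (-(a 0 x * (a 0 x * b 1 x - a 1 x * b 0 x))) * c1 -
    (b 0 x * (a 0 x * b 1 x - a 1 x * b 0 x)) * c2

end Coframe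

end

section

/-! ### The direction of the normal along a side -/

/-- The outward unit normal along a side, in the frame `(p, q)`, as a complex number. -/
def expNormal (G : E2 → Mat) (p q : E2 → E2) (i : Fin 3) (s : ℝ) : ℂ :=
  ⟨pair (G (sidePt i s)) (p (sidePt i s)) (nrm G i (sidePt i s)),
    pair (G (sidePt i s)) (q (sidePt i s)) (nrm G i (sidePt i s))⟩

/-- The derivative of the argument of the normal. -/
def dNormal (G : E2 → Mat) (p q : E2 → E2) (i : Fin 3) (s : ℝ) : ℝ :=
  (starRingEnd ℂ (expNormal G p q i s) *
    derivWithin (expNormal G p q i) (Set.Icc 0 1) s).im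

/-- The value of the complex valued form `a + i b` on a vector. -/
def cplx (a b : Fin 2 → E2 → ℝ) (x w : E2) : ℂ :=
  ⟨a 0 x * w 0 + a 1 x * w 1, b 0 x * w 0 + b 1 x * w 1⟩

namespace Coframe

variable {G : E2 → Mat} {a b : Fin 2 → E2 → ℝ} (c : Coframe G a b)
include c

theorem pair_eq {x : E2} (hx : x ∈ refTri) (v w : E2) :
    pair (G x) v w = (starRingEnd ℂ (cplx a b x v) * cplx a b x w).re := by
  simp only [pair, Fin.sum_univ_two, c.eq x hx, cplx, Complex.mul_re, Complex.conj_re,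
    Complex.conj_im]
  ring

theorem len_eq {x : E2} (hx : x ∈ refTri) (v : E2) : len (G x) v = ‖cplx a b x v‖ := by
  rw [len, c.pair_eq hx, ← Complex.normSq_eq_conj_mul_self, Complex.ofReal_re, Complex.norm_def]

theorem cplx_ne_zero (hG : IsMetric G) {x : E2} (hx : x ∈ refTri) {v : E2} (hv : v ≠ 0) :
    cplx a b x v ≠ 0 := by
  have := hG.len_pos hx hv
  rw [c.len_eq hx, norm_pos_iff] at this
  exact this

variable (hG : IsMetric G)
include hG

theorem pair_nrm {p q : E2 → E2} (d : DualFrame a b p q) {x : E2} (hx : x ∈ refTri) (i : Fin 3) :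
    pair (G x) (p x) (nrm G i x) =
        (b 0 x * sideDir i 0 + b 1 x * sideDir i 1) / len (G x) (sideDir i) ∧
    pair (G x) (q x) (nrm G i x) =
        - (a 0 x * sideDir i 0 + a 1 x * sideDir i 1) / len (G x) (sideDir i) := by
  obtain ⟨n0, n1⟩ := hG.nrm_eq hx i
  have hP := c.pos x hx
  have hP0 := hP.ne'
  have hl := (hG.len_pos hx (sideDir_ne_zero i)).ne'
  simp only [pair, Fin.sum_univ_two, n0, n1, c.dvol_eq hG hx, d.p0 x hx, d.p1 x hx, d.q0 x hx,
    d.q1 x hx, c.eq x hx]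
  generalize hPe : a 0 x * b 1 x - a 1 x * b 0 x = P at *
  constructor
  · field_simp; rw [← hPe]; ring
  · field_simp; rw [← hPe]; ring

theorem expNormal_eq {p q : E2 → E2} (d : DualFrame a b p q) (i : Fin 3) {s : ℝ}
    (hs : s ∈ Set.Icc (0:ℝ) 1) : expNormal G p q i s =
      - Complex.I * cplx a b (sidePt i s) (sideDir i) / ‖cplx a b (sidePt i s) (sideDir i)‖ := by
  have hx := sidePt_mem i hs
  obtain ⟨h1, h2⟩ := c.pair_nrm hG d hx i
  rw [c.len_eq hx] at h1 h2
  apply Complex.ext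
  · rw [Complex.div_ofReal_re, expNormal, h1]; simp [cplx]
  · rw [Complex.div_ofReal_im, expNormal, h2]; simp [cplx]

theorem dNormal_eq {p q : E2 → E2} (d : DualFrame a b p q) (i : Fin 3) {s : ℝ}
    (hs : s ∈ Set.Icc (0:ℝ) 1) :
    dNormal G p q i s = geoK G i (sidePt i s) * len (G (sidePt i s)) (sideDir i) +
      (connForm G p q (sidePt i s) 0 * sideDir i 0 + connForm G p q (sidePt i s) 1 * sideDir i 1) := by
  have hx := sidePt_mem i hs
  set x := sidePt i s with hxd
  set C : E2 → ℝ := fun y => a 0 y * sideDir i 0 + a 1 y * sideDir i 1 with hC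
  set D : E2 → ℝ := fun y => b 0 y * sideDir i 0 + b 1 y * sideDir i 1 with hD
  have hl2 : ∀ y ∈ refTri, 0 < C y ^ 2 + D y ^ 2 := fun y hy => by
    have := hG.pair_pos hy (sideDir_ne_zero i)
    rw [hG.pair_self_eq hy] at this
    simp only [c.eq y hy] at this
    simp only [hC, hD]; nlinarith
  have hlen : ∀ y ∈ refTri, len (G y) (sideDir i) = √(C y ^ 2 + D y ^ 2) := fun y hy => by
    rw [len, hG.pair_self_eq hy]; simp only [c.eq y hy, hC, hD]; congr 1; ring
  have sC : ContDiffOn ℝ ∞ C refTri := ((c.smooth₁ 0).mul contDiffOn_const).add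
    ((c.smooth₁ 1).mul contDiffOn_const)
  have sD : ContDiffOn ℝ ∞ D refTri := ((c.smooth₂ 0).mul contDiffOn_const).add
    ((c.smooth₂ 1).mul contDiffOn_const)
  have hsq : ContDiffOn ℝ ∞ (fun y => √(C y ^ 2 + D y ^ 2)) refTri :=
    ((sC.pow 2).add (sD.pow 2)).sqrt fun y hy => (hl2 y hy).ne'
  have h0 : ∀ y ∈ refTri, √(C y ^ 2 + D y ^ 2) ≠ 0 := fun y hy => (Real.sqrt_pos.2 (hl2 y hy)).ne'
  have sX := sD.div hsq h0
  have sY := sC.neg.div hsq h0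
  have hXpd := fun k => (((HasPd.of_contDiffOn sD (by simp) hx).div
    (HasPd.of_contDiffOn hsq (by simp) hx) (h0 x hx))).pd_eq hx k
  have hYpd := fun k => (((HasPd.of_contDiffOn sC (by simp) hx).neg.div
    (HasPd.of_contDiffOn hsq (by simp) hx) (h0 x hx))).pd_eq hx k
  have dX := hasDerivWithinAt_comp_sidePt i (sX.differentiableOn (by simp) x hx)
  have dY := hasDerivWithinAt_comp_sidePt i (sY.differentiableOn (by simp) x hx)
  have eE : ∀ t ∈ Set.Icc (0:ℝ) 1, expNormal G p q i t =
      (((D (sidePt i t) / √(C (sidePt i t) ^ 2 + D (sidePt i t) ^ 2) : ℝ) : ℂ) +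
      ((- C (sidePt i t) / √(C (sidePt i t) ^ 2 + D (sidePt i t) ^ 2) : ℝ) : ℂ) * Complex.I) := by
    intro t ht
    have hy := sidePt_mem i ht
    obtain ⟨h1, h2⟩ := c.pair_nrm hG d hy i
    rw [hlen _ hy] at h1 h2
    apply Complex.ext
    · simp only [expNormal, h1, Complex.add_re, Complex.ofReal_re, Complex.re_ofReal_mul,
        Complex.I_re, mul_zero, add_zero, hD]
    · simp only [expNormal, h2, Complex.add_im, Complex.ofReal_im, Complex.im_ofReal_mul,
        Complex.I_im, mul_one, zero_add, hC]
  have hder := ((dX.ofReal_comp.add (dY.ofReal_comp.mul_const Complex.I)).congr eE (eE s hs)).derivWithin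
    (uniqueDiffOn_Icc zero_lt_one s hs)
  rw [dNormal, hder, eE s hs]
  have hCpd : ∀ k, pd k C x = pd k (a 0) x * sideDir i 0 + pd k (a 1) x * sideDir i 1 := fun k => by
    have := (((HasPd.of_contDiffOn (c.smooth₁ 0) (by simp) hx).mul (HasPd.const (sideDir i 0))).add
      ((HasPd.of_contDiffOn (c.smooth₁ 1) (by simp) hx).mul (HasPd.const (sideDir i 1)))).pd_eq hx k
    simpa using this
  have hDpd : ∀ k, pd k D x = pd k (b 0) x * sideDir i 0 + pd k (b 1) x * sideDir i 1 := fun k => by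
    have := (((HasPd.of_contDiffOn (c.smooth₂ 0) (by simp) hx).mul (HasPd.const (sideDir i 0))).add
      ((HasPd.of_contDiffOn (c.smooth₂ 1) (by simp) hx).mul (HasPd.const (sideDir i 1)))).pd_eq hx k
    simpa using this
  have him : ∀ X Y X' Y' : ℝ, (starRingEnd ℂ ((X : ℂ) + (Y : ℂ) * Complex.I) *
      ((X' : ℂ) + (Y' : ℂ) * Complex.I)).im = X * Y' - Y * X' := by
    intro X Y X' Y'; simp; ring
  rw [him]
  have hXd : dapp (fun y => D y / √(C y ^ 2 + D y ^ 2)) x (sideDir i) =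
      (dapp D x (sideDir i) * √(C x ^ 2 + D x ^ 2) -
        D x * dapp (fun y => √(C y ^ 2 + D y ^ 2)) x (sideDir i)) / √(C x ^ 2 + D x ^ 2) ^ 2 := by
    simp only [dapp, Fin.sum_univ_two, hXpd]; ring
  have hYd : dapp (fun y => - C y / √(C y ^ 2 + D y ^ 2)) x (sideDir i) =
      (- dapp C x (sideDir i) * √(C x ^ 2 + D x ^ 2) +
        C x * dapp (fun y => √(C y ^ 2 + D y ^ 2)) x (sideDir i)) / √(C x ^ 2 + D x ^ 2) ^ 2 := by
    simp only [dapp, Fin.sum_univ_two, hYpd]; ring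
  have e1 : D x / √(C x ^ 2 + D x ^ 2) *
      dapp (fun y => - C y / √(C y ^ 2 + D y ^ 2)) x (sideDir i) -
      - C x / √(C x ^ 2 + D x ^ 2) * dapp (fun y => D y / √(C y ^ 2 + D y ^ 2)) x (sideDir i) =
      (C x * dapp D x (sideDir i) - D x * dapp C x (sideDir i)) / (C x ^ 2 + D x ^ 2) := by
    have hR := h0 x hx
    have hR2 : √(C x ^ 2 + D x ^ 2) ^ 2 = C x ^ 2 + D x ^ 2 := Real.sq_sqrt (hl2 x hx).le
    rw [hXd, hYd]
    generalize √(C x ^ 2 + D x ^ 2) = R at *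
    rw [← hR2]
    field_simp
    ring
  refine e1.trans ?_
  have hN := (hl2 x hx).ne'
  have hN2 : G x 0 0 * sideDir i 0 ^ 2 + 2 * G x 0 1 * sideDir i 0 * sideDir i 1 +
      G x 1 1 * sideDir i 1 ^ 2 = C x ^ 2 + D x ^ 2 := by
    simp only [c.eq x hx, hC, hD]; ring
  rw [geoK_mul_len hG hx, hG.pair_self_eq hx, hN2, div_add' _ _ _ hN]
  congr 1
  simp only [dapp, Fin.sum_univ_two, hCpd, hDpd, c.pd_eq hG d hx, c.dvol_eq hG hx, accel]
  simp only [hC, hD]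
  ring

/-- The local curvature functional in terms of the connection form and the normals. -/
theorem curvFun_eq {p q : E2 → E2} (d : DualFrame a b p q) {v : E2 → ℝ}
    (hv : ContDiffOn ℝ 1 v refTri) :
    curvFun G v = (∑ i, ∫ s in (0:ℝ)..1, v (sidePt i s) * dNormal G p q i s) -
      (∫ x in refTri, (pd 0 v x * connForm G p q x 1 - pd 1 v x * connForm G p q x 0)) -
      ∑ i, v (vtx i) * angle G i := by
  have hα := fun k => (c.contDiffOn_connForm hG d k).of_le one_le_smooth
  have e1 : triInt G (fun x => v x * gaussK G x) = ∫ x in refTri, v x *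
      (pd 0 (fun y => connForm G p q y 1) x - pd 1 (fun y => connForm G p q y 0) x) :=
    setIntegral_congr_fun isClosed_refTri.measurableSet fun x hx => by
      simp only [c.curl_connForm hG d hx]; ring
  have cα : ∀ i : Fin 3, ContinuousOn (fun x => v x * (connForm G p q x 0 * sideDir i 0 +
      connForm G p q x 1 * sideDir i 1)) refTri := fun i => hv.continuousOn.mul
    (((hα 0).continuousOn.mul continuousOn_const).add ((hα 1).continuousOn.mul continuousOn_const))
  have cl : ∀ i, ContinuousOn (fun x => v x * (geoK G i x * len (G x) (sideDir i))) refTri := by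
    intro i
    refine hv.continuousOn.mul (ContinuousOn.congr ?_ fun x hx => geoK_mul_len hG hx i)
    have ch := fun l p q => (hG.contDiffOn_chris l p q).continuousOn
    have ca : ∀ l, ContinuousOn (fun x => accel G i x l) refTri := fun l => by
      simp only [accel]
      exact continuousOn_finsetSum _ fun p _ => continuousOn_finsetSum _ fun q _ =>
        ((ch l p q).mul continuousOn_const).mul continuousOn_const
    refine (hG.contDiffOn_dvol.continuousOn.mul ((continuousOn_const.mul (ca 1)).sub
      (continuousOn_const.mul (ca 0)))).div ?_ fun x hx => (hG.pair_pos hx (sideDir_ne_zero i)).ne'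
    unfold pair
    exact continuousOn_finsetSum _ fun p _ => continuousOn_finsetSum _ fun q _ =>
      ((hG.smooth p q).continuousOn.mul continuousOn_const).mul continuousOn_const
  have e2 : ∀ i, ∫ s in (0:ℝ)..1, v (sidePt i s) * dNormal G p q i s =
      sideInt G i (fun x => v x * geoK G i x) + ∫ s in (0:ℝ)..1, v (sidePt i s) *
        (connForm G p q (sidePt i s) 0 * sideDir i 0 +
          connForm G p q (sidePt i s) 1 * sideDir i 1) := by
    intro i
    have : sideInt G i (fun x => v x * geoK G i x) =
        ∫ s in (0:ℝ)..1, (fun x => v x * (geoK G i x * len (G x) (sideDir i))) (sidePt i s) :=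
      intervalIntegral.integral_congr fun s _ => by simp only; ring
    rw [this, ← intervalIntegral.integral_add (intervalIntegrable_sidePt (cl i) i)
      (intervalIntegrable_sidePt (cα i) i)]
    refine intervalIntegral.integral_congr fun s hs => ?_
    rw [Set.uIcc_of_le zero_le_one] at hs
    simp only [c.dNormal_eq hG d i hs]
    ring
  rw [curvFun, e1, integral_mul_curl hv (hα 0) (hα 1)]
  simp only [e2, Finset.sum_add_distrib]
  ring

end Coframe

end

section

variable {M : Type*} [TopologicalSpace M] [ChartedSpace (EuclideanQuadrant 2) M]

theorem isInvertible_of_injective {L : E2 →L[ℝ] E2} (hL : Function.Injective L) :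
    L.IsInvertible := by
  have hs : Function.Surjective L := LinearMap.surjective_of_injective (f := (L : E2 →ₗ[ℝ] E2)) hL
  refine ⟨ContinuousLinearEquiv.ofBijective L (LinearMap.ker_eq_bot.2 hL)
    (LinearMap.range_eq_top.2 hs), ?_⟩
  ext; rfl

/-- The differential of a smooth triangle, in the preferred chart at the image point. -/
def dchart (f : E2 → M) (x : E2) : E2 →L[ℝ] E2 := dpar f x

theorem IsSmoothTriangle.isInvertible_dchart {f : E2 → M} (hf : IsSmoothTriangle f) {x : E2}
    (hx : x ∈ refTri) : (dchart f x).IsInvertible :=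
  isInvertible_of_injective (hf.immersion x hx)

theorem dpar_pullVec {f : E2 → M} (hf : IsSmoothTriangle f) {x : E2} (hx : x ∈ refTri)
    (e : ∀ x : M, TangentSpace IQ x) : dpar f x (pullVec f e x) = e (f x) :=
  (hf.isInvertible_dchart hx).self_apply_inverse (e (f x))

variable [IsManifold IQ ∞ M]

/-- The components of the `1`-form dual to the vector field `e`, pulled back along `f`. -/
def coform (g : Metric2 M) (e : ∀ x : M, TangentSpace IQ x) (f : E2 → M) (k : Fin 2) (x : E2) : ℝ :=
  g.inner (f x) (e (f x)) (dpar f x (EuclideanSpace.single k 1))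

/-- A tangent vector in the coordinates of a frame. -/
def frameZ (g : Metric2 M) (e₁ e₂ : ∀ x : M, TangentSpace IQ x) (y : M) (w : TangentSpace IQ y) : ℂ :=
  ⟨g.inner y (e₁ y) w, g.inner y (e₂ y) w⟩

theorem cplx_coform (g : Metric2 M) (e₁ e₂ : ∀ x : M, TangentSpace IQ x) (f : E2 → M) (x w : E2) :
    cplx (coform g e₁ f) (coform g e₂ f) x w = frameZ g e₁ e₂ (f x) (dpar f x w) := by
  rw [dpar_apply_eq f x w]
  apply Complex.ext <;> simp only [cplx, frameZ, coform, map_add, map_smul, smul_eq_mul] <;> ring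

theorem coframe_algebra {G Q : Mat} (h : Q.transpose * G * Q = 1) :
    G = (G * Q) * (G * Q).transpose ∨ G.transpose ≠ G := by
  by_cases hs : G.transpose = G
  · left
    have h1 : Q * (Q.transpose * G) = 1 := mul_eq_one_comm.1 h
    rw [Matrix.transpose_mul, hs, Matrix.mul_assoc, h1, Matrix.mul_one]
  · exact Or.inr hs

theorem IsSmoothTriangle.contDiffOn_coform {f : E2 → M} (hf : IsSmoothTriangle f) (g : Metric2 M)
    {e : ∀ x : M, TangentSpace IQ x}
    (he : ContMDiff IQ IQ.tangent ∞ fun x => (⟨x, e x⟩ : TangentBundle IQ M)) (k : Fin 2) :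
    ContDiffOn ℝ ∞ (coform g e f k) refTri :=
  contDiffOn_inner_along g (he.comp_contMDiffOn hf.smooth) (hf.contMDiffOn_dpar _)

section Frame

variable {g : Metric2 M} {e₁ e₂ : ∀ x : M, TangentSpace IQ x} (h : IsFrame g e₁ e₂) {f : E2 → M}
  (hf : IsSmoothTriangle f)
include h hf

theorem frame_algebra {x : E2} (hx : x ∈ refTri) (i j : Fin 2) : pull g f x i j =
    coform g e₁ f i x * coform g e₁ f j x + coform g e₂ f i x * coform g e₂ f j x := by
  have hG := hf.isMetric_pull g
  set p := pullVec f e₁ x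
  set q := pullVec f e₂ x
  have hp : dpar f x p = e₁ (f x) := dpar_pullVec hf hx e₁
  have hq : dpar f x q = e₂ (f x) := dpar_pullVec hf hx e₂
  have ha : ∀ k, coform g e₁ f k x = pair (pull g f x) p (EuclideanSpace.single k 1) := fun k => by
    rw [pair_pull, hp]; rfl
  have hb : ∀ k, coform g e₂ f k x = pair (pull g f x) q (EuclideanSpace.single k 1) := fun k => by
    rw [pair_pull, hq]; rfl
  have h11 : pair (pull g f x) p p = 1 := by rw [pair_pull, hp]; exact h.unit₁ _
  have h22 : pair (pull g f x) q q = 1 := by rw [pair_pull, hq]; exact h.unit₂ _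
  have h12 : pair (pull g f x) p q = 0 := by rw [pair_pull, hp, hq]; exact h.orth _
  have hs := hG.symm hx
  have key := coframe_algebra (G := pull g f x) (Q := !![p 0, q 0; p 1, q 1]) (by
    simp only [pair, Fin.sum_univ_two, hs] at h11 h22 h12
    ext i j
    fin_cases i <;> fin_cases j <;> simp [Matrix.mul_apply, Fin.sum_univ_two, hs] <;> linarith)
  have key := key.resolve_right (not_not.2 (by
    ext i j; fin_cases i <;> fin_cases j <;> simp [hs]))
  have := congrFun (congrFun key i) j
  rw [this, ha, ha, hb, hb]
  fin_cases i <;> fin_cases j <;> simp [Matrix.mul_apply, Fin.sum_univ_two, hs, pair] <;> ring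

theorem pair_pullVec {x : E2} (hx : x ∈ refTri) :
    pullVec f e₁ x 0 * coform g e₁ f 0 x + pullVec f e₁ x 1 * coform g e₁ f 1 x = 1 ∧
    pullVec f e₂ x 0 * coform g e₂ f 0 x + pullVec f e₂ x 1 * coform g e₂ f 1 x = 1 ∧
    pullVec f e₂ x 0 * coform g e₁ f 0 x + pullVec f e₂ x 1 * coform g e₁ f 1 x = 0 ∧
    pullVec f e₁ x 0 * coform g e₂ f 0 x + pullVec f e₁ x 1 * coform g e₂ f 1 x = 0 := by
  have c := cplx_coform g e₁ e₂ f x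
  have h1 := c (pullVec f e₁ x)
  have h2 := c (pullVec f e₂ x)
  rw [dpar_pullVec hf hx] at h1 h2
  have a1 := congrArg Complex.re h1
  have a2 := congrArg Complex.im h1
  have a3 := congrArg Complex.re h2
  have a4 := congrArg Complex.im h2
  simp only [cplx, frameZ, h.unit₁, h.unit₂, h.orth] at a1 a2 a3 a4
  rw [g.symm, h.orth] at a2
  exact ⟨by linarith, by linarith, by linarith, by linarith⟩

theorem IsFrame.coframe (ho : PreservesOrientation e₁ e₂ f) :
    Coframe (pull g f) (coform g e₁ f) (coform g e₂ f) := by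
  refine ⟨hf.contDiffOn_coform g h.smooth₁, hf.contDiffOn_coform g h.smooth₂,
    fun x hx => frame_algebra h hf hx, fun x hx => ?_⟩
  obtain ⟨h1, h2, h3, h4⟩ := pair_pullVec h hf hx
  have := ho x hx
  have e : (coform g e₁ f 0 x * coform g e₂ f 1 x - coform g e₁ f 1 x * coform g e₂ f 0 x) *
      (pullVec f e₁ x 0 * pullVec f e₂ x 1 - pullVec f e₁ x 1 * pullVec f e₂ x 0) = 1 := by
    linear_combination h1 * (pullVec f e₂ x 0 * coform g e₂ f 0 x +
      pullVec f e₂ x 1 * coform g e₂ f 1 x) + h2 - h3 * (pullVec f e₁ x 0 * coform g e₂ f 0 x +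
      pullVec f e₁ x 1 * coform g e₂ f 1 x)
  by_contra hc
  push Not at hc
  nlinarith

theorem IsFrame.dualFrame (ho : PreservesOrientation e₁ e₂ f) :
    DualFrame (coform g e₁ f) (coform g e₂ f) (pullVec f e₁) (pullVec f e₂) := by
  have hpos := (IsFrame.coframe h hf ho).pos
  refine ⟨fun x hx => ?_, fun x hx => ?_, fun x hx => ?_, fun x hx => ?_⟩ <;>
  · have hp := (hpos x hx).ne'
    obtain ⟨h1, h2, h3, h4⟩ := pair_pullVec h hf hx
    rw [eq_div_iff hp]
    first
    | linear_combination coform g e₂ f 1 x * h1 - coform g e₁ f 1 x * h4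
    | linear_combination - coform g e₂ f 0 x * h1 + coform g e₁ f 0 x * h4
    | linear_combination coform g e₂ f 1 x * h3 - coform g e₁ f 1 x * h2
    | linear_combination - coform g e₂ f 0 x * h3 + coform g e₁ f 0 x * h2

end Frame

/-! ### The functional of the smooth metric -/

open Classical in
/-- The contributions of the interior edges and of the vertices that cancel for a smooth metric. -/
def meshDefect (g : Metric2 M) (e₁ e₂ : ∀ x : M, TangentSpace IQ x) (𝒯 : Mesh M) (v : M → ℝ) : ℝ :=
  (∑ T, ∑ i, if IsBdrySide 𝒯 T i then 0 else
    ∫ s in (0 : ℝ)..1, res 𝒯 T v (sidePt i s) * dMu g e₁ e₂ (𝒯.par T) i s) +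
  ∑ p ∈ verts 𝒯, v p * ((if ModelWithCorners.IsBoundaryPoint (I := IQ) p then
    Real.pi - jumpMu g e₁ e₂ 𝒯 p else 2 * Real.pi) - angleSum 𝒯 (onMesh g 𝒯) p)

theorem Fh_onMesh_eq {g : Metric2 M} {e₁ e₂ : ∀ x : M, TangentSpace IQ x} (h : IsFrame g e₁ e₂)
    {u : M → ℝ} (hu : IsPotential g e₁ e₂ u) (𝒯 : Mesh M)
    (ho : ∀ T, PreservesOrientation e₁ e₂ (𝒯.par T)) {v : M → ℝ}
    (hv : ∀ T, ContDiffOn ℝ 1 (res 𝒯 T v) refTri) :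
    Fh g e₁ e₂ 𝒯 (onMesh g 𝒯) v = innerL2Form 𝒯 (onMesh g 𝒯) (dM 𝒯 v) (dM 𝒯 u) -
      meshDefect g e₁ e₂ 𝒯 v := by
  classical
  have hT : ∀ T, curvFun (onMesh g 𝒯 T) (res 𝒯 T v) =
      (∑ i, ∫ s in (0 : ℝ)..1, res 𝒯 T v (sidePt i s) * dMu g e₁ e₂ (𝒯.par T) i s) -
      triInt (onMesh g 𝒯 T) (fun x => inner1 (onMesh g 𝒯 T x) (dM 𝒯 v T x) (dM 𝒯 u T x)) -
      ∑ i, res 𝒯 T v (vtx i) * angle (onMesh g 𝒯 T) i := by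
    intro T
    have hf := 𝒯.smooth T
    have key := (IsFrame.coframe h hf (ho T)).curvFun_eq (hf.isMetric_pull g)
      (IsFrame.dualFrame h hf (ho T)) (hv T)
    refine key.trans ?_
    congr 2
    refine setIntegral_congr_fun isClosed_refTri.measurableSet fun x hx => ?_
    simp only [hu.2 _ hf (ho T) x hx, star1, Matrix.cons_val_zero, Matrix.cons_val_one, inner1,
      Fin.sum_univ_two, dM, dfn, dvol, onMesh]
    change _ = (_ * _ * pd 0 (fun y => u (𝒯.par T y)) x + _ * _ * pd 1 (fun y => u (𝒯.par T y)) x +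
      (_ * _ * pd 0 (fun y => u (𝒯.par T y)) x + _ * _ * pd 1 (fun y => u (𝒯.par T y)) x)) * _
    ring
  have h1 : ∑ T, curvFun (onMesh g 𝒯 T) (res 𝒯 T v) =
      (∑ T, ∑ i, ∫ s in (0 : ℝ)..1, res 𝒯 T v (sidePt i s) * dMu g e₁ e₂ (𝒯.par T) i s) -
      innerL2Form 𝒯 (onMesh g 𝒯) (dM 𝒯 v) (dM 𝒯 u) -
      ∑ p ∈ verts 𝒯, v p * angleSum 𝒯 (onMesh g 𝒯) p := by
    rw [sum_verts_angleSum, innerL2Form, ← Finset.sum_sub_distrib, ← Finset.sum_sub_distrib]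
    exact Finset.sum_congr rfl fun T _ => hT T
  have h2 : (∑ T, ∑ i, ∫ s in (0 : ℝ)..1, res 𝒯 T v (sidePt i s) * dMu g e₁ e₂ (𝒯.par T) i s) =
      (∑ T, ∑ i, if IsBdrySide 𝒯 T i then
        ∫ s in (0 : ℝ)..1, res 𝒯 T v (sidePt i s) * dMu g e₁ e₂ (𝒯.par T) i s else 0) +
      ∑ T, ∑ i, if IsBdrySide 𝒯 T i then 0 else
        ∫ s in (0 : ℝ)..1, res 𝒯 T v (sidePt i s) * dMu g e₁ e₂ (𝒯.par T) i s := by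
    simp only [← Finset.sum_add_distrib]
    refine Finset.sum_congr rfl fun T _ => Finset.sum_congr rfl fun i _ => ?_
    split_ifs <;> simp
  rw [Fh_eq, h1, h2, frameFun, meshDefect]
  simp only [mul_sub, Finset.sum_sub_distrib]
  ring

end

section

open Filter Topology Set

/-! ### Tangent cones of the reference triangle -/

/-- The tangent cone of the reference triangle at `u`. -/
def tcone (u : E2) : Set E2 :=
  {k | (u 0 = 0 → 0 ≤ k 0) ∧ (u 1 = 0 → 0 ≤ k 1) ∧ (u 0 + u 1 = 1 → k 0 + k 1 ≤ 0)}

/-- The interior of the tangent cone. -/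
def openCone (u : E2) : Set E2 :=
  {k | (u 0 = 0 → 0 < k 0) ∧ (u 1 = 0 → 0 < k 1) ∧ (u 0 + u 1 = 1 → k 0 + k 1 < 0)}

theorem isClosed_imp_le (p : Prop) {φ : E2 → ℝ} (hφ : Continuous φ) :
    IsClosed {k : E2 | p → 0 ≤ φ k} := by
  by_cases h : p
  · simpa [h] using isClosed_le continuous_const hφ
  · simp [h]

theorem isClosed_tcone (u : E2) : IsClosed (tcone u) := by
  have h2 := isClosed_imp_le (u 0 + u 1 = 1) (φ := fun k => -(k 0 + k 1))
    ((continuous_coord 0).add (continuous_coord 1)).neg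
  simp only [neg_nonneg] at h2
  exact (isClosed_imp_le (u 0 = 0) (continuous_coord 0)).inter
    ((isClosed_imp_le (u 1 = 0) (continuous_coord 1)).inter h2)

theorem smul_sub_mem_tcone {u x : E2} (hx : x ∈ refTri) {t : ℝ} (ht : 0 ≤ t) :
    t • (x - u) ∈ tcone u := by
  obtain ⟨h0, h1, h2⟩ := hx
  refine ⟨fun h => ?_, fun h => ?_, fun h => ?_⟩ <;>
    simp only [PiLp.smul_apply, PiLp.sub_apply, smul_eq_mul]
  · rw [h]; exact mul_nonneg ht (by linarith)
  · rw [h]; exact mul_nonneg ht (by linarith)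
  · rw [← mul_add]; exact mul_nonpos_of_nonneg_of_nonpos ht (by linarith)

theorem eventually_add_mul_pos {a : ℝ} (ha : 0 < a) (b : ℝ) : ∀ᶠ t in 𝓝[>] (0 : ℝ), 0 < a + t * b := by
  have : ContinuousAt (fun t : ℝ => a + t * b) 0 := by fun_prop
  exact nhdsWithin_le_nhds (this.eventually (lt_mem_nhds (by simpa using ha)))

theorem eventually_coord_nonneg {a b : ℝ} (ha : 0 ≤ a) (hb : a = 0 → 0 ≤ b) :
    ∀ᶠ t in 𝓝[>] (0 : ℝ), 0 ≤ a + t * b := by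
  rcases ha.eq_or_lt with h | h
  · filter_upwards [self_mem_nhdsWithin] with t ht
    rw [← h, zero_add]; exact mul_nonneg (le_of_lt ht) (hb h.symm)
  · exact (eventually_add_mul_pos h b).mono fun t => le_of_lt

theorem eventually_coord_pos {a b : ℝ} (ha : 0 ≤ a) (hb : a = 0 → 0 < b) :
    ∀ᶠ t in 𝓝[>] (0 : ℝ), 0 < a + t * b := by
  rcases ha.eq_or_lt with h | h
  · filter_upwards [self_mem_nhdsWithin] with t ht
    rw [← h, zero_add]; exact mul_pos ht (hb h.symm)
  · exact eventually_add_mul_pos h b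

theorem eventually_add_smul_mem {u k : E2} (hu : u ∈ refTri) (hk : k ∈ tcone u) :
    ∀ᶠ t in 𝓝[>] (0 : ℝ), u + t • k ∈ refTri := by
  obtain ⟨h0, h1, h2⟩ := hu
  obtain ⟨k0, k1, k2⟩ := hk
  filter_upwards [eventually_coord_nonneg h0 k0, eventually_coord_nonneg h1 k1,
    eventually_coord_nonneg (a := 1 - (u 0 + u 1)) (b := -(k 0 + k 1)) (by linarith)
      (fun h => by linarith [k2 (by linarith)])] with t e0 e1 e2
  exact ⟨by simpa using e0, by simpa using e1, by simp; linarith⟩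

theorem eventually_add_smul_mem_openTri {u k : E2} (hu : u ∈ refTri) (hk : k ∈ openCone u) :
    ∀ᶠ t in 𝓝[>] (0 : ℝ), u + t • k ∈ openTri := by
  obtain ⟨h0, h1, h2⟩ := hu
  obtain ⟨k0, k1, k2⟩ := hk
  filter_upwards [eventually_coord_pos h0 k0, eventually_coord_pos h1 k1,
    eventually_coord_pos (a := 1 - (u 0 + u 1)) (b := -(k 0 + k 1)) (by linarith)
      (fun h => by linarith [k2 (by linarith)])] with t e0 e1 e2
  exact ⟨by simpa using e0, by simpa using e1, by simp; linarith⟩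

theorem exists_forall_eventually_add_smul {u k : E2} (hu : u ∈ refTri) (hk : k ∈ openCone u) :
    ∃ c > 0, ∀ᶠ t in 𝓝[>] (0 : ℝ), Metric.closedBall (u + t • k) (c * t) ⊆ refTri := by
  obtain ⟨h0, h1, h2⟩ := hu
  obtain ⟨k0, k1, k2⟩ := hk
  have key : ∀ a b : ℝ, 0 ≤ a → (a = 0 → 0 < b) → ∃ c > 0, ∀ d ≤ c, ∀ᶠ t in 𝓝[>] (0 : ℝ),
      0 ≤ a + t * (b - d) := by
    intro a b ha hb
    by_cases h : a = 0
    · exact ⟨b, hb h, fun d hd => eventually_coord_nonneg ha fun _ => by linarith⟩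
    · exact ⟨1, one_pos, fun d _ => eventually_coord_nonneg ha fun h' => absurd h' h⟩
  obtain ⟨c0, hc0, H0⟩ := key _ _ h0 k0
  obtain ⟨c1, hc1, H1⟩ := key _ _ h1 k1
  obtain ⟨c2, hc2, H2⟩ := key (1 - (u 0 + u 1)) (-(k 0 + k 1)) (by linarith)
      (fun h => by linarith [k2 (by linarith)])
  refine ⟨min c0 (min c1 (c2 / 2)), by positivity, ?_⟩
  set c := min c0 (min c1 (c2 / 2))
  have l0 : c ≤ c0 := min_le_left _ _
  have l1 : c ≤ c1 := (min_le_right _ _).trans (min_le_left _ _)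
  have l2 : 2 * c ≤ c2 := by
    have : c ≤ c2 / 2 := (min_le_right _ _).trans (min_le_right _ _)
    linarith
  filter_upwards [H0 c l0, H1 c l1, H2 _ l2] with t e0 e1 e2 x hx
  have hn : ∀ j, |x j - (u j + t * k j)| ≤ c * t := fun j => by
    have := (PiLp.norm_apply_le (x - (u + t • k)) j).trans (mem_closedBall_iff_norm.1 hx)
    simpa using this
  have a0 := abs_le.1 (hn 0)
  have a1 := abs_le.1 (hn 1)
  exact ⟨by linarith [a0.1], by linarith [a1.1], by linarith [a0.2, a1.2]⟩

theorem notMem_face_of_mem_openTri {s : Finset (Fin 3)} (hs : s ≠ Finset.univ) {x : E2}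
    (hx : x ∈ openTri) : x ∉ face s := by
  intro hf
  obtain ⟨i, hi⟩ : ∃ i, i ∉ s := by
    by_contra h
    push Not at h
    exact hs (Finset.eq_univ_iff_forall.2 h)
  obtain ⟨h0, h1, h2⟩ := hx
  fin_cases i
  · have : face s ⊆ {y : E2 | y 0 + y 1 = 1} := by
      refine convexHull_min ?_ ?_
      · rintro _ ⟨j, hj, rfl⟩
        fin_cases j
        · exact absurd hj hi
        · simp [vtx]
        · simp [vtx]
      · intro a ha b hb p q _ _ hpq
        simp only [mem_ofPred_eq, PiLp.add_apply, PiLp.smul_apply, smul_eq_mul] at *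
        linear_combination p * ha + q * hb + hpq
    have := this hf
    simp only [mem_ofPred_eq] at this
    linarith
  · have : face s ⊆ {y : E2 | y 0 = 0} := by
      refine convexHull_min ?_ ?_
      · rintro _ ⟨j, hj, rfl⟩
        fin_cases j
        · simp [vtx]
        · exact absurd hj hi
        · simp [vtx]
      · intro a ha b hb p q _ _ hpq
        simp only [mem_ofPred_eq, PiLp.add_apply, PiLp.smul_apply, smul_eq_mul] at *
        rw [ha, hb]; simp
    have := this hf
    simp only [mem_ofPred_eq] at this
    linarith
  · have : face s ⊆ {y : E2 | y 1 = 0} := by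
      refine convexHull_min ?_ ?_
      · rintro _ ⟨j, hj, rfl⟩
        fin_cases j
        · simp [vtx]
        · simp [vtx]
        · exact absurd hj hi
      · intro a ha b hb p q _ _ hpq
        simp only [mem_ofPred_eq, PiLp.add_apply, PiLp.smul_apply, smul_eq_mul] at *
        rw [ha, hb]; simp
    have := this hf
    simp only [mem_ofPred_eq] at this
    linarith

/-! ### Maps with an invertible derivative on the reference triangle -/

theorem tendsto_slope_of_hasFDerivWithinAt {Φ : E2 → E2} {L : E2 →L[ℝ] E2} {u k : E2}
    (h : HasFDerivWithinAt Φ L refTri u) (hu : u ∈ refTri) (hk : k ∈ tcone u) :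
    Tendsto (fun t : ℝ => t⁻¹ • (Φ (u + t • k) - Φ u)) (𝓝[>] 0) (𝓝 (L k)) := by
  refine h.lim (d := fun t : ℝ => t • k) (c := fun t => t⁻¹) (l := 𝓝[>] 0) ?_
    (eventually_add_smul_mem hu hk) ?_
  · have : ContinuousAt (fun t : ℝ => t • k) 0 := by fun_prop
    simpa using this.tendsto.mono_left nhdsWithin_le_nhds
  · refine tendsto_const_nhds.congr' ?_
    filter_upwards [self_mem_nhdsWithin] with t ht
    rw [smul_smul, inv_mul_cancel₀ (ne_of_gt ht), one_smul]

theorem eventually_norm_sub_le {Φ : E2 → E2} {L : E2 →L[ℝ] E2} {u k : E2}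
    (h : HasFDerivWithinAt Φ L refTri u) (hu : u ∈ refTri) (hk : k ∈ tcone u) {η : ℝ} (hη : 0 < η) :
    ∀ᶠ t in 𝓝[>] (0 : ℝ), ‖Φ (u + t • k) - (Φ u + t • L k)‖ ≤ η * t := by
  filter_upwards [(tendsto_slope_of_hasFDerivWithinAt h hu hk) (Metric.closedBall_mem_nhds _ hη),
    self_mem_nhdsWithin] with t h1 ht
  have ht : 0 < t := ht
  have h1 : ‖t⁻¹ • (Φ (u + t • k) - Φ u) - L k‖ ≤ η := mem_closedBall_iff_norm.1 h1
  have e : Φ (u + t • k) - (Φ u + t • L k) = t • (t⁻¹ • (Φ (u + t • k) - Φ u) - L k) := by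
    rw [smul_sub, smul_smul, mul_inv_cancel₀ ht.ne', one_smul]; abel
  rw [e, norm_smul, Real.norm_of_nonneg ht.le, mul_comm]
  exact mul_le_mul_of_nonneg_right h1 ht.le

theorem openCone_subset (u : E2) : openCone u ⊆ tcone u := fun _ h =>
  ⟨fun a => (h.1 a).le, fun a => (h.2.1 a).le, fun a => (h.2.2 a).le⟩

theorem exists_approximatesLinearOn {Φ : E2 → E2} {L : E2 →L[ℝ] E2} {u : E2}
    (hΦ : ContDiffWithinAt ℝ 1 Φ refTri u) (h : HasFDerivWithinAt Φ L refTri u) (hu : u ∈ refTri)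
    {c : NNReal} (hc : 0 < c) :
    ∃ δ > 0, ApproximatesLinearOn Φ L (refTri ∩ Metric.ball u δ) c := by
  obtain ⟨V, hV, huV, hVd⟩ := hΦ.contDiffOn' le_rfl (by simp)
  obtain ⟨δ₁, hδ₁, hb⟩ := Metric.isOpen_iff.1 hV u huV
  have hs : ContDiffOn ℝ 1 Φ (refTri ∩ Metric.ball u δ₁) := hVd.mono fun x hx =>
    ⟨by rw [insert_eq_of_mem hu]; exact hx.1, hb hx.2⟩
  have hU : UniqueDiffOn ℝ (refTri ∩ Metric.ball u δ₁) := uniqueDiffOn_refTri.inter Metric.isOpen_ball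
  have hus : u ∈ refTri ∩ Metric.ball u δ₁ := ⟨hu, Metric.mem_ball_self hδ₁⟩
  have hL : fderivWithin ℝ Φ (refTri ∩ Metric.ball u δ₁) u = L :=
    (h.mono inter_subset_left).fderivWithin (hU u hus)
  have hcont := (hs.continuousOn_fderivWithin hU le_rfl) u hus
  obtain ⟨δ₂, hδ₂, hb₂⟩ := Metric.continuousWithinAt_iff.1 hcont c (by exact_mod_cast hc)
  refine ⟨min δ₁ δ₂, lt_min hδ₁ hδ₂, fun x hx y hy => ?_⟩
  have hsub : refTri ∩ Metric.ball u (min δ₁ δ₂) ⊆ refTri ∩ Metric.ball u δ₁ :=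
    inter_subset_inter_right _ (Metric.ball_subset_ball (min_le_left _ _))
  refine Convex.norm_image_sub_le_of_norm_hasFDerivWithin_le' (𝕜 := ℝ)
    (f' := fderivWithin ℝ Φ (refTri ∩ Metric.ball u δ₁))
    (s := refTri ∩ Metric.ball u (min δ₁ δ₂)) (fun z hz => ?_) (fun z hz => ?_)
    (convex_refTri.inter (convex_ball _ _)) hy hx
  · exact ((hs.differentiableOn one_ne_zero z (hsub hz)).hasFDerivWithinAt).mono hsub
  · have := hb₂ (hsub hz) (lt_of_lt_of_le (Metric.mem_ball.1 hz.2) (min_le_right _ _))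
    rw [hL, dist_eq_norm] at this
    exact this.le

theorem exists_closedBall_subset_image {Φ : E2 → E2} {L : E2 →L[ℝ] E2} {u k : E2}
    (hΦ : ContDiffWithinAt ℝ 1 Φ refTri u) (h : HasFDerivWithinAt Φ L refTri u)
    (hL : L.IsInvertible) (hu : u ∈ refTri) (hk : k ∈ openCone u) {W : Set E2} (hW : W ∈ 𝓝 u) :
    ∃ ρ > 0, ∀ᶠ t in 𝓝[>] (0 : ℝ),
      Metric.closedBall (Φ u + t • L k) (ρ * t) ⊆ Φ '' (refTri ∩ W) := by
  obtain ⟨e, rfl⟩ := hL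
  set R : (e : E2 →L[ℝ] E2).NonlinearRightInverse := e.toNonlinearRightInverse
  have hN : 0 < (R.nnnorm : ℝ) := by
    have := e.nnnorm_symm_pos
    exact_mod_cast this
  set c : NNReal := R.nnnorm⁻¹ / 2 with hc
  have hc0 : 0 < c := by
    have : 0 < R.nnnorm := by exact_mod_cast hN
    positivity
  obtain ⟨δ, hδ, happ⟩ := exists_approximatesLinearOn hΦ h hu hc0
  obtain ⟨c₁, hc₁, hball⟩ := exists_forall_eventually_add_smul hu hk
  have hcc : (0 : ℝ) < c := by exact_mod_cast hc0
  have hWδ : W ∩ Metric.ball u δ ∈ 𝓝 u := inter_mem hW (Metric.ball_mem_nhds u hδ)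
  obtain ⟨δ₂, hδ₂, hb₂⟩ := Metric.mem_nhds_iff.1 hWδ
  have hsm : ∀ᶠ t in 𝓝[>] (0 : ℝ), Metric.closedBall (u + t • k) (c₁ * t) ⊆ Metric.ball u δ₂ := by
    have : ContinuousAt (fun t : ℝ => ‖t • k‖ + c₁ * t) 0 := by fun_prop
    have := nhdsWithin_le_nhds (s := Ioi 0) (this.eventually (gt_mem_nhds (a := δ₂) (by simpa using hδ₂)))
    filter_upwards [this] with t ht x hx
    rw [mem_ball_iff_norm]
    have hx := mem_closedBall_iff_norm.1 hx
    calc ‖x - u‖ = ‖(x - (u + t • k)) + t • k‖ := by congr 1; abel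
      _ ≤ ‖x - (u + t • k)‖ + ‖t • k‖ := norm_add_le _ _
      _ < δ₂ := by linarith
  refine ⟨c * c₁ / 2, by positivity, ?_⟩
  filter_upwards [hball, hsm, self_mem_nhdsWithin,
    eventually_norm_sub_le h hu (openCone_subset u hk) (η := c * c₁ / 2) (by positivity)]
    with t h1 h2 ht h3 z hz
  have ht : 0 < t := ht
  have hsub : Metric.closedBall (u + t • k) (c₁ * t) ⊆ refTri ∩ Metric.ball u δ := fun x hx =>
    ⟨h1 hx, (hb₂ (h2 hx)).2⟩
  have hsurj := happ.surjOn_closedBall_of_nonlinearRightInverse R (by positivity) hsub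
  have hz' : z ∈ Metric.closedBall (Φ (u + t • k)) (((R.nnnorm : ℝ)⁻¹ - c) * (c₁ * t)) := by
    rw [mem_closedBall_iff_norm] at hz ⊢
    have e1 : (R.nnnorm : ℝ)⁻¹ - c = c := by rw [hc]; push_cast; ring
    rw [e1]
    calc ‖z - Φ (u + t • k)‖ = ‖(z - (Φ u + t • e k)) - (Φ (u + t • k) - (Φ u + t • e k))‖ := by
          congr 1; abel
      _ ≤ c * c₁ / 2 * t + c * c₁ / 2 * t := (norm_sub_le _ _).trans (add_le_add hz h3)
      _ = _ := by ring
  obtain ⟨x, hx, rfl⟩ := hsurj hz'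
  exact ⟨x, ⟨h1 hx, (hb₂ (h2 hx)).1⟩, rfl⟩

end

section

open Filter Topology Set

/-! ### The triangles of a mesh at a point of the surface -/

section Chart

variable {M : Type*} [TopologicalSpace M] [ChartedSpace (EuclideanQuadrant 2) M]

theorem IsDisc.t2Space (h : IsDisc M) : T2Space M := by
  obtain ⟨e⟩ := h
  exact e.symm.t2Space

theorem IsDisc.compactSpace (h : IsDisc M) : CompactSpace M := by
  obtain ⟨e⟩ := h
  have : CompactSpace (Metric.closedBall (0 : E2) 1) :=
    isCompact_iff_compactSpace.1 (isCompact_closedBall _ _)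
  exact e.symm.compactSpace

theorem IsSmoothTriangle.contDiffWithinAt_chart [IsManifold IQ ∞ M] {f : E2 → M}
    (hf : IsSmoothTriangle f) {u : E2} (hu : u ∈ refTri) :
    ContDiffWithinAt ℝ 1 (fun x => extChartAt IQ (f u) (f x)) refTri u := by
  have := (contMDiffWithinAt_iff.1 (hf.smooth u hu)).2
  simp only [mfld_simps] at this
  exact this.of_le (by norm_cast)

theorem IsSmoothTriangle.hasFDerivWithinAt_chart {f : E2 → M}
    (hf : IsSmoothTriangle f) {u : E2} (hu : u ∈ refTri) :
    HasFDerivWithinAt (fun x => extChartAt IQ (f u) (f x)) (dchart f u) refTri u := by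
  have := ((hf.smooth.mdifferentiableOn (by simp)) u hu).hasMFDerivWithinAt.2
  simp only [mfld_simps] at this
  exact this

theorem mem_range_IQ {x : E2} : x ∈ range IQ ↔ ∀ j, 0 ≤ x j := by
  have : range IQ = {y : E2 | ∀ i : Fin 2, 0 ≤ y i} := range_euclideanQuadrant 2
  rw [this]; rfl

theorem extChartAt_nonneg (y z : M) (j : Fin 2) : 0 ≤ extChartAt IQ y z j :=
  mem_range_IQ.1 (mem_range_self _) j

theorem IsSmoothTriangle.dchart_nonneg {f : E2 → M} (hf : IsSmoothTriangle f) {u k : E2}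
    (hu : u ∈ refTri) (hk : k ∈ tcone u) {j : Fin 2} (hj : extChartAt IQ (f u) (f u) j = 0) :
    0 ≤ dchart f u k j := by
  have h := tendsto_slope_of_hasFDerivWithinAt (hf.hasFDerivWithinAt_chart hu) hu hk
  have h := ((continuous_coord j).tendsto _).comp h
  refine ge_of_tendsto h ?_
  filter_upwards [self_mem_nhdsWithin] with t ht
  simp only [Function.comp_apply, PiLp.smul_apply, PiLp.sub_apply, hj, sub_zero, smul_eq_mul]
  exact mul_nonneg (inv_nonneg.2 (le_of_lt ht)) (extChartAt_nonneg _ _ _)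

variable (𝒯 : Mesh M)

theorem Mesh.exists_par_eq (y : M) : ∃ T, ∃ x ∈ refTri, 𝒯.par T x = y := by
  have : y ∈ ⋃ T, 𝒯.par T '' refTri := by rw [𝒯.cover]; trivial
  simpa using this

theorem face_subset (s : Finset (Fin 3)) : face s ⊆ refTri :=
  convexHull_min (by rintro _ ⟨i, -, rfl⟩; exact vtx_mem i) convex_refTri

/-- The tangent cones of the triangles at a point fill the tangent cone of the surface. -/
theorem Mesh.exists_dchart_eq [T2Space M] (y : M) {w : E2}
    (hw : ∀ j, extChartAt IQ y y j = 0 → 0 ≤ w j) :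
    ∃ T, ∃ u ∈ refTri, 𝒯.par T u = y ∧ ∃ k ∈ tcone u, dchart (𝒯.par T) u k = w := by
  set φ := extChartAt IQ y with hφ
  have hmem : ∀ᶠ t in 𝓝[>] (0 : ℝ), φ y + t • w ∈ φ.target := by
    have h1 : ∀ᶠ t in 𝓝[>] (0 : ℝ), φ y + t • w ∈ range IQ := by
      have : ∀ j : Fin 2, ∀ᶠ t in 𝓝[>] (0 : ℝ), 0 ≤ φ y j + t * w j := fun j =>
        eventually_coord_nonneg (extChartAt_nonneg y y j) (hw j)
      filter_upwards [this 0, this 1] with t h0 h1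
      refine mem_range_IQ.2 fun j => ?_
      fin_cases j
      · simpa using h0
      · simpa using h1
    have h2 : Tendsto (fun t : ℝ => φ y + t • w) (𝓝[>] 0) (𝓝[range IQ] (φ y)) := by
      refine tendsto_nhdsWithin_iff.2 ⟨?_, h1⟩
      have : ContinuousAt (fun t : ℝ => φ y + t • w) 0 := by fun_prop
      simpa using this.tendsto.mono_left nhdsWithin_le_nhds
    exact h2 (extChartAt_target_mem_nhdsWithin y)
  choose Tf xf hxf hpar using 𝒯.exists_par_eq
  set Y : ℝ → M := fun t => φ.symm (φ y + t • w)
  set U : Ultrafilter ℝ := Ultrafilter.of (𝓝[>] 0)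
  have hU : (U : Filter ℝ) ≤ 𝓝[>] 0 := Ultrafilter.of_le _
  obtain ⟨T, hT⟩ : ∃ T, ∀ᶠ t in (U : Filter ℝ), Tf (Y t) = T := by
    have : (⋃ T ∈ (univ : Set (Fin 𝒯.n)), {t | Tf (Y t) = T}) ∈ U := by
      have : (⋃ T ∈ (univ : Set (Fin 𝒯.n)), {t | Tf (Y t) = T}) = univ := by ext; simp
      rw [this]; exact Filter.univ_mem
    obtain ⟨T, -, h⟩ := (Ultrafilter.finite_biUnion_mem_iff finite_univ).1 this
    exact ⟨T, h⟩
  have hf := 𝒯.smooth T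
  obtain ⟨u, hu, hlim⟩ := isCompact_refTri.ultrafilter_le_nhds (U.map fun t => xf (Y t))
    (le_principal_iff.2 (Filter.Eventually.of_forall (f := (U : Filter ℝ)) fun t => hxf (Y t)))
  have hlim : Tendsto (fun t => xf (Y t)) U (𝓝 u) := hlim
  have hlimW : Tendsto (fun t => xf (Y t)) U (𝓝[refTri] u) :=
    tendsto_nhdsWithin_iff.2 ⟨hlim, Filter.Eventually.of_forall fun t => hxf _⟩
  have hYlim : Tendsto Y U (𝓝 y) := by
    have hc : ContinuousAt φ.symm (φ y) := continuousAt_extChartAt_symm y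
    have h0 : Tendsto (fun t : ℝ => φ y + t • w) (𝓝[>] 0) (𝓝 (φ y)) := by
      have : ContinuousAt (fun t : ℝ => φ y + t • w) 0 := by fun_prop
      simpa using this.tendsto.mono_left nhdsWithin_le_nhds
    have := (hc.tendsto.comp h0).mono_left hU
    rwa [extChartAt_to_inv] at this
  have hparU : ∀ᶠ t in (U : Filter ℝ), 𝒯.par T (xf (Y t)) = Y t := by
    filter_upwards [hT] with t ht
    rw [← ht]; exact hpar _
  have huy : 𝒯.par T u = y := by
    have h1 := ((hf.smooth.continuousOn u hu).tendsto.comp hlimW)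
    exact tendsto_nhds_unique (h1.congr' hparU) hYlim
  subst huy
  refine ⟨T, u, hu, rfl, ?_⟩
  obtain ⟨e, he⟩ := hf.isInvertible_dchart hu
  have hd := hf.hasFDerivWithinAt_chart hu
  have hrev := (hd.isTheta_sub (by
    rw [← he]; exact e.toHomeomorph.isInducing)).isBigO_symm.comp_tendsto hlimW
  rw [hasFDerivWithinAt_iff_isLittleO] at hd
  have hd := hd.comp_tendsto hlimW
  have hE : ∀ᶠ t in (U : Filter ℝ), φ (𝒯.par T (xf (Y t))) - φ (𝒯.par T u) = t • w := by
    filter_upwards [hparU, hU hmem] with t h1 h2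
    rw [h1, φ.right_inv h2]; abel
  refine ⟨e.symm w, ?_, by rw [← he]; exact e.apply_symm_apply w⟩
  have hkey : Tendsto (fun t => t⁻¹ • (xf (Y t) - u)) U (𝓝 (e.symm w)) := by
    have hO : (fun t => φ (𝒯.par T (xf (Y t))) - φ (𝒯.par T u)) =O[U] fun t : ℝ => t := by
      refine Asymptotics.IsBigO.congr' (f₁ := fun t : ℝ => t • w) ?_ (hE.mono fun t h => h.symm)
        (EventuallyEq.refl _ _)
      exact Asymptotics.IsBigO.of_bound ‖w‖ (Eventually.of_forall fun t => by
        rw [norm_smul, mul_comm])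
    have ho := hd.trans_isBigO (hrev.trans hO)
    have h2 := ((e.symm : E2 →L[ℝ] E2).isBigO_comp _ _).trans_isLittleO ho
    have h3 : Tendsto (fun t : ℝ => t⁻¹ • e.symm (φ (𝒯.par T (xf (Y t))) - φ (𝒯.par T u) -
        dchart (𝒯.par T) u (xf (Y t) - u))) U (𝓝 0) := by
      exact h2.tendsto_inv_smul_nhds_zero
    have h4 := (tendsto_const_nhds (x := e.symm w)).sub h3
    rw [sub_zero] at h4
    refine h4.congr' ?_
    filter_upwards [hE, hU self_mem_nhdsWithin] with t h5 ht
    have ht : (0 : ℝ) < t := ht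
    rw [h5, ← he]
    simp only [map_sub, map_smul, ContinuousLinearEquiv.coe_coe, ContinuousLinearEquiv.symm_apply_apply]
    rw [smul_sub, smul_smul, inv_mul_cancel₀ ht.ne', one_smul]
    abel
  refine (isClosed_tcone u).mem_of_tendsto hkey (hU ?_)
  filter_upwards [self_mem_nhdsWithin] with t ht
  exact smul_sub_mem_tcone (hxf _) (inv_nonneg.2 (le_of_lt ht))

/-- The interiors of the tangent cones of different triangles at a point are disjoint. -/
theorem Mesh.openCone_disjoint [IsManifold IQ ∞ M] {T T' : Fin 𝒯.n} (hT : T ≠ T') {u u' k k' : E2}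
    (hu : u ∈ refTri) (hu' : u' ∈ refTri) (huu : 𝒯.par T u = 𝒯.par T' u') (hk : k ∈ openCone u)
    (hk' : k' ∈ openCone u') : dchart (𝒯.par T) u k ≠ dchart (𝒯.par T') u' k' := by
  intro hkk
  have hf := 𝒯.smooth T
  have hf' := 𝒯.smooth T'
  have hd := hf.hasFDerivWithinAt_chart hu
  have hd' := hf'.hasFDerivWithinAt_chart hu'
  have hc' := hf'.contDiffWithinAt_chart hu'
  rw [← huu] at hd' hc'
  set φ := extChartAt IQ (𝒯.par T u)
  have hsrc : ∀ {S : Fin 𝒯.n} {a : E2}, a ∈ refTri → 𝒯.par S a = 𝒯.par T u →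
      ∀ᶠ x in 𝓝[refTri] a, 𝒯.par S x ∈ φ.source := fun {S a} ha h =>
    ((𝒯.smooth S).smooth.continuousOn a ha) (by
      rw [h]; exact extChartAt_source_mem_nhds _)
  obtain ⟨W, hW, hWs⟩ := mem_nhdsWithin_iff_exists_mem_nhds_inter.1 (hsrc hu' huu.symm)
  obtain ⟨ρ, hρ, hball⟩ := exists_closedBall_subset_image hc' hd' (hf'.isInvertible_dchart hu')
    hu' hk' hW
  have hx : Tendsto (fun t : ℝ => u + t • k) (𝓝[>] 0) (𝓝[refTri] u) := by
    refine tendsto_nhdsWithin_iff.2 ⟨?_, eventually_add_smul_mem hu (openCone_subset u hk)⟩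
    have : ContinuousAt (fun t : ℝ => u + t • k) 0 := by fun_prop
    simpa using this.tendsto.mono_left nhdsWithin_le_nhds
  obtain ⟨t, h1, h2, h3, h4⟩ := (hball.and ((eventually_norm_sub_le hd hu (openCone_subset u hk) hρ).and
    ((eventually_add_smul_mem_openTri hu hk).and (hx (hsrc hu rfl))))).exists
  rw [← huu, ← hkk] at h1
  obtain ⟨x', ⟨hx', hxW⟩, e⟩ := h1 (mem_closedBall_iff_norm.2 h2)
  have e2 : 𝒯.par T (u + t • k) = 𝒯.par T' x' := φ.injOn h4 (hWs ⟨hxW, hx'⟩) e.symm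
  have hin : 𝒯.par T (u + t • k) ∈ 𝒯.par T '' refTri ∩ 𝒯.par T' '' refTri :=
    ⟨mem_image_of_mem _ (openTri_subset h3), e2 ▸ mem_image_of_mem _ hx'⟩
  rcases 𝒯.inter T T' hT with h0 | ⟨s, s', hs, -, h0, -⟩
  · rw [h0] at hin; exact hin
  · rw [h0] at hin
    obtain ⟨z, hz, hzz⟩ := hin
    have hzr : z ∈ refTri := face_subset s hz
    rw [𝒯.inj T hzr (openTri_subset h3) hzz] at hz
    exact notMem_face_of_mem_openTri hs h3 hz

end Chart

end

section

open Filter Topology Set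

/-! ### Sectors of the plane -/

/-- The oriented area of the parallelogram spanned by two complex numbers. -/
def wedge (a b : ℂ) : ℝ := a.re * b.im - a.im * b.re

theorem wedge_swap (a b : ℂ) : wedge a b = - wedge b a := by simp only [wedge]; ring

theorem wedge_smul_left (c : ℝ) (a b : ℂ) : wedge (c • a) b = c * wedge a b := by
  simp [wedge]; ring

theorem wedge_smul_right (c : ℝ) (a b : ℂ) : wedge a (c • b) = c * wedge a b := by
  simp [wedge]; ring

theorem wedge_add_left (a b c : ℂ) : wedge (a + b) c = wedge a c + wedge b c := by
  simp [wedge]; ring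

theorem wedge_add_right (a b c : ℂ) : wedge a (b + c) = wedge a b + wedge a c := by
  simp [wedge]; ring

theorem wedge_neg_left (a b : ℂ) : wedge (-a) b = - wedge a b := by simp [wedge]; ring

theorem wedge_neg_right (a b : ℂ) : wedge a (-b) = - wedge a b := by simp [wedge]; ring

theorem wedge_self (a : ℂ) : wedge a a = 0 := by simp only [wedge]; ring

/-- The closed sector swept counterclockwise from `a` to `b`. -/
def sector (a b : ℂ) : Set ℂ := {w | 0 ≤ wedge a w ∧ 0 ≤ wedge w b}

/-- The open sector swept counterclockwise from `a` to `b`. -/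
def openSector (a b : ℂ) : Set ℂ := {w | 0 < wedge a w ∧ 0 < wedge w b}

/-- `a` and `b` span a convex sector of angle in `(0, π]`. -/
def IsConvexPair (a b : ℂ) : Prop := 0 < wedge a b ∨ a ≠ 0 ∧ ∃ c : ℝ, 0 < c ∧ b = -(c • a)

theorem continuous_wedge_left (a : ℂ) : Continuous (wedge a) := by
  unfold wedge; fun_prop

theorem continuous_wedge_right (b : ℂ) : Continuous fun w => wedge w b := by
  unfold wedge; fun_prop

theorem measurableSet_sector (a b : ℂ) : MeasurableSet (sector a b) :=
  ((isClosed_le continuous_const (continuous_wedge_left a)).inter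
    (isClosed_le continuous_const (continuous_wedge_right b))).measurableSet

theorem measurableSet_openSector (a b : ℂ) : MeasurableSet (openSector a b) :=
  ((isOpen_lt continuous_const (continuous_wedge_left a)).inter
    (isOpen_lt continuous_const (continuous_wedge_right b))).measurableSet

theorem openSector_subset (a b : ℂ) : openSector a b ⊆ sector a b := fun _ h => ⟨h.1.le, h.2.le⟩

/-- The angular measure of a set of directions. -/
def ang (S : Set ℂ) : ℝ := ∫ φ in -Real.pi..Real.pi, S.indicator (fun _ => (1 : ℝ)) (Complex.exp (φ * Complex.I))

theorem intervalIntegrable_ang {S : Set ℂ} (hS : MeasurableSet S) (a b : ℝ) :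
    IntervalIntegrable (fun φ : ℝ => S.indicator (fun _ => (1 : ℝ)) (Complex.exp (φ * Complex.I)))
      volume a b := by
  have hm : Measurable fun φ : ℝ => S.indicator (fun _ => (1 : ℝ)) (Complex.exp (φ * Complex.I)) :=
    (measurable_const.indicator hS).comp (by fun_prop)
  refine (intervalIntegrable_const (c := (1 : ℝ)) (μ := volume)).mono_fun hm.aestronglyMeasurable ?_
  refine Filter.Eventually.of_forall fun φ => ?_
  simp only [indicator]
  split_ifs <;> simp

theorem ang_univ : ang univ = 2 * Real.pi := by
  simp [ang]; ring

theorem ang_le_sum {S : Set ℂ} (hS : MeasurableSet S) {ι : Type*}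
    (s : Finset ι) {A : ι → Set ℂ} (hA : ∀ i, MeasurableSet (A i))
    (h : S ⊆ ⋃ i ∈ s, A i) : ang S ≤ ∑ i ∈ s, ang (A i) := by
  simp only [ang]
  rw [← intervalIntegral.integral_finset_sum fun i _ => intervalIntegrable_ang (hA i) _ _]
  refine intervalIntegral.integral_mono_on (by linarith [Real.pi_pos]) (intervalIntegrable_ang hS _ _)
    (by simpa only [Finset.sum_fn] using! IntervalIntegrable.sum s fun i _ => intervalIntegrable_ang (hA i) _ _) fun φ _ => ?_
  simp only [indicator]
  split_ifs with h1
  · obtain ⟨i, hi, hw⟩ := mem_iUnion₂.1 (h h1)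
    refine le_trans ?_ (Finset.single_le_sum (fun j _ => ?_) hi)
    · simp [hw]
    · split_ifs <;> norm_num
  · exact Finset.sum_nonneg fun j _ => by split_ifs <;> norm_num

theorem sum_ang_le {S : Set ℂ} (hS : MeasurableSet S) {ι : Type*}
    (s : Finset ι) {A : ι → Set ℂ} (hA : ∀ i, MeasurableSet (A i)) (hsub : ∀ i ∈ s, A i ⊆ S)
    (hd : ∀ i ∈ s, ∀ j ∈ s, i ≠ j → Disjoint (A i) (A j)) : ∑ i ∈ s, ang (A i) ≤ ang S := by
  simp only [ang]
  rw [← intervalIntegral.integral_finset_sum fun i _ => intervalIntegrable_ang (hA i) _ _]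
  refine intervalIntegral.integral_mono_on (by linarith [Real.pi_pos])
    (by simpa only [Finset.sum_fn] using! IntervalIntegrable.sum s fun i _ => intervalIntegrable_ang (hA i) _ _)
    (intervalIntegrable_ang hS _ _) fun φ _ => ?_
  set w := Complex.exp (φ * Complex.I)
  simp only [indicator]
  by_cases hw : ∃ i ∈ s, w ∈ A i
  · obtain ⟨i, hi, hwi⟩ := hw
    rw [Finset.sum_eq_single_of_mem i hi fun j hj hji => if_neg fun hwj =>
      (Set.disjoint_left.1 (hd j hj i hi hji)) hwj hwi, if_pos hwi, if_pos (hsub i hi hwi)]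
  · push Not at hw
    rw [Finset.sum_eq_zero fun i hi => if_neg (hw i hi)]
    split_ifs <;> norm_num

theorem IsConvexPair.ne_zero {a b : ℂ} (h : IsConvexPair a b) : a ≠ 0 ∧ b ≠ 0 := by
  rcases h with h | ⟨ha, c, hc, rfl⟩
  · constructor <;> rintro rfl <;> simp [wedge] at h
  · exact ⟨ha, neg_ne_zero.2 (smul_ne_zero hc.ne' ha)⟩

theorem IsConvexPair.arg_mem {a b : ℂ} (h : IsConvexPair a b) :
    (b / a).arg ∈ Ioc 0 Real.pi := by
  refine ⟨?_, Complex.arg_le_pi _⟩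
  obtain ⟨ha, hb⟩ := h.ne_zero
  have him : (b / a).im = wedge a b / Complex.normSq a := by
    rw [Complex.div_im, wedge]; ring
  have hn : 0 < Complex.normSq a := Complex.normSq_pos.2 ha
  rcases h with h | ⟨-, c, hc, rfl⟩
  · have : 0 < (b / a).im := by rw [him]; positivity
    refine lt_of_le_of_ne (Complex.arg_nonneg_iff.2 this.le) fun h0 => ?_
    rw [eq_comm, Complex.arg_eq_zero_iff] at h0
    exact this.ne' h0.2
  · have : -(c • a) / a = ((-c : ℝ) : ℂ) := by
      rw [Complex.real_smul, neg_div, mul_div_cancel_right₀ _ ha]; simp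
    rw [this, Complex.arg_ofReal_of_neg (by linarith)]
    exact Real.pi_pos

theorem wedge_exp_left {a : ℂ} (φ : ℝ) :
    wedge a (Complex.exp ((φ + a.arg : ℝ) * Complex.I)) = ‖a‖ * Real.sin φ := by
  have h : a = ‖a‖ * Complex.exp (a.arg * Complex.I) := (Complex.norm_mul_exp_arg_mul_I a).symm
  rw [wedge, Complex.exp_ofReal_mul_I_im, Complex.exp_ofReal_mul_I_re]
  have hre := Complex.norm_mul_cos_arg a
  have him := Complex.norm_mul_sin_arg a
  rw [← hre, ← him, Real.sin_add, Real.cos_add]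
  linear_combination ‖a‖ * Real.sin φ * Real.sin_sq_add_cos_sq a.arg

theorem wedge_exp_right {a b : ℂ} (ha : a ≠ 0) (φ : ℝ) :
    wedge (Complex.exp ((φ + a.arg : ℝ) * Complex.I)) b = ‖b‖ * Real.sin ((b / a).arg - φ) := by
  have hb : b = (b / a) * a := by field_simp
  have hn : ‖b‖ = ‖b / a‖ * ‖a‖ := by rw [← norm_mul, ← hb]
  have hre := Complex.norm_mul_cos_arg a
  have him := Complex.norm_mul_sin_arg a
  have hre' := Complex.norm_mul_cos_arg (b / a)
  have him' := Complex.norm_mul_sin_arg (b / a)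
  set q := b / a
  rw [wedge, Complex.exp_ofReal_mul_I_im, Complex.exp_ofReal_mul_I_re, hn, hb, Complex.mul_re,
    Complex.mul_im, ← hre, ← him, ← hre', ← him', Real.sin_sub, Real.sin_add, Real.cos_add]
  linear_combination ‖q‖ * ‖a‖ * (Real.sin q.arg * Real.cos φ - Real.cos q.arg * Real.sin φ) *
    Real.sin_sq_add_cos_sq a.arg

theorem ang_eq_of_openSector {a b : ℂ} (h : IsConvexPair a b) {S : Set ℂ} (hS : MeasurableSet S)
    (h1 : openSector a b ⊆ S) (h2 : S ⊆ sector a b) : ang S = (b / a).arg := by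
  obtain ⟨ha, hb⟩ := h.ne_zero
  obtain ⟨hθ0, hθ1⟩ := h.arg_mem
  set θ := (b / a).arg
  have hna : 0 < ‖a‖ := norm_pos_iff.2 ha
  have hnb : 0 < ‖b‖ := norm_pos_iff.2 hb
  set F : ℝ → ℝ := fun φ => S.indicator (fun _ => (1 : ℝ)) (Complex.exp (φ * Complex.I)) with hF
  have hper : Function.Periodic F (2 * Real.pi) := fun φ => by
    simp only [hF]; congr 1
    rw [Complex.ofReal_add, add_mul, Complex.exp_add]
    simp [Complex.exp_two_pi_mul_I]
  have e1 : ang S = ∫ φ in (0 : ℝ)..2 * Real.pi, F (φ + a.arg) := by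
    rw [intervalIntegral.integral_comp_add_right F, zero_add, add_comm (2 * Real.pi),
      hper.intervalIntegral_add_eq a.arg (-Real.pi)]
    rw [ang]; congr 1; ring
  have hint : ∀ x y : ℝ, IntervalIntegrable (fun φ => F (φ + a.arg)) volume x y := fun x y => by
    have := (intervalIntegrable_ang hS (x + a.arg) (y + a.arg)).comp_add_right a.arg
    simpa only [add_sub_cancel_right] using this
  rw [e1, ← intervalIntegral.integral_add_adjacent_intervals (hint 0 θ) (hint θ _)]
  have i1 : ∫ φ in (0 : ℝ)..θ, F (φ + a.arg) = ∫ φ in (0 : ℝ)..θ, (1 : ℝ) := by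
    refine intervalIntegral.integral_congr_Ioo_of_le hθ0.le fun φ hφ => ?_
    refine indicator_of_mem (h1 ⟨?_, ?_⟩) _
    · rw [wedge_exp_left]
      exact mul_pos hna (Real.sin_pos_of_pos_of_lt_pi hφ.1 (by linarith [hφ.2]))
    · rw [wedge_exp_right ha]
      exact mul_pos hnb (Real.sin_pos_of_pos_of_lt_pi (by linarith [hφ.2]) (by linarith [hφ.1]))
  have i2 : ∫ φ in θ..2 * Real.pi, F (φ + a.arg) = ∫ φ in θ..2 * Real.pi, (0 : ℝ) := by
    refine intervalIntegral.integral_congr_Ioo_of_le (by linarith [Real.pi_pos]) fun φ hφ => ?_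
    refine indicator_of_notMem (fun hm => ?_) _
    obtain ⟨m1, m2⟩ := h2 hm
    rw [wedge_exp_left] at m1
    rw [wedge_exp_right ha] at m2
    have m1 := nonneg_of_mul_nonneg_right m1 hna
    have m2 := nonneg_of_mul_nonneg_right m2 hnb
    rcases lt_or_ge Real.pi φ with hp | hp
    · have : Real.sin φ < 0 := by
        have := Real.sin_neg_of_neg_of_neg_pi_lt (x := φ - 2 * Real.pi) (by linarith [hφ.2]) (by linarith)
        rwa [Real.sin_sub_two_pi] at this
      linarith
    · have : Real.sin (θ - φ) < 0 :=
        Real.sin_neg_of_neg_of_neg_pi_lt (by linarith [hφ.1]) (by linarith)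
      linarith
  rw [i1, i2]
  simp

/-- The angles of convex sectors with disjoint interiors that fill `D` add up to the
angle of `D`. -/
theorem sum_arg_eq_ang {ι : Type*} (s : Finset ι) {a b : ι → ℂ} (h : ∀ i ∈ s, IsConvexPair (a i) (b i))
    {D : Set ℂ} (hD : MeasurableSet D) (hcover : D ⊆ ⋃ i ∈ s, sector (a i) (b i))
    (hsub : ∀ i ∈ s, sector (a i) (b i) ⊆ D)
    (hd : ∀ i ∈ s, ∀ j ∈ s, i ≠ j → Disjoint (openSector (a i) (b i)) (openSector (a j) (b j))) :
    ∑ i ∈ s, (b i / a i).arg = ang D := by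
  apply le_antisymm
  · rw [← Finset.sum_congr rfl fun i hi => ang_eq_of_openSector (h i hi)
      (measurableSet_openSector (a i) (b i)) subset_rfl (openSector_subset _ _)]
    exact sum_ang_le hD s (fun i => measurableSet_openSector _ _)
      (fun i hi => (openSector_subset _ _).trans (hsub i hi)) hd
  · rw [← Finset.sum_congr rfl fun i hi => ang_eq_of_openSector (h i hi)
      (measurableSet_sector (a i) (b i)) (openSector_subset _ _) subset_rfl]
    exact ang_le_sum hD s (fun i => measurableSet_sector _ _) hcover

theorem ang_sector {a b : ℂ} (h : IsConvexPair a b) : ang (sector a b) = (b / a).arg :=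
  ang_eq_of_openSector h (measurableSet_sector _ _) (openSector_subset _ _) subset_rfl

end

section

open Filter Topology Set

/-! ### Directions at a point, in the coordinates of a frame -/

/-- The oriented area of the parallelogram spanned by two vectors. -/
def cross (v w : E2) : ℝ := v 0 * w 1 - v 1 * w 0

theorem mem_tcone_vtx {i : Fin 3} {k : E2} :
    k ∈ tcone (vtx i) ↔ 0 ≤ cross (sideDir i) k ∧ 0 ≤ cross k (-sideDir (i + 2)) := by
  fin_cases i
  · simp [tcone, vtx, cross, sideDir]; tauto
  · simp [tcone, vtx, cross, sideDir]
    constructor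
    · rintro ⟨h1, h2⟩; exact ⟨by linarith, h1⟩
    · rintro ⟨h1, h2⟩; exact ⟨h2, by linarith⟩
  · simp [tcone, vtx, cross, sideDir]
    intro _
    constructor <;> intro h <;> linarith

theorem mem_openCone_vtx {i : Fin 3} {k : E2} :
    k ∈ openCone (vtx i) ↔ 0 < cross (sideDir i) k ∧ 0 < cross k (-sideDir (i + 2)) := by
  fin_cases i
  · simp [openCone, vtx, cross, sideDir]; tauto
  · simp [openCone, vtx, cross, sideDir]
    constructor
    · rintro ⟨h1, h2⟩; exact ⟨by linarith, h1⟩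
    · rintro ⟨h1, h2⟩; exact ⟨h2, by linarith⟩
  · simp [openCone, vtx, cross, sideDir]
    intro _
    constructor <;> intro h <;> linarith

theorem cross_nonneg_of_mem_tcone_sidePt {i : Fin 3} {s : ℝ} {k : E2}
    (h : k ∈ tcone (sidePt i s)) : 0 ≤ cross (sideDir i) k := by
  obtain ⟨h0, h1, h2⟩ := h
  fin_cases i
  · simp [sidePt, vtx, cross, sideDir] at *; exact h1
  · simp [sidePt, vtx, cross, sideDir] at *; linarith
  · simp [sidePt, vtx, cross, sideDir] at *; exact h0

theorem mem_openCone_sidePt {i : Fin 3} {s : ℝ} (hs : s ∈ Ioo (0 : ℝ) 1) {k : E2}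
    (h : 0 < cross (sideDir i) k) : k ∈ openCone (sidePt i s) := by
  obtain ⟨s0, s1⟩ := hs
  fin_cases i
  · simp [openCone, sidePt, vtx, cross, sideDir] at *
    exact ⟨fun e => absurd e (by linarith), h, fun e => absurd e (by linarith)⟩
  · simp [openCone, sidePt, vtx, cross, sideDir] at *
    exact ⟨fun e => absurd e (by linarith), fun e => absurd e (by linarith), by linarith⟩
  · simp [openCone, sidePt, vtx, cross, sideDir] at *
    exact ⟨h, fun e => absurd e (by linarith), fun e => absurd e (by linarith)⟩

theorem sidePt_at_zero (i : Fin 3) : sidePt i 0 = vtx i := by simp [sidePt]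

theorem sidePt_at_one (i : Fin 3) : sidePt i 1 = vtx (i + 1) := by simp [sidePt, sideDir]

section Frame

variable {M : Type*} [TopologicalSpace M] [ChartedSpace (EuclideanQuadrant 2) M] [IsManifold IQ ∞ M]

/-- A tangent vector, given in the preferred chart, in the coordinates of a frame. -/
def zeta (g : Metric2 M) (e₁ e₂ : ∀ x : M, TangentSpace IQ x) (y : M) (w : E2) : ℂ :=
  frameZ g e₁ e₂ y w

/-- The tangent vector of a side of a triangle in the coordinates of a frame. -/
def sideZ (g : Metric2 M) (e₁ e₂ : ∀ x : M, TangentSpace IQ x) (f : E2 → M) (i : Fin 3) (s : ℝ) : ℂ :=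
  zeta g e₁ e₂ (f (sidePt i s)) (dchart f (sidePt i s) (sideDir i))

section

variable (g : Metric2 M) (e₁ e₂ : ∀ x : M, TangentSpace IQ x) (y : M)

theorem zeta_add (v w : E2) : zeta g e₁ e₂ y (v + w) = zeta g e₁ e₂ y v + zeta g e₁ e₂ y w :=
  Complex.ext ((g.inner y (e₁ y)).map_add v w) ((g.inner y (e₂ y)).map_add v w)

theorem zeta_smul (c : ℝ) (v : E2) : zeta g e₁ e₂ y (c • v) = c • zeta g e₁ e₂ y v := by
  refine Complex.ext (((g.inner y (e₁ y)).map_smul c v).trans ?_)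
    (((g.inner y (e₂ y)).map_smul c v).trans ?_) <;> simp [zeta, frameZ]

theorem zeta_eq (v : E2) : zeta g e₁ e₂ y v =
    v 0 • zeta g e₁ e₂ y (EuclideanSpace.single 0 1) + v 1 • zeta g e₁ e₂ y (EuclideanSpace.single 1 1) := by
  conv_lhs => rw [vec_eq_sum v]
  rw [zeta_add, zeta_smul, zeta_smul]

theorem wedge_zeta (v w : E2) : wedge (zeta g e₁ e₂ y v) (zeta g e₁ e₂ y w) =
    wedge (zeta g e₁ e₂ y (EuclideanSpace.single 0 1)) (zeta g e₁ e₂ y (EuclideanSpace.single 1 1)) *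
      cross v w := by
  rw [zeta_eq g e₁ e₂ y v, zeta_eq g e₁ e₂ y w]
  simp only [wedge_add_left, wedge_add_right, wedge_smul_left, wedge_smul_right, wedge_self, cross]
  rw [wedge_swap (zeta g e₁ e₂ y (EuclideanSpace.single 1 1))]
  ring

end

variable {g : Metric2 M} {e₁ e₂ : ∀ x : M, TangentSpace IQ x} (h : IsFrame g e₁ e₂) {f : E2 → M}
  (hf : IsSmoothTriangle f) (ho : PreservesOrientation e₁ e₂ f)
include h hf ho

theorem exists_wedge_dchart_eq {u : E2} (hu : u ∈ refTri) : ∃ D > 0, ∀ k l : E2,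
    wedge (zeta g e₁ e₂ (f u) (dchart f u k)) (zeta g e₁ e₂ (f u) (dchart f u l)) = D * cross k l := by
  refine ⟨_, (IsFrame.coframe h hf ho).pos u hu, fun k l => ?_⟩
  have e : ∀ k, zeta g e₁ e₂ (f u) (dchart f u k) = cplx (coform g e₁ f) (coform g e₂ f) u k :=
    fun k => (cplx_coform g e₁ e₂ f u k).symm
  rw [e, e]
  simp only [wedge, cplx, cross]
  ring

theorem zeta_ne {u : E2} (hu : u ∈ refTri) : wedge (zeta g e₁ e₂ (f u) (EuclideanSpace.single 0 1))
    (zeta g e₁ e₂ (f u) (EuclideanSpace.single 1 1)) ≠ 0 := by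
  intro h0
  obtain ⟨D, hD, hw⟩ := exists_wedge_dchart_eq h hf ho hu
  have := hw (EuclideanSpace.single 0 1) (EuclideanSpace.single 1 1)
  rw [wedge_zeta, h0] at this
  simp [cross] at this
  exact hD.ne this

theorem zeta_surjective {u : E2} (hu : u ∈ refTri) (z : ℂ) : ∃ w, zeta g e₁ e₂ (f u) w = z := by
  have h0 := zeta_ne h hf ho hu
  set a := zeta g e₁ e₂ (f u) (EuclideanSpace.single 0 1)
  set b := zeta g e₁ e₂ (f u) (EuclideanSpace.single 1 1)
  refine ⟨pt (wedge z b / wedge a b) (wedge a z / wedge a b), ?_⟩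
  rw [zeta_eq, pt_zero, pt_one]
  have e : ∀ x y : ℝ, (wedge a b) • z = x • a + y • b → z = (x / wedge a b) • a + (y / wedge a b) • b := by
    intro x y hxy
    rw [div_eq_inv_mul, div_eq_inv_mul, mul_smul, mul_smul, ← smul_add, ← hxy, smul_smul,
      inv_mul_cancel₀ h0, one_smul]
  refine (e _ _ ?_).symm
  apply Complex.ext <;> simp [wedge] <;> ring

theorem zeta_injective {u : E2} (hu : u ∈ refTri) {v w : E2}
    (hvw : zeta g e₁ e₂ (f u) v = zeta g e₁ e₂ (f u) w) : v = w := by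
  have h0 := zeta_ne h hf ho hu
  have key : ∀ l : E2, cross v l = cross w l := fun l => by
    have h1 := wedge_zeta g e₁ e₂ (f u) v l
    rw [hvw, wedge_zeta] at h1
    exact (mul_left_cancel₀ h0 h1).symm
  have k0 := key (EuclideanSpace.single 0 1)
  have k1 := key (EuclideanSpace.single 1 1)
  simp [cross] at k0 k1
  ext j; fin_cases j
  · exact k1
  · exact k0

theorem zeta_dchart_surjective {u : E2} (hu : u ∈ refTri) (z : ℂ) :
    ∃ k, zeta g e₁ e₂ (f u) (dchart f u k) = z := by
  obtain ⟨w, hw⟩ := zeta_surjective h hf ho hu z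
  obtain ⟨e, he⟩ := hf.isInvertible_dchart hu
  exact ⟨e.symm w, by rw [← he]; simpa using hw⟩

theorem sideZ_ne_zero (i : Fin 3) {s : ℝ} (hs : s ∈ Icc (0 : ℝ) 1) : sideZ g e₁ e₂ f i s ≠ 0 := by
  have := (IsFrame.coframe h hf ho).cplx_ne_zero (hf.isMetric_pull g) (sidePt_mem i hs)
    (sideDir_ne_zero i)
  rwa [cplx_coform] at this

theorem sideZ_zero (i : Fin 3) :
    sideZ g e₁ e₂ f i 0 = zeta g e₁ e₂ (f (vtx i)) (dchart f (vtx i) (sideDir i)) := by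
  rw [sideZ, sidePt_at_zero]

omit h hf ho in
theorem sideZ_one (i : Fin 3) :
    -sideZ g e₁ e₂ f (i + 2) 1 = zeta g e₁ e₂ (f (vtx i)) (dchart f (vtx i) (-sideDir (i + 2))) := by
  have : sidePt (i + 2) 1 = vtx i := by
    rw [sidePt_at_one]; congr 1; fin_cases i <;> rfl
  rw [sideZ, this, map_neg, ← neg_one_smul ℝ, ← neg_one_smul ℝ (dchart f (vtx i) _), zeta_smul]

theorem mem_tcone_vtx_iff {i : Fin 3} {k : E2} : k ∈ tcone (vtx i) ↔
    zeta g e₁ e₂ (f (vtx i)) (dchart f (vtx i) k) ∈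
      sector (sideZ g e₁ e₂ f i 0) (-sideZ g e₁ e₂ f (i + 2) 1) := by
  obtain ⟨D, hD, hw⟩ := exists_wedge_dchart_eq h hf ho (vtx_mem i)
  rw [mem_tcone_vtx, sideZ_zero h hf ho, sideZ_one, sector, mem_ofPred_eq, hw, hw,
    mul_nonneg_iff_of_pos_left hD, mul_nonneg_iff_of_pos_left hD]

theorem mem_openCone_vtx_iff {i : Fin 3} {k : E2} : k ∈ openCone (vtx i) ↔
    zeta g e₁ e₂ (f (vtx i)) (dchart f (vtx i) k) ∈
      openSector (sideZ g e₁ e₂ f i 0) (-sideZ g e₁ e₂ f (i + 2) 1) := by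
  obtain ⟨D, hD, hw⟩ := exists_wedge_dchart_eq h hf ho (vtx_mem i)
  rw [mem_openCone_vtx, sideZ_zero h hf ho, sideZ_one, openSector, mem_ofPred_eq, hw, hw,
    mul_pos_iff_of_pos_left hD, mul_pos_iff_of_pos_left hD]

theorem wedge_sideZ_pos (i : Fin 3) :
    0 < wedge (sideZ g e₁ e₂ f i 0) (-sideZ g e₁ e₂ f (i + 2) 1) := by
  obtain ⟨D, hD, hw⟩ := exists_wedge_dchart_eq h hf ho (vtx_mem i)
  rw [sideZ_zero h hf ho, sideZ_one, hw]
  refine mul_pos hD ?_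
  fin_cases i <;> simp [cross, sideDir, vtx]

theorem wedge_sideZ_nonneg {i : Fin 3} {s : ℝ} (hs : s ∈ Icc (0 : ℝ) 1) {k : E2}
    (hk : k ∈ tcone (sidePt i s)) : 0 ≤ wedge (sideZ g e₁ e₂ f i s)
      (zeta g e₁ e₂ (f (sidePt i s)) (dchart f (sidePt i s) k)) := by
  obtain ⟨D, hD, hw⟩ := exists_wedge_dchart_eq h hf ho (sidePt_mem i hs)
  rw [sideZ, hw]
  exact mul_nonneg hD.le (cross_nonneg_of_mem_tcone_sidePt hk)

theorem exists_mem_openCone_sidePt {i : Fin 3} {s : ℝ} (hs : s ∈ Ioo (0 : ℝ) 1) {z : ℂ}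
    (hz : 0 < wedge (sideZ g e₁ e₂ f i s) z) : ∃ k ∈ openCone (sidePt i s),
      zeta g e₁ e₂ (f (sidePt i s)) (dchart f (sidePt i s) k) = z := by
  have hm := sidePt_mem i (Ioo_subset_Icc_self hs)
  obtain ⟨k, rfl⟩ := zeta_dchart_surjective h hf ho hm z
  obtain ⟨D, hD, hw⟩ := exists_wedge_dchart_eq h hf ho hm
  rw [sideZ, hw] at hz
  exact ⟨k, mem_openCone_sidePt hs (pos_of_mul_pos_right hz hD.le), rfl⟩

theorem angle_pull_eq_arg (i : Fin 3) : angle (pull g f) i =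
    (-sideZ g e₁ e₂ f (i + 2) 1 / sideZ g e₁ e₂ f i 0).arg := by
  have c := IsFrame.coframe h hf ho
  have hp := wedge_sideZ_pos h hf ho i
  have hx := vtx_mem i
  have e : ∀ k, cplx (coform g e₁ f) (coform g e₂ f) (vtx i) k =
      zeta g e₁ e₂ (f (vtx i)) (dchart f (vtx i) k) := fun k => cplx_coform g e₁ e₂ f _ k
  have hd : vtx (i + 2) - vtx i = -sideDir (i + 2) := by
    have : i + 2 + 1 = i := by fin_cases i <;> rfl
    rw [sideDir, this]; abel
  rw [angle, c.len_eq hx, c.len_eq hx, c.pair_eq hx, hd, e, e]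
  change Real.arccos ((starRingEnd ℂ (zeta g e₁ e₂ (f (vtx i)) (dchart f (vtx i) (sideDir i))) * _).re /
    (‖zeta g e₁ e₂ (f (vtx i)) (dchart f (vtx i) (sideDir i))‖ * _)) = _
  rw [← sideZ_one, ← sideZ_zero h hf ho]
  set a := sideZ g e₁ e₂ f i 0
  set b := -sideZ g e₁ e₂ f (i + 2) 1
  obtain ⟨ha, hb⟩ := (IsConvexPair.ne_zero (Or.inl hp))
  have hn : 0 < Complex.normSq a := Complex.normSq_pos.2 ha
  have hm : (b / a).im = wedge a b / Complex.normSq a := by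
    rw [Complex.div_im, wedge]; ring
  rw [Complex.arg_of_im_nonneg_of_ne_zero (by rw [hm]; positivity) (div_ne_zero hb ha)]
  congr 1
  have hna : ‖a‖ ≠ 0 := norm_ne_zero_iff.2 ha
  have hnb : ‖b‖ ≠ 0 := norm_ne_zero_iff.2 hb
  rw [norm_div, Complex.div_re, Complex.normSq_eq_norm_sq, Complex.mul_re]
  simp only [Complex.conj_re, Complex.conj_im]
  field_simp
  ring

theorem expMu_eq (i : Fin 3) {s : ℝ} (hs : s ∈ Icc (0 : ℝ) 1) : expMu g e₁ e₂ f i s =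
    -Complex.I * sideZ g e₁ e₂ f i s / ‖sideZ g e₁ e₂ f i s‖ := by
  have := (IsFrame.coframe h hf ho).expNormal_eq (hf.isMetric_pull g) (IsFrame.dualFrame h hf ho) i hs
  rw [cplx_coform] at this
  exact this

end Frame

end

section

open Filter Topology Set

/-! ### Sides with the same image -/

theorem exists_reparametrization {X : Type*} [TopologicalSpace X] [T2Space X] {c c' : ℝ → X}
    (hc : ContinuousOn c (Icc 0 1)) (hc' : ContinuousOn c' (Icc 0 1)) (hi : InjOn c (Icc 0 1))
    (hi' : InjOn c' (Icc 0 1)) (himg : c '' Icc 0 1 = c' '' Icc 0 1) :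
    ∃ ψ : ℝ → ℝ, MapsTo ψ (Icc 0 1) (Icc 0 1) ∧ ContinuousOn ψ (Icc 0 1) ∧
      (∀ s ∈ Icc (0 : ℝ) 1, c' (ψ s) = c s) ∧
      ((StrictMonoOn ψ (Icc 0 1) ∧ ψ 0 = 0 ∧ ψ 1 = 1) ∨
        (StrictAntiOn ψ (Icc 0 1) ∧ ψ 0 = 1 ∧ ψ 1 = 0)) := by
  have hex : ∀ s : Icc (0 : ℝ) 1, ∃ t : Icc (0 : ℝ) 1, c' t = c s := fun s => by
    have : c s ∈ c' '' Icc 0 1 := himg ▸ mem_image_of_mem c s.2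
    obtain ⟨t, ht, e⟩ := this
    exact ⟨⟨t, ht⟩, e⟩
  choose ψ₀ hψ₀ using hex
  have hemb : IsClosedEmbedding ((Icc (0 : ℝ) 1).domRestrict c') :=
    hc'.domRestrict.isClosedEmbedding hi'.injective
  have hcont : Continuous ψ₀ := by
    rw [hemb.isEmbedding.continuous_iff]
    exact hc.domRestrict.congr fun s => (hψ₀ s).symm
  set ψ : ℝ → ℝ := IccExtend zero_le_one fun s => (ψ₀ s : ℝ) with hψ
  have hmap : MapsTo ψ (Icc 0 1) (Icc 0 1) := fun s hs => by
    rw [hψ, IccExtend_of_mem _ _ hs]; exact (ψ₀ _).2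
  have hcont' : ContinuousOn ψ (Icc 0 1) := (continuous_subtype_val.comp hcont).Icc_extend'.continuousOn
  have hψc : ∀ s ∈ Icc (0 : ℝ) 1, c' (ψ s) = c s := fun s hs => by
    rw [hψ, IccExtend_of_mem _ _ hs]; exact hψ₀ _
  have hinj : InjOn ψ (Icc 0 1) := fun s hs t ht hst =>
    hi hs ht (by rw [← hψc s hs, ← hψc t ht, hst])
  have hsurj : ∀ t ∈ Icc (0 : ℝ) 1, ∃ s ∈ Icc (0 : ℝ) 1, ψ s = t := fun t ht => by
    have : c' t ∈ c '' Icc 0 1 := himg ▸ mem_image_of_mem c' ht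
    obtain ⟨s, hs, e⟩ := this
    exact ⟨s, hs, hi' (hmap hs) ht (by rw [hψc s hs, e])⟩
  have h0 : (0 : ℝ) ∈ Icc (0 : ℝ) 1 := by simp
  have h1 : (1 : ℝ) ∈ Icc (0 : ℝ) 1 := by simp
  obtain ⟨a, ha, ea⟩ := hsurj 0 h0
  obtain ⟨b, hb, eb⟩ := hsurj 1 h1
  refine ⟨ψ, hmap, hcont', hψc, ?_⟩
  rcases hcont'.strictMonoOn_of_injOn_Icc' zero_le_one hinj with hm | hm
  · refine Or.inl ⟨hm, le_antisymm ?_ (hmap h0).1, le_antisymm (hmap h1).2 ?_⟩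
    · exact (hm.monotoneOn h0 ha ha.1).trans_eq ea
    · exact eb.symm.trans_le (hm.monotoneOn hb h1 hb.2)
  · refine Or.inr ⟨hm, le_antisymm (hmap h0).2 ?_, le_antisymm ?_ (hmap h1).1⟩
    · exact eb.symm.trans_le (hm.antitoneOn h0 hb hb.1)
    · exact (hm.antitoneOn ha h1 ha.2).trans_eq ea

theorem hasDerivWithinAt_of_comp {C C' : ℝ → E2} {v v' : E2} {ψ : ℝ → ℝ} {s : ℝ}
    (hs : s ∈ Icc (0 : ℝ) 1) (hmap : MapsTo ψ (Icc 0 1) (Icc 0 1)) (hψ : ContinuousOn ψ (Icc 0 1))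
    (hC : HasDerivWithinAt C v (Icc 0 1) s) (hC' : HasDerivWithinAt C' v' (Icc 0 1) (ψ s))
    (hv' : v' ≠ 0) (h : ∀ t ∈ Icc (0 : ℝ) 1, C' (ψ t) = C t) :
    ∃ m, HasDerivWithinAt ψ m (Icc 0 1) s ∧ v = m • v' := by
  set ℓ : E2 →L[ℝ] ℝ := innerSL ℝ v'
  have hℓ : ℓ v' ≠ 0 := by simpa [ℓ] using hv'
  have hψs : Tendsto ψ (𝓝[Icc 0 1] s) (𝓝[Icc 0 1] (ψ s)) :=
    (hψ s hs).tendsto_nhdsWithin hmap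
  have hk : HasDerivWithinAt (fun t => ℓ (C t)) (ℓ v) (Icc 0 1) s := ℓ.hasFDerivAt.comp_hasDerivWithinAt s hC
  have hg : HasDerivWithinAt (fun t => ℓ (C' t)) (ℓ v') (Icc 0 1) (ψ s) :=
    ℓ.hasFDerivAt.comp_hasDerivWithinAt _ hC'
  have hder : HasDerivWithinAt ψ (ℓ v / ℓ v') (Icc 0 1) s := by
    have hev : (fun t => ℓ (C' (ψ t)) - ℓ (C' (ψ s))) =ᶠ[𝓝[Icc 0 1] s] fun t => ℓ (C t) - ℓ (C s) := by
      filter_upwards [self_mem_nhdsWithin] with t ht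
      rw [h t ht, h s hs]
    have hO : (fun t => ψ t - ψ s) =O[𝓝[Icc 0 1] s] fun t => t - s := by
      have h1 := ((hg.isTheta_sub hℓ).isBigO_symm).comp_tendsto
        (hψs.prodMk tendsto_const_pure)
      exact (h1.congr' (EventuallyEq.refl _ _) hev).trans
        (hk.isBigO_sub.comp_tendsto (tendsto_id.prodMk tendsto_const_pure))
    rw [hasDerivWithinAt_iff_isLittleO] at hg hk ⊢
    have h2 := (hg.comp_tendsto hψs).trans_isBigO hO
    have h2' : (fun t => ℓ (C t) - ℓ (C s) - (ψ t - ψ s) • ℓ v') =o[𝓝[Icc 0 1] s] fun t => t - s :=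
      h2.congr' (hev.mono fun t ht => by
        have ht : ℓ (C' (ψ t)) - ℓ (C' (ψ s)) = ℓ (C t) - ℓ (C s) := ht
        simp only [Function.comp_apply]; rw [ht]) (EventuallyEq.refl _ _)
    have h3 := (hk.sub h2').const_mul_left (ℓ v')⁻¹
    refine h3.congr_left fun t => ?_
    simp only [smul_eq_mul]
    field_simp
    ring
  refine ⟨_, hder, ?_⟩
  have h1 : HasDerivWithinAt C ((ℓ v / ℓ v') • v') (Icc 0 1) s :=
    (hC'.scomp s hder hmap).congr (fun t ht => (h t ht).symm) (h s hs).symm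
  exact (uniqueDiffOn_Icc zero_lt_one s hs).eq_deriv _ hC h1

theorem sidePt_injective (i : Fin 3) : Function.Injective (sidePt i) := by
  intro s t hst
  have : s • sideDir i = t • sideDir i := by simpa [sidePt] using hst
  have := sub_eq_zero.2 this
  rw [← sub_smul, smul_eq_zero, sub_eq_zero] at this
  exact this.resolve_right (sideDir_ne_zero i)

theorem vtx_injective : Function.Injective vtx := by
  intro i j hij
  have h0 := congrArg (fun x : E2 => x 0) hij
  have h1 := congrArg (fun x : E2 => x 1) hij
  fin_cases i <;> fin_cases j <;> simp [vtx] at h0 h1 ⊢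

theorem side_subset (i : Fin 3) : side i ⊆ refTri := by
  rintro _ ⟨s, hs, rfl⟩; exact sidePt_mem i hs

theorem face_pair (i : Fin 3) : face {i, i + 1} = side i := by
  rw [face]
  simp only [Finset.coe_insert, Finset.coe_singleton, image_insert_eq, image_singleton]
  rw [convexHull_pair, segment_eq_image', side]
  rfl

theorem face_singleton (i : Fin 3) : face {i} = {vtx i} := by simp [face]

theorem face_empty : face ∅ = ∅ := by simp [face]

theorem finset_fin_three (s : Finset (Fin 3)) :
    s = ∅ ∨ (∃ i, s = {i}) ∨ (∃ i, s = {i, i + 1}) ∨ s = Finset.univ := by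
  revert s; decide

theorem vtx_mem_side {i j : Fin 3} (h : vtx j ∈ side i) : j = i ∨ j = i + 1 := by
  obtain ⟨s, hs, e⟩ := h
  by_contra hc
  push Not at hc
  have hj : j = i + 2 := by revert hc; fin_cases i <;> fin_cases j <;> simp
  subst hj
  have h0 := congrArg (fun x : E2 => x 0) e
  have h1 := congrArg (fun x : E2 => x 1) e
  fin_cases i <;> simp [sidePt, sideDir, vtx] at h0 h1 <;> linarith

theorem sidePt_mem_face {i : Fin 3} {s : ℝ} (hs : s ∈ Ioo (0 : ℝ) 1) {t : Finset (Fin 3)}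
    (ht : t ≠ Finset.univ) (h : sidePt i s ∈ face t) : t = {i, i + 1} := by
  obtain ⟨s0, s1⟩ := hs
  rcases finset_fin_three t with rfl | ⟨j, rfl⟩ | ⟨j, rfl⟩ | rfl
  · rw [face_empty] at h; exact absurd h (notMem_empty _)
  · rw [face_singleton, mem_singleton_iff] at h
    exfalso
    have h0 := congrArg (fun x : E2 => x 0) h
    have h1 := congrArg (fun x : E2 => x 1) h
    fin_cases i <;> fin_cases j <;> simp [sidePt, sideDir, vtx] at h0 h1 <;> linarith
  · rw [face_pair] at h
    obtain ⟨r, hr, e⟩ := h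
    by_cases hij : j = i
    · rw [hij]
    exfalso
    have h0 := congrArg (fun x : E2 => x 0) e
    have h1 := congrArg (fun x : E2 => x 1) e
    fin_cases i <;> fin_cases j <;> simp [sidePt, sideDir, vtx] at h0 h1 hij <;> linarith
  · exact absurd rfl ht

section Mesh

variable {M : Type*} [TopologicalSpace M] [ChartedSpace (EuclideanQuadrant 2) M] (𝒯 : Mesh M)

theorem Mesh.par_vtx_injective (T : Fin 𝒯.n) {i j : Fin 3} (h : 𝒯.par T (vtx i) = 𝒯.par T (vtx j)) :
    i = j := vtx_injective (𝒯.inj T (vtx_mem i) (vtx_mem j) h)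

theorem Mesh.image_side_ne_singleton (T : Fin 𝒯.n) (i : Fin 3) (y : M) : 𝒯.par T '' side i ≠ {y} := by
  intro h
  have h0 : 𝒯.par T (sidePt i 0) ∈ 𝒯.par T '' side i := mem_image_of_mem _ ⟨0, by simp, rfl⟩
  have h1 : 𝒯.par T (sidePt i 1) ∈ 𝒯.par T '' side i := mem_image_of_mem _ ⟨1, by simp, rfl⟩
  rw [h, mem_singleton_iff] at h0 h1
  have := 𝒯.inj T (sidePt_mem i (by simp)) (sidePt_mem i (by simp)) (h0.trans h1.symm)
  exact zero_ne_one (sidePt_injective i this)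

/-- Two different triangles through a point have a common vertex there or meet in a common side. -/
theorem Mesh.inter_cases {T T' : Fin 𝒯.n} (hT : T ≠ T') {u u' : E2} (hu : u ∈ refTri)
    (hu' : u' ∈ refTri) (huu : 𝒯.par T u = 𝒯.par T' u') :
    (∃ i i', u = vtx i ∧ u' = vtx i') ∨
    ∃ i i', u ∈ side i ∧ u' ∈ side i' ∧ 𝒯.par T '' side i = 𝒯.par T' '' side i' := by
  have hin : 𝒯.par T u ∈ 𝒯.par T '' refTri ∩ 𝒯.par T' '' refTri :=
    ⟨mem_image_of_mem _ hu, huu ▸ mem_image_of_mem _ hu'⟩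
  rcases 𝒯.inter T T' hT with h0 | ⟨s, s', hs, hs', h0, h1⟩
  · rw [h0] at hin; exact absurd hin (notMem_empty _)
  rw [h0] at hin
  have m : u ∈ face s := by
    obtain ⟨z, hz, e⟩ := hin
    rwa [← 𝒯.inj T (face_subset s hz) hu e]
  have m' : u' ∈ face s' := by
    rw [h1, huu] at hin
    obtain ⟨z, hz, e⟩ := hin
    rwa [← 𝒯.inj T' (face_subset s' hz) hu' e]
  rcases finset_fin_three s with rfl | ⟨i, rfl⟩ | ⟨i, rfl⟩ | rfl
  · rw [face_empty] at m; exact absurd m (notMem_empty _)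
  · rcases finset_fin_three s' with rfl | ⟨i', rfl⟩ | ⟨i', rfl⟩ | rfl
    · rw [face_empty] at m'; exact absurd m' (notMem_empty _)
    · rw [face_singleton] at m m'
      exact Or.inl ⟨i, i', m, m'⟩
    · rw [face_singleton, face_pair, image_singleton] at h1
      exact absurd h1.symm (𝒯.image_side_ne_singleton _ _ _)
    · exact absurd rfl hs'
  · rcases finset_fin_three s' with rfl | ⟨i', rfl⟩ | ⟨i', rfl⟩ | rfl
    · rw [face_empty] at m'; exact absurd m' (notMem_empty _)
    · rw [face_singleton, face_pair, image_singleton] at h1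
      exact absurd h1 (𝒯.image_side_ne_singleton _ _ _)
    · rw [face_pair] at m m' h1
      rw [face_pair] at h1
      exact Or.inr ⟨i, i', m, m', h1⟩
    · exact absurd rfl hs'
  · exact absurd rfl hs

theorem Mesh.exists_side_reparametrization [T2Space M] {T T' : Fin 𝒯.n} {i i' : Fin 3}
    (h : 𝒯.par T '' side i = 𝒯.par T' '' side i') :
    ∃ ψ : ℝ → ℝ, MapsTo ψ (Icc 0 1) (Icc 0 1) ∧ ContinuousOn ψ (Icc 0 1) ∧
      (∀ s ∈ Icc (0 : ℝ) 1, 𝒯.par T' (sidePt i' (ψ s)) = 𝒯.par T (sidePt i s)) ∧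
      ((StrictMonoOn ψ (Icc 0 1) ∧ ψ 0 = 0 ∧ ψ 1 = 1) ∨
        (StrictAntiOn ψ (Icc 0 1) ∧ ψ 0 = 1 ∧ ψ 1 = 0)) := by
  refine exists_reparametrization (c := fun s => 𝒯.par T (sidePt i s))
    (c' := fun s => 𝒯.par T' (sidePt i' s))
    (continuousOn_comp_sidePt (𝒯.smooth T).smooth.continuousOn i)
    (continuousOn_comp_sidePt (𝒯.smooth T').smooth.continuousOn i') ?_ ?_ ?_
  · exact fun s hs t ht e => sidePt_injective i (𝒯.inj T (sidePt_mem i hs) (sidePt_mem i ht) e)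
  · exact fun s hs t ht e => sidePt_injective i' (𝒯.inj T' (sidePt_mem i' hs) (sidePt_mem i' ht) e)
  · rw [side, side, image_image, image_image] at h
    exact h

theorem Mesh.exists_vtx_eq [T2Space M] {T T' : Fin 𝒯.n} {j : Fin 3} {u' : E2} (hu' : u' ∈ refTri)
    (h : 𝒯.par T (vtx j) = 𝒯.par T' u') : ∃ j', u' = vtx j' := by
  by_cases hT : T = T'
  · subst hT
    exact ⟨j, (𝒯.inj T (vtx_mem j) hu' h).symm⟩
  rcases 𝒯.inter_cases hT (vtx_mem j) hu' h with ⟨_, i', -, e⟩ | ⟨i, i', m, -, himg⟩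
  · exact ⟨i', e⟩
  obtain ⟨ψ, hmap, -, hψ, hm⟩ := 𝒯.exists_side_reparametrization himg
  have key : ∀ s ∈ Icc (0 : ℝ) 1, sidePt i s = vtx j → (ψ s = 0 ∨ ψ s = 1) → ∃ j', u' = vtx j' := by
    intro s hs e e2
    have h1 := hψ s hs
    rw [e, h] at h1
    have h2 := 𝒯.inj T' (sidePt_mem i' (hmap hs)) hu' h1
    rcases e2 with e2 | e2
    · rw [e2, sidePt_at_zero] at h2; exact ⟨_, h2.symm⟩
    · rw [e2, sidePt_at_one] at h2; exact ⟨_, h2.symm⟩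
  rcases vtx_mem_side m with rfl | rfl
  · exact key 0 (by simp) (sidePt_at_zero _) (by rcases hm with ⟨-, e, -⟩ | ⟨-, e, -⟩ <;> simp [e])
  · exact key 1 (by simp) (sidePt_at_one _) (by rcases hm with ⟨-, -, e⟩ | ⟨-, -, e⟩ <;> simp [e])

end Mesh

end

section

open Filter Topology Set

/-! ### Interior sides -/

section Pairing

variable {M : Type*} [TopologicalSpace M] [ChartedSpace (EuclideanQuadrant 2) M]

theorem IsSmoothTriangle.hasDerivWithinAt_chart_sidePt {f : E2 → M} (hf : IsSmoothTriangle f)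
    (i : Fin 3) {s : ℝ} (hs : s ∈ Icc (0 : ℝ) 1) :
    HasDerivWithinAt (fun t => extChartAt IQ (f (sidePt i s)) (f (sidePt i t)))
      (dchart f (sidePt i s) (sideDir i)) (Icc 0 1) s := by
  have h1 : HasDerivWithinAt (sidePt i) (sideDir i) (Icc 0 1) s := by
    have := ((hasDerivAt_id s).smul_const (sideDir i)).const_add (vtx i)
    rw [one_smul] at this
    exact this.hasDerivWithinAt
  exact (hf.hasFDerivWithinAt_chart (sidePt_mem i hs)).comp_hasDerivWithinAt s h1
    fun t ht => sidePt_mem i ht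

theorem singleton_ne_univ (j : Fin 3) : ({j} : Finset (Fin 3)) ≠ Finset.univ := by
  revert j; decide

theorem pair_ne_univ (j : Fin 3) : ({j, j + 1} : Finset (Fin 3)) ≠ Finset.univ := by
  revert j; decide

theorem singleton_ne_pair (i j : Fin 3) : ({j} : Finset (Fin 3)) ≠ {i, i + 1} := by
  revert i j; decide

theorem side_injective {i j : Fin 3} (h : side i = side j) : i = j := by
  have h0 : vtx i ∈ side j := h ▸ ⟨0, by simp, sidePt_at_zero i⟩
  have h1 : vtx (i + 1) ∈ side j := h ▸ ⟨1, by simp, sidePt_at_one i⟩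
  have a0 := vtx_mem_side h0
  have a1 := vtx_mem_side h1
  clear h h0 h1
  revert i j; decide

variable [IsManifold IQ ∞ M] [T2Space M] {g : Metric2 M} {e₁ e₂ : ∀ x : M, TangentSpace IQ x}
  (h : IsFrame g e₁ e₂) {𝒯 : Mesh M} (ho : ∀ T, PreservesOrientation e₁ e₂ (𝒯.par T))
include h ho

theorem sideZ_ne_smul {T T' : Fin 𝒯.n} (hT : T ≠ T') {i i' : Fin 3} {s s' : ℝ}
    (hs : s ∈ Ioo (0 : ℝ) 1) (hs' : s' ∈ Ioo (0 : ℝ) 1)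
    (hp : 𝒯.par T (sidePt i s) = 𝒯.par T' (sidePt i' s')) {c : ℝ} (hc : 0 < c) :
    sideZ g e₁ e₂ (𝒯.par T) i s ≠ c • sideZ g e₁ e₂ (𝒯.par T') i' s' := by
  intro hz
  have hm := sidePt_mem i (Ioo_subset_Icc_self hs)
  have hm' := sidePt_mem i' (Ioo_subset_Icc_self hs')
  set z := sideZ g e₁ e₂ (𝒯.par T) i s
  set z' := sideZ g e₁ e₂ (𝒯.par T') i' s'
  have hz0 : z ≠ 0 := sideZ_ne_zero h (𝒯.smooth T) (ho T) i (Ioo_subset_Icc_self hs)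
  have hw : 0 < wedge z (Complex.I * z) := by
    have : wedge z (Complex.I * z) = Complex.normSq z := by
      simp [wedge, Complex.normSq_apply]
    rw [this]; exact Complex.normSq_pos.2 hz0
  have hw' : 0 < wedge z' (Complex.I * z) := by
    have : wedge z (Complex.I * z) = c * wedge z' (Complex.I * z) := by
      rw [← wedge_smul_left, ← hz]
    rw [this] at hw
    exact pos_of_mul_pos_right hw hc.le
  obtain ⟨k, hk, e⟩ := exists_mem_openCone_sidePt h (𝒯.smooth T) (ho T) hs hw
  obtain ⟨k', hk', e'⟩ := exists_mem_openCone_sidePt h (𝒯.smooth T') (ho T') hs' hw'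
  rw [← hp, ← e] at e'
  exact 𝒯.openCone_disjoint hT hm hm' hp hk hk'
    (zeta_injective h (𝒯.smooth T) (ho T) hm e').symm

/-- The transition between the parametrizations of a common side reverses its direction. -/
theorem exists_side_transition {T T' : Fin 𝒯.n} (hT : T ≠ T') {i i' : Fin 3}
    (himg : 𝒯.par T '' side i = 𝒯.par T' '' side i') :
    ∃ ψ m : ℝ → ℝ, MapsTo ψ (Icc 0 1) (Icc 0 1) ∧ StrictAntiOn ψ (Icc 0 1) ∧ ψ 0 = 1 ∧ ψ 1 = 0 ∧
      ∀ s ∈ Icc (0 : ℝ) 1, 𝒯.par T' (sidePt i' (ψ s)) = 𝒯.par T (sidePt i s) ∧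
        HasDerivWithinAt ψ (m s) (Icc 0 1) s ∧ m s < 0 ∧
        sideZ g e₁ e₂ (𝒯.par T) i s = m s • sideZ g e₁ e₂ (𝒯.par T') i' (ψ s) := by
  obtain ⟨ψ, hmap, hcont, hψ, hmono⟩ := 𝒯.exists_side_reparametrization himg
  have hder : ∀ s, ∃ m, s ∈ Icc (0 : ℝ) 1 → HasDerivWithinAt ψ m (Icc 0 1) s ∧ m ≠ 0 ∧
      sideZ g e₁ e₂ (𝒯.par T) i s = m • sideZ g e₁ e₂ (𝒯.par T') i' (ψ s) := by
    intro s
    by_cases hs : s ∈ Icc (0 : ℝ) 1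
    swap
    · exact ⟨0, fun h => absurd h hs⟩
    have hC := (𝒯.smooth T).hasDerivWithinAt_chart_sidePt i hs
    have hC' := (𝒯.smooth T').hasDerivWithinAt_chart_sidePt i' (hmap hs)
    rw [hψ s hs] at hC'
    have hv' : dchart (𝒯.par T') (sidePt i' (ψ s)) (sideDir i') ≠ 0 := fun h0 =>
      sideDir_ne_zero i' ((𝒯.smooth T').immersion _ (sidePt_mem i' (hmap hs)) (h0.trans (map_zero _).symm))
    obtain ⟨m, h1, h2⟩ := hasDerivWithinAt_of_comp hs hmap hcont hC hC' hv' fun t ht => by rw [hψ t ht]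
    have h3 : sideZ g e₁ e₂ (𝒯.par T) i s = m • sideZ g e₁ e₂ (𝒯.par T') i' (ψ s) := by
      rw [sideZ, sideZ, h2, zeta_smul, hψ s hs]
    refine ⟨m, fun _ => ⟨h1, ?_, h3⟩⟩
    rintro rfl
    rw [zero_smul] at h3
    exact sideZ_ne_zero h (𝒯.smooth T) (ho T) i hs h3
  choose m hm using hder
  have hhalf : (1 / 2 : ℝ) ∈ Ioo (0 : ℝ) 1 := by constructor <;> norm_num
  rcases hmono with ⟨hmono, h0, h1⟩ | ⟨hanti, h0, h1⟩
  · exfalso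
    have hI := Ioo_subset_Icc_self hhalf
    obtain ⟨d, hne, hz⟩ := hm _ hI
    have hnn : 0 ≤ m (1 / 2) := by
      rw [← d.derivWithin (uniqueDiffOn_Icc zero_lt_one _ hI)]
      exact hmono.monotoneOn.derivWithin_nonneg
    refine sideZ_ne_smul h ho hT hhalf (s' := ψ (1 / 2)) ⟨?_, ?_⟩ (hψ _ hI).symm
      (lt_of_le_of_ne hnn hne.symm) hz
    · exact h0.symm.trans_lt (hmono (by simp) hI hhalf.1)
    · exact (hmono hI (by simp) hhalf.2).trans_eq h1
  · refine ⟨ψ, m, hmap, hanti, h0, h1, fun s hs => ?_⟩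
    obtain ⟨d, hne, hz⟩ := hm s hs
    refine ⟨hψ s hs, d, lt_of_le_of_ne ?_ hne, hz⟩
    rw [← d.derivWithin (uniqueDiffOn_Icc zero_lt_one s hs)]
    exact hanti.antitoneOn.derivWithin_nonpos

theorem side_partner_unique {T T' T'' : Fin 𝒯.n} {i i' i'' : Fin 3} (hT' : T ≠ T') (hT'' : T ≠ T'')
    (h' : 𝒯.par T '' side i = 𝒯.par T' '' side i')
    (h'' : 𝒯.par T '' side i = 𝒯.par T'' '' side i'') : T' = T'' ∧ i' = i'' := by
  have hTT : T' = T'' := by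
    by_contra hne
    obtain ⟨ψ, m, -, ha, a0, a1, H⟩ := exists_side_transition h ho hT' h'
    obtain ⟨ψ', m', -, hb, b0, b1, H'⟩ := exists_side_transition h ho hT'' h''
    have hhalf : (1 / 2 : ℝ) ∈ Ioo (0 : ℝ) 1 := by constructor <;> norm_num
    have hI := Ioo_subset_Icc_self hhalf
    obtain ⟨e, -, hm, hz⟩ := H _ hI
    obtain ⟨e', -, hm', hz'⟩ := H' _ hI
    refine sideZ_ne_smul h ho hne (s := ψ (1 / 2)) (s' := ψ' (1 / 2)) (i := i') (i' := i'') ⟨?_, ?_⟩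
      ⟨?_, ?_⟩ (e.trans e'.symm) (c := (m (1 / 2))⁻¹ * m' (1 / 2)) (mul_pos_of_neg_of_neg (inv_lt_zero.2 hm) hm') ?_
    · exact a1.symm.trans_lt (ha hI (by simp) hhalf.2)
    · exact (ha (by simp) hI hhalf.1).trans_eq a0
    · exact b1.symm.trans_lt (hb hI (by simp) hhalf.2)
    · exact (hb (by simp) hI hhalf.1).trans_eq b0
    · rw [mul_smul, ← hz', hz, smul_smul, inv_mul_cancel₀ hm.ne, one_smul]
  subst hTT
  refine ⟨rfl, side_injective ?_⟩
  exact ((𝒯.inj T').image_eq_image_iff (side_subset _) (side_subset _)).1 (h'.symm.trans h'')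

omit h ho [T2Space M] [IsManifold IQ ∞ M] in
theorem interior_coord_ne_zero {y : M} (hy : ModelWithCorners.IsInteriorPoint (I := IQ) y) (j : Fin 2) :
    extChartAt IQ y y j ≠ 0 := by
  have h1 : extChartAt IQ y y ∈ interior (range IQ) := hy
  have h2 : range IQ = {y : E2 | ∀ i : Fin 2, 0 ≤ y i} := range_euclideanQuadrant 2
  rw [h2, interior_euclideanQuadrant 2 2 0] at h1
  exact (h1 j).ne'

theorem exists_side_partner {T : Fin 𝒯.n} {i : Fin 3} (hb : ¬ IsBdrySide 𝒯 T i) :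
    ∃ T' i', T ≠ T' ∧ 𝒯.par T '' side i = 𝒯.par T' '' side i' := by
  obtain ⟨s, hs, hint⟩ : ∃ s ∈ Ioo (0 : ℝ) 1,
      ModelWithCorners.IsInteriorPoint (I := IQ) (𝒯.par T (sidePt i s)) := by
    obtain ⟨_, ⟨_, ⟨s, hs, rfl⟩, rfl⟩, hy⟩ := not_subset.1 hb
    have hint : 𝒯.par T (sidePt i s) ∈ ModelWithCorners.interior (I := IQ) M :=
      (ModelWithCorners.isInteriorPoint_iff_not_isBoundaryPoint _).2 hy
    have hopen : IsOpen (ModelWithCorners.interior (I := IQ) M) :=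
      ModelWithCorners.isOpen_interior (n := ∞) (by simp)
    have hc : ContinuousOn (fun s => 𝒯.par T (sidePt i s)) (Icc 0 1) :=
      continuousOn_comp_sidePt (𝒯.smooth T).smooth.continuousOn i
    have hev : ∀ᶠ t in 𝓝[Icc 0 1] s, 𝒯.par T (sidePt i t) ∈ ModelWithCorners.interior (I := IQ) M :=
      hc s hs (hopen.mem_nhds hint)
    have hcl : s ∈ closure (Ioo (0 : ℝ) 1) := by rwa [closure_Ioo zero_ne_one]
    have := (mem_closure_iff_nhdsWithin_neBot.1 hcl)
    obtain ⟨t, ht, ht'⟩ := ((hev.filter_mono (nhdsWithin_mono s Ioo_subset_Icc_self)).and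
      self_mem_nhdsWithin).exists
    exact ⟨t, ht', ht⟩
  have hI := Ioo_subset_Icc_self hs
  have hm := sidePt_mem i hI
  set z := sideZ g e₁ e₂ (𝒯.par T) i s with hz
  obtain ⟨w, hw⟩ := zeta_surjective h (𝒯.smooth T) (ho T) hm (-(Complex.I * z))
  obtain ⟨T', u', hu', hp, k', hk', e'⟩ := 𝒯.exists_dchart_eq (𝒯.par T (sidePt i s)) (w := w)
    fun j hj => absurd hj (interior_coord_ne_zero hint j)
  have hT : T ≠ T' := by
    rintro rfl
    have := 𝒯.inj T hu' hm hp
    subst this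
    have h1 := wedge_sideZ_nonneg h (𝒯.smooth T) (ho T) hI hk'
    rw [e', hw, ← hz, wedge_neg_right] at h1
    have h2 : wedge z (Complex.I * z) = Complex.normSq z := by simp [wedge, Complex.normSq_apply]
    have := Complex.normSq_pos.2 (sideZ_ne_zero h (𝒯.smooth T) (ho T) i hI)
    rw [h2] at h1
    linarith
  rcases 𝒯.inter_cases hT hm hu' hp.symm with ⟨j, j', e, -⟩ | ⟨j, j', hj, -, himg⟩
  · have := sidePt_mem_face hs (t := {j}) (singleton_ne_univ j) (by rw [face_singleton]; exact e)
    exact absurd this (singleton_ne_pair i j)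
  · rw [← face_pair] at hj
    have := sidePt_mem_face hs (pair_ne_univ j) hj
    have e2 : side j = side i := by rw [← face_pair, ← face_pair, this]
    exact ⟨T', j', hT, e2 ▸ himg⟩

omit [T2Space M] in
theorem contDiffOn_expMu (T : Fin 𝒯.n) (i : Fin 3) :
    ContDiffOn ℝ 1 (expMu g e₁ e₂ (𝒯.par T) i) (Icc 0 1) := by
  have hf := 𝒯.smooth T
  have hp : ContDiffOn ℝ 1 (sidePt i) (Icc 0 1) := by
    have : ContDiff ℝ 1 (sidePt i) := by unfold sidePt; fun_prop
    exact this.contDiffOn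
  have hmap : MapsTo (sidePt i) (Icc 0 1) refTri := fun t ht => sidePt_mem i ht
  have h1 := fun k => ((hf.contDiffOn_coform g h.smooth₁ k).of_le one_le_smooth).comp hp hmap
  have h2 := fun k => ((hf.contDiffOn_coform g h.smooth₂ k).of_le one_le_smooth).comp hp hmap
  have hZ : ContDiffOn ℝ 1 (fun s => sideZ g e₁ e₂ (𝒯.par T) i s) (Icc 0 1) := by
    have e : ∀ s, sideZ g e₁ e₂ (𝒯.par T) i s =
        (((coform g e₁ (𝒯.par T) 0 (sidePt i s) * sideDir i 0 +
          coform g e₁ (𝒯.par T) 1 (sidePt i s) * sideDir i 1 : ℝ) : ℂ)) +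
        (((coform g e₂ (𝒯.par T) 0 (sidePt i s) * sideDir i 0 +
          coform g e₂ (𝒯.par T) 1 (sidePt i s) * sideDir i 1 : ℝ) : ℂ)) * Complex.I := by
      intro s
      refine (cplx_coform g e₁ e₂ (𝒯.par T) (sidePt i s) (sideDir i)).symm.trans ?_
      apply Complex.ext <;> simp [cplx]
    simp only [e]
    exact (Complex.ofRealCLM.contDiff.comp_contDiffOn
      (((h1 0).mul contDiffOn_const).add ((h1 1).mul contDiffOn_const))).add
      ((Complex.ofRealCLM.contDiff.comp_contDiffOn
      (((h2 0).mul contDiffOn_const).add ((h2 1).mul contDiffOn_const))).mul contDiffOn_const)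
  have h0 : ∀ s ∈ Icc (0 : ℝ) 1, sideZ g e₁ e₂ (𝒯.par T) i s ≠ 0 := fun s hs =>
    sideZ_ne_zero h hf (ho T) i hs
  refine (((hZ.norm ℝ h0).inv fun s hs => norm_ne_zero_iff.2 (h0 s hs)).smul
    ((contDiffOn_const (c := -Complex.I)).mul hZ)).congr fun s hs => ?_
  rw [expMu_eq h hf (ho T) i hs, div_eq_inv_mul, ← Complex.ofReal_inv, ← Complex.real_smul]
  rfl

omit [T2Space M] in
theorem continuousOn_dMu (T : Fin 𝒯.n) (i : Fin 3) :
    ContinuousOn (dMu g e₁ e₂ (𝒯.par T) i) (Icc 0 1) := by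
  have hE := contDiffOn_expMu h ho T i
  have := hE.continuousOn_derivWithin (uniqueDiffOn_Icc zero_lt_one) le_rfl
  exact Complex.continuous_im.comp_continuousOn
    ((Complex.continuous_conj.comp_continuousOn hE.continuousOn).mul this)

theorem integral_dMu_partner {T T' : Fin 𝒯.n} (hT : T ≠ T') {i i' : Fin 3}
    (himg : 𝒯.par T '' side i = 𝒯.par T' '' side i') {v : M → ℝ} (hv : Continuous v) :
    (∫ s in (0 : ℝ)..1, res 𝒯 T v (sidePt i s) * dMu g e₁ e₂ (𝒯.par T) i s) +
      ∫ s in (0 : ℝ)..1, res 𝒯 T' v (sidePt i' s) * dMu g e₁ e₂ (𝒯.par T') i' s = 0 := by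
  obtain ⟨ψ, m, hmap, hanti, h0, h1, H⟩ := exists_side_transition h ho hT himg
  have hU := uniqueDiffOn_Icc (zero_lt_one (α := ℝ))
  have hE : ∀ s ∈ Icc (0 : ℝ) 1, expMu g e₁ e₂ (𝒯.par T) i s =
      - expMu g e₁ e₂ (𝒯.par T') i' (ψ s) := fun s hs => by
    obtain ⟨-, -, hm, hz⟩ := H s hs
    rw [expMu_eq h (𝒯.smooth T) (ho T) i hs, expMu_eq h (𝒯.smooth T') (ho T') i' (hmap hs), hz,
      norm_smul, Real.norm_of_nonpos hm.le, Complex.real_smul]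
    have hz0 : (‖sideZ g e₁ e₂ (𝒯.par T') i' (ψ s)‖ : ℂ) ≠ 0 := by
      simpa using sideZ_ne_zero h (𝒯.smooth T') (ho T') i' (hmap hs)
    have hm0 : (m s : ℂ) ≠ 0 := by exact_mod_cast hm.ne
    push_cast
    field_simp
  have hd : ∀ s ∈ Icc (0 : ℝ) 1, dMu g e₁ e₂ (𝒯.par T) i s =
      dMu g e₁ e₂ (𝒯.par T') i' (ψ s) * m s := fun s hs => by
    obtain ⟨-, hder, hm, hz⟩ := H s hs
    have h2 := ((contDiffOn_expMu h ho T' i').differentiableOn one_ne_zero (ψ s)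
      (hmap hs)).hasDerivWithinAt
    have h3 := ((h2.scomp s hder hmap).neg.congr hE (hE s hs)).derivWithin (hU s hs)
    rw [dMu, dMu, h3, hE s hs, Complex.real_smul]
    simp only [map_neg, neg_mul_neg]
    rw [mul_left_comm, Complex.im_ofReal_mul, mul_comm]
  have hc' : ContinuousOn (fun s => res 𝒯 T' v (sidePt i' s) * dMu g e₁ e₂ (𝒯.par T') i' s) (Icc 0 1) :=
    (hv.comp_continuousOn (continuousOn_comp_sidePt (𝒯.smooth T').smooth.continuousOn i')).mul
      (continuousOn_dMu h ho T' i')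
  have hc : ContinuousOn (fun s => res 𝒯 T v (sidePt i s) * dMu g e₁ e₂ (𝒯.par T) i s) (Icc 0 1) :=
    (hv.comp_continuousOn (continuousOn_comp_sidePt (𝒯.smooth T).smooth.continuousOn i)).mul
      (continuousOn_dMu h ho T i)
  have heq : ∀ s ∈ Icc (0 : ℝ) 1, res 𝒯 T v (sidePt i s) * dMu g e₁ e₂ (𝒯.par T) i s =
      ((fun t => res 𝒯 T' v (sidePt i' t) * dMu g e₁ e₂ (𝒯.par T') i' t) ∘ ψ) s * m s := fun s hs => by
    rw [hd s hs, Function.comp_apply, res, res, (H s hs).1]; ring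
  have hψc : ContinuousOn ψ (Icc 0 1) := fun s hs => (H s hs).2.1.continuousWithinAt
  have hu : uIcc (0 : ℝ) 1 = Icc 0 1 := uIcc_of_le zero_le_one
  have himgψ : ψ '' Icc 0 1 ⊆ Icc 0 1 := hmap.image_subset
  have key := intervalIntegral.integral_comp_mul_deriv''' (a := 0) (b := 1) (f := ψ) (f' := m)
    (g := fun t => res 𝒯 T' v (sidePt i' t) * dMu g e₁ e₂ (𝒯.par T') i' t) (by rwa [hu]) ?_ ?_ ?_ ?_
  · rw [h0, h1, intervalIntegral.integral_symm 0 1] at key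
    have e1 : ∫ s in (0 : ℝ)..1, res 𝒯 T v (sidePt i s) * dMu g e₁ e₂ (𝒯.par T) i s = _ :=
      intervalIntegral.integral_congr (fun s hs => heq s (hu ▸ hs))
    rw [e1, key]
    ring
  · intro x hx
    simp only [min_eq_left zero_le_one, max_eq_right zero_le_one] at hx
    have := (H x (Ioo_subset_Icc_self hx)).2.1
    exact (this.hasDerivAt (Icc_mem_nhds hx.1 hx.2)).hasDerivWithinAt
  · refine hc'.mono ((image_mono ?_).trans himgψ)
    simp only [min_eq_left zero_le_one, max_eq_right zero_le_one]
    exact Ioo_subset_Icc_self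
  · rw [hu]
    exact (hc'.integrableOn_Icc).mono_set himgψ
  · rw [hu]
    exact (hc.congr fun s hs => (heq s hs).symm).integrableOn_Icc

open Classical in
theorem sum_integral_dMu_eq_zero {v : M → ℝ} (hv : Continuous v) :
    (∑ T, ∑ i, if IsBdrySide 𝒯 T i then 0 else
      ∫ s in (0 : ℝ)..1, res 𝒯 T v (sidePt i s) * dMu g e₁ e₂ (𝒯.par T) i s) = 0 := by
  have hb : ∀ q : Fin 𝒯.n × Fin 3, ∃ q' : Fin 𝒯.n × Fin 3, ¬ IsBdrySide 𝒯 q.1 q.2 →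
      q.1 ≠ q'.1 ∧ 𝒯.par q.1 '' side q.2 = 𝒯.par q'.1 '' side q'.2 := fun q => by
    by_cases hq : IsBdrySide 𝒯 q.1 q.2
    · exact ⟨q, fun h => absurd hq h⟩
    · obtain ⟨T', i', h1, h2⟩ := exists_side_partner h ho hq
      exact ⟨(T', i'), fun _ => ⟨h1, h2⟩⟩
  choose σ hσ using hb
  have hbσ : ∀ q : Fin 𝒯.n × Fin 3, ¬ IsBdrySide 𝒯 q.1 q.2 → ¬ IsBdrySide 𝒯 (σ q).1 (σ q).2 :=
    fun q hq => by rw [IsBdrySide, ← (hσ q hq).2]; exact hq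
  rw [← Fintype.sum_prod_type' (f := fun T i => if IsBdrySide 𝒯 T i then (0 : ℝ) else
      ∫ s in (0 : ℝ)..1, res 𝒯 T v (sidePt i s) * dMu g e₁ e₂ (𝒯.par T) i s)]
  refine (Finset.sum_filter_add_sum_filter_not _ (fun q : Fin 𝒯.n × Fin 3 => IsBdrySide 𝒯 q.1 q.2) _).symm.trans ?_
  rw [Finset.sum_eq_zero fun q hq => if_pos (Finset.mem_filter.1 hq).2, zero_add]
  refine Finset.sum_involution (fun q _ => σ q) (fun q hq => ?_) (fun q hq _ e => ?_) (fun q hq => ?_)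
    (fun q hq => ?_)
  · have hq := (Finset.mem_filter.1 hq).2
    rw [if_neg hq, if_neg (hbσ q hq)]
    exact integral_dMu_partner h ho (hσ q hq).1 (hσ q hq).2 hv
  · exact (hσ q (Finset.mem_filter.1 hq).2).1 (congrArg Prod.fst e).symm
  · exact Finset.mem_filter.2 ⟨Finset.mem_univ _, hbσ q (Finset.mem_filter.1 hq).2⟩
  · have hq := (Finset.mem_filter.1 hq).2
    obtain ⟨h1, h2⟩ := hσ q hq
    obtain ⟨h3, h4⟩ := hσ (σ q) (hbσ q hq)
    obtain ⟨e1, e2⟩ := side_partner_unique h ho h3 h1.symm h4 h2.symm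
    exact Prod.ext e1 e2

end Pairing

end

section

open Filter Topology Set

/-! ### Extreme rays of a sector -/

theorem exists_smul_eq_of_wedge_eq_zero {a r : ℂ} (hr : r ≠ 0) (h : wedge r a = 0) :
    ∃ c : ℝ, a = c • r := by
  have hn : Complex.normSq r ≠ 0 := (Complex.normSq_pos.2 hr).ne'
  refine ⟨(r.re * a.re + r.im * a.im) / Complex.normSq r, ?_⟩
  simp only [wedge] at h
  apply Complex.ext
  · simp only [Complex.smul_re, smul_eq_mul]
    rw [div_mul_eq_mul_div, eq_div_iff hn, Complex.normSq_apply]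
    linear_combination (-r.im) * h
  · simp only [Complex.smul_im, smul_eq_mul]
    rw [div_mul_eq_mul_div, eq_div_iff hn, Complex.normSq_apply]
    linear_combination (r.re) * h

theorem IsConvexPair.wedge_nonneg {a b : ℂ} (h : IsConvexPair a b) : 0 ≤ wedge a b := by
  rcases h with h | ⟨-, c, -, rfl⟩
  · exact h.le
  · rw [wedge_neg_right, wedge_smul_right, wedge_self]; simp

theorem IsConvexPair.exists_smul_left {r₀ r₁ a b : ℂ} (hr : IsConvexPair r₀ r₁) (hab : 0 < wedge a b)
    (ha : a ∈ sector r₀ r₁) (hb : b ∈ sector r₀ r₁) (h : wedge r₀ a = 0 ∨ wedge a r₁ = 0) :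
    ∃ c : ℝ, 0 < c ∧ a = c • r₀ := by
  obtain ⟨h0, h1⟩ := hr.ne_zero
  have ha0 : a ≠ 0 := (IsConvexPair.ne_zero (Or.inl hab)).1
  have key : wedge r₀ a = 0 → ∃ c : ℝ, 0 < c ∧ a = c • r₀ := by
    intro h
    obtain ⟨c, rfl⟩ := exists_smul_eq_of_wedge_eq_zero h0 h
    refine ⟨c, ?_, rfl⟩
    rw [wedge_smul_left] at hab
    exact pos_of_mul_pos_left hab hb.1
  rcases h with h | h
  · exact key h
  · obtain ⟨c, rfl⟩ := exists_smul_eq_of_wedge_eq_zero h1 (by rw [wedge_swap, h, neg_zero])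
    rw [wedge_smul_left, wedge_swap] at hab
    have hc : c < 0 := by
      by_contra hc
      push Not at hc
      nlinarith [hb.2]
    apply key
    have h2 := ha.1
    rw [wedge_smul_right] at h2 ⊢
    have h3 := hr.wedge_nonneg
    have : wedge r₀ r₁ = 0 := by nlinarith
    rw [this, mul_zero]

theorem wedge_conj (a b : ℂ) : wedge (starRingEnd ℂ a) (starRingEnd ℂ b) = wedge b a := by
  simp [wedge]; ring

theorem conj_mem_sector {a b w : ℂ} :
    starRingEnd ℂ w ∈ sector (starRingEnd ℂ b) (starRingEnd ℂ a) ↔ w ∈ sector a b := by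
  simp only [sector, mem_ofPred_eq, wedge_conj]
  exact and_comm

theorem IsConvexPair.conj {a b : ℂ} (h : IsConvexPair a b) :
    IsConvexPair (starRingEnd ℂ b) (starRingEnd ℂ a) := by
  rcases h with h | ⟨ha, c, hc, rfl⟩
  · exact Or.inl (by rwa [wedge_conj])
  · refine Or.inr ⟨?_, c⁻¹, by positivity, ?_⟩
    · simp [hc.ne', ha]
    · rw [Complex.real_smul, Complex.real_smul, map_neg, map_mul, Complex.conj_ofReal]
      have : (c : ℂ) ≠ 0 := by exact_mod_cast hc.ne'
      push_cast
      field_simp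

theorem IsConvexPair.exists_smul_right {r₀ r₁ a b : ℂ} (hr : IsConvexPair r₀ r₁)
    (hab : 0 < wedge a b) (ha : a ∈ sector r₀ r₁) (hb : b ∈ sector r₀ r₁)
    (h : wedge r₀ b = 0 ∨ wedge b r₁ = 0) : ∃ c : ℝ, 0 < c ∧ b = c • r₁ := by
  obtain ⟨c, hc, e⟩ := hr.conj.exists_smul_left (a := starRingEnd ℂ b) (b := starRingEnd ℂ a)
    (by rwa [wedge_conj]) (conj_mem_sector.2 hb) (conj_mem_sector.2 ha) (by
      rw [wedge_conj, wedge_conj]; exact h.symm)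
  refine ⟨c, hc, ?_⟩
  have := congrArg (starRingEnd ℂ) e
  simpa [Complex.real_smul] using this

theorem exists_mem_openSector_left {a b b' : ℂ} {c : ℝ} (hc : 0 < c) (h : 0 < wedge a b)
    (h' : 0 < wedge (c • a) b') : ∃ w, w ∈ openSector a b ∧ w ∈ openSector (c • a) b' := by
  rw [wedge_smul_left] at h'
  have h' := pos_of_mul_pos_right h' hc.le
  have hev : ∀ᶠ ε in 𝓝[>] (0 : ℝ), 0 < wedge a b' + ε * wedge b b' := eventually_add_mul_pos h' _
  obtain ⟨ε, h1, hε⟩ := (hev.and self_mem_nhdsWithin).exists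
  have hε : 0 < ε := hε
  refine ⟨a + ε • b, ⟨?_, ?_⟩, ?_, ?_⟩ <;>
    simp only [wedge_add_left, wedge_add_right, wedge_smul_left, wedge_smul_right, wedge_self]
  · simpa using mul_pos hε h
  · simpa using h
  · simpa using mul_pos hε (mul_pos hc h)
  · exact h1

theorem exists_mem_openSector_right {a a' b : ℂ} {c : ℝ} (hc : 0 < c) (h : 0 < wedge a b)
    (h' : 0 < wedge a' (c • b)) : ∃ w, w ∈ openSector a b ∧ w ∈ openSector a' (c • b) := by
  rw [wedge_smul_right] at h'
  have h' := pos_of_mul_pos_right h' hc.le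
  have hev : ∀ᶠ ε in 𝓝[>] (0 : ℝ), 0 < wedge a' b + ε * wedge a' a := eventually_add_mul_pos h' _
  obtain ⟨ε, h1, hε⟩ := (hev.and self_mem_nhdsWithin).exists
  have hε : 0 < ε := hε
  refine ⟨b + ε • a, ⟨?_, ?_⟩, ?_, ?_⟩ <;>
    simp only [wedge_add_left, wedge_add_right, wedge_smul_left, wedge_smul_right, wedge_self]
  · simpa using h
  · simpa using mul_pos hε h
  · exact h1
  · simpa using mul_pos hc (mul_pos hε h)

theorem arg_neg_mul_conj {a b : ℂ} (h : IsConvexPair a b) :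
    (-Complex.I * a / ‖a‖ * starRingEnd ℂ (-Complex.I * -b / ‖b‖)).arg = Real.pi - (b / a).arg := by
  obtain ⟨ha, hb⟩ := h.ne_zero
  obtain ⟨t0, t1⟩ := h.arg_mem
  have hna : (‖a‖ : ℂ) ≠ 0 := by simpa using ha
  have hnb : (‖b‖ : ℂ) ≠ 0 := by simpa using hb
  have e : -Complex.I * a / ‖a‖ * starRingEnd ℂ (-Complex.I * -b / ‖b‖) =
      Real.cos (Real.pi - (b / a).arg) + Real.sin (Real.pi - (b / a).arg) * Complex.I := by
    have hn : ‖b / a‖ ≠ 0 := norm_ne_zero_iff.2 (div_ne_zero hb ha)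
    have hc : Real.cos (b / a).arg = (b / a).re / ‖b / a‖ := Complex.cos_arg (div_ne_zero hb ha)
    have hs : Real.sin (b / a).arg = (b / a).im / ‖b / a‖ := Complex.sin_arg _
    rw [Real.cos_pi_sub, Real.sin_pi_sub, hc, hs]
    have e1 : starRingEnd ℂ (b / a) = (b / a).re - (b / a).im * Complex.I := by
      apply Complex.ext
      · rw [Complex.conj_re]; simp
      · rw [Complex.conj_im]; simp
    have e2 : ((-((b / a).re / ‖b / a‖) : ℝ) : ℂ) + (((b / a).im / ‖b / a‖ : ℝ) : ℂ) * Complex.I =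
        - starRingEnd ℂ (b / a) / ‖b / a‖ := by
      rw [e1]; push_cast; ring
    rw [e2, map_div₀, norm_div]
    have hca : starRingEnd ℂ a ≠ 0 := by simpa using ha
    have hmul : starRingEnd ℂ a * a = (‖a‖ : ℂ) ^ 2 := by
      rw [← Complex.normSq_eq_conj_mul_self, Complex.normSq_eq_norm_sq]; push_cast; ring
    simp only [map_div₀, map_mul, map_neg, Complex.conj_I, Complex.conj_ofReal]
    push_cast
    field_simp
    linear_combination starRingEnd ℂ b * Complex.I ^ 2 * hmul + (‖a‖ : ℂ) ^ 2 * starRingEnd ℂ b * Complex.I_sq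
  rw [e]
  exact_mod_cast Complex.arg_cos_add_sin_mul_I (θ := Real.pi - (b / a).arg)
    ⟨by linarith [Real.pi_pos], by linarith⟩

/-! ### The tangent cone of the surface at a vertex -/

section Vertex

variable {M : Type*} [TopologicalSpace M] [ChartedSpace (EuclideanQuadrant 2) M]

theorem exists_coord_eq_zero {y : M} (hy : ModelWithCorners.IsBoundaryPoint (I := IQ) y) :
    ∃ j, extChartAt IQ y y j = 0 := by
  by_contra hc
  push Not at hc
  refine (ModelWithCorners.isBoundaryPoint_iff_not_isInteriorPoint _).1 hy ?_
  have h2 : range IQ = {y : E2 | ∀ i : Fin 2, 0 ≤ y i} := range_euclideanQuadrant 2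
  change extChartAt IQ y y ∈ interior (range IQ)
  rw [h2, interior_euclideanQuadrant 2 2 0]
  exact fun j => lt_of_le_of_ne (extChartAt_nonneg y y j) (hc j).symm

variable [IsManifold IQ ∞ M]

theorem exists_coord_eq_zero_of_mem_source {y z : M} (hz : z ∈ (extChartAt IQ y).source)
    (hb : ModelWithCorners.IsBoundaryPoint (I := IQ) z) : ∃ j, extChartAt IQ y z j = 0 := by
  by_contra hc
  push Not at hc
  rw [extChartAt_source] at hz
  refine (ModelWithCorners.isBoundaryPoint_iff_not_isInteriorPoint _).1 hb ?_
  rw [ModelWithCorners.isInteriorPoint_iff_of_mem_atlas (n := (∞ : WithTop ℕ∞)) (by simp)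
    (chart_mem_atlas _ y) hz]
  refine OpenPartialHomeomorph.mem_interior_extend_target _ ((chartAt _ y).map_source hz) ?_
  have h2 : range IQ = {y : E2 | ∀ i : Fin 2, 0 ≤ y i} := range_euclideanQuadrant 2
  rw [h2, interior_euclideanQuadrant 2 2 0]
  exact fun j => lt_of_le_of_ne (extChartAt_nonneg y z j) (hc j).symm

/-- A side on the boundary is tangent to a boundary face of the chart. -/
theorem IsBdrySide.exists_coord {𝒯 : Mesh M} {T : Fin 𝒯.n} {i : Fin 3} (hb : IsBdrySide 𝒯 T i) {s : ℝ}
    (hs : s ∈ Icc (0 : ℝ) 1) :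
    ∃ j, extChartAt IQ (𝒯.par T (sidePt i s)) (𝒯.par T (sidePt i s)) j = 0 ∧
      dchart (𝒯.par T) (sidePt i s) (sideDir i) j = 0 := by
  set φ := extChartAt IQ (𝒯.par T (sidePt i s))
  set c : ℝ → M := fun t => 𝒯.par T (sidePt i t)
  have hc : ContinuousOn c (Icc 0 1) :=
    continuousOn_comp_sidePt (𝒯.smooth T).smooth.continuousOn i
  have hd := (𝒯.smooth T).hasDerivWithinAt_chart_sidePt i hs
  have hsl := hasDerivWithinAt_iff_tendsto_slope.1 hd
  have hne : (𝓝[Icc 0 1 \ {s}] s).NeBot := by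
    have := uniqueDiffWithinAt_iff_accPt.1 (uniqueDiffOn_Icc (zero_lt_one (α := ℝ)) s hs)
    exact accPt_principal_iff_nhdsWithin.1 this
  have hle : 𝓝[Icc 0 1 \ {s}] s ≤ 𝓝[Icc 0 1] s := nhdsWithin_mono s sdiff_subset
  have hev : ∀ᶠ t in 𝓝[Icc 0 1 \ {s}] s, φ (c t) 0 = 0 ∨ φ (c t) 1 = 0 := by
    have hsrc : ∀ᶠ t in 𝓝[Icc 0 1] s, c t ∈ φ.source := hc s hs (extChartAt_source_mem_nhds _)
    filter_upwards [hle hsrc, hle self_mem_nhdsWithin] with t h1 h2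
    obtain ⟨j, hj⟩ := exists_coord_eq_zero_of_mem_source h1
      (hb (mem_image_of_mem _ ⟨t, h2, rfl⟩))
    fin_cases j
    · exact Or.inl hj
    · exact Or.inr hj
  obtain ⟨j, hj⟩ : ∃ j : Fin 2, ∃ᶠ t in 𝓝[Icc 0 1 \ {s}] s, φ (c t) j = 0 := by
    rcases frequently_or_distrib.1 hev.frequently with h | h
    · exact ⟨0, h⟩
    · exact ⟨1, h⟩
  have h0 : φ (c s) j = 0 := by
    have ht : Tendsto (fun t => φ (c t) j) (𝓝[Icc 0 1 \ {s}] s) (𝓝 (φ (c s) j)) :=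
      ((continuous_coord j).tendsto _).comp (hd.continuousWithinAt.tendsto.mono_left hle)
    exact isClosed_singleton.mem_of_frequently_of_tendsto hj ht
  refine ⟨j, h0, ?_⟩
  have ht := ((continuous_coord j).tendsto _).comp hsl
  refine isClosed_singleton.mem_of_frequently_of_tendsto (hj.mono fun t hjt => ?_) ht
  have e : (slope (fun t => φ (c t)) s t) j = 0 := by
    simp [slope, hjt, h0]
  exact e

/-- The directions, in the coordinates of the frame, that point into the surface. -/
def coneM (g : Metric2 M) (e₁ e₂ : ∀ x : M, TangentSpace IQ x) (y : M) : Set ℂ :=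
  zeta g e₁ e₂ y '' {w | ∀ j, extChartAt IQ y y j = 0 → 0 ≤ w j}

/-- At a boundary point the tangent cone is a convex sector; its edges are the boundary faces of
the chart. -/
theorem exists_boundary_sector {g : Metric2 M} {e₁ e₂ : ∀ x : M, TangentSpace IQ x} {y : M}
    (hy : ModelWithCorners.IsBoundaryPoint (I := IQ) y)
    (hne : wedge (zeta g e₁ e₂ y (EuclideanSpace.single 0 1))
      (zeta g e₁ e₂ y (EuclideanSpace.single 1 1)) ≠ 0) :
    ∃ (r₀ r₁ : ℂ) (i j : Fin 2) (d : ℝ), IsConvexPair r₀ r₁ ∧ 0 < d ∧ extChartAt IQ y y i = 0 ∧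
      extChartAt IQ y y j = 0 ∧ (∀ k, extChartAt IQ y y k = 0 → k = i ∨ k = j) ∧
      ∀ w, wedge r₀ (zeta g e₁ e₂ y w) = d * w i ∧ wedge (zeta g e₁ e₂ y w) r₁ = d * w j := by
  set Z₀ := zeta g e₁ e₂ y (EuclideanSpace.single 0 1) with hZ₀
  set Z₁ := zeta g e₁ e₂ y (EuclideanSpace.single 1 1) with hZ₁
  set c := wedge Z₀ Z₁ with hcdef
  have w0 : ∀ w, wedge Z₀ (zeta g e₁ e₂ y w) = c * w 1 := fun w => by
    rw [hZ₀, wedge_zeta, ← hZ₀, ← hZ₁, ← hcdef]; simp [cross]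
  have w1 : ∀ w, wedge Z₁ (zeta g e₁ e₂ y w) = -c * w 0 := fun w => by
    rw [hZ₁, wedge_zeta, ← hZ₀, ← hZ₁, ← hcdef]; simp [cross]
  have w0' : ∀ w, wedge (zeta g e₁ e₂ y w) Z₀ = -c * w 1 := fun w => by
    rw [wedge_swap, w0]; ring
  have w1' : ∀ w, wedge (zeta g e₁ e₂ y w) Z₁ = c * w 0 := fun w => by
    rw [wedge_swap, w1]; ring
  have z0 : Z₀ ≠ 0 := fun h => hne (by rw [hcdef, h]; simp [wedge])
  have z1 : Z₁ ≠ 0 := fun h => hne (by rw [hcdef, h]; simp [wedge])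
  have fin2 : ∀ k : Fin 2, k = 0 ∨ k = 1 := by decide
  have half : ∀ a : ℂ, a ≠ 0 → IsConvexPair a (-a) := fun a ha =>
    Or.inr ⟨ha, 1, one_pos, by simp⟩
  have half' : ∀ a : ℂ, a ≠ 0 → IsConvexPair (-a) a := fun a ha =>
    Or.inr ⟨neg_ne_zero.2 ha, 1, one_pos, by simp⟩
  by_cases h0 : extChartAt IQ y y 0 = 0 <;> by_cases h1 : extChartAt IQ y y 1 = 0
  · rcases lt_or_gt_of_ne hne with hc | hc
    · refine ⟨Z₁, Z₀, 0, 1, -c, Or.inl ?_, by linarith, h0, h1, fun k _ => fin2 k, fun w => ⟨w1 w, w0' w⟩⟩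
      rw [wedge_swap]; linarith
    · exact ⟨Z₀, Z₁, 1, 0, c, Or.inl hc, hc, h1, h0, fun k _ => (fin2 k).symm, fun w => ⟨w0 w, w1' w⟩⟩
  · have hk : ∀ k, extChartAt IQ y y k = 0 → k = 0 ∨ k = 0 := fun k hk => by
      rcases fin2 k with rfl | rfl
      · exact Or.inl rfl
      · exact absurd hk h1
    rcases lt_or_gt_of_ne hne with hc | hc
    · exact ⟨Z₁, -Z₁, 0, 0, -c, half _ z1, by linarith, h0, h0, hk, fun w =>
        ⟨w1 w, by rw [wedge_neg_right, w1']; ring⟩⟩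
    · exact ⟨-Z₁, Z₁, 0, 0, c, half' _ z1, hc, h0, h0, hk, fun w =>
        ⟨by rw [wedge_neg_left, w1]; ring, w1' w⟩⟩
  · have hk : ∀ k, extChartAt IQ y y k = 0 → k = 1 ∨ k = 1 := fun k hk => by
      rcases fin2 k with rfl | rfl
      · exact absurd hk h0
      · exact Or.inl rfl
    rcases lt_or_gt_of_ne hne with hc | hc
    · exact ⟨-Z₀, Z₀, 1, 1, -c, half' _ z0, by linarith, h1, h1, hk, fun w =>
        ⟨by rw [wedge_neg_left, w0]; ring, w0' w⟩⟩
    · exact ⟨Z₀, -Z₀, 1, 1, c, half _ z0, hc, h1, h1, hk, fun w =>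
        ⟨w0 w, by rw [wedge_neg_right, w0']; ring⟩⟩
  · obtain ⟨j, hj⟩ := exists_coord_eq_zero hy
    rcases fin2 j with rfl | rfl
    · exact absurd hj h0
    · exact absurd hj h1

end Vertex

end

section

open Filter Topology Set

/-! ### The angles at the vertices -/

section

variable {M : Type*} [TopologicalSpace M] [ChartedSpace (EuclideanQuadrant 2) M] [IsManifold IQ ∞ M]
  {g : Metric2 M} {e₁ e₂ : ∀ x : M, TangentSpace IQ x}
  (h : IsFrame g e₁ e₂) {𝒯 : Mesh M} (ho : ∀ T, PreservesOrientation e₁ e₂ (𝒯.par T))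

open Classical in
/-- The corners of the triangles at a point. -/
def corners (𝒯 : Mesh M) (p : M) : Finset (Fin 𝒯.n × Fin 3) :=
  Finset.univ.filter fun q => 𝒯.par q.1 (vtx q.2) = p

omit [IsManifold IQ ∞ M] in
theorem mem_corners {p : M} {q : Fin 𝒯.n × Fin 3} :
    q ∈ corners 𝒯 p ↔ 𝒯.par q.1 (vtx q.2) = p := by simp [corners]

/-- The direction of the side of a triangle that starts at a corner. -/
def cornerA (g : Metric2 M) (e₁ e₂ : ∀ x : M, TangentSpace IQ x) (𝒯 : Mesh M)
    (q : Fin 𝒯.n × Fin 3) : ℂ := sideZ g e₁ e₂ (𝒯.par q.1) q.2 0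

/-- The reversed direction of the side of a triangle that ends at a corner. -/
def cornerB (g : Metric2 M) (e₁ e₂ : ∀ x : M, TangentSpace IQ x) (𝒯 : Mesh M)
    (q : Fin 𝒯.n × Fin 3) : ℂ := -sideZ g e₁ e₂ (𝒯.par q.1) (q.2 + 2) 1

include h ho

theorem wedge_corner_pos (q : Fin 𝒯.n × Fin 3) :
    0 < wedge (cornerA g e₁ e₂ 𝒯 q) (cornerB g e₁ e₂ 𝒯 q) :=
  wedge_sideZ_pos h (𝒯.smooth q.1) (ho q.1) q.2

theorem sector_corner_subset {p : M} {q : Fin 𝒯.n × Fin 3} (hq : q ∈ corners 𝒯 p) :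
    sector (cornerA g e₁ e₂ 𝒯 q) (cornerB g e₁ e₂ 𝒯 q) ⊆ coneM g e₁ e₂ p := by
  obtain rfl := mem_corners.1 hq
  intro z hz
  obtain ⟨k, rfl⟩ := zeta_dchart_surjective h (𝒯.smooth q.1) (ho q.1) (vtx_mem q.2) z
  have hk := (mem_tcone_vtx_iff h (𝒯.smooth q.1) (ho q.1)).2 hz
  exact ⟨_, fun j hj => (𝒯.smooth q.1).dchart_nonneg (vtx_mem q.2) hk hj, rfl⟩

theorem coneM_subset [T2Space M] {p : M} {q : Fin 𝒯.n × Fin 3} (hq : q ∈ corners 𝒯 p) :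
    coneM g e₁ e₂ p ⊆ ⋃ q ∈ corners 𝒯 p, sector (cornerA g e₁ e₂ 𝒯 q) (cornerB g e₁ e₂ 𝒯 q) := by
  rintro _ ⟨w, hw, rfl⟩
  obtain ⟨T, u, hu, hp, k, hk, rfl⟩ := 𝒯.exists_dchart_eq p hw
  obtain ⟨j, rfl⟩ := 𝒯.exists_vtx_eq hu ((mem_corners.1 hq).trans hp.symm)
  refine mem_iUnion₂.2 ⟨(T, j), mem_corners.2 hp, ?_⟩
  rw [← hp]
  exact (mem_tcone_vtx_iff h (𝒯.smooth T) (ho T)).1 hk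

theorem corner_unique {p : M} {q q' : Fin 𝒯.n × Fin 3} (hq : q ∈ corners 𝒯 p)
    (hq' : q' ∈ corners 𝒯 p) {z : ℂ}
    (hz : z ∈ openSector (cornerA g e₁ e₂ 𝒯 q) (cornerB g e₁ e₂ 𝒯 q))
    (hz' : z ∈ openSector (cornerA g e₁ e₂ 𝒯 q') (cornerB g e₁ e₂ 𝒯 q')) : q = q' := by
  have e := mem_corners.1 hq
  have e' := mem_corners.1 hq'
  by_cases hT : q.1 = q'.1
  · refine Prod.ext hT (𝒯.par_vtx_injective q'.1 ?_)
    rw [e', ← hT, e]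
  exfalso
  obtain ⟨k, hk⟩ := zeta_dchart_surjective h (𝒯.smooth q.1) (ho q.1) (vtx_mem q.2) z
  obtain ⟨k', hk'⟩ := zeta_dchart_surjective h (𝒯.smooth q'.1) (ho q'.1) (vtx_mem q'.2) z
  rw [← hk] at hz
  rw [← hk'] at hz'
  have m := (mem_openCone_vtx_iff h (𝒯.smooth q.1) (ho q.1)).2 hz
  have m' := (mem_openCone_vtx_iff h (𝒯.smooth q'.1) (ho q'.1)).2 hz'
  refine 𝒯.openCone_disjoint hT (vtx_mem _) (vtx_mem _) (e.trans e'.symm) m m' ?_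
  refine zeta_injective h (𝒯.smooth q.1) (ho q.1) (vtx_mem q.2) (hk.trans ?_)
  rw [e, ← e', hk']

theorem angleSum_eq_ang [T2Space M] {p : M} {q : Fin 𝒯.n × Fin 3} (hq : q ∈ corners 𝒯 p)
    (hD : MeasurableSet (coneM g e₁ e₂ p)) :
    angleSum 𝒯 (onMesh g 𝒯) p = ang (coneM g e₁ e₂ p) := by
  classical
  have e1 : angleSum 𝒯 (onMesh g 𝒯) p =
      ∑ q ∈ corners 𝒯 p, (cornerB g e₁ e₂ 𝒯 q / cornerA g e₁ e₂ 𝒯 q).arg := by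
    rw [angleSum, ← Fintype.sum_prod_type' (f := fun T i =>
      if 𝒯.par T (vtx i) = p then angle (onMesh g 𝒯 T) i else 0), corners, Finset.sum_filter]
    refine Finset.sum_congr (by simp) fun q _ => ?_
    simp only [onMesh, angle_pull_eq_arg h (𝒯.smooth q.1) (ho q.1) q.2]
    rfl
  rw [e1]
  refine sum_arg_eq_ang _ (fun q _ => Or.inl (wedge_corner_pos h ho q)) hD (coneM_subset h ho hq)
    (fun q hq => sector_corner_subset h ho hq) fun q hq q' hq' hne => ?_
  exact Set.disjoint_left.2 fun z hz hz' => hne (corner_unique h ho hq hq' hz hz')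

theorem angleSum_interior [T2Space M] {p : M} {q : Fin 𝒯.n × Fin 3} (hq : q ∈ corners 𝒯 p)
    (hp : ¬ ModelWithCorners.IsBoundaryPoint (I := IQ) p) :
    angleSum 𝒯 (onMesh g 𝒯) p = 2 * Real.pi := by
  have hint := (ModelWithCorners.isInteriorPoint_iff_not_isBoundaryPoint p).2 hp
  have e : coneM g e₁ e₂ p = univ := by
    refine eq_univ_of_forall fun z => ?_
    have := zeta_surjective h (𝒯.smooth q.1) (ho q.1) (vtx_mem q.2) z
    rw [mem_corners.1 hq] at this
    obtain ⟨w, hw⟩ := this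
    exact ⟨w, fun j hj => absurd hj (interior_coord_ne_zero hint j), hw⟩
  rw [angleSum_eq_ang h ho hq (by rw [e]; exact MeasurableSet.univ), e, ang_univ]

theorem jumpMu_boundary [T2Space M] {p : M} {q₀ : Fin 𝒯.n × Fin 3} (hq₀ : q₀ ∈ corners 𝒯 p)
    (hp : ModelWithCorners.IsBoundaryPoint (I := IQ) p) :
    jumpMu g e₁ e₂ 𝒯 p = Real.pi - angleSum 𝒯 (onMesh g 𝒯) p := by
  classical
  have hne := zeta_ne h (𝒯.smooth q₀.1) (ho q₀.1) (vtx_mem q₀.2)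
  rw [mem_corners.1 hq₀] at hne
  obtain ⟨r₀, r₁, i, j, d, hr, hd, hi, hj, hij, hw⟩ := exists_boundary_sector hp hne
  have hsurj : ∀ z, ∃ w, zeta g e₁ e₂ p w = z := fun z => by
    have := zeta_surjective h (𝒯.smooth q₀.1) (ho q₀.1) (vtx_mem q₀.2) z
    rwa [mem_corners.1 hq₀] at this
  have hcone : coneM g e₁ e₂ p = sector r₀ r₁ := by
    ext z
    constructor
    · rintro ⟨w, hw', rfl⟩
      refine ⟨?_, ?_⟩
      · rw [(hw w).1]; exact mul_nonneg hd.le (hw' i hi)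
      · rw [(hw w).2]; exact mul_nonneg hd.le (hw' j hj)
    · rintro ⟨h1, h2⟩
      obtain ⟨w, rfl⟩ := hsurj z
      rw [(hw w).1] at h1
      rw [(hw w).2] at h2
      refine ⟨w, fun k hk => ?_, rfl⟩
      rcases hij k hk with rfl | rfl
      · exact nonneg_of_mul_nonneg_right h1 hd
      · exact nonneg_of_mul_nonneg_right h2 hd
  rw [angleSum_eq_ang h ho hq₀ (by rw [hcone]; exact measurableSet_sector _ _), hcone, ang_sector hr]
  have hsub := fun {q} (hq : q ∈ corners 𝒯 p) => hcone ▸ sector_corner_subset h ho hq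
  have hA : ∀ {q}, q ∈ corners 𝒯 p → cornerA g e₁ e₂ 𝒯 q ∈ sector r₀ r₁ := fun {q} hq =>
    hsub hq ⟨(wedge_self _).ge, (wedge_corner_pos h ho q).le⟩
  have hB : ∀ {q}, q ∈ corners 𝒯 p → cornerB g e₁ e₂ 𝒯 q ∈ sector r₀ r₁ := fun {q} hq =>
    hsub hq ⟨(wedge_corner_pos h ho q).le, (wedge_self _).ge⟩
  have hcov := hcone ▸ coneM_subset h ho hq₀
  have hpos := wedge_corner_pos h ho
  -- the corner at the first boundary edge
  obtain ⟨q, hq, hqr⟩ := mem_iUnion₂.1 (hcov (⟨(wedge_self _).ge, hr.wedge_nonneg⟩ : r₀ ∈ sector r₀ r₁))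
  obtain ⟨c, hc, hqA⟩ := hr.exists_smul_left (hpos q) (hA hq) (hB hq) (Or.inl (le_antisymm (by
    have := hqr.1
    rw [wedge_swap] at this
    linarith) (hA hq).1))
  -- the corner at the last boundary edge
  obtain ⟨q', hq', hqr'⟩ := mem_iUnion₂.1 (hcov (⟨hr.wedge_nonneg, (wedge_self _).ge⟩ : r₁ ∈ sector r₀ r₁))
  obtain ⟨c', hc', hqB⟩ := hr.exists_smul_right (hpos q') (hA hq') (hB hq') (Or.inr (le_antisymm (by
    have := hqr'.2
    rw [wedge_swap] at this
    linarith) (hB hq').2))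
  have add2 : ∀ k : Fin 3, k + 1 + 2 = k := by decide
  have add1 : ∀ k : Fin 3, k + 2 + 1 = k := by decide
  have hbq : IsBdrySide 𝒯 q.1 q.2 := by
    by_contra hb
    obtain ⟨T', i', hT, himg⟩ := exists_side_partner h ho hb
    obtain ⟨ψ, m, -, -, h0, -, H⟩ := exists_side_transition h ho hT himg
    obtain ⟨e, -, hm, hz⟩ := H 0 (by simp)
    rw [h0, sidePt_at_one, sidePt_at_zero, mem_corners.1 hq] at e
    have hm' : (T', i' + 1) ∈ corners 𝒯 p := mem_corners.2 e
    have hz : cornerA g e₁ e₂ 𝒯 q = (-m 0) • cornerB g e₁ e₂ 𝒯 (T', i' + 1) := by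
      rw [cornerA, hz, cornerB, h0, add2, smul_neg, neg_smul, neg_neg]
    have h1 := (hA hm').1
    have h2 := hpos (T', i' + 1)
    have h3 : 0 ≤ c * wedge r₀ (cornerA g e₁ e₂ 𝒯 (T', i' + 1)) := mul_nonneg hc.le h1
    rw [← wedge_smul_left, ← hqA, hz, wedge_smul_left, wedge_swap] at h3
    nlinarith
  have hbq' : IsBdrySide 𝒯 q'.1 (q'.2 + 2) := by
    by_contra hb
    obtain ⟨T', i', hT, himg⟩ := exists_side_partner h ho hb
    obtain ⟨ψ, m, -, -, -, h0, H⟩ := exists_side_transition h ho hT himg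
    obtain ⟨e, -, hm, hz⟩ := H 1 (by simp)
    rw [h0, sidePt_at_one, sidePt_at_zero, add1, mem_corners.1 hq'] at e
    have hm' : (T', i') ∈ corners 𝒯 p := mem_corners.2 e
    have hz : cornerB g e₁ e₂ 𝒯 q' = (-m 1) • cornerA g e₁ e₂ 𝒯 (T', i') := by
      rw [cornerB, hz, cornerA, h0, neg_smul]
    have h1 := (hB hm').2
    have h2 := hpos (T', i')
    have h3 : 0 ≤ c' * wedge (cornerB g e₁ e₂ 𝒯 (T', i')) r₁ := mul_nonneg hc'.le h1
    rw [← wedge_smul_right, ← hqB, hz, wedge_smul_right, wedge_swap] at h3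
    nlinarith
  have edge : ∀ {T k s}, s ∈ Icc (0 : ℝ) 1 → IsBdrySide 𝒯 T k → 𝒯.par T (sidePt k s) = p →
      wedge r₀ (sideZ g e₁ e₂ (𝒯.par T) k s) = 0 ∨ wedge (sideZ g e₁ e₂ (𝒯.par T) k s) r₁ = 0 := by
    intro T k s hs hb hk
    obtain ⟨l, h1, h2⟩ := hb.exists_coord hs
    rw [hk] at h1
    rw [sideZ, hk, (hw _).1, (hw _).2]
    rcases hij l h1 with rfl | rfl
    · left; rw [h2, mul_zero]
    · right; rw [h2, mul_zero]
  have P1 : (∏ T, ∏ i, if IsBdrySide 𝒯 T i ∧ 𝒯.par T (sidePt i 0) = p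
      then expMu g e₁ e₂ (𝒯.par T) i 0 else 1) = expMu g e₁ e₂ (𝒯.par q.1) q.2 0 := by
    rw [← Fintype.prod_prod_type' (f := fun T i => if IsBdrySide 𝒯 T i ∧ 𝒯.par T (sidePt i 0) = p
      then expMu g e₁ e₂ (𝒯.par T) i 0 else 1), Fintype.prod_eq_single q]
    · exact if_pos ⟨hbq, by rw [sidePt_at_zero]; exact mem_corners.1 hq⟩
    · intro x hx
      refine if_neg fun hcond => hx ?_
      have hxc : x ∈ corners 𝒯 p := mem_corners.2 (by rw [← sidePt_at_zero]; exact hcond.2)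
      obtain ⟨b, hb, hxA⟩ := hr.exists_smul_left (hpos x) (hA hxc) (hB hxc)
        (edge (by simp) hcond.1 hcond.2)
      have e : cornerA g e₁ e₂ 𝒯 x = (b * c⁻¹) • cornerA g e₁ e₂ 𝒯 q := by
        rw [hxA, hqA, smul_smul, mul_assoc, inv_mul_cancel₀ hc.ne', mul_one]
      obtain ⟨w, w1, w2⟩ := exists_mem_openSector_left (c := b * c⁻¹) (by positivity) (hpos q)
        (e ▸ hpos x)
      rw [← e] at w2
      exact corner_unique h ho hxc hq w2 w1
  have P2 : (∏ T, ∏ i, if IsBdrySide 𝒯 T i ∧ 𝒯.par T (sidePt i 1) = p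
      then starRingEnd ℂ (expMu g e₁ e₂ (𝒯.par T) i 1) else 1) =
      starRingEnd ℂ (expMu g e₁ e₂ (𝒯.par q'.1) (q'.2 + 2) 1) := by
    rw [← Fintype.prod_prod_type' (f := fun T i => if IsBdrySide 𝒯 T i ∧ 𝒯.par T (sidePt i 1) = p
      then starRingEnd ℂ (expMu g e₁ e₂ (𝒯.par T) i 1) else 1),
      Fintype.prod_eq_single (q'.1, q'.2 + 2)]
    · exact if_pos ⟨hbq', by rw [sidePt_at_one, add1]; exact mem_corners.1 hq'⟩
    · intro x hx
      refine if_neg fun hcond => hx ?_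
      have hxc : (x.1, x.2 + 1) ∈ corners 𝒯 p := mem_corners.2 (by
        rw [← sidePt_at_one]; exact hcond.2)
      have hxz : cornerB g e₁ e₂ 𝒯 (x.1, x.2 + 1) = -sideZ g e₁ e₂ (𝒯.par x.1) x.2 1 := by
        rw [cornerB, add2]
      obtain ⟨b, hb, hxB⟩ := hr.exists_smul_right (hpos _) (hA hxc) (hB hxc) (by
        rw [hxz, wedge_neg_left, wedge_neg_right, neg_eq_zero, neg_eq_zero]
        exact edge (by simp) hcond.1 hcond.2)
      have e : cornerB g e₁ e₂ 𝒯 (x.1, x.2 + 1) = (b * c'⁻¹) • cornerB g e₁ e₂ 𝒯 q' := by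
        rw [hxB, hqB, smul_smul, mul_assoc, inv_mul_cancel₀ hc'.ne', mul_one]
      obtain ⟨w, w1, w2⟩ := exists_mem_openSector_right (c := b * c'⁻¹) (by positivity) (hpos q')
        (e ▸ hpos (x.1, x.2 + 1))
      rw [← e] at w2
      have := corner_unique h ho hxc hq' w2 w1
      rw [← this]
      exact Prod.ext rfl (add2 x.2).symm
  have hz' : sideZ g e₁ e₂ (𝒯.par q'.1) (q'.2 + 2) 1 = -(c' • r₁) := by
    rw [← hqB, cornerB, neg_neg]
  have hz : sideZ g e₁ e₂ (𝒯.par q.1) q.2 0 = c • r₀ := hqA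
  rw [jumpMu, P1, P2, expMu_eq h (𝒯.smooth _) (ho _) _ (by simp),
    expMu_eq h (𝒯.smooth _) (ho _) _ (by simp), hz, hz', norm_neg, norm_smul, norm_smul,
    Real.norm_of_nonneg hc.le, Real.norm_of_nonneg hc'.le, Complex.real_smul, Complex.real_smul]
  rw [← arg_neg_mul_conj hr]
  have hcc : (c : ℂ) ≠ 0 := by exact_mod_cast hc.ne'
  have hcc' : (c' : ℂ) ≠ 0 := by exact_mod_cast hc'.ne'
  have e1 : -Complex.I * (c * r₀) / ((c * ‖r₀‖ : ℝ) : ℂ) = -Complex.I * r₀ / ‖r₀‖ := by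
    push_cast
    rw [mul_left_comm, mul_div_mul_left _ _ hcc]
  have e2 : -Complex.I * -(c' * r₁) / ((c' * ‖r₁‖ : ℝ) : ℂ) = -Complex.I * -r₁ / ‖r₁‖ := by
    push_cast
    rw [← mul_neg, mul_left_comm, mul_div_mul_left _ _ hcc']
  rw [e1, e2]

/-- For a smooth metric, the contributions of interior edges and vertices cancel. -/
theorem meshDefect_eq_zero [T2Space M] {v : M → ℝ} (hv : Continuous v) :
    meshDefect g e₁ e₂ 𝒯 v = 0 := by
  classical
  rw [meshDefect, sum_integral_dMu_eq_zero h ho hv, zero_add]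
  refine Finset.sum_eq_zero fun p hp => ?_
  obtain ⟨q, -, hq⟩ := Finset.mem_image.1 hp
  have hq : q ∈ corners 𝒯 p := mem_corners.2 hq
  split_ifs with hb
  · rw [jumpMu_boundary h ho hq hb]; ring
  · rw [angleSum_interior h ho hq hb]; ring

end

end

section

open Filter Topology Set

theorem cross_map (L : E2 →L[ℝ] E2) (v w : E2) : cross (L v) (L w) = L.det * cross v w := by
  have hd : L.det = L (EuclideanSpace.single 0 1) 0 * L (EuclideanSpace.single 1 1) 1 -
      L (EuclideanSpace.single 1 1) 0 * L (EuclideanSpace.single 0 1) 1 := by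
    rw [ContinuousLinearMap.det, ← LinearMap.det_toMatrix (EuclideanSpace.basisFun (Fin 2) ℝ).toBasis,
      Matrix.det_fin_two]
    simp [LinearMap.toMatrix_apply]
  have e : ∀ (u : E2) k, L u k = u 0 * L (EuclideanSpace.single 0 1) k +
      u 1 * L (EuclideanSpace.single 1 1) k := fun u k => by
    conv_lhs => rw [vec_eq_sum u]
    simp
  rw [hd, cross, cross, e v, e v, e w, e w]
  ring

theorem refTri_ae_eq_openTri : refTri =ᵐ[volume] openTri := by
  refine Filter.EventuallyEq.symm ?_
  refine (HasSubset.Subset.eventuallyLE openTri_subset).antisymm ?_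
  have h0 : volume (frontier refTri) = 0 := convex_refTri.addHaar_frontier volume
  have hi : refTri \ frontier refTri ⊆ openTri := by
    rw [self_diff_frontier]
    intro x hx
    obtain ⟨ε, hε, hb⟩ := Metric.mem_nhds_iff.1 (mem_interior_iff_mem_nhds.1 hx)
    have key : ∀ k : Fin 2, ∀ s : ℝ, |s| < ε → x + s • EuclideanSpace.single k 1 ∈ refTri := by
      intro k s hs
      apply hb
      simpa [norm_smul] using hs
    have h2 : |ε / 2| < ε := by rw [abs_of_pos (by positivity)]; linarith
    have h3 : |-(ε / 2)| < ε := by rwa [abs_neg]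
    have a := key 0 _ h3
    have b := key 1 _ h3
    have c := key 0 _ h2
    simp [refTri] at a b c
    exact ⟨by linarith, by linarith, by linarith⟩
  rw [ae_le_set]
  refine measure_mono_null (fun x hx => ?_) h0
  by_contra hc
  exact hx.2 (hi ⟨hx.1, hc⟩)

section

variable {M : Type*} [TopologicalSpace M] [ChartedSpace (EuclideanQuadrant 2) M]
  [IsManifold IQ ∞ M]

/-- A vector field in the chart at `y`. -/
def chartField (y : M) (e : ∀ x : M, TangentSpace IQ x) (z : M) : E2 :=
  mfderiv IQ 𝓘(ℝ, E2) (extChartAt IQ y) z (e z)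

theorem continuousAt_chartField (y : M) {e : ∀ x : M, TangentSpace IQ x}
    (he : ContMDiff IQ IQ.tangent ∞ fun x => (⟨x, e x⟩ : TangentBundle IQ M)) :
    ContinuousAt (chartField y e) y := by
  have h := ((FiberBundle.continuousAt_totalSpace E2 (fun x => (⟨x, e x⟩ : TangentBundle IQ M))).1
    (he.continuous.continuousAt (x := y))).2
  refine h.congr ?_
  filter_upwards [(chartAt (EuclideanQuadrant 2) y).open_source.mem_nhds
    (mem_chart_source (EuclideanQuadrant 2) y)] with z hz
  have hm := TangentBundle.continuousLinearMapAt_trivializationAt (I := IQ) hz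
  rw [chartField, ← hm]
  exact (Bundle.Trivialization.continuousLinearMapAt_apply_of_mem (R := ℝ)
    (trivializationAt E2 (TangentSpace IQ) y) hz (e z)).symm

theorem IsFrame.cross_chartField_ne_zero {g : Metric2 M} {e₁ e₂ : ∀ x : M, TangentSpace IQ x}
    (h : IsFrame g e₁ e₂) (y : M) : cross (chartField y e₁ y) (chartField y e₂ y) ≠ 0 := by
  have e : ∀ e : ∀ x : M, TangentSpace IQ x, chartField y e y = e y := fun e => by
    rw [chartField, mfderiv_extChartAt_self]; rfl
  rw [e, e]
  intro hc
  set v : E2 := e₁ y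
  set w : E2 := e₂ y
  have e0 : w 0 • v - v 0 • w = 0 := by
    ext k; fin_cases k <;> simp [cross] at hc ⊢ <;> linarith
  have e1 : w 1 • v - v 1 • w = 0 := by
    ext k; fin_cases k <;> simp [cross] at hc ⊢ <;> linarith
  have k : ∀ a b : ℝ, a • v - b • w = 0 → a = 0 := fun a b hab => by
    have : g.inner y (e₁ y) (a • e₁ y - b • e₂ y) = 0 := by
      rw [show a • e₁ y - b • e₂ y = 0 from hab]; simp
    rw [map_sub, map_smul, map_smul, h.unit₁, h.orth] at this
    simpa using this
  have w0 : w = 0 := by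
    ext i; fin_cases i
    · exact k _ _ e0
    · exact k _ _ e1
  have := h.unit₂ y
  rw [show e₂ y = 0 from w0] at this
  simp at this

theorem IsSmoothTriangle.hasFDerivWithinAt_extChartAt {f : E2 → M} (hf : IsSmoothTriangle f) {x : E2}
    (hx : x ∈ refTri) {y : M} (hy : f x ∈ (chartAt (EuclideanQuadrant 2) y).source) :
    ∃ L : E2 →L[ℝ] E2, HasFDerivWithinAt (fun z => extChartAt IQ y (f z)) L refTri x ∧
      ∀ e : ∀ x : M, TangentSpace IQ x, L (pullVec f e x) = chartField y e (f x) := by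
  have h1 := ((hf.smooth.mdifferentiableOn (by simp)) x hx).hasMFDerivWithinAt
  have h2 := (mdifferentiableAt_extChartAt (I := IQ) hy).hasMFDerivAt
  have h3 := (h2.comp_hasMFDerivWithinAt x h1)
  refine ⟨_, hasMFDerivWithinAt_iff_hasFDerivWithinAt.1 h3, fun e => ?_⟩
  exact congrArg (fun w : TangentSpace IQ (f x) => mfderiv IQ 𝓘(ℝ, E2) (extChartAt IQ y) (f x) w)
    (dpar_pullVec hf hx e)

/-- The derivative of a function along a vector field. -/
def dirDeriv (u : M → ℝ) (e : ∀ x : M, TangentSpace IQ x) (y : M) : ℝ := mfderiv IQ 𝓘(ℝ, ℝ) u y (e y)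

theorem continuous_dirDeriv {u : M → ℝ} (hu : ContMDiff IQ 𝓘(ℝ, ℝ) ∞ u)
    {e : ∀ x : M, TangentSpace IQ x}
    (he : ContMDiff IQ IQ.tangent ∞ fun x => (⟨x, e x⟩ : TangentBundle IQ M)) :
    Continuous (dirDeriv u e) := by
  have h1 := (hu.continuous_tangentMap (by simp)).comp he.continuous
  exact (contMDiff_snd_tangentBundle_modelSpace (n := 0) ℝ 𝓘(ℝ, ℝ)).continuous.comp h1

section

variable {g : Metric2 M} {e₁ e₂ : ∀ x : M, TangentSpace IQ x} (h : IsFrame g e₁ e₂)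
include h

theorem IsFrame.dvol_mul_cross {f : E2 → M} (hf : IsSmoothTriangle f)
    (ho : PreservesOrientation e₁ e₂ f) {x : E2} (hx : x ∈ refTri) :
    dvol (pull g f) x * cross (pullVec f e₁ x) (pullVec f e₂ x) = 1 := by
  obtain ⟨h1, h2, h3, h4⟩ := pair_pullVec h hf hx
  rw [(h.coframe hf ho).dvol_eq (hf.isMetric_pull g) hx, cross]
  linear_combination h1 * (pullVec f e₂ x 0 * coform g e₂ f 0 x +
    pullVec f e₂ x 1 * coform g e₂ f 1 x) + h2 - h3 * (pullVec f e₁ x 0 * coform g e₂ f 0 x +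
    pullVec f e₁ x 1 * coform g e₂ f 1 x)

theorem IsFrame.inner1_dfn {f : E2 → M} (hf : IsSmoothTriangle f)
    (ho : PreservesOrientation e₁ e₂ f) {x : E2} (hx : x ∈ refTri) {u : M → ℝ}
    (hu : ContMDiff IQ 𝓘(ℝ, ℝ) ∞ u) :
    inner1 (pull g f x) (dfn (fun z => u (f z)) x) (dfn (fun z => u (f z)) x) =
      dirDeriv u e₁ (f x) ^ 2 + dirDeriv u e₂ (f x) ^ 2 := by
  have h1 := ((hf.smooth.mdifferentiableOn (by simp)) x hx).hasMFDerivWithinAt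
  have h2 := (hu.mdifferentiable (by simp) (f x)).hasMFDerivAt
  have h3 := hasMFDerivWithinAt_iff_hasFDerivWithinAt.1 (h2.comp_hasMFDerivWithinAt x h1)
  have h4 : ∀ L : E2 →L[ℝ] ℝ, HasFDerivWithinAt (fun z => u (f z)) L refTri x →
      fderivWithin ℝ (fun z => u (f z)) refTri x = L := fun L hL =>
    hL.fderivWithin (uniqueDiffOn_refTri x hx)
  have h5 : ∀ e : ∀ x : M, TangentSpace IQ x, dirDeriv u e (f x) =
      pullVec f e x 0 * pd 0 (fun z => u (f z)) x + pullVec f e x 1 * pd 1 (fun z => u (f z)) x := by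
    intro e
    rw [← fderivWithin_apply_eq, dirDeriv, ← dpar_pullVec hf hx e, h4 _ h3]
    rfl
  have c := h.coframe hf ho
  have d := h.dualFrame hf ho
  have hD := (c.pos x hx).ne'
  obtain ⟨i0, i1, i2, i3⟩ := inv_entries ((hf.isMetric_pull g).symm hx)
  rw [h5, h5, d.p0 x hx, d.p1 x hx, d.q0 x hx, d.q1 x hx]
  simp only [inner1, Fin.sum_univ_two, i0, i1, i2, i3, c.eq x hx, dfn]
  have e : (coform g e₁ f 0 x * coform g e₁ f 0 x + coform g e₂ f 0 x * coform g e₂ f 0 x) *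
      (coform g e₁ f 1 x * coform g e₁ f 1 x + coform g e₂ f 1 x * coform g e₂ f 1 x) -
      (coform g e₁ f 0 x * coform g e₁ f 1 x + coform g e₂ f 0 x * coform g e₂ f 1 x) ^ 2 =
      (coform g e₁ f 0 x * coform g e₂ f 1 x - coform g e₁ f 1 x * coform g e₂ f 0 x) ^ 2 := by ring
  rw [e]
  generalize coform g e₁ f 0 x * coform g e₂ f 1 x - coform g e₁ f 1 x * coform g e₂ f 0 x = D at hD ⊢
  rw [div_mul_eq_mul_div]
  field_simp
  ring

/-- The part of the area of the triangles that lies in a suitable neighbourhood of a point is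
bounded independently of the mesh. -/
theorem IsFrame.exists_sum_lintegral_le (y : M) : ∃ U : Set M, IsOpen U ∧ y ∈ U ∧ ∃ B : ℝ≥0∞, B ≠ ⊤ ∧
    ∀ 𝒯 : Mesh M, (∀ T, PreservesOrientation e₁ e₂ (𝒯.par T)) →
      ∑ T, ∫⁻ x in openTri ∩ 𝒯.par T ⁻¹' U, ENNReal.ofReal (dvol (onMesh g 𝒯 T) x) ≤ B := by
  have hc := h.cross_chartField_ne_zero y
  set ε : M → ℝ := fun z => |cross (chartField y e₁ z) (chartField y e₂ z)| with hε
  have cε : ContinuousAt ε y := by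
    have h1 := continuousAt_chartField y h.smooth₁
    have h2 := continuousAt_chartField y h.smooth₂
    have k : ∀ {φ : M → E2} (_ : ContinuousAt φ y) (j : Fin 2), ContinuousAt (fun z => φ z j) y :=
      fun hφ j => (continuous_coord j).continuousAt.comp hφ
    exact (((k h1 0).mul (k h2 1)).sub ((k h1 1).mul (k h2 0))).abs
  obtain ⟨δ, hδ, hδy⟩ : ∃ δ, 0 < δ ∧ δ < ε y := exists_between (abs_pos.2 hc)
  have n1 : ∀ᶠ z in 𝓝 y, δ < ε z := cε.eventually_const_lt hδy
  have n2 : ∀ᶠ z in 𝓝 y, z ∈ (chartAt (EuclideanQuadrant 2) y).source :=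
    (chartAt (EuclideanQuadrant 2) y).open_source.mem_nhds (mem_chart_source _ y)
  have n3 : ∀ᶠ z in 𝓝 y, extChartAt IQ y z ∈ Metric.ball (extChartAt IQ y y) 1 :=
    (continuousAt_extChartAt y).eventually (Metric.ball_mem_nhds _ one_pos)
  obtain ⟨U, hU, oU, yU⟩ := eventually_nhds_iff.1 (n1.and (n2.and n3))
  refine ⟨U, oU, yU, volume (Metric.ball (extChartAt IQ y y) 1) / ENNReal.ofReal δ,
    (ENNReal.div_lt_top measure_ball_lt_top.ne (by simpa using hδ)).ne, fun 𝒯 ho => ?_⟩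
  set S : Fin 𝒯.n → Set E2 := fun T => openTri ∩ 𝒯.par T ⁻¹' U
  set Φ : Fin 𝒯.n → E2 → E2 := fun T x => extChartAt IQ y (𝒯.par T x)
  have hSr : ∀ T, S T ⊆ refTri := fun T x hx => openTri_subset hx.1
  have mS : ∀ T, MeasurableSet (S T) := fun T =>
    (((𝒯.smooth T).smooth.continuousOn.mono openTri_subset).isOpen_inter_preimage
      isOpen_openTri oU).measurableSet
  have hL : ∀ T x, ∃ L : E2 →L[ℝ] E2, x ∈ S T → HasFDerivWithinAt (Φ T) L (S T) x ∧
      ∀ e : ∀ x : M, TangentSpace IQ x, L (pullVec (𝒯.par T) e x) = chartField y e (𝒯.par T x) := by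
    intro T x
    by_cases hx : x ∈ S T
    · obtain ⟨L, h1, h2⟩ := (𝒯.smooth T).hasFDerivWithinAt_extChartAt (hSr T hx) (hU _ hx.2).2.1
      exact ⟨L, fun _ => ⟨h1.mono (hSr T), h2⟩⟩
    · exact ⟨0, fun h => (hx h).elim⟩
  choose L hL using hL
  have inj : ∀ T T' x x', x ∈ S T → x' ∈ S T' → Φ T x = Φ T' x' → 𝒯.par T x = 𝒯.par T' x' := by
    intro T T' x x' hx hx' e
    exact (extChartAt IQ y).injOn (by rw [extChartAt_source]; exact (hU _ hx.2).2.1)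
      (by rw [extChartAt_source]; exact (hU _ hx'.2).2.1) e
  have injT : ∀ T, InjOn (Φ T) (S T) := fun T x hx x' hx' e =>
    𝒯.inj T (hSr T hx) (hSr T hx') (inj T T x x' hx hx' e)
  have disj : Pairwise (Function.onFun Disjoint fun T => Φ T '' S T) := by
    intro T T' hT
    rw [Function.onFun, Set.disjoint_left]
    rintro _ ⟨x, hx, rfl⟩ ⟨x', hx', e⟩
    have e := inj T' T x' x hx' hx e
    have hm : 𝒯.par T x ∈ 𝒯.par T '' refTri ∩ 𝒯.par T' '' refTri :=
      ⟨mem_image_of_mem _ (hSr T hx), ⟨x', hSr T' hx', e⟩⟩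
    rcases 𝒯.inter T T' hT with h0 | ⟨s, s', hs, -, h1, -⟩
    · rw [h0] at hm; exact hm
    · rw [h1] at hm
      obtain ⟨z, hz, ez⟩ := hm
      have := 𝒯.inj T (face_subset s hz) (hSr T hx) ez
      exact notMem_face_of_mem_openTri hs hx.1 (this ▸ hz)
  have loc : ∀ T, ENNReal.ofReal δ * ∫⁻ x in S T, ENNReal.ofReal (dvol (onMesh g 𝒯 T) x) ≤
      volume (Φ T '' S T) := by
    intro T
    rw [← lintegral_abs_det_fderiv_eq_addHaar_image volume (mS T) (fun x hx => (hL T x hx).1) (injT T),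
      ← lintegral_const_mul' _ _ ENNReal.ofReal_ne_top]
    refine setLIntegral_mono' (mS T) fun x hx => ?_
    rw [← ENNReal.ofReal_mul hδ.le]
    refine ENNReal.ofReal_le_ofReal ?_
    have d := h.dvol_mul_cross (𝒯.smooth T) (ho T) (hSr T hx)
    have d0 := (isMetric_onMesh g 𝒯 T).dvol_pos (hSr T hx)
    have c := cross_map (L T x) (pullVec (𝒯.par T) e₁ x) (pullVec (𝒯.par T) e₂ x)
    rw [(hL T x hx).2, (hL T x hx).2] at c
    have hdet : (L T x).det = cross (chartField y e₁ (𝒯.par T x)) (chartField y e₂ (𝒯.par T x)) *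
        dvol (onMesh g 𝒯 T) x := by
      rw [c, mul_assoc, mul_comm (cross _ _)]
      exact (by rw [show dvol (onMesh g 𝒯 T) x * _ = 1 from d, mul_one])
    rw [hdet, abs_mul, abs_of_pos d0]
    exact mul_le_mul_of_nonneg_right (hU _ hx.2).1.le d0.le
  rw [ENNReal.le_div_iff_mul_le (Or.inl (by simpa using hδ)) (Or.inl ENNReal.ofReal_ne_top), mul_comm,
    Finset.mul_sum]
  refine (Finset.sum_le_sum fun T _ => loc T).trans ?_
  rw [← tsum_fintype (L := SummationFilter.unconditional _), ← measure_iUnion disj fun T =>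
    measurable_image_of_fderivWithin (mS T) (fun x hx => (hL T x hx).1) (injT T)]
  refine measure_mono (iUnion_subset fun T => ?_)
  rintro _ ⟨x, hx, rfl⟩
  exact (hU _ hx.2).2.2

/-- The area of the surface is bounded independently of the mesh. -/
theorem IsFrame.exists_area_le [CompactSpace M] : ∃ B : ℝ, ∀ 𝒯 : Mesh M,
    (∀ T, PreservesOrientation e₁ e₂ (𝒯.par T)) → ∑ T, ∫ x in refTri, dvol (onMesh g 𝒯 T) x ≤ B := by
  choose U oU yU B hB hle using h.exists_sum_lintegral_le
  obtain ⟨t, ht⟩ := isCompact_univ.elim_finite_subcover U oU fun y _ => mem_iUnion.2 ⟨y, yU y⟩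
  refine ⟨(∑ y ∈ t, B y).toReal, fun 𝒯 ho => ?_⟩
  have ftop : ∑ y ∈ t, B y ≠ ⊤ := (ENNReal.sum_lt_top.2 fun y _ => (hB y).lt_top).ne
  have e : ∀ T, ∫ x in refTri, dvol (onMesh g 𝒯 T) x =
      (∫⁻ x in openTri, ENNReal.ofReal (dvol (onMesh g 𝒯 T) x)).toReal := by
    intro T
    rw [setIntegral_congr_set refTri_ae_eq_openTri]
    refine integral_eq_lintegral_of_nonneg_ae (Eventually.of_forall fun x => Real.sqrt_nonneg _) ?_
    exact ((isMetric_onMesh g 𝒯 T).contDiffOn_dvol.continuousOn.mono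
      openTri_subset).aestronglyMeasurable isOpen_openTri.measurableSet
  have b : ∑ T, ∫⁻ x in openTri, ENNReal.ofReal (dvol (onMesh g 𝒯 T) x) ≤ ∑ y ∈ t, B y := by
    refine le_trans (Finset.sum_le_sum fun T _ => ?_) ((Finset.sum_comm.le).trans
      (Finset.sum_le_sum fun y (_ : y ∈ t) => hle y 𝒯 ho))
    have sub : openTri ⊆ ⋃ y : t, openTri ∩ 𝒯.par T ⁻¹' U y := fun x hx => by
      obtain ⟨y, hy, hxy⟩ := mem_iUnion₂.1 (ht (mem_univ (𝒯.par T x)))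
      exact mem_iUnion.2 ⟨⟨y, hy⟩, hx, hxy⟩
    refine (lintegral_mono_set sub).trans ((lintegral_iUnion_le _ _).trans ?_)
    rw [tsum_fintype, Finset.sum_coe_sort t fun y => ∫⁻ x in openTri ∩ 𝒯.par T ⁻¹' U y,
      ENNReal.ofReal (dvol (onMesh g 𝒯 T) x)]
  have bt : ∀ T, ∫⁻ x in openTri, ENNReal.ofReal (dvol (onMesh g 𝒯 T) x) ≠ ⊤ := fun T =>
    ne_top_of_le_ne_top ftop ((Finset.single_le_sum (f := fun T => ∫⁻ x in openTri,
      ENNReal.ofReal (dvol (onMesh g 𝒯 T) x)) (fun _ _ => zero_le) (Finset.mem_univ T)).trans b)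
  simp only [e]
  rw [← ENNReal.toReal_sum fun T _ => bt T]
  exact ENNReal.toReal_mono ftop b

/-- The Dirichlet energy of a smooth function is bounded independently of the mesh. -/
theorem IsFrame.exists_normL2Form_dM_le [CompactSpace M] {u : M → ℝ}
    (hu : ContMDiff IQ 𝓘(ℝ, ℝ) ∞ u) : ∃ B : ℝ, 0 ≤ B ∧ ∀ 𝒯 : Mesh M,
    (∀ T, PreservesOrientation e₁ e₂ (𝒯.par T)) → normL2Form 𝒯 (onMesh g 𝒯) (dM 𝒯 u) ≤ B := by
  obtain ⟨A, hA⟩ := h.exists_area_le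
  set F : M → ℝ := fun y => dirDeriv u e₁ y ^ 2 + dirDeriv u e₂ y ^ 2
  have cF : Continuous F := ((continuous_dirDeriv hu h.smooth₁).pow 2).add
    ((continuous_dirDeriv hu h.smooth₂).pow 2)
  obtain ⟨c, hc⟩ := isCompact_univ.bddAbove_image (f := F) cF.continuousOn
  have hc : ∀ y, F y ≤ c := fun y => hc ⟨y, mem_univ y, rfl⟩
  have hc' : ∀ y, F y ≤ max c 0 := fun y => (hc y).trans (le_max_left _ _)
  refine ⟨√(max c 0 * A), Real.sqrt_nonneg _, fun 𝒯 ho => Real.sqrt_le_sqrt ?_⟩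
  refine le_trans ?_ (mul_le_mul_of_nonneg_left (hA 𝒯 ho) (le_max_right c 0))
  rw [Finset.mul_sum]
  refine Finset.sum_le_sum fun T _ => ?_
  have cd := (isMetric_onMesh g 𝒯 T).contDiffOn_dvol.continuousOn
  have e : ∀ x ∈ refTri, inner1 (onMesh g 𝒯 T x) (dM 𝒯 u T x) (dM 𝒯 u T x) = F (𝒯.par T x) :=
    fun x hx => h.inner1_dfn (𝒯.smooth T) (ho T) hx hu
  have ci : ContinuousOn (fun x => F (𝒯.par T x)) refTri :=
    cF.comp_continuousOn (𝒯.smooth T).smooth.continuousOn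
  rw [← integral_const_mul, triInt, setIntegral_congr_fun (g := fun x => F (𝒯.par T x) *
    dvol (onMesh g 𝒯 T) x) isClosed_refTri.measurableSet fun x hx => by rw [e x hx]]
  refine setIntegral_mono_on (integrableOn_refTri (ci.mul cd))
    (integrableOn_refTri (continuousOn_const.mul cd)) isClosed_refTri.measurableSet fun x hx => ?_
  exact mul_le_mul_of_nonneg_right (hc' _) (Real.sqrt_nonneg _)

end

end

end

section

/-! ### The `L²` geometry of piecewise continuous forms -/

section

variable {M : Type*} [TopologicalSpace M] [ChartedSpace (EuclideanQuadrant 2) M] {𝒯 : Mesh M}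

/-- A form that is continuous on each closed triangle. -/
def ContForm (𝒯 : Mesh M) (a : Fin 𝒯.n → E2 → Fin 2 → ℝ) : Prop :=
  ∀ T k, ContinuousOn (fun x => a T x k) refTri

theorem ContForm.smul_add_smul {a b : Fin 𝒯.n → E2 → Fin 2 → ℝ} (ha : ContForm 𝒯 a)
    (hb : ContForm 𝒯 b) (s t : ℝ) : ContForm 𝒯 (s • a + t • b) := fun T k =>
  (continuousOn_const.mul (ha T k)).add (continuousOn_const.mul (hb T k))

theorem contForm_dM {v : M → ℝ} (hv : ∀ T, ContDiffOn ℝ 1 (res 𝒯 T v) refTri) :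
    ContForm 𝒯 (dM 𝒯 v) := fun T k => continuousOn_pd (hv T) le_rfl k

theorem dM_sub {v w : M → ℝ} (hv : ∀ T, ContDiffOn ℝ 1 (res 𝒯 T v) refTri)
    (hw : ∀ T, ContDiffOn ℝ 1 (res 𝒯 T w) refTri) (T : Fin 𝒯.n) {x : E2} (hx : x ∈ refTri) :
    dM 𝒯 (v - w) T x = dM 𝒯 v T x - dM 𝒯 w T x := by
  funext k
  have h1 := (hv T).differentiableOn (by simp) x hx
  have h2 := (hw T).differentiableOn (by simp) x hx
  change pd k (fun y => res 𝒯 T v y - res 𝒯 T w y) x = _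
  rw [pd, fderivWithin_fun_sub (uniqueDiffOn_refTri x hx) h1 h2]
  rfl

theorem innerL2Form_congr (G : Fin 𝒯.n → E2 → Mat) {a a' b b' : Fin 𝒯.n → E2 → Fin 2 → ℝ}
    (ha : ∀ T, ∀ x ∈ refTri, a T x = a' T x) (hb : ∀ T, ∀ x ∈ refTri, b T x = b' T x) :
    innerL2Form 𝒯 G a b = innerL2Form 𝒯 G a' b' :=
  Finset.sum_congr rfl fun T _ => setIntegral_congr_fun isClosed_refTri.measurableSet fun x hx => by
    simp only [ha T x hx, hb T x hx]

theorem isMetric_flat : IsMetric flat :=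
  ⟨fun _ _ => contDiffOn_const, fun _ _ => Matrix.PosDef.one⟩

theorem inner1_flat (x : E2) (a : Fin 2 → ℝ) :
    inner1 (flat x) a a * dvol flat x = a 0 ^ 2 + a 1 ^ 2 := by
  simp [inner1, flat, dvol]; ring

variable {G : Fin 𝒯.n → E2 → Mat} (hG : ∀ T, IsMetric (G T)) {a b : Fin 𝒯.n → E2 → Fin 2 → ℝ}
include hG

theorem continuousOn_inner1_mul_dvol (ha : ContForm 𝒯 a) (hb : ContForm 𝒯 b) (T : Fin 𝒯.n) :
    ContinuousOn (fun x => inner1 (G T x) (a T x) (b T x) * dvol (G T) x) refTri :=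
  (continuousOn_inner1 (hG T) (ha T) (hb T)).mul (hG T).contDiffOn_dvol.continuousOn

theorem innerL2Form_smul_add_smul (ha : ContForm 𝒯 a) (hb : ContForm 𝒯 b) (s t : ℝ)
    {c : Fin 𝒯.n → E2 → Fin 2 → ℝ} (hc : ContForm 𝒯 c) :
    innerL2Form 𝒯 G (s • a + t • b) c = s * innerL2Form 𝒯 G a c + t * innerL2Form 𝒯 G b c := by
  simp only [innerL2Form, Finset.mul_sum, ← Finset.sum_add_distrib]
  refine Finset.sum_congr rfl fun T _ => ?_
  have c1 := continuousOn_inner1_mul_dvol hG ha hc T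
  have c2 := continuousOn_inner1_mul_dvol hG hb hc T
  rw [triInt, triInt, triInt, ← integral_const_mul, ← integral_const_mul,
    ← integral_add ((integrableOn_refTri c1).const_mul s) ((integrableOn_refTri c2).const_mul t)]
  refine integral_congr_ae (Filter.Eventually.of_forall fun x => ?_)
  simp only [inner1, Fin.sum_univ_two, Pi.add_apply, Pi.smul_apply, smul_eq_mul]
  ring

theorem innerL2Form_comm (a b : Fin 𝒯.n → E2 → Fin 2 → ℝ) :
    innerL2Form 𝒯 G a b = innerL2Form 𝒯 G b a :=
  Finset.sum_congr rfl fun T _ => setIntegral_congr_fun isClosed_refTri.measurableSet fun x hx => by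
    obtain ⟨-, i1, i2, -⟩ := inv_entries ((hG T).symm hx)
    simp only [inner1, Fin.sum_univ_two, i1, i2]
    ring

theorem innerL2Form_self_smul_add_smul (ha : ContForm 𝒯 a) (hb : ContForm 𝒯 b) (s t : ℝ) :
    innerL2Form 𝒯 G (s • a + t • b) (s • a + t • b) = innerL2Form 𝒯 G a a * s ^ 2 +
      2 * innerL2Form 𝒯 G a b * s * t + innerL2Form 𝒯 G b b * t ^ 2 := by
  have hc := ha.smul_add_smul hb s t
  rw [innerL2Form_smul_add_smul hG ha hb s t hc, innerL2Form_comm hG a, innerL2Form_comm hG b,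
    innerL2Form_smul_add_smul hG ha hb s t ha, innerL2Form_smul_add_smul hG ha hb s t hb,
    innerL2Form_comm hG b a]
  ring

variable [IsManifold IQ ∞ M]

theorem sq_normL2Form (a : Fin 𝒯.n → E2 → Fin 2 → ℝ) :
    normL2Form 𝒯 G a ^ 2 = innerL2Form 𝒯 G a a := Real.sq_sqrt (innerL2Form_self_nonneg hG a)

theorem abs_innerL2Form_le (ha : ContForm 𝒯 a) (hb : ContForm 𝒯 b) :
    |innerL2Form 𝒯 G a b| ≤ normL2Form 𝒯 G a * normL2Form 𝒯 G b := by
  refine abs_le_of_sq_le_sq ?_ (mul_nonneg (normL2Form_nonneg _) (normL2Form_nonneg _))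
  rw [mul_pow, sq_normL2Form hG, sq_normL2Form hG]
  refine sq_le_mul_of_quad_nonneg fun s t => ?_
  rw [← innerL2Form_self_smul_add_smul hG ha hb]
  exact innerL2Form_self_nonneg hG _

theorem normL2Form_add_le (ha : ContForm 𝒯 a) (hb : ContForm 𝒯 b) :
    normL2Form 𝒯 G (a + b) ≤ normL2Form 𝒯 G a + normL2Form 𝒯 G b := by
  refine abs_le_of_sq_le_sq' ?_ (add_nonneg (normL2Form_nonneg _) (normL2Form_nonneg _)) |>.2
  have e := innerL2Form_self_smul_add_smul hG ha hb 1 1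
  rw [one_smul, one_smul] at e
  rw [sq_normL2Form hG, e, add_sq, sq_normL2Form hG, sq_normL2Form hG]
  have := (abs_le.1 (abs_innerL2Form_le hG ha hb)).2
  linarith

/-- Two inner products whose quadratic forms are close are close. -/
theorem abs_innerL2Form_sub_le {G₁ G₂ : Fin 𝒯.n → E2 → Mat} (h₁ : ∀ T, IsMetric (G₁ T))
    (h₂ : ∀ T, IsMetric (G₂ T)) {C : ℝ} (hC : 0 ≤ C)
    (h : ∀ c, ContForm 𝒯 c →
      |innerL2Form 𝒯 G₁ c c - innerL2Form 𝒯 G₂ c c| ≤ C * innerL2Form 𝒯 G c c)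
    (ha : ContForm 𝒯 a) (hb : ContForm 𝒯 b) :
    |innerL2Form 𝒯 G₁ a b - innerL2Form 𝒯 G₂ a b| ≤ C * (normL2Form 𝒯 G a * normL2Form 𝒯 G b) := by
  refine abs_le_of_sq_le_sq ?_ (mul_nonneg hC (mul_nonneg (normL2Form_nonneg _) (normL2Form_nonneg _)))
  have := sq_le_mul_of_quad_nonneg (p := C * innerL2Form 𝒯 G a a) (r := C * innerL2Form 𝒯 G b b)
    (q := innerL2Form 𝒯 G₁ a b - innerL2Form 𝒯 G₂ a b) fun s t => by
      have e1 := (abs_le.1 (h _ (ha.smul_add_smul hb s t))).1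
      have e2 := (abs_le.1 (h _ (ha.smul_add_smul hb s (-t)))).2
      simp only [innerL2Form_self_smul_add_smul hG ha hb, innerL2Form_self_smul_add_smul h₁ ha hb,
        innerL2Form_self_smul_add_smul h₂ ha hb] at e1 e2
      nlinarith
  refine this.trans_eq ?_
  rw [mul_pow, mul_pow, sq_normL2Form hG, sq_normL2Form hG]; ring

theorem innerL2Form_self_le {c : Fin 𝒯.n → E2 → Fin 2 → ℝ} (ha : ContForm 𝒯 a) (hb : ContForm 𝒯 b)
    {p q : ℝ} (h : ∀ T, ∀ x ∈ refTri, inner1 (G T x) (c T x) (c T x) * dvol (G T) x ≤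
      p * (a T x 0 ^ 2 + a T x 1 ^ 2) + q * (b T x 0 ^ 2 + b T x 1 ^ 2)) :
    innerL2Form 𝒯 G c c ≤ p * innerL2Form 𝒯 (fun _ => flat) a a +
      q * innerL2Form 𝒯 (fun _ => flat) b b := by
  simp only [innerL2Form, Finset.mul_sum, ← Finset.sum_add_distrib]
  refine Finset.sum_le_sum fun T _ => ?_
  have c1 := continuousOn_inner1_mul_dvol (fun _ => isMetric_flat) ha ha T
  have c2 := continuousOn_inner1_mul_dvol (fun _ => isMetric_flat) hb hb T
  have i1 := (integrableOn_refTri c1).const_mul p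
  have i2 := (integrableOn_refTri c2).const_mul q
  rw [triInt, triInt, triInt, ← integral_const_mul, ← integral_const_mul, ← integral_add i1 i2]
  refine integral_mono_of_nonneg ?_ (i1.add i2) ?_
  · refine (ae_restrict_iff' isClosed_refTri.measurableSet).2 (Filter.Eventually.of_forall
      fun x hx => mul_nonneg ?_ (Real.sqrt_nonneg _))
    have hi := ((hG T).posDef x hx).inv.posSemidef.dotProduct_mulVec_nonneg (c T x)
    refine hi.trans_eq ?_
    simp only [inner1, Matrix.mulVec, dotProduct, Fin.sum_univ_two, Pi.star_apply, star_trivial]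
    ring
  · refine (ae_restrict_iff' isClosed_refTri.measurableSet).2 (Filter.Eventually.of_forall
      fun x hx => ?_)
    simp only [inner1_flat]
    exact h T x hx

end

/-! ### Comparison of two metrics -/

theorem abs_div_sub_div_le {a a' P P' L m n k : ℝ} (hL : 0 < L) (hP : L ≤ P) (hP' : L ≤ P')
    (ha : |a - a'| ≤ m) (ha' : |a'| ≤ n) (hk : |P - P'| ≤ k) :
    |a / P - a' / P'| ≤ m / L + n * k / L ^ 2 := by
  have p := hL.trans_le hP
  have p' := hL.trans_le hP'
  have e : a / P - a' / P' = (a - a') / P + a' * (P' - P) / (P * P') := by field_simp; ring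
  rw [e]
  refine (abs_add_le _ _).trans (add_le_add ?_ ?_)
  · rw [abs_div, abs_of_pos p]
    exact div_le_div₀ ((abs_nonneg _).trans ha) ha hL hP
  · rw [abs_div, abs_of_pos (mul_pos p p'), abs_mul, abs_sub_comm]
    refine div_le_div₀ (mul_nonneg ((abs_nonneg _).trans ha') ((abs_nonneg _).trans hk))
      (mul_le_mul ha' hk (abs_nonneg _) ((abs_nonneg _).trans ha')) (by positivity) ?_
    rw [sq]; exact mul_le_mul hP hP' hL.le p.le

theorem IsMetric.inner1_mul_dvol {G : E2 → Mat} (hG : IsMetric G) {x : E2} (hx : x ∈ refTri)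
    (a : Fin 2 → ℝ) : inner1 (G x) a a * dvol G x = G x 1 1 / dvol G x * a 0 ^ 2 -
      2 * (G x 0 1 / dvol G x) * a 0 * a 1 + G x 0 0 / dvol G x * a 1 ^ 2 := by
  obtain ⟨i0, i1, i2, i3⟩ := inv_entries (hG.symm hx)
  have hP := (hG.dvol_pos hx).ne'
  simp only [inner1, Fin.sum_univ_two, i0, i1, i2, i3]
  rw [← hG.dvol_sq hx]
  field_simp
  ring

theorem IsMetric.star1_eq {G : E2 → Mat} (hG : IsMetric G) {x : E2} (hx : x ∈ refTri)
    (a : Fin 2 → ℝ) : star1 (G x) a 0 = G x 0 1 / dvol G x * a 0 - G x 0 0 / dvol G x * a 1 ∧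
      star1 (G x) a 1 = G x 1 1 / dvol G x * a 0 - G x 0 1 / dvol G x * a 1 := by
  obtain ⟨i0, i1, i2, i3⟩ := inv_entries (hG.symm hx)
  have hP := (hG.dvol_pos hx).ne'
  have e : √(G x).det = dvol G x := rfl
  simp only [star1, Fin.sum_univ_two, i0, i1, i2, i3, e, Matrix.cons_val_zero, Matrix.cons_val_one]
  rw [← hG.dvol_sq hx]
  constructor <;> field_simp <;> ring

theorem abs_quad_le {p q r m : ℝ} (hp : |p| ≤ m) (hq : |q| ≤ m) (hr : |r| ≤ m) (s t : ℝ) :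
    |p * s ^ 2 - 2 * q * s * t + r * t ^ 2| ≤ 2 * m * (s ^ 2 + t ^ 2) := by
  rw [abs_le] at *
  constructor <;>
    nlinarith [sq_nonneg (s + t), sq_nonneg (s - t), sq_nonneg s, sq_nonneg t]

theorem sq_sub_le {p q m : ℝ} (hp : |p| ≤ m) (hq : |q| ≤ m) (s t : ℝ) :
    (p * s - q * t) ^ 2 ≤ 2 * m ^ 2 * (s ^ 2 + t ^ 2) := by
  have h1 : p ^ 2 ≤ m ^ 2 := sq_le_sq' (abs_le.1 hp).1 (abs_le.1 hp).2
  have h2 : q ^ 2 ≤ m ^ 2 := sq_le_sq' (abs_le.1 hq).1 (abs_le.1 hq).2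
  nlinarith [sq_nonneg (p * s + q * t), mul_le_mul_of_nonneg_right h1 (sq_nonneg s),
    mul_le_mul_of_nonneg_right h2 (sq_nonneg t)]

theorem Pinch.abs_div_dvol_le {L κ : ℝ} {G : E2 → Mat} {x : E2} (h : Pinch L κ (G x)) (hL : 0 < L)
    (i j : Fin 2) : |G x i j / dvol G x| ≤ κ := by
  have hP := (h.dvol_bounds hL).1
  rw [abs_div, abs_of_pos (hL.trans_le hP), div_le_iff₀ (hL.trans_le hP)]
  refine (h.entry hL i j).trans ?_
  exact mul_le_mul_of_nonneg_left hP (zero_le_one.trans (h.one_le hL))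

namespace MetricPair

variable {L κ : ℝ} {g γ : E2 → Mat} (h : MetricPair L κ g γ) {ε : ℝ}
  (hd : linf2 g (g - γ) ≤ ENNReal.ofReal ε) {x : E2}
include h hd

theorem abs_entry_sub_le (hε : 0 ≤ ε) (hx : x ∈ refTri) (i j : Fin 2) :
    |g x i j - γ x i j| ≤ ε * (κ * L) := by
  have n : ∀ k : Fin 2, EuclideanSpace.single k (1:ℝ) ≠ 0 := fun k => by simp
  have hp : ∀ (A : Mat) (i j : Fin 2), pair A (EuclideanSpace.single i 1) (EuclideanSpace.single j 1) =
      A i j := fun A i j => by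
    fin_cases i <;> fin_cases j <;> simp [pair]
  have h1 := abs_pair_le_of_linf2 h.metric₁ hε hd hx (n i) (n j)
  rw [hp, Pi.sub_apply, Matrix.sub_apply] at h1
  refine h1.trans (mul_le_mul_of_nonneg_left ?_ hε)
  have hl : ∀ k, len (g x) (EuclideanSpace.single k 1) ≤ √(κ * L) := fun k => by
    rw [len, hp]; exact Real.sqrt_le_sqrt ((le_abs_self _).trans ((h.pinch₁ x hx).entry h.pos k k))
  refine (mul_le_mul (hl i) (hl j) (Real.sqrt_nonneg _) (Real.sqrt_nonneg _)).trans_eq ?_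
  exact Real.mul_self_sqrt ((abs_nonneg _).trans ((h.pinch₁ x hx).entry h.pos 0 0))

theorem sqrt_diffSq_le (hε : 0 ≤ ε) (hx : x ∈ refTri) :
    √(diffSq g γ x) ≤ 2 * (ε * (κ * L)) := by
  have e := h.abs_entry_sub_le hd hε hx
  have e0 := (abs_nonneg _).trans (e 0 0)
  rw [Real.sqrt_le_left (by positivity)]
  have k : ∀ i j, (γ x i j - g x i j) ^ 2 ≤ (ε * (κ * L)) ^ 2 := fun i j => by
    have := abs_le.1 (e i j)
    exact sq_le_sq' (by linarith) (by linarith)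
  simp only [diffSq, Fin.sum_univ_two]
  linarith [k 0 0, k 0 1, k 1 0, k 1 1]

theorem abs_div_dvol_sub_le (hε : 0 ≤ ε) (hx : x ∈ refTri) (i j : Fin 2) :
    |g x i j / dvol g x - γ x i j / dvol γ x| ≤ ε * (κ + 4 * κ ^ 3) := by
  have hL := h.pos
  refine (abs_div_sub_div_le hL ((h.pinch₁ x hx).dvol_bounds hL).1 ((h.pinch₂ x hx).dvol_bounds hL).1
    (h.abs_entry_sub_le hd hε hx i j) ((h.pinch₂ x hx).entry hL i j)
    (k := 2 * κ * (2 * (ε * (κ * L)))) ?_).trans_eq ?_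
  · rw [abs_sub_comm]
    exact (h.abs_dvol_sub_le hx).trans (mul_le_mul_of_nonneg_left (h.sqrt_diffSq_le hd hε hx)
      (mul_nonneg zero_le_two (zero_le_one.trans h.one_le_kappa)))
  field_simp
  ring

end MetricPair

end

section

variable {M : Type*} [TopologicalSpace M] [ChartedSpace (EuclideanQuadrant 2) M]
  [IsManifold IQ ∞ M]

/-! ### Convergence of the discrete solution -/

theorem sq_star_row_le {p q r s m n : ℝ} (hp : |p| ≤ m) (hq : |q| ≤ m) (hr : |r - p| ≤ n)
    (hs : |s - q| ≤ n) (t u v w : ℝ) : (p * (t + v) - q * (u + w) - (r * t - s * u)) ^ 2 ≤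
      4 * m ^ 2 * (v ^ 2 + w ^ 2) + 4 * n ^ 2 * (t ^ 2 + u ^ 2) := by
  have h1 := sq_sub_le hp hq v w
  have h2 := sq_sub_le hr hs t u
  rw [show p * (t + v) - q * (u + w) - (r * t - s * u) =
    (p * v - q * w) - ((r - p) * t - (s - q) * u) by ring]
  nlinarith [sq_nonneg ((p * v - q * w) + ((r - p) * t - (s - q) * u))]

/-- The Euclidean norm of a form, triangle by triangle. -/
def flatNorm (𝒯 : Mesh M) (a : Fin 𝒯.n → E2 → Fin 2 → ℝ) : ℝ := normL2Form 𝒯 (fun _ => flat) a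

section Compare

variable {𝒯 : Mesh M} {κ : ℝ} {L : Fin 𝒯.n → ℝ} {G : Fin 𝒯.n → E2 → Mat}
  {a : Fin 𝒯.n → E2 → Fin 2 → ℝ}

theorem normL2Form_le_flatNorm (hL : ∀ T, 0 < L T) (hG : ∀ T, IsMetric (G T))
    (hp : ∀ T, ∀ x ∈ refTri, Pinch (L T) κ (G T x)) (ha : ContForm 𝒯 a) :
    normL2Form 𝒯 G a ≤ √(2 * κ) * flatNorm 𝒯 a := by
  by_cases hκ : 0 ≤ κ
  · rw [normL2Form, flatNorm, normL2Form, ← Real.sqrt_mul (by positivity)]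
    refine Real.sqrt_le_sqrt ?_
    have := innerL2Form_self_le hG ha ha (c := a) (p := 2 * κ) (q := 0) fun T x hx => by
      rw [(hG T).inner1_mul_dvol hx, zero_mul, add_zero]
      have k := (hp T x hx).abs_div_dvol_le (hL T)
      exact (le_abs_self _).trans (abs_quad_le (k 1 1) (k 0 1) (k 0 0) _ _)
    linarith
  · have : IsEmpty (Fin 𝒯.n) := ⟨fun T => hκ
      (zero_le_one.trans ((hp T _ (vtx_mem 0)).one_le (hL T)))⟩
    simp [normL2Form, innerL2Form, flatNorm]

theorem flatNorm_le_normL2Form (hL : ∀ T, 0 < L T) (hG : ∀ T, IsMetric (G T))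
    (hp : ∀ T, ∀ x ∈ refTri, Pinch (L T) κ (G T x)) (ha : ContForm 𝒯 a) :
    flatNorm 𝒯 a ≤ √(2 * κ) * normL2Form 𝒯 G a := by
  by_cases hκ : 0 ≤ κ
  · rw [flatNorm, normL2Form, normL2Form, ← Real.sqrt_mul (by positivity), innerL2Form, innerL2Form,
      Finset.mul_sum]
    refine Real.sqrt_le_sqrt (Finset.sum_le_sum fun T _ => ?_)
    have c1 := continuousOn_inner1_mul_dvol (fun _ => isMetric_flat) ha ha T
    have c2 := continuousOn_inner1_mul_dvol hG ha ha T
    rw [triInt, triInt, ← integral_const_mul]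
    refine setIntegral_mono_on (integrableOn_refTri c1) ((integrableOn_refTri c2).const_mul _)
      isClosed_refTri.measurableSet fun x hx => ?_
    have l := (hp T x hx).inner1_lower (hL T) (a T x)
    have d := ((hp T x hx).dvol_bounds (hL T)).1
    have k := (hp T x hx).one_le (hL T)
    have hl := hL T
    rw [inner1_flat]
    have m : (κ * L T)⁻¹ * (a T x 0 ^ 2 + a T x 1 ^ 2) * L T ≤
        inner1 (G T x) (a T x) (a T x) * dvol (G T) x :=
      mul_le_mul l d (hL T).le ((hp T x hx).inner1_nonneg (hL T) _)
    have e : (κ * L T)⁻¹ * (a T x 0 ^ 2 + a T x 1 ^ 2) * L T = (a T x 0 ^ 2 + a T x 1 ^ 2) / κ := by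
      field_simp
    rw [e, div_le_iff₀ (by linarith)] at m
    have m0 : 0 ≤ inner1 (G T x) (a T x) (a T x) * dvol (G T) x :=
      mul_nonneg ((hp T x hx).inner1_nonneg (hL T) _) (Real.sqrt_nonneg _)
    nlinarith
  · have : IsEmpty (Fin 𝒯.n) := ⟨fun T => hκ
      (zero_le_one.trans ((hp T _ (vtx_mem 0)).one_le (hL T)))⟩
    simp [normL2Form, innerL2Form, flatNorm]

variable {g γ : Fin 𝒯.n → E2 → Mat} (h : ∀ T, MetricPair (L T) κ (g T) (γ T)) (hκ : 0 ≤ κ) {ε : ℝ}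
  (hd : ∀ T, linf2 (g T) (g T - γ T) ≤ ENNReal.ofReal ε) (hε : 0 ≤ ε)
  {b : Fin 𝒯.n → E2 → Fin 2 → ℝ}
include h hκ hd hε

theorem abs_innerL2Form_sub_le_flatNorm (ha : ContForm 𝒯 a) (hb : ContForm 𝒯 b) :
    |innerL2Form 𝒯 g a b - innerL2Form 𝒯 γ a b| ≤
      2 * (ε * (κ + 4 * κ ^ 3)) * (flatNorm 𝒯 a * flatNorm 𝒯 b) := by
  have m1 := fun T => (h T).metric₁
  have m2 := fun T => (h T).metric₂
  refine abs_innerL2Form_sub_le (fun _ => isMetric_flat) m1 m2 (by positivity) (fun c hc => ?_) ha hb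
  simp only [innerL2Form, Finset.mul_sum, ← Finset.sum_sub_distrib]
  refine (Finset.abs_sum_le_sum_abs _ _).trans (Finset.sum_le_sum fun T _ => ?_)
  have c1 := continuousOn_inner1_mul_dvol m1 hc hc T
  have c2 := continuousOn_inner1_mul_dvol m2 hc hc T
  have c3 := continuousOn_inner1_mul_dvol (fun _ => isMetric_flat) hc hc T
  rw [triInt, triInt, triInt, ← integral_sub (integrableOn_refTri c1) (integrableOn_refTri c2),
    ← integral_const_mul]
  refine abs_integral_le_integral_abs.trans (setIntegral_mono_on
    ((integrableOn_refTri c1).sub (integrableOn_refTri c2)).abs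
    ((integrableOn_refTri c3).const_mul _) isClosed_refTri.measurableSet fun x hx => ?_)
  have k := (h T).abs_div_dvol_sub_le (hd T) hε hx
  rw [inner1_flat]
  rw [(m1 T).inner1_mul_dvol hx, (m2 T).inner1_mul_dvol hx]
  refine le_of_eq_of_le (congrArg abs ?_) (abs_quad_le (k 1 1) (k 0 1) (k 0 0) _ _)
  ring

theorem normL2Form_star1_sub_le (hb : ContForm 𝒯 b)
    {c : Fin 𝒯.n → E2 → Fin 2 → ℝ} (hc : ∀ T, ∀ x ∈ refTri, c T x = a T x - b T x)
    (hcc : ContForm 𝒯 c) :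
    normL2Form 𝒯 g (fun T x => star1 (γ T x) (a T x) - star1 (g T x) (b T x)) ≤
      4 * √κ * (κ * flatNorm 𝒯 c + ε * (κ + 4 * κ ^ 3) * flatNorm 𝒯 b) := by
  have m1 := fun T => (h T).metric₁
  have m2 := fun T => (h T).metric₂
  have fl : ∀ T : Fin 𝒯.n, IsMetric ((fun _ => flat) T) := fun _ => isMetric_flat
  set η := ε * (κ + 4 * κ ^ 3) with hη
  have hη0 : 0 ≤ η := by positivity
  have key := innerL2Form_self_le m1 hcc hb (p := 16 * κ ^ 3) (q := 16 * κ * η ^ 2)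
    (c := fun T x => star1 (γ T x) (a T x) - star1 (g T x) (b T x)) fun T x hx => by
      have k := ((h T).pinch₁ x hx).abs_div_dvol_le (h T).pos
      have k' := ((h T).pinch₂ x hx).abs_div_dvol_le (h T).pos
      have d := (h T).abs_div_dvol_sub_le (hd T) hε hx
      rw [(m1 T).inner1_mul_dvol hx]
      refine (le_abs_self _).trans ((abs_quad_le (k 1 1) (k 0 1) (k 0 0) _ _).trans ?_)
      obtain ⟨s0, s1⟩ := (m2 T).star1_eq hx (a T x)
      obtain ⟨t0, t1⟩ := (m1 T).star1_eq hx (b T x)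
      have e : ∀ i, a T x i = b T x i + c T x i := fun i => by rw [hc T x hx]; simp
      have w0 := sq_star_row_le (k' 0 1) (k' 0 0) (d 0 1) (d 0 0) (b T x 0) (b T x 1) (c T x 0)
        (c T x 1)
      have w1 := sq_star_row_le (k' 1 1) (k' 0 1) (d 1 1) (d 0 1) (b T x 0) (b T x 1) (c T x 0)
        (c T x 1)
      simp only [Pi.sub_apply, s0, s1, t0, t1, e]
      refine (mul_le_mul_of_nonneg_left (add_le_add w0 w1) (mul_nonneg zero_le_two hκ)).trans_eq ?_
      rw [hη]; ring
  have f1 := sq_normL2Form fl c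
  have f2 := sq_normL2Form fl b
  have n1 : 0 ≤ flatNorm 𝒯 c := normL2Form_nonneg _
  have n2 : 0 ≤ flatNorm 𝒯 b := normL2Form_nonneg _
  rw [← f1, ← f2] at key
  rw [normL2Form, Real.sqrt_le_left (by positivity), mul_pow, mul_pow, Real.sq_sqrt hκ]
  refine key.trans ?_
  change 16 * κ ^ 3 * flatNorm 𝒯 c ^ 2 + 16 * κ * η ^ 2 * flatNorm 𝒯 b ^ 2 ≤ _
  have : 0 ≤ 32 * κ * (κ * flatNorm 𝒯 c * (η * flatNorm 𝒯 b)) := by positivity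
  linarith

end Compare

end

section

variable {M : Type*} [TopologicalSpace M] [ChartedSpace (EuclideanQuadrant 2) M]
  [IsManifold IQ ∞ M]

theorem contDiffOn_res_of_contMDiff {u : M → ℝ} (hu : ContMDiff IQ 𝓘(ℝ, ℝ) ∞ u) (𝒯 : Mesh M)
    (T : Fin 𝒯.n) : ContDiffOn ℝ 1 (res 𝒯 T u) refTri :=
  (contMDiffOn_iff_contDiffOn.1 (hu.comp_contMDiffOn (𝒯.smooth T).smooth)).of_le (by norm_cast)

/-- The constant in the estimate of the discrete error. -/
def errorConst (κ CF B A₅ A₆ : ℝ) : ℝ :=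
  CF + 2 * (A₆ * (κ + 4 * κ ^ 3)) * (√(2 * κ) ^ 2 * B) + √(2 * κ) ^ 2 * A₅

section Strang

variable {g : Metric2 M} {e₁ e₂ : ∀ x : M, TangentSpace IQ x} {𝒯 : Mesh M} {γ : ReggeMetric 𝒯}
  {V : Submodule ℝ (M → ℝ)} {κ CF B A₅ A₆ δ : ℝ} {L : Fin 𝒯.n → ℝ}
  (h : ∀ T, MetricPair (L T) κ (onMesh g 𝒯 T) (γ.G T)) (hκ : 0 ≤ κ)
  (hd : ∀ T, linf2 (onMesh g 𝒯 T) (onMesh g 𝒯 T - γ.G T) ≤ ENNReal.ofReal (A₆ * δ))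
  (hδ : 0 ≤ δ) (hCF : 0 ≤ CF) (hA₅ : 0 ≤ A₅) (hA₆ : 0 ≤ A₆)
  (hF : ∀ v ∈ V, |Fh g e₁ e₂ 𝒯 (onMesh g 𝒯) v - Fh g e₁ e₂ 𝒯 γ.G v| ≤
    CF * δ * normL2Form 𝒯 γ.G (dM 𝒯 v))
  (hV : ∀ v ∈ V, ∀ T, ContDiffOn ℝ 1 (res 𝒯 T v) refTri)
  {u w uh : M → ℝ} (hu : ∀ T, ContDiffOn ℝ 1 (res 𝒯 T u) refTri)
  (hFu : ∀ v ∈ V, Fh g e₁ e₂ 𝒯 (onMesh g 𝒯) v =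
    innerL2Form 𝒯 (onMesh g 𝒯) (dM 𝒯 v) (dM 𝒯 u))
  (hB : normL2Form 𝒯 (onMesh g 𝒯) (dM 𝒯 u) ≤ B)
  (hw : w ∈ V) (hwu : normL2Form 𝒯 (onMesh g 𝒯) (dM 𝒯 u - dM 𝒯 w) ≤ A₅ * δ)
  (huh : uh ∈ V) (heq : ∀ v ∈ V, innerL2Form 𝒯 γ.G (dM 𝒯 uh) (dM 𝒯 v) = Fh g e₁ e₂ 𝒯 γ.G v)
include h hκ hd hδ hCF hA₅ hA₆ hF hV hu hFu hB hw hwu huh heq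

/-- The distance of the discrete solution to any element of the discrete space is bounded by the
consistency errors and the approximation error. -/
theorem normL2Form_dM_sub_le :
    normL2Form 𝒯 γ.G (dM 𝒯 (uh - w)) ≤ errorConst κ CF B A₅ A₆ * δ := by
  have m1 := fun T => (h T).metric₁
  have m2 := fun T => (h T).metric₂
  have hv := V.sub_mem huh hw
  have cu := contForm_dM hu
  have ch := contForm_dM (hV _ huh)
  have cw := contForm_dM (hV _ hw)
  have cv := contForm_dM (hV _ hv)
  have cd : ContForm 𝒯 (dM 𝒯 u - dM 𝒯 w) := fun T k => (cu T k).sub (cw T k)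
  have B0 := (normL2Form_nonneg _).trans hB
  set n := normL2Form 𝒯 γ.G (dM 𝒯 (uh - w)) with hn
  have n0 : 0 ≤ n := normL2Form_nonneg _
  have sub : ∀ {G : Fin 𝒯.n → E2 → Mat} (_ : ∀ T, IsMetric (G T))
      {a b c : Fin 𝒯.n → E2 → Fin 2 → ℝ}, ContForm 𝒯 a → ContForm 𝒯 b → ContForm 𝒯 c →
      innerL2Form 𝒯 G (a - b) c = innerL2Form 𝒯 G a c - innerL2Form 𝒯 G b c := by
    intro G hG a b c ha hb hc
    have := innerL2Form_smul_add_smul hG ha hb 1 (-1) hc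
    rw [one_smul, neg_smul, one_smul, ← sub_eq_add_neg] at this
    linarith
  have e0 : n ^ 2 = innerL2Form 𝒯 γ.G (dM 𝒯 uh - dM 𝒯 w) (dM 𝒯 (uh - w)) := by
    rw [hn, sq_normL2Form m2]
    exact innerL2Form_congr _ (fun T x hx => dM_sub (hV _ huh) (hV _ hw) T hx) fun _ _ _ => rfl
  have e1 : n ^ 2 = (Fh g e₁ e₂ 𝒯 γ.G (uh - w) - Fh g e₁ e₂ 𝒯 (onMesh g 𝒯) (uh - w)) +
      (innerL2Form 𝒯 (onMesh g 𝒯) (dM 𝒯 u) (dM 𝒯 (uh - w)) -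
        innerL2Form 𝒯 γ.G (dM 𝒯 u) (dM 𝒯 (uh - w))) +
      innerL2Form 𝒯 γ.G (dM 𝒯 u - dM 𝒯 w) (dM 𝒯 (uh - w)) := by
    rw [e0, sub m2 ch cw cv, sub m2 cu cw cv, heq _ hv, hFu _ hv, innerL2Form_comm m1 (dM 𝒯 (uh - w))]
    ring
  have σ0 : 0 ≤ √(2 * κ) := Real.sqrt_nonneg _
  have hL := fun T => (h T).pos
  have b1 := (abs_le.1 (hF _ hv)).1
  have b2 := (abs_le.1 (abs_innerL2Form_sub_le_flatNorm h hκ hd (mul_nonneg hA₆ hδ) cu cv)).2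
  have b3 := (abs_le.1 (abs_innerL2Form_le m2 cd cv)).2
  have f1 := flatNorm_le_normL2Form hL m1 (fun T => (h T).pinch₁) cu
  have f2 := flatNorm_le_normL2Form hL m2 (fun T => (h T).pinch₂) cv
  have f3 := flatNorm_le_normL2Form hL m1 (fun T => (h T).pinch₁) cd
  have f4 := normL2Form_le_flatNorm hL m2 (fun T => (h T).pinch₂) cd
  have d1 : flatNorm 𝒯 (dM 𝒯 u) * flatNorm 𝒯 (dM 𝒯 (uh - w)) ≤ √(2 * κ) * B * (√(2 * κ) * n) :=
    mul_le_mul (f1.trans (mul_le_mul_of_nonneg_left hB σ0)) f2 (normL2Form_nonneg _) (by positivity)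
  have d2 : normL2Form 𝒯 γ.G (dM 𝒯 u - dM 𝒯 w) ≤ √(2 * κ) * (√(2 * κ) * (A₅ * δ)) :=
    f4.trans (mul_le_mul_of_nonneg_left (f3.trans (mul_le_mul_of_nonneg_left hwu σ0)) σ0)
  have d3 := mul_le_mul_of_nonneg_left d1 (show 0 ≤ 2 * (A₆ * δ * (κ + 4 * κ ^ 3)) by positivity)
  have d4 := mul_le_mul_of_nonneg_right d2 n0
  have tot : n * n ≤ errorConst κ CF B A₅ A₆ * δ * n := by
    rw [← sq, e1, errorConst]
    rw [← hn] at b1 b3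
    linarith
  rcases n0.eq_or_lt with h0 | hpos
  · rw [← h0, errorConst]; positivity
  · exact le_of_mul_le_mul_right tot hpos

theorem flatNorm_dM_sub_le : flatNorm 𝒯 (dM 𝒯 uh - dM 𝒯 u) ≤
    √(2 * κ) * (errorConst κ CF B A₅ A₆ + A₅) * δ := by
  have m1 := fun T => (h T).metric₁
  have m2 := fun T => (h T).metric₂
  have fl : ∀ T : Fin 𝒯.n, IsMetric ((fun _ => flat) T) := fun _ => isMetric_flat
  have cu := contForm_dM hu
  have cw := contForm_dM (hV _ hw)
  have cv := contForm_dM (hV _ (V.sub_mem huh hw))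
  have cd : ContForm 𝒯 (dM 𝒯 u - dM 𝒯 w) := fun T k => (cu T k).sub (cw T k)
  have cn : ContForm 𝒯 (- (dM 𝒯 u - dM 𝒯 w)) := fun T k => (cd T k).neg
  have hL := fun T => (h T).pos
  have n1 := normL2Form_dM_sub_le h hκ hd hδ hCF hA₅ hA₆ hF hV hu hFu hB hw hwu huh heq
  have f1 := flatNorm_le_normL2Form hL m2 (fun T => (h T).pinch₂) cv
  have f2 := flatNorm_le_normL2Form hL m1 (fun T => (h T).pinch₁) cd
  have e1 : flatNorm 𝒯 (dM 𝒯 uh - dM 𝒯 u) = flatNorm 𝒯 (dM 𝒯 (uh - w) + - (dM 𝒯 u - dM 𝒯 w)) := by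
    have k : ∀ T, ∀ x ∈ refTri, (dM 𝒯 uh - dM 𝒯 u) T x =
        (dM 𝒯 (uh - w) + - (dM 𝒯 u - dM 𝒯 w)) T x := fun T x hx => by
      simp only [Pi.sub_apply, Pi.add_apply, Pi.neg_apply, dM_sub (hV _ huh) (hV _ hw) T hx]
      abel
    rw [flatNorm, flatNorm, normL2Form, normL2Form, innerL2Form_congr _ k k]
  have e2 : flatNorm 𝒯 (- (dM 𝒯 u - dM 𝒯 w)) = flatNorm 𝒯 (dM 𝒯 u - dM 𝒯 w) := by
    simp only [flatNorm, normL2Form, innerL2Form, inner1, Pi.neg_apply, mul_neg, neg_mul, neg_neg]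
  have t : flatNorm 𝒯 _ ≤ flatNorm 𝒯 _ + flatNorm 𝒯 _ := normL2Form_add_le fl cv cn
  rw [e1]
  rw [e2] at t
  have σ0 : 0 ≤ √(2 * κ) := Real.sqrt_nonneg _
  have g1 := f1.trans (mul_le_mul_of_nonneg_left n1 σ0)
  have g2 := f2.trans (mul_le_mul_of_nonneg_left hwu σ0)
  linarith

end Strang

/-- Convergence of the discrete potential and of the discrete connection form. -/
theorem exists_normL2Form_le [T2Space M] [CompactSpace M] (g : Metric2 M)
    {Vhat : Submodule ℝ (E2 → ℝ)} (hVhat : IsRefSpace Vhat) (r : ℕ) (K K' : ℝ) {C' : ℝ}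
    (A₁ A₂ A₄ : ℝ) (hC' : C' < 1) {e₁ e₂ : ∀ x : M, TangentSpace IQ x} {u : M → ℝ} (A₅ A₆ : ℝ)
    (he : IsFrame g e₁ e₂) (hu : IsPotential g e₁ e₂ u) :
    ∃ C : ℝ, ∀ (h : ℝ) (_ : 0 < h) (𝒯 : Mesh M) (γ : ReggeMetric 𝒯) (V : Submodule ℝ (M → ℝ)),
      IsAdmissible g Vhat r K K' C' A₁ A₂ A₄ h 𝒯 γ V →
      (∀ T, PreservesOrientation e₁ e₂ (𝒯.par T)) →
      ⨅ v ∈ V, ENNReal.ofReal (normHd 𝒯 (onMesh g 𝒯) (u - v)) ≤ ENNReal.ofReal (A₅ * h ^ r) →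
      normLinf 𝒯 (onMesh g 𝒯) (onMesh g 𝒯 - γ.G) ≤ ENNReal.ofReal (A₆ * h ^ r) →
      ∀ uh : M → ℝ, IsDiscreteSolution g e₁ e₂ 𝒯 γ.G V uh →
        normL2Form 𝒯 (onMesh g 𝒯) (dM 𝒯 uh - dM 𝒯 u) ≤ C * h ^ r ∧
        normL2Form 𝒯 (onMesh g 𝒯) (fun T x => star1 (γ.G T x) (dM 𝒯 uh T x) -
          star1 (onMesh g 𝒯 T x) (dM 𝒯 u T x)) ≤ C * h ^ r := by
  obtain ⟨CV, hCV, hinv⟩ := exists_gradSq_le hVhat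
  obtain ⟨B, hB0, hB⟩ := he.exists_normL2Form_dM_le hu.1
  set κ := pinchConst K C'
  have hκ : 0 ≤ κ := pinchConst_nonneg hC'
  set CF := FhConst K K' C' A₁ A₂ CV
  have hCF : 0 ≤ CF := FhConst_nonneg hC'
  set D₅ := max A₅ 0 + 1
  have hD₅ : 0 ≤ D₅ := by positivity
  set D₆ := max A₆ 0
  have hD₆ : 0 ≤ D₆ := le_max_right _ _
  set X := √(2 * κ) * (errorConst κ CF B D₅ D₆ + D₅)
  have hX : 0 ≤ X := by simp only [X, errorConst]; positivity
  set Y := 4 * √κ * (κ * X + D₆ * (κ + 4 * κ ^ 3) * (√(2 * κ) * B))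
  have hY : 0 ≤ Y := by positivity
  refine ⟨√(2 * κ) * X + Y, fun h hh 𝒯 γ V ad ho hinf hlinf uh sol => ?_⟩
  set δ := h ^ r
  have hδ : 0 < δ := by positivity
  choose L hL using fun T => ad.exists_metricPair hC' hh T
  have mp := fun T => (hL T).1
  have m1 := fun T => (mp T).metric₁
  have hV : ∀ v ∈ V, ∀ T, ContDiffOn ℝ 1 (res 𝒯 T v) refTri := fun v hv T =>
    (ad.space.contDiffOn_res hVhat hv T).of_le (by norm_num)
  have hur := contDiffOn_res_of_contMDiff hu.1 𝒯
  have hd : ∀ T, linf2 (onMesh g 𝒯 T) (onMesh g 𝒯 T - γ.G T) ≤ ENNReal.ofReal (D₆ * δ) := fun T =>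
    (le_iSup (fun T => linf2 (onMesh g 𝒯 T) ((onMesh g 𝒯 - γ.G) T)) T).trans (hlinf.trans
      (ENNReal.ofReal_le_ofReal (mul_le_mul_of_nonneg_right (le_max_left _ _) hδ.le)))
  have hFu : ∀ v ∈ V, Fh g e₁ e₂ 𝒯 (onMesh g 𝒯) v =
      innerL2Form 𝒯 (onMesh g 𝒯) (dM 𝒯 v) (dM 𝒯 u) := fun v hv => by
    rw [Fh_onMesh_eq he hu 𝒯 ho (hV v hv), meshDefect_eq_zero he ho (ad.space.cont v hv), sub_zero]
  obtain ⟨w, hw, hwu⟩ : ∃ w ∈ V, normHd 𝒯 (onMesh g 𝒯) (u - w) ≤ D₅ * δ := by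
    have hlt : ENNReal.ofReal (A₅ * δ) < ENNReal.ofReal (D₅ * δ) := by
      refine (ENNReal.ofReal_lt_ofReal_iff (by positivity)).2 (mul_lt_mul_of_pos_right ?_ hδ)
      exact (le_max_left A₅ 0).trans_lt (lt_add_one _)
    obtain ⟨w, hw⟩ := iInf_lt_iff.1 (hinf.trans_lt hlt)
    obtain ⟨hwV, hw⟩ := iInf_lt_iff.1 hw
    exact ⟨w, hwV, ((ENNReal.ofReal_lt_ofReal_iff (by positivity)).1 hw).le⟩
  have hwu : normL2Form 𝒯 (onMesh g 𝒯) (dM 𝒯 u - dM 𝒯 w) ≤ D₅ * δ := by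
    have k : ∀ T, ∀ x ∈ refTri, (dM 𝒯 u - dM 𝒯 w) T x = dM 𝒯 (u - w) T x := fun T x hx =>
      (dM_sub hur (hV w hw) T hx).symm
    rw [normL2Form, innerL2Form_congr _ k k]
    exact (le_add_of_nonneg_left (Real.sqrt_nonneg _)).trans hwu
  have hBu := hB 𝒯 ho
  have main := flatNorm_dM_sub_le mp hκ hd hδ.le hCF hD₅ hD₆
    (fun v hv => abs_Fh_sub_le ad hVhat hC' hh hCV hinv e₁ e₂ hv) hV hur hFu hBu hw hwu sol.mem sol.eqn
  have cu := contForm_dM hur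
  have ch := contForm_dM (hV _ sol.mem)
  have cc : ContForm 𝒯 (dM 𝒯 uh - dM 𝒯 u) := fun T k => (ch T k).sub (cu T k)
  have fu := flatNorm_le_normL2Form (fun T => (mp T).pos) m1 (fun T => (mp T).pinch₁) cu
  have σ0 : 0 ≤ √(2 * κ) := Real.sqrt_nonneg _
  constructor
  · refine (normL2Form_le_flatNorm (fun T => (mp T).pos) m1 (fun T => (mp T).pinch₁) cc).trans
      ((mul_le_mul_of_nonneg_left main σ0).trans ?_)
    have := mul_nonneg hY hδ.le
    linarith
  · refine (normL2Form_star1_sub_le mp hκ hd (mul_nonneg hD₆ hδ.le) cu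
      (c := dM 𝒯 uh - dM 𝒯 u) (fun _ _ _ => rfl) cc).trans ?_
    have f1 := fu.trans (mul_le_mul_of_nonneg_left hBu σ0)
    have s1 : κ * flatNorm 𝒯 (dM 𝒯 uh - dM 𝒯 u) + D₆ * δ * (κ + 4 * κ ^ 3) * flatNorm 𝒯 (dM 𝒯 u) ≤
        κ * (X * δ) + D₆ * δ * (κ + 4 * κ ^ 3) * (√(2 * κ) * B) :=
      add_le_add (mul_le_mul_of_nonneg_left main hκ) (mul_le_mul_of_nonneg_left f1 (by positivity))
    refine (mul_le_mul_of_nonneg_left s1 (by positivity)).trans ?_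
    have : 0 ≤ √(2 * κ) * X * δ := by positivity
    have e : 4 * √κ * (κ * (X * δ) + D₆ * δ * (κ + 4 * κ ^ 3) * (√(2 * κ) * B)) = Y * δ := by
      simp only [Y]; ring
    linarith

end

end Regge

end

open Regge in
theorem mainTheorem1 {M : Type*} [TopologicalSpace M] [ChartedSpace (EuclideanQuadrant 2) M]
    [IsManifold IQ ∞ M] (hM : IsDisc M) (g : Metric2 M)
    (Vhat : Submodule ℝ (E2 → ℝ)) (hVhat : IsRefSpace Vhat)
    (r : ℕ) (K K' C' A₁ A₂ A₄ : ℝ) (hC' : C' < 1) :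
    -- the bound for `b_h` and for `F_h(g) - F_h(g_h)`
    (∃ C : ℝ, ∀ (S : Set ℝ) (_ : ∀ h ∈ S, 0 < h) (𝒯 : S → Mesh M)
      (γ : ∀ h : S, ReggeMetric (𝒯 h)) (V : S → Submodule ℝ (M → ℝ)),
      (∀ h : S, IsAdmissible g Vhat r K K' C' A₁ A₂ A₄ h (𝒯 h) (γ h) (V h)) →
      ∀ h : S,
        (∀ t ∈ Set.Icc (0 : ℝ) 1,
          dualNorm (normHd (𝒯 h) (γ h).G) (V h)
            (bh (𝒯 h) (t • (γ h).G + (1 - t) • onMesh g (𝒯 h)) (onMesh g (𝒯 h) - (γ h).G))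
            ≤ ENNReal.ofReal (C * (h : ℝ) ^ r)) ∧
        (∀ e₁ e₂ : ∀ x : M, TangentSpace IQ x, IsFrame g e₁ e₂ →
          (∀ T, PreservesOrientation e₁ e₂ ((𝒯 h).par T)) →
          dualNorm (normHd (𝒯 h) (γ h).G) (V h)
            (Fh g e₁ e₂ (𝒯 h) (onMesh g (𝒯 h)) - Fh g e₁ e₂ (𝒯 h) (γ h).G)
            ≤ ENNReal.ofReal (C * (h : ℝ) ^ r))) ∧
    -- convergence of the computed connection form
    (∀ (e₁ e₂ : ∀ x : M, TangentSpace IQ x) (u : M → ℝ) (A₅ A₆ : ℝ),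
      IsFrame g e₁ e₂ → IsPotential g e₁ e₂ u →
      ∃ C : ℝ, ∀ (S : Set ℝ) (_ : ∀ h ∈ S, 0 < h) (𝒯 : S → Mesh M)
        (γ : ∀ h : S, ReggeMetric (𝒯 h)) (V : S → Submodule ℝ (M → ℝ)),
        (∀ h : S, IsAdmissible g Vhat r K K' C' A₁ A₂ A₄ h (𝒯 h) (γ h) (V h)) →
        (∀ (h : S) (T), PreservesOrientation e₁ e₂ ((𝒯 h).par T)) →
        (∀ h : S, (fun _ => 1) ∈ V h) →
        (∀ h : S, ⨅ v ∈ V h, ENNReal.ofReal (normHd (𝒯 h) (onMesh g (𝒯 h)) (u - v))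
          ≤ ENNReal.ofReal (A₅ * (h : ℝ) ^ r)) →
        (∀ h : S, normLinf (𝒯 h) (onMesh g (𝒯 h)) (onMesh g (𝒯 h) - (γ h).G)
          ≤ ENNReal.ofReal (A₆ * (h : ℝ) ^ r)) →
        ∀ (h : S) (uh : M → ℝ), IsDiscreteSolution g e₁ e₂ (𝒯 h) (γ h).G (V h) uh →
          normL2Form (𝒯 h) (onMesh g (𝒯 h)) (dM (𝒯 h) uh - dM (𝒯 h) u) ≤ C * (h : ℝ) ^ r ∧
          normL2Form (𝒯 h) (onMesh g (𝒯 h))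
            (fun T x => star1 ((γ h).G T x) (dM (𝒯 h) uh T x) -
              star1 (onMesh g (𝒯 h) T x) (dM (𝒯 h) u T x)) ≤ C * (h : ℝ) ^ r) := by
  refine ⟨exists_dualNorm_le g hVhat r K K' A₁ A₂ A₄ hC', fun e₁ e₂ u A₅ A₆ he hu => ?_⟩
  have := hM.t2Space
  have := hM.compactSpace
  obtain ⟨C, hC⟩ := exists_normL2Form_le g hVhat r K K' A₁ A₂ A₄ hC' A₅ A₆ he hu
  exact ⟨C, fun S hS 𝒯 γ V ad ho _ hinf hlinf h uh sol =>
    hC h (hS h h.2) (𝒯 h) (γ h) (V h) (ad h) (ho h) (hinf h) (hlinf h) uh sol⟩
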